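/- **Setting.** For every $N\ge 1$ let, on a probability space, $\mathbf V$ be an $N\times N$ Haar distributed orthogonal matrix, $\mathbf x\in\mathbb R^N$ a signal with IID entries and $\mathrm E\{x_n^2\}=1$, and $\boldsymbol{\mathcal X}=\mathbf V\mathbf x$. For measurable functions $\gamma_t,\phi_t$ ($t\ge1$) that do not depend on $N$, consider the separable estimators $$[\gamma_t(\mathbf u)]_n=\gamma_t(u_n,\mathcal X_n,\xi_n),\qquad [\phi_t(\mathbf u)]_n=\phi_t(u_n,x_n,w_n),$$ where $\boldsymbol\xi$ and $\mathbf w$ are noises with values in arbitrary measurable spaces (so the $n$-th scalar estimators are random functions, IID over $n$ except that they may also contain an observation of the $n$-th signal entry). The generic iterative process is $$\hat{\boldsymbol{\mathcal X}}^{\rm out}_t=\gamma_t(\hat{\boldsymbol{\mathcal X}}^{\rm in}_{t-1}),\quad \hat{\mathbf x}^{\rm out}_t=\phi_t(\hat{\mathbf x}^{\rm in}_{t-1}),\quad \hat{\mathbf x}^{\rm in}_t=\mathbf V^{\rm T}\hat{\boldsymbol{\mathcal X}}^{\rm out}_t,\quad \hat{\boldsymbol{\mathcal X}}^{\rm in}_t=\mathbf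 V\hat{\mathbf x}^{\rm out}_t,\qquad t\ge1,$$ initialized with $\hat{\boldsymbol{\mathcal X}}^{\rm in}_0=a_\gamma\boldsymbol{\mathcal X}+\mathbf g_0$ and $\hat{\mathbf x}^{\rm in}_0=a_\phi\mathbf x+\mathbf f_0$, with constants $a_\gamma,a_\phi\in\mathbb R$ and errors $\mathbf g_0$, $\mathbf f_0$ having IID $\mathcal N(0,v_\gamma)$, resp. IID $\mathcal N(0,v_\phi)$ entries ($v_\gamma,v_\phi\ge 0$; $a_\gamma,a_\phi,v_\gamma,v_\phi$ do not depend on $N$), $\mathbf g_0$ independent of $\boldsymbol{\mathcal X}$ and $\mathbf f_0$ independent of $\mathbf x$. The triples $(x_n,f_{0,n},w_n)$ are IID over $n$, the pairs $(g_{0,n},\xi_n)$ are IID over $n$, both with laws that do not depend on $N$, and $\mathbf V$ is independent of $(\mathbf x,\mathbf g_0,\mathbf f_0,\boldsymbol\xi,\mathbf w)$. For each $t\ge 1$ the entries of $\hat{\boldsymbol{\mathcal X}}^{\rm out}_t$ and those of $\hat{\mathbf x}^{\rm out}_t$ are square integrable, uniformly in $n$ and $N$: $\lim_{K\to\infty}\sup_{N,\,n\le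 N}\mathrm E\{a_n^2\,\mathbf 1_{|a_n|>K}\}=0$ for $\mathbf a=\hat{\boldsymbol{\mathcal X}}^{\rm out}_t,\hat{\mathbf x}^{\rm out}_t$. The Gram–Schmidt (GS) error of a message $\hat{\mathbf s}$ with respect to a signal $\mathbf s$ is $\hat{\mathbf s}-\alpha\mathbf s$ with $\alpha=\frac1N\mathrm E\{\hat{\mathbf s}^{\rm T}\mathbf s\}$. Let $\mathbf g^{\rm in}_t,\mathbf g^{\rm out}_t$ be the GS errors of $\hat{\boldsymbol{\mathcal X}}^{\rm in}_t,\hat{\boldsymbol{\mathcal X}}^{\rm out}_t$ with respect to $\boldsymbol{\mathcal X}$, and $\mathbf f^{\rm in}_t,\mathbf f^{\rm out}_t$ those of $\hat{\mathbf x}^{\rm in}_t,\hat{\mathbf x}^{\rm out}_t$ with respect to $\mathbf x$ (so $\mathbf g_0^{\rm in}=\mathbf g_0$, $\mathbf f_0^{\rm in}=\mathbf f_0$), and $$\mathbf G^{\rm in}_t=[\mathbf g^{\rm in}_0,\dots,\mathbf g^{\rm in}_{t-1}],\qquad \mathbf F^{\rm in}_t=[\mathbf f^{\rm in}_0,\dots,\mathbf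 f^{\rm in}_{t-1}].$$ Write $\frac1N\mathbf a^{\rm T}\mathbf b\overset{\rm LLN}{\to}0$ if $(\mathbf a^{\rm T}\mathbf b)^2/(\mathrm E\|\mathbf a\|^2\,\mathrm E\|\mathbf b\|^2)\to0$ in probability as $N\to\infty$ (the quotient being read as $0$ if the denominator vanishes). The process is assumed to be OAMP: for all $0\le t'<t$, $$\tfrac1N(\mathbf g^{\rm in}_{t'})^{\rm T}\mathbf g^{\rm out}_t\overset{\rm LLN}{\to}0,\quad \tfrac1N(\mathbf f^{\rm in}_{t'})^{\rm T}\mathbf f^{\rm out}_t\overset{\rm LLN}{\to}0,\quad \tfrac1N\boldsymbol{\mathcal X}^{\rm T}\mathbf g^{\rm out}_t\overset{\rm LLN}{\to}0,\quad \tfrac1N\mathbf x^{\rm T}\mathbf f^{\rm out}_t\overset{\rm LLN}{\to}0 .$$ **Theorem.** For every fixed $t$, as $N\to\infty$ and with probabilities taken over all the randomness including $\mathbf V$: (a) $\mathbf G^{\rm in}_t$ is column-wise pseudo-IID Gaussian and row-wise jointly Gaussian: for each column there is $v\ge0$ such that for every fixed $M$ the law of any $M$ distinct entries of the column converges weakly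 to that of $M$ IID $\mathcal N(0,v)$ variables; and the law of every row converges weakly to a Gaussian law on $\mathbb R^t$, the same for all rows (both convergences uniform over the choice of entries, resp. row). Moreover $\mathbf G^{\rm in}_t$ is asymptotically independent of $\boldsymbol{\mathcal X}$. More generally, let $\mathbf z$ be any random object such that $\mathbf V$ is independent of $(\mathbf x,\mathbf g_0,\mathbf f_0,\boldsymbol\xi,\mathbf w,\mathbf z)$ and $\mathbf g_0$ is independent of $(\boldsymbol{\mathcal X},\mathbf z)$; then $\mathbf G^{\rm in}_t$ is asymptotically independent of $(\boldsymbol{\mathcal X},\mathbf z)$. (b) $\mathbf F^{\rm in}_t$ is column-wise pseudo-IID Gaussian and row-wise jointly Gaussian, and asymptotically independent of $\mathbf x$; and it is asymptotically independent of $(\mathbf x,\mathbf z)$ for any random object $\mathbf z$ such that $\mathbf V$ is independent of $(\mathbf x,\mathbf g_0,\mathbf f_0,\boldsymbol\xi,\mathbf w,\mathbf z)$ and $\mathbf f_0$ is independent of $(\mathbf x,\mathbf z)$. Here an $N\times t$ random matrix $\mathbf G$ is asymptotically independent of $\mathbf y$ if for every fixed $M$, every bounded continuous $h$ and all measurable $k_N$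 with $|k_N|\le1$, $$\mathrm E\{h(\mathbf R)\,k_N(\mathbf y)\}-\mathrm E\{h(\mathbf R)\}\,\mathrm E\{k_N(\mathbf y)\}\to0,$$ uniformly over all choices $\mathbf R$ of $M$ distinct rows of $\mathbf G$. -/

import Mathlib

open MeasureTheory ProbabilityTheory
open scoped NNReal BoundedContinuousFunction Matrix

namespace OAMP

universe u v w

/-- A random real `N × N` matrix `V` (given through its entries) is Haar distributed on the
orthogonal group: it is orthogonal almost surely and its law is invariant under multiplication
by any fixed orthogonal matrix. -/
structure IsHaarOrthogonal {Ω : Type u} [MeasurableSpace Ω] (P : Measure Ω) {N : ℕ}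
    (V : Ω → Fin N → Fin N → ℝ) : Prop where
  measurable : Measurable V
  orthogonal : ∀ᵐ ω ∂P, Matrix.of (V ω) ∈ Matrix.orthogonalGroup (Fin N) ℝ
  invariant : ∀ U ∈ Matrix.orthogonalGroup (Fin N) ℝ,
    P.map (fun ω i j => (U * Matrix.of (V ω)) i j) = P.map V

/-- The data of the model, for every dimension `N`.
* `V` is the random transform and `x` the signal;
* `γ t · · (ξ n)` and `φ t · · (w n)` describe the separable local estimators of iteration `t`:
  the `n`-th scalar estimator is `u ↦ γ t u 𝒳ₙ ξₙ`, resp. `u ↦ φ t u xₙ wₙ`, so that its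
  randomness comes from the private noise `ξₙ`, resp. `wₙ`, and possibly from an observation of
  the `n`-th entry of the signal;
* `g₀`, `f₀` are the initial errors, `aγ`, `aφ` the initial Gram-Schmidt coefficients and
  `vγ`, `vφ` the variances of the initial errors. -/
structure System (Ω : ℕ → Type u) (Ξ : Type v) (W : Type w) where
  V : ∀ N, Ω N → Fin N → Fin N → ℝ
  x : ∀ N, Ω N → Fin N → ℝ
  g₀ : ∀ N, Ω N → Fin N → ℝ
  f₀ : ∀ N, Ω N → Fin N → ℝ
  ξ : ∀ N, Ω N → Fin N → Ξ
  w : ∀ N, Ω N → Fin N → W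
  γ : ℕ → ℝ → ℝ → Ξ → ℝ
  φ : ℕ → ℝ → ℝ → W → ℝ
  aγ : ℝ
  aφ : ℝ
  vγ : ℝ≥0
  vφ : ℝ≥0

namespace System

variable {Ω : ℕ → Type u} {Ξ : Type v} {W : Type w}

/-- The transformed signal `𝒳 = V x`. -/
def X (S : System Ω Ξ W) (N : ℕ) (ω : Ω N) : Fin N → ℝ :=
  Matrix.of (S.V N ω) *ᵥ S.x N ω

/-- The separable estimator `γ_t` applied to a vector. -/
def applyγ (S : System Ω Ξ W) (t N : ℕ) (ω : Ω N) (u : Fin N → ℝ) : Fin N → ℝ :=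
  fun n => S.γ t (u n) (S.X N ω n) (S.ξ N ω n)

/-- The separable estimator `φ_t` applied to a vector. -/
def applyφ (S : System Ω Ξ W) (t N : ℕ) (ω : Ω N) (u : Fin N → ℝ) : Fin N → ℝ :=
  fun n => S.φ t (u n) (S.x N ω n) (S.w N ω n)

/-- The generic iterative process: the pair of input messages `(𝒳̂_t^in, x̂_t^in)`. -/
def inputs (S : System Ω Ξ W) : ℕ → ∀ N, Ω N → (Fin N → ℝ) × (Fin N → ℝ)
  | 0, N, ω => (S.aγ • S.X N ω + S.g₀ N ω, S.aφ • S.x N ω + S.f₀ N ω)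
  | t + 1, N, ω =>
      (Matrix.of (S.V N ω) *ᵥ S.applyφ (t + 1) N ω (S.inputs t N ω).2,
        (Matrix.of (S.V N ω))ᵀ *ᵥ S.applyγ (t + 1) N ω (S.inputs t N ω).1)

/-- `𝒳̂_t^in`. -/
def XIn (S : System Ω Ξ W) (t N : ℕ) (ω : Ω N) : Fin N → ℝ := (S.inputs t N ω).1

/-- `x̂_t^in`. -/
def xIn (S : System Ω Ξ W) (t N : ℕ) (ω : Ω N) : Fin N → ℝ := (S.inputs t N ω).2

/-- `𝒳̂_t^out = γ_t(𝒳̂_{t-1}^in)`, used for `t ≥ 1` only. -/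
def XOut (S : System Ω Ξ W) (t N : ℕ) (ω : Ω N) : Fin N → ℝ :=
  S.applyγ t N ω (S.XIn (t - 1) N ω)

/-- `x̂_t^out = φ_t(x̂_{t-1}^in)`, used for `t ≥ 1` only. -/
def xOut (S : System Ω Ξ W) (t N : ℕ) (ω : Ω N) : Fin N → ℝ :=
  S.applyφ t N ω (S.xIn (t - 1) N ω)

/-- All the random objects other than the transform `V`. -/
def primitives (S : System Ω Ξ W) (N : ℕ) (ω : Ω N) :
    (Fin N → ℝ) × (Fin N → ℝ) × (Fin N → ℝ) × (Fin N → Ξ) × (Fin N → W) :=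
  (S.x N ω, S.g₀ N ω, S.f₀ N ω, S.ξ N ω, S.w N ω)

end System

section Sequences

variable {Ω : ℕ → Type u} [∀ N, MeasurableSpace (Ω N)] (P : ∀ N, Measure (Ω N))

/-- The Gram-Schmidt coefficient `(1/N) E[aᵀ s]` of `a` with respect to `s`. -/
noncomputable def gsCoeff (s a : ∀ N, Ω N → Fin N → ℝ) (N : ℕ) : ℝ :=
  (1 / (N : ℝ)) * ∫ ω, a N ω ⬝ᵥ s N ω ∂(P N)

/-- The Gram-Schmidt error `a - α s` of `a` with respect to `s`. -/
noncomputable def gsError (s a : ∀ N, Ω N → Fin N → ℝ) (N : ℕ) (ω : Ω N) : Fin N → ℝ :=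
  a N ω - gsCoeff P s a N • s N ω

/-- `(1/N) aᵀ b → 0` in the sense of the law of large numbers. If one of the second moments in
the denominator vanishes, the quotient is read as zero. -/
def LLNOrthogonal (a b : ∀ N, Ω N → Fin N → ℝ) : Prop :=
  ∀ δ > (0 : ℝ), ∀ ε > (0 : ℝ), ∃ N' : ℕ, ∀ N > N',
    1 - δ ≤ (P N).real {ω | (a N ω ⬝ᵥ b N ω) ^ 2 /
      ((∫ ω', a N ω' ⬝ᵥ a N ω' ∂(P N)) * (∫ ω', b N ω' ⬝ᵥ b N ω' ∂(P N))) < ε}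

/-- The entries of the vectors `a N` are uniformly square integrable. -/
def UnifSqIntegrable (a : ∀ N, Ω N → Fin N → ℝ) : Prop :=
  ∀ ε > (0 : ℝ), ∃ K : ℝ, ∀ (N : ℕ) (n : Fin N),
    ∫⁻ ω in {ω | K < |a N ω n|}, ENNReal.ofReal ((a N ω n) ^ 2) ∂(P N) ≤ ENNReal.ofReal ε

/-- Pseudo-IID (zero-mean) Gaussian: the laws of any `M` distinct entries converge weakly to that
of `M` IID Gaussian variables `𝒩(0, v)`, as `N → ∞` with `M` fixed. -/
def IsPIIDG (a : ∀ N, Ω N → Fin N → ℝ) : Prop :=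
  ∃ v : ℝ≥0, ∀ (M : ℕ) (h : (Fin M → ℝ) →ᵇ ℝ), ∀ ε > (0 : ℝ), ∃ N₀ : ℕ, ∀ N ≥ N₀,
    ∀ idx : Fin M ↪ Fin N,
      |(∫ ω, h (fun i => a N ω (idx i)) ∂(P N)) -
        ∫ y, h y ∂(Measure.pi fun _ : Fin M => gaussianReal 0 v)| ≤ ε

/-- Asymptotic joint Gaussianity of the rows of an `N × t` random matrix. -/
def IsRowJointGaussian {t : ℕ} (G : ∀ N, Ω N → Matrix (Fin N) (Fin t) ℝ) : Prop :=
  ∃ μ : Measure (Fin t → ℝ), IsGaussian μ ∧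
    ∀ h : (Fin t → ℝ) →ᵇ ℝ, ∀ ε > (0 : ℝ), ∃ N₀ : ℕ, ∀ N ≥ N₀, ∀ n : Fin N,
      |(∫ ω, h (G N ω n) ∂(P N)) - ∫ y, h y ∂μ| ≤ ε

/-- Column-wise pseudo-IID Gaussian and row-wise joint Gaussian. -/
def IsCPIIDGRJG {t : ℕ} (G : ∀ N, Ω N → Matrix (Fin N) (Fin t) ℝ) : Prop :=
  (∀ s : Fin t, IsPIIDG P fun N ω n => G N ω n s) ∧ IsRowJointGaussian P G

/-- Asymptotic independence of an `N × t` random matrix `G` and a random object `Y`: for fixed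
`M`, any `M` distinct rows of `G` become independent of `Y`. -/
def AsympIndep {t : ℕ} (G : ∀ N, Ω N → Matrix (Fin N) (Fin t) ℝ)
    {E : ℕ → Type v} [∀ N, MeasurableSpace (E N)] (Y : ∀ N, Ω N → E N) : Prop :=
  ∀ (M : ℕ) (h : (Fin M → Fin t → ℝ) →ᵇ ℝ) (k : ∀ N, E N → ℝ),
    (∀ N, Measurable (k N)) → (∀ N y, |k N y| ≤ 1) →
    ∀ ε > (0 : ℝ), ∃ N₀ : ℕ, ∀ N ≥ N₀, ∀ idx : Fin M ↪ Fin N,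
      |(∫ ω, h (fun i => G N ω (idx i)) * k N (Y N ω) ∂(P N)) -
        (∫ ω, h (fun i => G N ω (idx i)) ∂(P N)) * ∫ ω, k N (Y N ω) ∂(P N)| ≤ ε

end Sequences

namespace System

variable {Ω : ℕ → Type u} {Ξ : Type v} {W : Type w}
  [∀ N, MeasurableSpace (Ω N)] (P : ∀ N, Measure (Ω N))

/-- `g_t^in`. -/
noncomputable def gIn (S : System Ω Ξ W) (t : ℕ) : ∀ N, Ω N → Fin N → ℝ :=
  gsError P S.X (S.XIn t)

/-- `f_t^in`. -/
noncomputable def fIn (S : System Ω Ξ W) (t : ℕ) : ∀ N, Ω N → Fin N → ℝ :=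
  gsError P S.x (S.xIn t)

/-- `g_t^out`, used for `t ≥ 1` only. -/
noncomputable def gOut (S : System Ω Ξ W) (t : ℕ) : ∀ N, Ω N → Fin N → ℝ :=
  gsError P S.X (S.XOut t)

/-- `f_t^out`, used for `t ≥ 1` only. -/
noncomputable def fOut (S : System Ω Ξ W) (t : ℕ) : ∀ N, Ω N → Fin N → ℝ :=
  gsError P S.x (S.xOut t)

/-- `G_t^in = [g_0^in, …, g_{t-1}^in]`. -/
noncomputable def GIn (S : System Ω Ξ W) (t N : ℕ) (ω : Ω N) : Matrix (Fin N) (Fin t) ℝ :=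
  Matrix.of fun n s => S.gIn P s N ω n

/-- `F_t^in = [f_0^in, …, f_{t-1}^in]`. -/
noncomputable def FIn (S : System Ω Ξ W) (t N : ℕ) (ω : Ω N) : Matrix (Fin N) (Fin t) ℝ :=
  Matrix.of fun n s => S.fIn P s N ω n

/-- The orthogonal constraint which turns the generic iterative process into OAMP. -/
structure IsOAMP (S : System Ω Ξ W) : Prop where
  g_orth : ∀ t ≥ 1, ∀ t' < t, LLNOrthogonal P (S.gIn P t') (S.gOut P t)
  f_orth : ∀ t ≥ 1, ∀ t' < t, LLNOrthogonal P (S.fIn P t') (S.fOut P t)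
  X_orth : ∀ t ≥ 1, LLNOrthogonal P S.X (S.gOut P t)
  x_orth : ∀ t ≥ 1, LLNOrthogonal P S.x (S.fOut P t)

/-- The standing assumptions. The laws of the rows `(xₙ, f₀ₙ, wₙ)` and `(g₀ₙ, ξₙ)` do not depend
on `n` and `N`. -/
structure Standing [MeasurableSpace Ξ] [MeasurableSpace W] (S : System Ω Ξ W) : Prop where
  haar : ∀ N, IsHaarOrthogonal (P N) (S.V N)
  measurable_x : ∀ N, Measurable (S.x N)
  measurable_g₀ : ∀ N, Measurable (S.g₀ N)
  measurable_f₀ : ∀ N, Measurable (S.f₀ N)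
  measurable_ξ : ∀ N, Measurable (S.ξ N)
  measurable_w : ∀ N, Measurable (S.w N)
  measurable_γ : ∀ t, Measurable fun p : ℝ × ℝ × Ξ => S.γ t p.1 p.2.1 p.2.2
  measurable_φ : ∀ t, Measurable fun p : ℝ × ℝ × W => S.φ t p.1 p.2.1 p.2.2
  /-- `V` is independent of everything that does not arise from it. -/
  V_indep : ∀ N, IndepFun (S.V N) (S.primitives N) (P N)
  x_iid : ∀ N, iIndepFun (fun n ω => (S.x N ω n, S.f₀ N ω n, S.w N ω n)) (P N)
  x_law : ∃ ρ : Measure (ℝ × ℝ × W), ∀ N n,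
    (P N).map (fun ω => (S.x N ω n, S.f₀ N ω n, S.w N ω n)) = ρ
  X_iid : ∀ N, iIndepFun (fun n ω => (S.g₀ N ω n, S.ξ N ω n)) (P N)
  X_law : ∃ ρ : Measure (ℝ × Ξ), ∀ N n, (P N).map (fun ω => (S.g₀ N ω n, S.ξ N ω n)) = ρ
  x_normalized : ∀ N n, ∫ ω, (S.x N ω n) ^ 2 ∂(P N) = 1
  g₀_gaussian : ∀ N n, (P N).map (fun ω => S.g₀ N ω n) = gaussianReal 0 S.vγ
  f₀_gaussian : ∀ N n, (P N).map (fun ω => S.f₀ N ω n) = gaussianReal 0 S.vφ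
  g₀_indep : ∀ N, IndepFun (S.g₀ N) (S.X N) (P N)
  f₀_indep : ∀ N, IndepFun (S.f₀ N) (S.x N) (P N)
  /-- The powers of the messages are uniformly integrable. -/
  XOut_sq : ∀ t ≥ 1, UnifSqIntegrable P (S.XOut t)
  xOut_sq : ∀ t ≥ 1, UnifSqIntegrable P (S.xOut t)

end System

end OAMP

/-!
A message that crosses a Haar distributed orthogonal matrix `V` arrives as fresh Gaussian noise plus
a combination of the images of what has already crossed `V`. Under the orthogonality assumption no
earlier estimate from the receiving side survives in this combination in the limit: there remain
earlier Gaussian noise and a multiple of the signal, which the Gram–Schmidt error removes. The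
iteration is viewed as one sequence of steps: step `0` sends the signal `x`, step `2t - 1` sends the
output of `φ_t`, and step `2t` that of `γ_t`; each step splits the message sent into its components
along the directions used before and along a new direction.

*Simulation.* Conditionally on the images of the directions used so far, the image of a new
direction is uniform on a sphere of the orthogonal complement, hence distributed as the normalized
projection of a fresh standard Gaussian vector (`LeftInv.lintegral_dice`). So the process has,
jointly with the primitives and with any further object independent of `V`, the law of a process
that is driven by independent Gaussian columns instead of `V` (`lintegral_runOrig_matrix`,
`map_ost`). This holds for every `N`; no conditioning on null events is needed, since the matrix is
corrected by reflections so that it has the images drawn.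

*State evolution.* In the simulated process all directions and messages are approximated, in
normalized mean square and in probability, by fixed functions of independent identically
distributed rows which consist of the primitives and of the Gaussian noise (`evol_run`). The
difficulty is that the estimators are merely measurable, so that closeness of the inputs does not
imply closeness of the outputs. It does if the laws of the rows are dominated, up to events of small
probability, by one measure that is absolutely continuous with respect to the limit law (`Dom`): the
sets to which a row belongs, with high probability, exactly if its limit does then form a σ-algebra,
and it contains all measurable sets (`CloseRows.comp`). Domination persists because an entry of a
random direction has a bounded density (`OrthZero.stdG_direction_le`). A message whose residual
vanishes in the limit is treated apart: its residual vanishes already for finite `N`, with high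
probability.

*Orthogonality.* In the limit an estimator depends on the noise of earlier steps only through the
error of one received message, and its correlation with the noise of a single step is proportional
to its correlation with that error (`integral_mul_lin`). The latter vanishes by assumption, so all
components along earlier messages from the other side vanish, except that along the signal
(`Scheme.lcoef_eq_zero`, `Scheme.received_eq`). The limits of the errors of received messages
are thus linear in the Gaussian noise, and do not involve the column that simulates the transformed signal
(`Regular.lerr_eq`, `Regular.limG_eq`).

*Conclusion.* Finitely many rows of the errors therefore converge in law to independent Gaussian
rows, which are independent of the signal and of any object the initial error is independent of
(`Regular.isCPIIDGRJG`, `Regular.asympIndep`). The assumptions on the system supply what these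
results need (`System.exists_regular`).
-/

namespace OAMP

/-! ### Orthogonal matrices and reflections -/

section LinearAlgebra

set_option linter.unusedSectionVars false

variable {ι : Type*} [Fintype ι] [DecidableEq ι]

/-- Orthogonality of a real square matrix, in the form `Uᵀ U = 1`. -/
def IsOrth (U : Matrix ι ι ℝ) : Prop := Uᵀ * U = 1

lemma IsOrth.mul_transpose {U : Matrix ι ι ℝ} (h : IsOrth U) : U * Uᵀ = 1 :=
  mul_eq_one_comm.1 h

lemma IsOrth.transpose {U : Matrix ι ι ℝ} (h : IsOrth U) : IsOrth Uᵀ := by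
  rw [IsOrth, Matrix.transpose_transpose]; exact h.mul_transpose

lemma IsOrth.mul {U W : Matrix ι ι ℝ} (h : IsOrth U) (h' : IsOrth W) : IsOrth (U * W) := by
  rw [IsOrth, Matrix.transpose_mul, Matrix.mul_assoc, ← Matrix.mul_assoc Uᵀ, h, Matrix.one_mul, h']

lemma isOrth_one : IsOrth (1 : Matrix ι ι ℝ) := by simp [IsOrth]

lemma isOrth_iff {U : Matrix ι ι ℝ} : IsOrth U ↔ U ∈ Matrix.orthogonalGroup ι ℝ := by
  rw [Matrix.mem_orthogonalGroup_iff', IsOrth]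

lemma IsOrth.transpose_mulVec {U : Matrix ι ι ℝ} (h : IsOrth U) (a : ι → ℝ) :
    Uᵀ *ᵥ (U *ᵥ a) = a := by
  rw [Matrix.mulVec_mulVec, h, Matrix.one_mulVec]

lemma IsOrth.mulVec_transpose {U : Matrix ι ι ℝ} (h : IsOrth U) (a : ι → ℝ) :
    U *ᵥ (Uᵀ *ᵥ a) = a := by
  rw [Matrix.mulVec_mulVec, h.mul_transpose, Matrix.one_mulVec]

lemma IsOrth.dotProduct {U : Matrix ι ι ℝ} (h : IsOrth U) (a b : ι → ℝ) :
    (U *ᵥ a) ⬝ᵥ (U *ᵥ b) = a ⬝ᵥ b := by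
  rw [Matrix.dotProduct_mulVec, ← Matrix.mulVec_transpose, h.transpose_mulVec]

/-- The reflection in the hyperplane orthogonal to `a - b`; it exchanges `a` and `b` when these
have the same norm. For `a = b` it is the identity, since `2 / 0 = 0`. -/
noncomputable def refl (a b : ι → ℝ) : Matrix ι ι ℝ :=
  1 - (2 / ((a - b) ⬝ᵥ (a - b))) • Matrix.vecMulVec (a - b) (a - b)

lemma refl_mulVec (a b v : ι → ℝ) :
    refl a b *ᵥ v = v - (2 / ((a - b) ⬝ᵥ (a - b)) * ((a - b) ⬝ᵥ v)) • (a - b) := by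
  rw [refl, Matrix.sub_mulVec, Matrix.one_mulVec, Matrix.smul_mulVec, Matrix.vecMulVec_mulVec]
  congr 1
  ext i
  simp [mul_assoc, mul_comm]

lemma refl_apply_left {a b : ι → ℝ} (h : a ⬝ᵥ a = b ⬝ᵥ b) : refl a b *ᵥ a = b := by
  rw [refl_mulVec]
  by_cases h0 : a - b = 0
  · rw [h0]; simp [sub_eq_zero.1 h0]
  · have h1 : (a - b) ⬝ᵥ (a - b) ≠ 0 := fun h => h0 (dotProduct_self_eq_zero.1 h)
    have h2 : (a - b) ⬝ᵥ (a - b) = 2 * ((a - b) ⬝ᵥ a) := by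
      simp only [sub_dotProduct, dotProduct_sub, dotProduct_comm b a]
      linarith
    have h3 : (2 / ((a - b) ⬝ᵥ (a - b)) * ((a - b) ⬝ᵥ a)) = 1 := by
      rw [h2] at h1 ⊢
      rw [div_mul_eq_mul_div, div_self h1]
    rw [h3]; simp

lemma refl_apply_of_dotProduct_eq {a b v : ι → ℝ} (h : a ⬝ᵥ v = b ⬝ᵥ v) :
    refl a b *ᵥ v = v := by
  have h0 : (a - b) ⬝ᵥ v = 0 := by rw [sub_dotProduct, h, sub_self]
  rw [refl_mulVec, h0]; simp

lemma refl_comm (a b : ι → ℝ) : refl a b = refl b a := by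
  rw [refl, refl, ← neg_sub a b, Matrix.vecMulVec_neg, Matrix.neg_vecMulVec, neg_neg,
    neg_dotProduct_neg]

lemma refl_transpose (a b : ι → ℝ) : (refl a b)ᵀ = refl a b := by
  rw [refl, Matrix.transpose_sub, Matrix.transpose_smul, Matrix.transpose_vecMulVec]
  simp

lemma isOrth_refl (a b : ι → ℝ) : IsOrth (refl a b) := by
  rw [IsOrth, refl_transpose]
  refine Matrix.ext_iff_mulVec.2 fun v => ?_
  rw [← Matrix.mulVec_mulVec, Matrix.one_mulVec, refl_mulVec a b (refl a b *ᵥ v), refl_mulVec a b v]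
  generalize a - b = w
  by_cases h0 : w ⬝ᵥ w = 0
  · simp [h0]
  · rw [dotProduct_sub, dotProduct_smul, sub_sub, ← add_smul, smul_eq_mul]
    convert sub_zero v
    convert zero_smul ℝ w
    field_simp
    ring

/-- Reflections are conjugated by orthogonal matrices. -/
lemma IsOrth.mul_refl {U : Matrix ι ι ℝ} (h : IsOrth U) (a b : ι → ℝ) :
    U * refl a b = refl (U *ᵥ a) (U *ᵥ b) * U := by
  refine Matrix.ext_iff_mulVec.2 fun v => ?_
  rw [← Matrix.mulVec_mulVec, ← Matrix.mulVec_mulVec, refl_mulVec, refl_mulVec,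
    ← Matrix.mulVec_sub, h.dotProduct, h.dotProduct, Matrix.mulVec_sub, Matrix.mulVec_smul]

/-- The normalization of a vector (zero if the vector is zero). -/
noncomputable def nrm (v : ι → ℝ) : ι → ℝ := (Real.sqrt (v ⬝ᵥ v))⁻¹ • v

lemma dotProduct_self_nonneg' (v : ι → ℝ) : 0 ≤ v ⬝ᵥ v :=
  Finset.sum_nonneg fun i _ => mul_self_nonneg (v i)

lemma sqrt_smul_nrm (v : ι → ℝ) : Real.sqrt (v ⬝ᵥ v) • nrm v = v := by
  by_cases h : v ⬝ᵥ v = 0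
  · rw [dotProduct_self_eq_zero.1 h]; simp [nrm]
  · have : Real.sqrt (v ⬝ᵥ v) ≠ 0 := (Real.sqrt_ne_zero (dotProduct_self_nonneg' v)).2 h
    rw [nrm, smul_smul, mul_inv_cancel₀ this, one_smul]

lemma nrm_zero : nrm (0 : ι → ℝ) = 0 := by simp [nrm]

lemma nrm_dotProduct_self {v : ι → ℝ} (h : v ≠ 0) : nrm v ⬝ᵥ nrm v = 1 := by
  have h1 : v ⬝ᵥ v ≠ 0 := fun h' => h (dotProduct_self_eq_zero.1 h')
  rw [nrm, smul_dotProduct, dotProduct_smul, smul_smul, smul_eq_mul, ← mul_inv,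
    Real.mul_self_sqrt (dotProduct_self_nonneg' v), inv_mul_cancel₀ h1]

lemma nrm_dotProduct_self_or (v : ι → ℝ) : nrm v ⬝ᵥ nrm v = 0 ∨ nrm v ⬝ᵥ nrm v = 1 := by
  by_cases h : v = 0
  · left; simp [h, nrm_zero]
  · exact Or.inr (nrm_dotProduct_self h)

lemma IsOrth.mulVec_nrm {U : Matrix ι ι ℝ} (h : IsOrth U) (v : ι → ℝ) :
    U *ᵥ nrm v = nrm (U *ᵥ v) := by
  rw [nrm, nrm, h.dotProduct, Matrix.mulVec_smul]

/-- The residual of `v` with respect to the first `k` vectors of the family `U`; an orthogonal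
projection if these are orthonormal or zero. -/
def proj (U : ℕ → ι → ℝ) (k : ℕ) (v : ι → ℝ) : ι → ℝ :=
  v - ∑ j ∈ Finset.range k, (v ⬝ᵥ U j) • U j

/-- The first `k` vectors of the family are pairwise orthogonal, and each is a unit vector or
zero. -/
def OrthZero (U : ℕ → ι → ℝ) (k : ℕ) : Prop :=
  (∀ i < k, ∀ j < k, i ≠ j → U i ⬝ᵥ U j = 0) ∧ ∀ i < k, U i ⬝ᵥ U i = 0 ∨ U i ⬝ᵥ U i = 1

lemma OrthZero.smul_self {U : ℕ → ι → ℝ} {k i : ℕ} (h : OrthZero U k) (hi : i < k) :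
    (U i ⬝ᵥ U i) • U i = U i := by
  rcases h.2 i hi with h' | h'
  · rw [dotProduct_self_eq_zero.1 h']; simp
  · rw [h', one_smul]

lemma OrthZero.proj_dotProduct {U : ℕ → ι → ℝ} {k i : ℕ} (h : OrthZero U k) (hi : i < k)
    (v : ι → ℝ) : proj U k v ⬝ᵥ U i = 0 := by
  rw [proj, sub_dotProduct, sum_dotProduct, Finset.sum_eq_single_of_mem i (Finset.mem_range.2 hi)]
  · rw [smul_dotProduct, smul_eq_mul, ← smul_eq_mul, ← h.smul_self hi]
    rcases h.2 i hi with h' | h' <;> simp [h']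
  · intro j hj hji
    rw [smul_dotProduct, h.1 j (Finset.mem_range.1 hj) i hi hji, smul_zero]

end LinearAlgebra

end OAMP


namespace OAMP

/-! ### Uniqueness of invariant laws of orthogonal matrices with prescribed values -/

/-- Matrices carry the product `σ`-algebra of their entries. -/
instance matrixMeasurableSpace {m n : Type*} : MeasurableSpace (Matrix m n ℝ) :=
  inferInstanceAs (MeasurableSpace (m → n → ℝ))

section Invariance

set_option linter.unusedSectionVars false

open scoped ENNReal

variable {ι : Type*} [Fintype ι] [DecidableEq ι]

lemma measurable_matrix_iff {α : Type*} [MeasurableSpace α] {f : α → Matrix ι ι ℝ} :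
    Measurable f ↔ ∀ i j, Measurable fun a => f a i j := by
  constructor
  · intro h i j
    exact (measurable_pi_apply j).comp ((measurable_pi_apply i).comp h)
  · intro h
    exact measurable_pi_iff.2 fun i => measurable_pi_iff.2 fun j => h i j

section Measurability

variable {α : Type*} [MeasurableSpace α]

@[fun_prop]
lemma Measurable.matrix_mul {f g : α → Matrix ι ι ℝ} (hf : Measurable f) (hg : Measurable g) :
    Measurable fun a => f a * g a := by
  refine measurable_matrix_iff.2 fun i j => ?_
  simp only [Matrix.mul_apply]
  fun_prop

@[fun_prop]
lemma Measurable.matrix_transpose {f : α → Matrix ι ι ℝ} (hf : Measurable f) :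
    Measurable fun a => (f a)ᵀ := by
  refine measurable_matrix_iff.2 fun i j => ?_
  simp only [Matrix.transpose_apply]
  fun_prop

@[fun_prop]
lemma Measurable.matrix_mulVec {f : α → Matrix ι ι ℝ} {v : α → ι → ℝ} (hf : Measurable f)
    (hv : Measurable v) : Measurable fun a => f a *ᵥ v a := by
  refine measurable_pi_iff.2 fun i => ?_
  simp only [Matrix.mulVec, dotProduct]
  fun_prop

@[fun_prop]
lemma Measurable.dotProduct {u v : α → ι → ℝ} (hu : Measurable u) (hv : Measurable v) :
    Measurable fun a => u a ⬝ᵥ v a := by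
  simp only [_root_.dotProduct]
  fun_prop

@[fun_prop]
lemma Measurable.refl {u v : α → ι → ℝ} (hu : Measurable u) (hv : Measurable v) :
    Measurable fun a => refl (u a) (v a) := by
  refine measurable_matrix_iff.2 fun i j => ?_
  simp only [OAMP.refl, Matrix.sub_apply, Matrix.smul_apply, Matrix.vecMulVec_apply, smul_eq_mul]
  have h : Measurable fun a => (u a - v a) ⬝ᵥ (u a - v a) :=
    Measurable.dotProduct (hu.sub hv) (hu.sub hv)
  simp only [Pi.sub_apply]
  fun_prop

@[fun_prop]
lemma Measurable.nrm {u : α → ι → ℝ} (hu : Measurable u) : Measurable fun a => nrm (u a) := by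
  simp only [OAMP.nrm]
  fun_prop

lemma Measurable.proj {U : α → ℕ → ι → ℝ} {v : α → ι → ℝ} (k : ℕ)
    (hU : ∀ j, Measurable fun a => U a j) (hv : Measurable v) :
    Measurable fun a => proj (U a) k (v a) := by
  simp only [OAMP.proj]
  refine hv.sub (Finset.measurable_sum _ fun j _ => ?_)
  exact (Measurable.dotProduct hv (hU j)).smul (hU j)

end Measurability

lemma measurableSet_coset (q p : ℕ → ι → ℝ) (k : ℕ) :
    MeasurableSet {W : Matrix ι ι ℝ | IsOrth W ∧ ∀ j < k, W *ᵥ q j = p j} := by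
  have : {W : Matrix ι ι ℝ | IsOrth W ∧ ∀ j < k, W *ᵥ q j = p j} =
      {W | ∀ a b, (Wᵀ * W) a b = (1 : Matrix ι ι ℝ) a b} ∩
        ⋂ j, ⋂ (_ : j < k), {W | W *ᵥ q j = p j} := by
    ext W
    simp [IsOrth, ← Matrix.ext_iff]
  rw [this]
  refine MeasurableSet.inter ?_ (MeasurableSet.iInter fun j => MeasurableSet.iInter fun _ => ?_)
  · simp only [Set.ofPred_forall]
    refine MeasurableSet.iInter fun a => MeasurableSet.iInter fun b => ?_
    exact measurableSet_eq_fun (by fun_prop) (by fun_prop)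
  · exact measurableSet_eq_fun (by fun_prop) (by fun_prop)

/-- The law `μ` is supported on the orthogonal matrices which map `q j` to `p j` for `j < k`. -/
def Coset (μ : Measure (Matrix ι ι ℝ)) (q p : ℕ → ι → ℝ) (k : ℕ) : Prop :=
  ∀ᵐ W ∂μ, IsOrth W ∧ ∀ j < k, W *ᵥ q j = p j

/-- The law `μ` is invariant under left multiplication by the orthogonal matrices which fix
`p j` for `j < k`. -/
def LeftInv (μ : Measure (Matrix ι ι ℝ)) (p : ℕ → ι → ℝ) (k : ℕ) : Prop :=
  ∀ U, IsOrth U → (∀ j < k, U *ᵥ p j = p j) → μ.map (fun W => U * W) = μ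

variable {μ ν : Measure (Matrix ι ι ℝ)} {q p : ℕ → ι → ℝ} {k : ℕ}

lemma LeftInv.lintegral (h : LeftInv μ p k) {U : Matrix ι ι ℝ} (hU : IsOrth U)
    (hp : ∀ j < k, U *ᵥ p j = p j) {f : Matrix ι ι ℝ → ℝ≥0∞} (hf : Measurable f) :
    ∫⁻ W, f (U * W) ∂μ = ∫⁻ W, f W ∂μ := by
  conv_rhs => rw [← h U hU hp]
  rw [lintegral_map hf (by fun_prop)]

/-- A left invariant law on a coset is invariant under `W ↦ A Wᵀ A`, for `A` in the coset. -/
lemma LeftInv.lintegral_flip [IsProbabilityMeasure μ] (h : LeftInv μ p k) (hc : Coset μ q p k)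
    {A : Matrix ι ι ℝ} (hA : IsOrth A) (hAp : ∀ j < k, A *ᵥ q j = p j)
    {f : Matrix ι ι ℝ → ℝ≥0∞} (hf : Measurable f) :
    ∫⁻ W, f (A * Wᵀ * A) ∂μ = ∫⁻ W, f W ∂μ := by
  -- both sides are averages over two independent copies `W`, `W'`, of `f (A Wᵀ W')`
  have key : ∀ g : Matrix ι ι ℝ → ℝ≥0∞, Measurable g →
      ∫⁻ W, g W ∂μ = ∫⁻ W, ∫⁻ W', g (A * Wᵀ * W') ∂μ ∂μ := by
    intro g hg
    have : ∀ᵐ W ∂μ, ∫⁻ W', g (A * Wᵀ * W') ∂μ = ∫⁻ W', g W' ∂μ := by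
      filter_upwards [hc] with W hW
      refine h.lintegral (hA.mul hW.1.transpose) (fun j hj => ?_) hg
      rw [← Matrix.mulVec_mulVec, ← hW.2 j hj, hW.1.transpose_mulVec, hAp j hj, hW.2 j hj]
    rw [lintegral_congr_ae this]
    simp
  rw [key _ hf, key (fun W => f (A * Wᵀ * A)) (by fun_prop), lintegral_lintegral_swap]
  · refine lintegral_congr fun W => lintegral_congr fun W' => ?_
    rw [Matrix.transpose_mul, Matrix.transpose_mul, Matrix.transpose_transpose,
      Matrix.mul_assoc A, Matrix.mul_assoc Wᵀ, Matrix.mul_assoc W', hA, Matrix.mul_one,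
      Matrix.mul_assoc]
  · exact Measurable.aemeasurable (by
      simp only [Function.uncurry_def]; fun_prop)

/-- A left invariant law on a coset is right invariant. -/
lemma LeftInv.lintegral_mul_right [IsProbabilityMeasure μ] (h : LeftInv μ p k)
    (hc : Coset μ q p k) {K : Matrix ι ι ℝ} (hK : IsOrth K) (hKq : ∀ j < k, K *ᵥ q j = q j)
    {f : Matrix ι ι ℝ → ℝ≥0∞} (hf : Measurable f) :
    ∫⁻ W, f (W * K) ∂μ = ∫⁻ W, f W ∂μ := by
  obtain ⟨A, hA, hAp⟩ := hc.exists
  rw [← h.lintegral_flip hc hA hAp hf,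
    ← h.lintegral_flip hc hA hAp (f := fun W => f (W * K)) (by fun_prop)]
  rw [← h.lintegral (U := A * Kᵀ * Aᵀ) ((hA.mul hK.transpose).mul hA.transpose) ?_
    (f := fun W => f (A * Wᵀ * A)) (by fun_prop)]
  · refine lintegral_congr fun W => ?_
    congr 1
    simp only [Matrix.transpose_mul, Matrix.transpose_transpose, Matrix.mul_assoc]
    rw [hA, Matrix.mul_one]
  · intro j hj
    rw [← Matrix.mulVec_mulVec, ← Matrix.mulVec_mulVec]
    nth_rw 1 [← hAp j hj]
    rw [hA.transpose_mulVec]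
    nth_rw 1 [← hKq j hj]
    rw [hK.transpose_mulVec, hAp j hj]

/-- There is at most one left invariant law on a coset. -/
lemma LeftInv.unique [IsProbabilityMeasure μ] [IsProbabilityMeasure ν] (h : LeftInv μ p k)
    (hc : Coset μ q p k) (h' : LeftInv ν p k) (hc' : Coset ν q p k) : μ = ν := by
  refine Measure.ext_of_lintegral _ fun f hf => ?_
  obtain ⟨A, hA, hAp⟩ := hc.exists
  -- average `f (W Aᵀ W')` over `W ∼ μ`, `W' ∼ ν`
  have h1 : ∫⁻ W, ∫⁻ W', f (W * Aᵀ * W') ∂ν ∂μ = ∫⁻ W', f W' ∂ν := by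
    have : ∀ᵐ W ∂μ, ∫⁻ W', f (W * Aᵀ * W') ∂ν = ∫⁻ W', f W' ∂ν := by
      filter_upwards [hc] with W hW
      refine h'.lintegral (hW.1.mul hA.transpose) (fun j hj => ?_) hf
      rw [← Matrix.mulVec_mulVec, ← hAp j hj, hA.transpose_mulVec, hW.2 j hj, hAp j hj]
    rw [lintegral_congr_ae this]
    simp
  have h2 : ∫⁻ W', ∫⁻ W, f (W * Aᵀ * W') ∂μ ∂ν = ∫⁻ W, f W ∂μ := by
    have : ∀ᵐ W' ∂ν, ∫⁻ W, f (W * Aᵀ * W') ∂μ = ∫⁻ W, f W ∂μ := by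
      filter_upwards [hc'] with W' hW'
      simp only [Matrix.mul_assoc]
      refine h.lintegral_mul_right hc (hA.transpose.mul hW'.1) (fun j hj => ?_) hf
      rw [← Matrix.mulVec_mulVec, hW'.2 j hj, ← hAp j hj, hA.transpose_mulVec]
    rw [lintegral_congr_ae this]
    simp
  rw [← h1, ← h2, lintegral_lintegral_swap]
  exact Measurable.aemeasurable (by simp only [Function.uncurry_def]; fun_prop)

lemma LeftInv.transpose [IsProbabilityMeasure μ] (h : LeftInv μ p k)
    (hc : Coset μ q p k) : LeftInv (μ.map fun W => Wᵀ) q k := by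
  intro U hU hUq
  refine Measure.ext_of_lintegral _ fun f hf => ?_
  rw [lintegral_map hf (by fun_prop), lintegral_map (by fun_prop) (by fun_prop),
    lintegral_map (by fun_prop) (by fun_prop)]
  rw [← h.lintegral_mul_right hc (K := Uᵀ) hU.transpose _ (f := fun W => f Wᵀ) (by fun_prop)]
  · simp
  · intro j hj
    nth_rw 1 [← hUq j hj]
    rw [hU.transpose_mulVec]

lemma Coset.transpose (hc : Coset μ q p k) : Coset (μ.map fun W => Wᵀ) p q k := by
  have hm : Measurable fun W : Matrix ι ι ℝ => Wᵀ := by fun_prop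
  rw [Coset, ae_map_iff hm.aemeasurable (measurableSet_coset p q k)]
  filter_upwards [hc] with W hW
  refine ⟨hW.1.transpose, fun j hj => ?_⟩
  rw [← hW.2 j hj, hW.1.transpose_mulVec]

end Invariance

/-! ### Standard Gaussian vectors -/

section Gauss

open scoped ENNReal

variable {ι : Type*} [Fintype ι]

/-- The standard Gaussian law on `ℝ^ι`. -/
noncomputable def stdG (ι : Type*) [Fintype ι] : Measure (ι → ℝ) :=
  Measure.pi fun _ => gaussianReal 0 1

instance : IsProbabilityMeasure (stdG ι) := by unfold stdG; infer_instance

variable [DecidableEq ι]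

lemma stdG_map_mulVec {U : Matrix ι ι ℝ} (hU : IsOrth U) :
    (stdG ι).map (fun z => U *ᵥ z) = stdG ι := by
  let L : EuclideanSpace ℝ ι →ₗᵢ[ℝ] EuclideanSpace ℝ ι :=
    { toLinearMap := Matrix.toEuclideanLin U
      norm_map' := fun x => by
        rw [← sq_eq_sq₀ (norm_nonneg _) (norm_nonneg _), EuclideanSpace.real_norm_sq_eq,
          EuclideanSpace.real_norm_sq_eq]
        have := hU.dotProduct x.ofLp x.ofLp
        simp only [dotProduct, ← sq] at this
        simpa using this }
  let e := L.toLinearIsometryEquiv rfl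
  have h := stdGaussian_map e
  rw [← map_pi_eq_stdGaussian, Measure.map_map (by fun_prop) (by fun_prop)] at h
  have h2 := congrArg (fun m => m.map (fun x : EuclideanSpace ℝ ι => x.ofLp)) h
  simp only at h2
  rw [Measure.map_map (by fun_prop) (by fun_prop), Measure.map_map (by fun_prop) (by fun_prop)] at h2
  have e1 : (fun x : EuclideanSpace ℝ ι => x.ofLp) ∘ (WithLp.toLp 2) = id := rfl
  rw [e1, Measure.map_id] at h2
  exact h2

/-- Replacing one coordinate of a Gaussian vector by a fresh one does not change the law. -/
lemma stdG_resample (n : ι) :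
    ((stdG ι).prod (gaussianReal 0 1)).map (fun a => Function.update a.1 n a.2) = stdG ι := by
  have hm : Measurable fun a : (ι → ℝ) × ℝ => Function.update a.1 n a.2 := by
    refine measurable_pi_iff.2 fun i => ?_
    by_cases h : i = n
    · subst h; simp only [Function.update_self]; fun_prop
    · simp only [Function.update_of_ne h]; fun_prop
  symm
  refine Measure.pi_eq fun s hs => ?_
  rw [Measure.map_apply hm (MeasurableSet.univ_pi hs)]
  have : (fun a : (ι → ℝ) × ℝ => Function.update a.1 n a.2) ⁻¹' (Set.univ.pi s) =
      (Set.univ.pi (Function.update s n Set.univ)) ×ˢ (s n) := by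
    ext a
    simp only [Set.mem_preimage, Set.mem_pi, Set.mem_univ, true_implies, Set.mem_prod]
    constructor
    · intro h
      refine ⟨fun i => ?_, by simpa using h n⟩
      by_cases hi : i = n
      · subst hi; simp
      · simpa [hi] using h i
    · rintro ⟨h1, h2⟩ i
      by_cases hi : i = n
      · subst hi; simpa using h2
      · simpa [hi] using h1 i
  rw [this, Measure.prod_prod, stdG, Measure.pi_pi,
    ← Finset.mul_prod_erase _ _ (Finset.mem_univ n),
    ← Finset.mul_prod_erase _ (fun i => gaussianReal 0 1 (s i)) (Finset.mem_univ n)]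
  simp only [Function.update_self, measure_univ, one_mul]
  rw [mul_comm]
  congr 1
  refine Finset.prod_congr rfl fun i hi => ?_
  rw [Function.update_of_ne (Finset.ne_of_mem_erase hi)]

lemma lintegral_stdG_resample (n : ι) {f : (ι → ℝ) → ℝ≥0∞} (hf : Measurable f) :
    ∫⁻ z, f z ∂(stdG ι) = ∫⁻ z, ∫⁻ s, f (Function.update z n s) ∂(gaussianReal 0 1) ∂(stdG ι) := by
  have hm : Measurable fun a : (ι → ℝ) × ℝ => Function.update a.1 n a.2 := by
    refine measurable_pi_iff.2 fun i => ?_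
    by_cases h : i = n
    · subst h; simp only [Function.update_self]; fun_prop
    · simp only [Function.update_of_ne h]; fun_prop
  conv_lhs => rw [← stdG_resample n]
  rw [lintegral_map hf hm, lintegral_prod]
  exact (hf.comp hm).aemeasurable

/-- Hyperplanes are Gaussian null sets. -/
lemma stdG_hyperplane {w : ι → ℝ} (hw : w ≠ 0) : stdG ι {z | z ⬝ᵥ w = 0} = 0 := by
  obtain ⟨n, hn⟩ : ∃ n, w n ≠ 0 := by
    by_contra! h; exact hw (funext h)
  have hms : MeasurableSet {z : ι → ℝ | z ⬝ᵥ w = 0} :=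
    measurableSet_eq_fun (by fun_prop) (by fun_prop)
  rw [← lintegral_indicator_one hms, lintegral_stdG_resample n (measurable_one.indicator hms)]
  refine lintegral_eq_zero_of_ae_eq_zero (Filter.Eventually.of_forall fun z => ?_)
  have : (fun s : ℝ => Set.indicator {z : ι → ℝ | z ⬝ᵥ w = 0} (1 : (ι → ℝ) → ℝ≥0∞)
      (Function.update z n s)) =
      Set.indicator {s | Function.update z n s ⬝ᵥ w = 0} 1 := by
    ext s; simp [Set.indicator]
  simp only [Pi.zero_apply]
  rw [this, lintegral_indicator_one]
  · have hsub : Set.Subsingleton {s : ℝ | Function.update z n s ⬝ᵥ w = 0} := by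
      intro s hs s' hs'
      have e : ∀ s, Function.update z n s ⬝ᵥ w = s * w n + ∑ i ∈ Finset.univ.erase n, z i * w i := by
        intro s
        rw [dotProduct, ← Finset.add_sum_erase _ _ (Finset.mem_univ n)]
        congr 1
        · simp
        · refine Finset.sum_congr rfl fun i hi => ?_
          rw [Function.update_of_ne (Finset.ne_of_mem_erase hi)]
      simp only [Set.mem_ofPred_eq, e] at hs hs'
      exact mul_right_cancel₀ hn (by linarith)
    have := nullSingletonClass_gaussianReal (μ := 0) (v := 1) one_ne_zero
    exact hsub.measure_zero _
  · refine measurableSet_eq_fun (Measurable.dotProduct ?_ (by fun_prop)) (by fun_prop)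
    exact measurable_update z

end Gauss

end OAMP


namespace OAMP

/-! ### Revealing one more image of a Haar distributed matrix -/

section Dice

set_option linter.unusedSectionVars false

open scoped ENNReal

variable {ι : Type*} [Fintype ι] [DecidableEq ι]

/-- The direction of the part of `z` orthogonal to `p 0, …, p (k-1)`, scaled to the norm of `u`.
For a Gaussian `z` and a unit vector `u` it is uniformly distributed on the unit sphere of the
orthogonal complement. -/
noncomputable def dice (p : ℕ → ι → ℝ) (k : ℕ) (u z : ι → ℝ) : ι → ℝ :=
  Real.sqrt (u ⬝ᵥ u) • nrm (proj p k z)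

lemma proj_mulVec {U : Matrix ι ι ℝ} (hU : IsOrth U) {p : ℕ → ι → ℝ} {k : ℕ}
    (hp : ∀ j < k, U *ᵥ p j = p j) (z : ι → ℝ) : U *ᵥ proj p k z = proj p k (U *ᵥ z) := by
  rw [proj, proj, Matrix.mulVec_sub, Matrix.mulVec_sum]
  congr 1
  refine Finset.sum_congr rfl fun j hj => ?_
  have := hp j (Finset.mem_range.1 hj)
  rw [Matrix.mulVec_smul, this]
  nth_rw 3 [← this]
  rw [hU.dotProduct]

lemma dice_mulVec {U : Matrix ι ι ℝ} (hU : IsOrth U) {p : ℕ → ι → ℝ} {k : ℕ}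
    (hp : ∀ j < k, U *ᵥ p j = p j) (u z : ι → ℝ) :
    U *ᵥ dice p k u z = dice p k u (U *ᵥ z) := by
  rw [dice, dice, Matrix.mulVec_smul, hU.mulVec_nrm, proj_mulVec hU hp]

lemma OrthZero.dice_dotProduct {p : ℕ → ι → ℝ} {k i : ℕ} (h : OrthZero p k) (hi : i < k)
    (u z : ι → ℝ) : dice p k u z ⬝ᵥ p i = 0 := by
  rw [dice, nrm, smul_dotProduct, smul_dotProduct, h.proj_dotProduct hi]; simp

lemma dice_dotProduct_self {p : ℕ → ι → ℝ} {k : ℕ} {u z : ι → ℝ}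
    (h : u ⬝ᵥ u = 0 ∨ proj p k z ≠ 0) : dice p k u z ⬝ᵥ dice p k u z = u ⬝ᵥ u := by
  rw [dice, smul_dotProduct, dotProduct_smul, smul_smul,
    Real.mul_self_sqrt (dotProduct_self_nonneg' u)]
  rcases h with h | h
  · rw [h]; simp
  · rw [nrm_dotProduct_self h]; simp

lemma Measurable.dice {α : Type*} [MeasurableSpace α] {p : α → ℕ → ι → ℝ} {u z : α → ι → ℝ} (k : ℕ)
    (hp : ∀ j, Measurable fun a => p a j) (hu : Measurable u) (hz : Measurable z) :
    Measurable fun a => dice (p a) k (u a) (z a) := by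
  have := Measurable.nrm (Measurable.proj k hp hz)
  simp only [OAMP.dice]
  fun_prop

/-- Almost every Gaussian vector has a nonzero residual, as soon as some vector has one. -/
lemma ae_proj_ne_zero {p : ℕ → ι → ℝ} {k : ℕ} {w : ι → ℝ} (hw : w ≠ 0)
    (hwp : ∀ j < k, p j ⬝ᵥ w = 0) : ∀ᵐ z ∂(stdG ι), proj p k z ≠ 0 := by
  refine measure_mono_null (fun z hz => ?_) (stdG_hyperplane hw)
  have h0 : proj p k z = 0 := by simpa using hz
  have h1 : proj p k z ⬝ᵥ w = z ⬝ᵥ w := by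
    rw [proj, sub_dotProduct, sum_dotProduct, Finset.sum_eq_zero, sub_zero]
    intro j hj
    rw [smul_dotProduct, hwp j (Finset.mem_range.1 hj), smul_zero]
  show z ⬝ᵥ w = 0
  rw [← h1, h0, zero_dotProduct]

variable {μ : Measure (Matrix ι ι ℝ)} {q p : ℕ → ι → ℝ} {k : ℕ}

lemma ae_dice_dotProduct_self {C : Matrix ι ι ℝ} (hC : IsOrth C) (hCq : ∀ j < k, C *ᵥ q j = p j)
    {u : ι → ℝ} (hu : ∀ j < k, u ⬝ᵥ q j = 0) :
    ∀ᵐ z ∂(stdG ι), dice p k u z ⬝ᵥ dice p k u z = u ⬝ᵥ u := by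
  by_cases h0 : u ⬝ᵥ u = 0
  · exact Filter.Eventually.of_forall fun z => dice_dotProduct_self (Or.inl h0)
  · have hw : C *ᵥ u ≠ 0 := by
      intro h
      apply h0
      rw [← hC.dotProduct, h, zero_dotProduct]
    filter_upwards [ae_proj_ne_zero (p := p) (k := k) hw fun j hj => by
      rw [← hCq j hj, hC.dotProduct, dotProduct_comm, hu j hj]] with z hz
    exact dice_dotProduct_self (Or.inr hz)

/-- The image of `u` under a matrix `C` with a left invariant law may be replaced by a uniformly
random direction, by composing `C` with the reflection that exchanges the two. -/
lemma LeftInv.lintegral_dice [IsProbabilityMeasure μ] (h : LeftInv μ p k) (hc : Coset μ q p k)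
    (hp : OrthZero p k) {u : ι → ℝ} (hu : ∀ j < k, u ⬝ᵥ q j = 0)
    {f : Matrix ι ι ℝ → ℝ≥0∞} (hf : Measurable f) :
    ∫⁻ C, f C ∂μ = ∫⁻ C, ∫⁻ z, f (refl (C *ᵥ u) (dice p k u z) * C) ∂(stdG ι) ∂μ := by
  have hd : Measurable fun z : ι → ℝ => dice p k u z :=
    Measurable.dice k (fun j => measurable_const) measurable_const measurable_id
  have hF : Measurable fun a : Matrix ι ι ℝ × (ι → ℝ) =>
      refl (a.1 *ᵥ u) (dice p k u a.2) * a.1 := by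
    have : Measurable fun a : Matrix ι ι ℝ × (ι → ℝ) => dice p k u a.2 := hd.comp measurable_snd
    fun_prop
  set ν := (μ.prod (stdG ι)).map fun a => refl (a.1 *ᵥ u) (dice p k u a.2) * a.1 with hν
  have hνp : IsProbabilityMeasure ν := Measure.isProbabilityMeasure_map hF.aemeasurable
  have hνi : ∀ g : Matrix ι ι ℝ → ℝ≥0∞, Measurable g → ∫⁻ W, g W ∂ν =
      ∫⁻ C, ∫⁻ z, g (refl (C *ᵥ u) (dice p k u z) * C) ∂(stdG ι) ∂μ := by
    intro g hg
    rw [hν, lintegral_map hg hF, lintegral_prod]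
    exact (hg.comp hF).aemeasurable
  have hνl : LeftInv ν p k := by
    intro U hU hUp
    refine Measure.ext_of_lintegral _ fun g hg => ?_
    rw [lintegral_map hg (by fun_prop), hνi _ (by fun_prop), hνi _ hg]
    have e1 : ∀ C z, U * (refl (C *ᵥ u) (dice p k u z) * C) =
        refl ((U * C) *ᵥ u) (dice p k u (U *ᵥ z)) * (U * C) := by
      intro C z
      rw [← Matrix.mul_assoc, hU.mul_refl, dice_mulVec hU hUp, Matrix.mulVec_mulVec,
        Matrix.mul_assoc]
    simp only [e1]
    have e2 : ∀ C, ∫⁻ z, g (refl ((U * C) *ᵥ u) (dice p k u (U *ᵥ z)) * (U * C)) ∂(stdG ι) =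
        ∫⁻ z, g (refl ((U * C) *ᵥ u) (dice p k u z) * (U * C)) ∂(stdG ι) := by
      intro C
      conv_rhs => rw [← stdG_map_mulVec hU]
      rw [lintegral_map (by fun_prop) (by fun_prop)]
    simp only [e2]
    refine h.lintegral hU hUp
      (f := fun C => ∫⁻ z, g (refl (C *ᵥ u) (dice p k u z) * C) ∂(stdG ι)) ?_
    exact Measurable.lintegral_prod_right (hg.comp hF)
  have hνc : Coset ν q p k := by
    rw [Coset, hν]
    rw [ae_map_iff hF.aemeasurable (measurableSet_coset q p k)]
    have : ∀ᵐ a ∂(μ.prod (stdG ι)), IsOrth a.1 ∧ ∀ j < k, a.1 *ᵥ q j = p j :=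
      Measure.quasiMeasurePreserving_fst.ae hc
    filter_upwards [this] with a ha
    refine ⟨(isOrth_refl _ _).mul ha.1, fun j hj => ?_⟩
    rw [← Matrix.mulVec_mulVec, ha.2 j hj]
    refine refl_apply_of_dotProduct_eq ?_
    rw [hp.dice_dotProduct hj, ← ha.2 j hj, ha.1.dotProduct, hu j hj]
  rw [h.unique hc hνl hνc, hνi f hf, ← h.unique hc hνl hνc]

end Dice

/-! ### Sequential revelation of a Haar distributed matrix -/

section MessagePassing

set_option linter.unusedSectionVars false

open scoped ENNReal

variable {ι : Type*} [Fintype ι] [DecidableEq ι]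

/-- The state of a message passing process between two sides, `true` and `false`, which exchange
messages through an orthogonal matrix: for every past step and every side, the message on that
side (sent or received), and the new direction revealed on that side. Entries of future steps are
zero. -/
abbrev MsgState (ι : Type*) := ℕ → Bool → (ι → ℝ) × (ι → ℝ)

/-- The messages seen on side `b`. -/
def msgs (s : MsgState ι) (b : Bool) (j : ℕ) : ι → ℝ := (s j b).1

/-- The directions revealed on side `b`. -/
def dirs (s : MsgState ι) (b : Bool) (j : ℕ) : ι → ℝ := (s j b).2

/-- The new direction in the message `v` sent from side `b` in step `k`. -/
noncomputable def newDir (s : MsgState ι) (k : ℕ) (b : Bool) (v : ι → ℝ) : ι → ℝ :=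
  nrm (proj (dirs s b) k v)

/-- The message received in step `k` on the side opposite to `b`, if `v` is sent from side `b` and
`d` is the image of the new direction. -/
noncomputable def received (s : MsgState ι) (k : ℕ) (b : Bool) (v d : ι → ℝ) : ι → ℝ :=
  ∑ j ∈ Finset.range k, (v ⬝ᵥ dirs s b j) • dirs s (!b) j +
    Real.sqrt (proj (dirs s b) k v ⬝ᵥ proj (dirs s b) k v) • d

/-- The state after step `k`, in which `v` is sent from side `b` and `d` is the image of the new
direction on the other side. -/
noncomputable def step (k : ℕ) (b : Bool) (s : MsgState ι) (v d : ι → ℝ) : MsgState ι :=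
  Function.update s k fun c => if c = b then (v, newDir s k b v) else (received s k b v d, d)

/-- The message passing process: in step `k` side `snd k` sends `Φ k s`, where `s` is the current
state, and `D k s` is the image of the new direction on the other side. -/
noncomputable def run (snd : ℕ → Bool) (Φ D : ℕ → MsgState ι → ι → ℝ) : ℕ → MsgState ι
  | 0 => 0
  | k + 1 => step k (snd k) (run snd Φ D k) (Φ k (run snd Φ D k)) (D k (run snd Φ D k))

/-- The images of the new directions under the matrix `V` (from side `true` to side `false`). -/
noncomputable def dirOrig (snd : ℕ → Bool) (Φ : ℕ → MsgState ι → ι → ℝ) (V : Matrix ι ι ℝ)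
    (k : ℕ) (s : MsgState ι) : ι → ℝ :=
  (if snd k then V else Vᵀ) *ᵥ newDir s k (snd k) (Φ k s)

/-- The images of the new directions, simulated by Gaussian noise. -/
noncomputable def dirHat (snd : ℕ → Bool) (Φ : ℕ → MsgState ι → ι → ℝ) (ζ : ι → ℕ → ℝ)
    (k : ℕ) (s : MsgState ι) : ι → ℝ :=
  dice (dirs s (!snd k)) k (newDir s k (snd k) (Φ k s)) fun n => ζ n k

/-- `V`, corrected by reflections so that it maps the directions of `s` on side `true` to those
on side `false`. -/
noncomputable def Cmat (V : Matrix ι ι ℝ) (s : MsgState ι) : ℕ → Matrix ι ι ℝ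
  | 0 => V
  | k + 1 => refl (Cmat V s k *ᵥ dirs s true k) (dirs s false k) * Cmat V s k

/-- Consistency of a state: on both sides the directions are orthonormal or zero, and all messages
have the same coordinates on both sides. -/
structure Good (s : MsgState ι) (k : ℕ) : Prop where
  orth : ∀ b, OrthZero (dirs s b) k
  norm : ∀ j < k, dirs s true j ⬝ᵥ dirs s true j = dirs s false j ⬝ᵥ dirs s false j
  rep : ∃ c : ℕ → ℕ → ℝ, ∀ i < k, ∀ b, msgs s b i = ∑ m ∈ Finset.range k, c i m • dirs s b m

section StepLemmas

variable (s : MsgState ι) (k : ℕ) (b c : Bool) (v d : ι → ℝ)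

lemma step_of_ne {j : ℕ} (h : j ≠ k) : step k b s v d j = s j := by
  rw [step, Function.update_of_ne h]

lemma dirs_step_of_ne {j : ℕ} (h : j ≠ k) : dirs (step k b s v d) c j = dirs s c j := by
  rw [dirs, step_of_ne _ _ _ _ _ h]; rfl

lemma msgs_step_of_ne {j : ℕ} (h : j ≠ k) : msgs (step k b s v d) c j = msgs s c j := by
  rw [msgs, step_of_ne _ _ _ _ _ h]; rfl

lemma dirs_step_self : dirs (step k b s v d) b k = newDir s k b v := by simp [dirs, step]

lemma dirs_step_not : dirs (step k b s v d) (!b) k = d := by simp [dirs, step]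

lemma msgs_step_self : msgs (step k b s v d) b k = v := by simp [msgs, step]

lemma msgs_step_not : msgs (step k b s v d) (!b) k = received s k b v d := by simp [msgs, step]

end StepLemmas

lemma Cmat_congr {s s' : MsgState ι} (V : Matrix ι ι ℝ) {k : ℕ}
    (h : ∀ j < k, ∀ b, dirs s b j = dirs s' b j) : Cmat V s k = Cmat V s' k := by
  induction k with
  | zero => rfl
  | succ k ih =>
    rw [Cmat, Cmat, ih fun j hj => h j (by omega), h k (by omega), h k (by omega)]

lemma newDir_dotProduct {s : MsgState ι} {k j : ℕ} {b : Bool} (h : OrthZero (dirs s b) k)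
    (hj : j < k) (v : ι → ℝ) : newDir s k b v ⬝ᵥ dirs s b j = 0 := by
  rw [newDir, nrm, smul_dotProduct, h.proj_dotProduct hj]; simp

lemma OrthZero.succ {U : ℕ → ι → ℝ} {k : ℕ} (h : OrthZero U k) (h1 : ∀ j < k, U k ⬝ᵥ U j = 0)
    (h2 : U k ⬝ᵥ U k = 0 ∨ U k ⬝ᵥ U k = 1) : OrthZero U (k + 1) := by
  refine ⟨fun i hi j hj hij => ?_, fun i hi => ?_⟩
  · rcases Nat.lt_succ_iff_lt_or_eq.1 hi with hi | rfl
    · rcases Nat.lt_succ_iff_lt_or_eq.1 hj with hj | rfl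
      · exact h.1 i hi j hj hij
      · rw [dotProduct_comm]; exact h1 i hi
    · rcases Nat.lt_succ_iff_lt_or_eq.1 hj with hj | rfl
      · exact h1 j hj
      · exact absurd rfl hij
  · rcases Nat.lt_succ_iff_lt_or_eq.1 hi with hi | rfl
    · exact h.2 i hi
    · exact h2

lemma OrthZero.congr {U U' : ℕ → ι → ℝ} {k : ℕ} (h : OrthZero U k) (h' : ∀ j < k, U' j = U j) :
    OrthZero U' k :=
  ⟨fun i hi j hj hij => by rw [h' i hi, h' j hj]; exact h.1 i hi j hj hij,
    fun i hi => by rw [h' i hi]; exact h.2 i hi⟩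

/-- A step preserves consistency if the image of the new direction is orthogonal to the earlier
directions on its side and has the right norm. -/
lemma Good.step {s : MsgState ι} {k : ℕ} (h : Good s k) (b : Bool) (v : ι → ℝ) {d : ι → ℝ}
    (hd : ∀ j < k, d ⬝ᵥ dirs s (!b) j = 0) (hdd : d ⬝ᵥ d = newDir s k b v ⬝ᵥ newDir s k b v) :
    Good (step k b s v d) (k + 1) := by
  have hn := nrm_dotProduct_self_or (proj (dirs s b) k v)
  have hlt : ∀ c, ∀ j < k, dirs (OAMP.step k b s v d) c j = dirs s c j := fun c j hj =>
    dirs_step_of_ne _ _ _ _ _ _ hj.ne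
  refine ⟨fun c => ?_, fun j hj => ?_, ?_⟩
  · refine ((h.orth c).congr (hlt c)).succ (fun j hj => ?_) ?_
    · rw [hlt c j hj]
      by_cases hc : c = b
      · subst hc
        rw [dirs_step_self, newDir_dotProduct (h.orth c) hj]
      · obtain rfl : c = !b := by cases c <;> cases b <;> simp_all
        rw [dirs_step_not, hd j hj]
    · by_cases hc : c = b
      · subst hc
        rw [dirs_step_self]; exact hn
      · obtain rfl : c = !b := by cases c <;> cases b <;> simp_all
        rw [dirs_step_not, hdd]; exact hn
  · rcases Nat.lt_succ_iff_lt_or_eq.1 hj with hj | rfl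
    · rw [hlt _ j hj, hlt _ j hj, h.norm j hj]
    · cases b
      · rw [dirs_step_self, show true = !false from rfl, dirs_step_not, hdd]
      · rw [dirs_step_self, show false = !true from rfl, dirs_step_not, hdd]
  · obtain ⟨c, hc⟩ := h.rep
    refine ⟨fun i m => if i = k then (if m = k then
      Real.sqrt (proj (dirs s b) k v ⬝ᵥ proj (dirs s b) k v) else v ⬝ᵥ dirs s b m)
      else (if m = k then 0 else c i m), fun i hi a => ?_⟩
    rw [Finset.sum_range_succ]
    rcases Nat.lt_succ_iff_lt_or_eq.1 hi with hi | rfl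
    · rw [msgs_step_of_ne _ _ _ _ _ _ hi.ne, hc i hi a]
      simp only [hi.ne, if_false, if_true, zero_smul, add_zero]
      refine Finset.sum_congr rfl fun m hm => ?_
      have hm := Finset.mem_range.1 hm
      rw [if_neg hm.ne, hlt _ m hm]
    · simp only [if_true]
      have e : ∀ a, ∑ m ∈ Finset.range i, (if m = i then
          Real.sqrt (proj (dirs s b) i v ⬝ᵥ proj (dirs s b) i v) else v ⬝ᵥ dirs s b m) •
            dirs (OAMP.step i b s v d) a m =
          ∑ m ∈ Finset.range i, (v ⬝ᵥ dirs s b m) • dirs s a m := fun a =>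
        Finset.sum_congr rfl fun m hm => by
          have hm := Finset.mem_range.1 hm
          rw [if_neg hm.ne, hlt _ m hm]
      rw [e]
      by_cases ha : a = b
      · subst ha
        rw [msgs_step_self, dirs_step_self, newDir, sqrt_smul_nrm, proj]
        abel
      · obtain rfl : a = !b := by cases a <;> cases b <;> simp_all
        rw [msgs_step_not, dirs_step_not, received]

lemma Good.zero (s : MsgState ι) : Good s 0 :=
  ⟨fun _ => ⟨fun i hi => by omega, fun i hi => by omega⟩, fun j hj => by omega,
    ⟨0, fun i hi => by omega⟩⟩

/-- The corrected matrix is orthogonal and maps the directions of a consistent state on side `true`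
to those on side `false`. -/
lemma Good.Cmat_coset {s : MsgState ι} {k : ℕ} (h : Good s k) {V : Matrix ι ι ℝ} (hV : IsOrth V) :
    ∀ m ≤ k, IsOrth (Cmat V s m) ∧ ∀ j < m, Cmat V s m *ᵥ dirs s true j = dirs s false j := by
  intro m
  induction m with
  | zero => exact fun _ => ⟨hV, fun j hj => by omega⟩
  | succ m ih =>
    intro hm
    obtain ⟨h1, h2⟩ := ih (by omega)
    refine ⟨(isOrth_refl _ _).mul h1, fun j hj => ?_⟩
    rw [Cmat, ← Matrix.mulVec_mulVec]
    rcases Nat.lt_succ_iff_lt_or_eq.1 hj with hj | rfl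
    · rw [h2 j hj]
      refine refl_apply_of_dotProduct_eq ?_
      rw [← h2 j hj, h1.dotProduct, h2 j hj, (h.orth true).1 m (by omega) j (by omega) hj.ne',
        (h.orth false).1 m (by omega) j (by omega) hj.ne']
    · exact refl_apply_left (by rw [h1.dotProduct, h.norm j (by omega)])

lemma Cmat_mul {s : MsgState ι} {U : Matrix ι ι ℝ} (hU : IsOrth U) (V : Matrix ι ι ℝ) {k : ℕ}
    (h : ∀ j < k, U *ᵥ dirs s false j = dirs s false j) : Cmat (U * V) s k = U * Cmat V s k := by
  induction k with
  | zero => rfl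
  | succ k ih =>
    rw [Cmat, Cmat, ih fun j hj => h j (by omega), ← Matrix.mul_assoc U, hU.mul_refl, h k (by omega),
      Matrix.mulVec_mulVec, Matrix.mul_assoc]

end MessagePassing

end OAMP


namespace OAMP

section ProcessLaw

set_option linter.unusedSectionVars false

open scoped ENNReal

variable {ι : Type*} [Fintype ι] [DecidableEq ι]

/-! ### The noise that simulates the process -/

/-- The law of a sequence of independent standard Gaussian variables. -/
noncomputable def seqG : Measure (ℕ → ℝ) := Measure.infinitePi fun _ => gaussianReal 0 1

instance : IsProbabilityMeasure seqG := by unfold seqG; infer_instance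

/-- The law of a matrix of independent standard Gaussian variables with a row for every entry of
the messages and a column for every step. -/
noncomputable def noise (ι : Type*) [Fintype ι] : Measure (ι → ℕ → ℝ) := Measure.pi fun _ => seqG

instance : IsProbabilityMeasure (noise ι) := by unfold noise; infer_instance

lemma seqG_resample (k : ℕ) :
    (seqG.prod (gaussianReal 0 1)).map (fun a => Function.update a.1 k a.2) = seqG := by
  have hm : Measurable fun a : (ℕ → ℝ) × ℝ => Function.update a.1 k a.2 := by
    refine measurable_pi_iff.2 fun i => ?_
    by_cases h : i = k
    · subst h; simp only [Function.update_self]; fun_prop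
    · simp only [Function.update_of_ne h]; fun_prop
  have : IsProbabilityMeasure
      ((seqG.prod (gaussianReal 0 1)).map (fun a => Function.update a.1 k a.2)) :=
    Measure.isProbabilityMeasure_map hm.aemeasurable
  refine Measure.eq_infinitePi _ fun s t ht => ?_
  classical
  rw [Measure.map_apply hm (MeasurableSet.pi (Finset.countable_toSet s) (fun i _ => ht i))]
  have : (fun a : (ℕ → ℝ) × ℝ => Function.update a.1 k a.2) ⁻¹' ((s : Set ℕ).pi t) =
      (((s.erase k : Finset ℕ) : Set ℕ).pi t) ×ˢ (if k ∈ s then t k else Set.univ) := by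
    ext a
    simp only [Set.mem_preimage, Set.mem_pi, Set.mem_prod, Finset.mem_coe, Finset.mem_erase]
    constructor
    · intro h
      refine ⟨fun i hi => by simpa [hi.1] using h i hi.2, ?_⟩
      split_ifs with hk
      · simpa using h k hk
      · trivial
    · rintro ⟨h1, h2⟩ i hi
      by_cases hik : i = k
      · subst hik; simpa [hi] using h2
      · simpa [hik] using h1 i ⟨hik, hi⟩
  rw [this, Measure.prod_prod, seqG, Measure.infinitePi_pi _ (fun i _ => ht i)]
  split_ifs with hk
  · rw [mul_comm, Finset.mul_prod_erase s (fun i => gaussianReal 0 1 (t i)) hk]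
  · rw [Finset.erase_eq_of_notMem hk]; simp

/-- Replacement of the column `k` of the noise by a given vector. -/
def setCol (ζ : ι → ℕ → ℝ) (k : ℕ) (z : ι → ℝ) : ι → ℕ → ℝ := fun n => Function.update (ζ n) k (z n)

lemma measurable_setCol (k : ℕ) :
    Measurable fun a : (ι → ℕ → ℝ) × (ι → ℝ) => setCol a.1 k a.2 := by
  refine measurable_pi_iff.2 fun n => measurable_pi_iff.2 fun i => ?_
  simp only [setCol]
  by_cases h : i = k
  · subst h; simp only [Function.update_self]; fun_prop
  · simp only [Function.update_of_ne h]; fun_prop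

lemma noise_resample (k : ℕ) :
    ((noise ι).prod (stdG ι)).map (fun a => setCol a.1 k a.2) = noise ι := by
  have hm : Measurable fun a : (ℕ → ℝ) × ℝ => Function.update a.1 k a.2 := by
    refine measurable_pi_iff.2 fun i => ?_
    by_cases h : i = k
    · subst h; simp only [Function.update_self]; fun_prop
    · simp only [Function.update_of_ne h]; fun_prop
  have h1 := (measurePreserving_arrowProdEquivProdArrow (ℕ → ℝ) ℝ ι (fun _ => seqG)
    (fun _ => gaussianReal 0 1)).map_eq
  have h2 : (noise ι).prod (stdG ι) = (Measure.pi fun _ : ι => seqG).prod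
    (Measure.pi fun _ : ι => gaussianReal 0 1) := rfl
  have hp : ∀ i : ι, SigmaFinite
      ((seqG.prod (gaussianReal 0 1)).map (fun a => Function.update a.1 k a.2)) := fun i => by
    rw [seqG_resample]; infer_instance
  rw [h2, ← h1, Measure.map_map (measurable_setCol k) (MeasurableEquiv.measurable _)]
  have h3 := Measure.pi_map_pi (μ := fun _ : ι => seqG.prod (gaussianReal 0 1))
    (f := fun _ a => Function.update a.1 k a.2) (fun _ => hm.aemeasurable)
  simp only [seqG_resample] at h3
  rw [noise, ← h3]
  rfl

lemma lintegral_noise_resample (k : ℕ) {f : (ι → ℕ → ℝ) → ℝ≥0∞} (hf : Measurable f) :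
    ∫⁻ ζ, f ζ ∂(noise ι) = ∫⁻ ζ, ∫⁻ z, f (setCol ζ k z) ∂(stdG ι) ∂(noise ι) := by
  conv_lhs => rw [← noise_resample k]
  rw [lintegral_map hf (measurable_setCol k), lintegral_prod]
  exact (hf.comp (measurable_setCol k)).aemeasurable

/-! ### Measurability of the process -/

section Measurability

variable {α : Type*} [MeasurableSpace α]

lemma measurable_dirs {s : α → MsgState ι} (hs : Measurable s) (b : Bool) (j : ℕ) :
    Measurable fun a => dirs (s a) b j := by
  unfold dirs; fun_prop

lemma measurable_msgs {s : α → MsgState ι} (hs : Measurable s) (b : Bool) (j : ℕ) :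
    Measurable fun a => msgs (s a) b j := by
  unfold msgs; fun_prop

lemma measurable_newDir {s : α → MsgState ι} {v : α → ι → ℝ} (hs : Measurable s)
    (hv : Measurable v) (k : ℕ) (b : Bool) : Measurable fun a => newDir (s a) k b (v a) :=
  Measurable.nrm (Measurable.proj k (measurable_dirs hs b) hv)

lemma measurable_step {s : α → MsgState ι} {v d : α → ι → ℝ} (hs : Measurable s)
    (hv : Measurable v) (hd : Measurable d) (k : ℕ) (b : Bool) :
    Measurable fun a => step k b (s a) (v a) (d a) := by
  refine measurable_pi_iff.2 fun j => ?_
  by_cases h : j = k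
  · subst h
    simp only [step, Function.update_self]
    refine measurable_pi_iff.2 fun c => ?_
    by_cases hc : c = b
    · simp only [hc, if_true]
      exact hv.prodMk (measurable_newDir hs hv j b)
    · simp only [hc, if_false]
      refine Measurable.prodMk ?_ hd
      simp only [received]
      have h1 := Measurable.proj j (measurable_dirs hs b) hv
      refine Measurable.add (Finset.measurable_sum _ fun i _ => ?_) ?_
      · have h2 := measurable_dirs hs b i
        have h3 := measurable_dirs hs (!b) i
        fun_prop
      · fun_prop
  · simp only [step_of_ne _ _ _ _ _ h]
    fun_prop

lemma measurable_run (snd : ℕ → Bool) {Φ D : α → ℕ → MsgState ι → ι → ℝ}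
    (hΦ : ∀ k, Measurable fun p : α × MsgState ι => Φ p.1 k p.2)
    (hD : ∀ k, Measurable fun p : α × MsgState ι => D p.1 k p.2) (k : ℕ) :
    Measurable fun a => run snd (Φ a) (D a) k := by
  induction k with
  | zero => exact measurable_const
  | succ k ih =>
    have h := measurable_id.prodMk ih
    exact measurable_step ih ((hΦ k).comp h) ((hD k).comp h) k (snd k)

lemma measurable_dirOrig (snd : ℕ → Bool) {Φ : α → ℕ → MsgState ι → ι → ℝ} (k : ℕ)
    (hΦ : Measurable fun p : α × MsgState ι => Φ p.1 k p.2) :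
    Measurable fun p : (α × Matrix ι ι ℝ) × MsgState ι =>
      dirOrig snd (Φ p.1.1) p.1.2 k p.2 := by
  unfold dirOrig
  have h0 : Measurable fun p : (α × Matrix ι ι ℝ) × MsgState ι => Φ p.1.1 k p.2 :=
    hΦ.comp ((measurable_fst.comp measurable_fst).prodMk measurable_snd)
  have h1 : Measurable fun p : (α × Matrix ι ι ℝ) × MsgState ι =>
      newDir p.2 k (snd k) (Φ p.1.1 k p.2) := measurable_newDir measurable_snd h0 k (snd k)
  split_ifs <;> fun_prop

lemma measurable_dirHat (snd : ℕ → Bool) {Φ : α → ℕ → MsgState ι → ι → ℝ} (k : ℕ)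
    (hΦ : Measurable fun p : α × MsgState ι => Φ p.1 k p.2) :
    Measurable fun p : (α × (ι → ℕ → ℝ)) × MsgState ι => dirHat snd (Φ p.1.1) p.1.2 k p.2 := by
  unfold dirHat
  have h0 : Measurable fun p : (α × (ι → ℕ → ℝ)) × MsgState ι => Φ p.1.1 k p.2 :=
    hΦ.comp ((measurable_fst.comp measurable_fst).prodMk measurable_snd)
  refine Measurable.dice k (measurable_dirs measurable_snd _)
    (measurable_newDir measurable_snd h0 k (snd k)) ?_
  fun_prop

lemma measurable_Cmat {V : α → Matrix ι ι ℝ} {s : α → MsgState ι} (hV : Measurable V)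
    (hs : Measurable s) (k : ℕ) : Measurable fun a => Cmat (V a) (s a) k := by
  induction k with
  | zero => exact hV
  | succ k ih =>
    have h1 := measurable_dirs hs true k
    have h2 := measurable_dirs hs false k
    simp only [Cmat]
    fun_prop

end Measurability

/-! ### The simulated process has the law of the original one -/

/-- The process driven by an orthogonal matrix. -/
noncomputable def runOrig (snd : ℕ → Bool) (Φ : ℕ → MsgState ι → ι → ℝ) (V : Matrix ι ι ℝ)
    (k : ℕ) : MsgState ι := run snd Φ (dirOrig snd Φ V) k

/-- The process simulated by Gaussian noise. -/
noncomputable def runHat (snd : ℕ → Bool) (Φ : ℕ → MsgState ι → ι → ℝ) (ζ : ι → ℕ → ℝ)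
    (k : ℕ) : MsgState ι := run snd Φ (dirHat snd Φ ζ) k

lemma runHat_succ (snd : ℕ → Bool) (Φ : ℕ → MsgState ι → ι → ℝ) (ζ : ι → ℕ → ℝ) (k : ℕ) :
    runHat snd Φ ζ (k + 1) = step k (snd k) (runHat snd Φ ζ k) (Φ k (runHat snd Φ ζ k))
      (dice (dirs (runHat snd Φ ζ k) (!snd k)) k
        (newDir (runHat snd Φ ζ k) k (snd k) (Φ k (runHat snd Φ ζ k))) fun n => ζ n k) := rfl

lemma runOrig_succ (snd : ℕ → Bool) (Φ : ℕ → MsgState ι → ι → ℝ) (V : Matrix ι ι ℝ) (k : ℕ) :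
    runOrig snd Φ V (k + 1) = step k (snd k) (runOrig snd Φ V k) (Φ k (runOrig snd Φ V k))
      (dirOrig snd Φ V k (runOrig snd Φ V k)) := rfl

variable (snd : ℕ → Bool) (Φ : ℕ → MsgState ι → ι → ℝ)

/-- The state before step `k` does not depend on the noise of the steps from `k` on. -/
lemma runHat_setCol (ζ : ι → ℕ → ℝ) (z : ι → ℝ) {k m : ℕ} (h : m ≤ k) :
    runHat snd Φ (setCol ζ k z) m = runHat snd Φ ζ m := by
  induction m with
  | zero => rfl
  | succ m ih =>
    have : (fun n => setCol ζ k z n m) = fun n => ζ n m := by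
      ext n; rw [setCol, Function.update_of_ne (by omega)]
    rw [runHat_succ, runHat_succ, ih (by omega), this]

lemma runHat_setCol_succ (ζ : ι → ℕ → ℝ) (z : ι → ℝ) (k : ℕ) :
    runHat snd Φ (setCol ζ k z) (k + 1) =
      step k (snd k) (runHat snd Φ ζ k) (Φ k (runHat snd Φ ζ k))
        (dice (dirs (runHat snd Φ ζ k) (!snd k)) k
          (newDir (runHat snd Φ ζ k) k (snd k) (Φ k (runHat snd Φ ζ k))) z) := by
  rw [runHat_succ, runHat_setCol snd Φ ζ z le_rfl]
  simp [setCol]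

lemma measurable_runHat {α : Type*} [MeasurableSpace α] {Φ : α → ℕ → MsgState ι → ι → ℝ}
    (hΦ : ∀ k, Measurable fun p : α × MsgState ι => Φ p.1 k p.2) (k : ℕ) :
    Measurable fun a : α × (ι → ℕ → ℝ) => runHat snd (Φ a.1) a.2 k := by
  refine measurable_run (α := α × (ι → ℕ → ℝ)) snd (Φ := fun a => Φ a.1)
    (D := fun a => dirHat snd (Φ a.1) a.2) (fun k => ?_) (fun k => ?_) k
  · exact (hΦ k).comp ((measurable_fst.comp measurable_fst).prodMk measurable_snd)
  · exact measurable_dirHat snd k (hΦ k)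

lemma measurable_runOrig {α : Type*} [MeasurableSpace α] {Φ : α → ℕ → MsgState ι → ι → ℝ}
    (hΦ : ∀ k, Measurable fun p : α × MsgState ι => Φ p.1 k p.2) (k : ℕ) :
    Measurable fun a : α × Matrix ι ι ℝ => runOrig snd (Φ a.1) a.2 k := by
  refine measurable_run (α := α × Matrix ι ι ℝ) snd (Φ := fun a => Φ a.1)
    (D := fun a => dirOrig snd (Φ a.1) a.2) (fun k => ?_) (fun k => ?_) k
  · exact (hΦ k).comp ((measurable_fst.comp measurable_fst).prodMk measurable_snd)
  · exact measurable_dirOrig snd k (hΦ k)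

lemma lintegral_noise_resample_ae {f : (ι → ℕ → ℝ) → ℝ≥0∞} (hf : Measurable f) (k : ℕ)
    {g : (ι → ℕ → ℝ) → ℝ≥0∞}
    (h : ∀ᵐ ζ ∂(noise ι), ∫⁻ z, f (setCol ζ k z) ∂(stdG ι) = g ζ) :
    ∫⁻ ζ, f ζ ∂(noise ι) = ∫⁻ ζ, g ζ ∂(noise ι) := by
  rw [lintegral_noise_resample k hf]
  exact lintegral_congr_ae h

lemma ae_noise_of_resample {p : (ι → ℕ → ℝ) → Prop} (k : ℕ)
    (h : ∀ᵐ ζ ∂(noise ι), ∀ᵐ z ∂(stdG ι), p (setCol ζ k z)) (hp : MeasurableSet {ζ | p ζ}) :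
    ∀ᵐ ζ ∂(noise ι), p ζ := by
  rw [← noise_resample k, ae_map_iff (measurable_setCol k).aemeasurable hp]
  rw [Measure.ae_prod_iff_ae_ae (p := fun a => p (setCol a.1 k a.2)) (measurable_setCol k hp)]
  exact h

variable {Φ}

lemma good_runHat_of_norm (ζ : ι → ℕ → ℝ) {k : ℕ}
    (h : ∀ j < k, dirs (runHat snd Φ ζ k) true j ⬝ᵥ dirs (runHat snd Φ ζ k) true j =
      dirs (runHat snd Φ ζ k) false j ⬝ᵥ dirs (runHat snd Φ ζ k) false j) :
    Good (runHat snd Φ ζ k) k := by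
  induction k with
  | zero => exact Good.zero _
  | succ k ih =>
    have hlt : ∀ b, ∀ j < k, dirs (runHat snd Φ ζ (k + 1)) b j = dirs (runHat snd Φ ζ k) b j :=
      fun b j hj => dirs_step_of_ne _ _ _ _ _ _ hj.ne
    have hG := ih fun j hj => by
      rw [← hlt _ j hj, ← hlt _ j hj]; exact h j (by omega)
    have hk := h k (by omega)
    rw [runHat_succ] at hk ⊢
    refine hG.step _ _ (fun j hj => (hG.orth _).dice_dotProduct hj _ _) ?_
    cases hs : snd k <;> rw [hs] at hk
    · rwa [dirs_step_self, show true = !false from rfl, dirs_step_not] at hk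
    · rw [dirs_step_self, show false = !true from rfl, dirs_step_not] at hk
      exact hk.symm

lemma measurable_runHat_right (hΦ : ∀ k, Measurable (Φ k)) (k : ℕ) :
    Measurable fun ζ : ι → ℕ → ℝ => runHat snd Φ ζ k := by
  induction k with
  | zero => exact measurable_const
  | succ k ih =>
    have h := (hΦ k).comp ih
    exact measurable_step ih h (Measurable.dice k (measurable_dirs ih _)
      (measurable_newDir ih h k _) (by fun_prop)) k _

lemma measurable_dirOrig_right (k : ℕ) (hΦ : Measurable (Φ k)) :
    Measurable fun a : MsgState ι × Matrix ι ι ℝ => dirOrig snd Φ a.2 k a.1 := by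
  unfold dirOrig
  have h1 : Measurable fun p : MsgState ι × Matrix ι ι ℝ =>
      newDir p.1 k (snd k) (Φ k p.1) :=
    measurable_newDir measurable_fst (hΦ.comp measurable_fst) k (snd k)
  split_ifs <;> fun_prop

/-- The simulated states are almost surely consistent. -/
lemma ae_good_runHat (hΦ : ∀ k, Measurable (Φ k)) (k : ℕ) :
    ∀ᵐ ζ ∂(noise ι), Good (runHat snd Φ ζ k) k := by
  have hm := measurable_runHat_right snd hΦ
  induction k with
  | zero => exact Filter.Eventually.of_forall fun _ => Good.zero _
  | succ k ih =>
    suffices h : ∀ᵐ ζ ∂(noise ι), ∀ j < k + 1,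
        dirs (runHat snd Φ ζ (k + 1)) true j ⬝ᵥ dirs (runHat snd Φ ζ (k + 1)) true j =
        dirs (runHat snd Φ ζ (k + 1)) false j ⬝ᵥ dirs (runHat snd Φ ζ (k + 1)) false j by
      filter_upwards [h] with ζ hζ using good_runHat_of_norm snd ζ hζ
    refine ae_noise_of_resample k ?_ ?_
    · filter_upwards [ih] with ζ hζ
      obtain ⟨hC, hCq⟩ := hζ.Cmat_coset isOrth_one k le_rfl
      have hu : ∀ b, ∀ j < k, newDir (runHat snd Φ ζ k) k b (Φ k (runHat snd Φ ζ k)) ⬝ᵥ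
          dirs (runHat snd Φ ζ k) b j = 0 := fun b j hj => newDir_dotProduct (hζ.orth b) hj _
      -- the new directions have the same norm on both sides
      have hd : ∀ᵐ z ∂(stdG ι),
          dice (dirs (runHat snd Φ ζ k) (!snd k)) k
            (newDir (runHat snd Φ ζ k) k (snd k) (Φ k (runHat snd Φ ζ k))) z ⬝ᵥ
          dice (dirs (runHat snd Φ ζ k) (!snd k)) k
            (newDir (runHat snd Φ ζ k) k (snd k) (Φ k (runHat snd Φ ζ k))) z =
          newDir (runHat snd Φ ζ k) k (snd k) (Φ k (runHat snd Φ ζ k)) ⬝ᵥ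
            newDir (runHat snd Φ ζ k) k (snd k) (Φ k (runHat snd Φ ζ k)) := by
        cases snd k
        · refine ae_dice_dotProduct_self hC.transpose (fun j hj => ?_) (hu false)
          show _ = dirs (runHat snd Φ ζ k) true j
          rw [← hCq j hj, hC.transpose_mulVec]
        · exact ae_dice_dotProduct_self hC hCq (hu true)
      filter_upwards [hd] with z hz
      have := hζ.step (snd k) (Φ k (runHat snd Φ ζ k))
        (fun j hj => (hζ.orth _).dice_dotProduct hj _ _) hz
      rw [runHat_setCol_succ]
      exact this.norm
    · simp only [Set.ofPred_forall]
      refine MeasurableSet.iInter fun j => MeasurableSet.iInter fun _ => ?_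
      have h1 := measurable_dirs (hm (k + 1)) true j
      have h2 := measurable_dirs (hm (k + 1)) false j
      exact measurableSet_eq_fun (by fun_prop) (by fun_prop)

/-- For a matrix `V` with a Haar law, the state of the process together with `V` has the same law
as the simulated state together with the corrected matrix. -/
lemma lintegral_runOrig_matrix {μ : Measure (Matrix ι ι ℝ)} [IsProbabilityMeasure μ]
    (horth : ∀ᵐ V ∂μ, IsOrth V) (hinv : ∀ U, IsOrth U → μ.map (fun V => U * V) = μ)
    (hΦ : ∀ k, Measurable (Φ k)) (k : ℕ) {f : MsgState ι × Matrix ι ι ℝ → ℝ≥0∞}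
    (hf : Measurable f) :
    ∫⁻ V, f (runOrig snd Φ V k, V) ∂μ =
      ∫⁻ ζ, ∫⁻ V, f (runHat snd Φ ζ k, Cmat V (runHat snd Φ ζ k) k) ∂μ ∂(noise ι) := by
  have hm := measurable_runHat_right snd hΦ
  induction k generalizing f with
  | zero =>
    simp only [Cmat]
    show _ = ∫⁻ ζ, ∫⁻ V, f (0, V) ∂μ ∂(noise ι)
    simp; rfl
  | succ k ih =>
    have hD := measurable_dirOrig_right snd k (hΦ k)
    have hG : Measurable fun a : MsgState ι × Matrix ι ι ℝ =>
        f (step k (snd k) a.1 (Φ k a.1) (dirOrig snd Φ a.2 k a.1), a.2) := by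
      refine hf.comp (Measurable.prodMk ?_ measurable_snd)
      exact measurable_step measurable_fst ((hΦ k).comp measurable_fst) hD k (snd k)
    have h1 := ih hG
    simp only [runOrig_succ]
    rw [h1]
    symm
    refine lintegral_noise_resample_ae ?_ k ?_
    · refine Measurable.lintegral_prod_right' (f := fun a : (ι → ℕ → ℝ) × Matrix ι ι ℝ =>
        f (runHat snd Φ a.1 (k + 1), Cmat a.2 (runHat snd Φ a.1 (k + 1)) (k + 1))) ?_
      have h2 : Measurable fun a : (ι → ℕ → ℝ) × Matrix ι ι ℝ => runHat snd Φ a.1 (k + 1) :=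
        (hm (k + 1)).comp measurable_fst
      exact hf.comp (h2.prodMk (measurable_Cmat measurable_snd h2 (k + 1)))
    · filter_upwards [ae_good_runHat snd hΦ k] with ζ hζ
      simp only [runHat_setCol_succ]
      generalize runHat snd Φ ζ k = s at hζ
      set v := Φ k s with hv
      set u := newDir s k (snd k) v with hu
      have hC : Measurable fun V => Cmat V s k := measurable_Cmat measurable_id measurable_const k
      set μ' := μ.map fun V => Cmat V s k with hμ'
      have hp' : IsProbabilityMeasure μ' := Measure.isProbabilityMeasure_map hC.aemeasurable
      -- Given the noise of the earlier steps the state `s` is fixed, and the corrected matrix is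
      -- conditionally uniform on the orthogonal matrices that map the directions of `s` correctly:
      -- correction commutes with the left multiplications that fix the images.
      have hl : LeftInv μ' (dirs s false) k := by
        intro U hU hUp
        rw [hμ', Measure.map_map (by fun_prop) hC]
        conv_rhs => rw [← hinv U hU]
        rw [Measure.map_map hC (by fun_prop)]
        congr 1
        ext V
        simp only [Function.comp]
        rw [Cmat_mul hU V hUp]
      have hc : Coset μ' (dirs s true) (dirs s false) k := by
        rw [Coset, hμ', ae_map_iff hC.aemeasurable (measurableSet_coset _ _ _)]
        filter_upwards [horth] with V hV using hζ.Cmat_coset hV k le_rfl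
      have hCs : ∀ V z, Cmat V (step k (snd k) s v (dice (dirs s (!snd k)) k u z)) k = Cmat V s k :=
        fun V z => Cmat_congr V fun j hj b => dirs_step_of_ne _ _ _ _ _ _ hj.ne
      have hd : Measurable fun z : ι → ℝ => dice (dirs s (!snd k)) k u z :=
        Measurable.dice k (fun j => measurable_const) measurable_const measurable_id
      have hsw : ∀ F : Matrix ι ι ℝ → (ι → ℝ) → ℝ≥0∞, Measurable (Function.uncurry F) →
          ∫⁻ C, ∫⁻ z, F C z ∂(stdG ι) ∂μ' = ∫⁻ z, ∫⁻ V, F (Cmat V s k) z ∂μ ∂(stdG ι) := by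
        intro F hF
        rw [lintegral_lintegral_swap hF.aemeasurable]
        refine lintegral_congr fun z => ?_
        have hFz : Measurable fun C => F C z := hF.comp measurable_prodMk_right
        rw [hμ', lintegral_map hFz hC]
      have hGs : Measurable fun C : Matrix ι ι ℝ =>
          f (step k (snd k) s v (dirOrig snd Φ C k s), C) := by
        have h3 : Measurable fun C : Matrix ι ι ℝ => dirOrig snd Φ C k s :=
          hD.comp measurable_prodMk_left
        exact hf.comp ((measurable_step measurable_const measurable_const h3 k _).prodMk
          measurable_id)
      have hstep : Measurable fun a : Matrix ι ι ℝ × (ι → ℝ) =>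
          step k (snd k) s v (dice (dirs s (!snd k)) k u a.2) :=
        measurable_step measurable_const measurable_const (hd.comp measurable_snd) k _
      have hd2 : Measurable fun a : Matrix ι ι ℝ × (ι → ℝ) => dice (dirs s (!snd k)) k u a.2 :=
        hd.comp measurable_snd
      have hr : ∫⁻ V, f (step k (snd k) s v (dirOrig snd Φ (Cmat V s k) k s), Cmat V s k) ∂μ =
          ∫⁻ C, f (step k (snd k) s v (dirOrig snd Φ C k s), C) ∂μ' := by
        rw [hμ', lintegral_map hGs hC]
      rw [hr]
      cases hs : snd k
      · -- side `false` sends: apply the revelation lemma to the transposed matrix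
        simp only [hs, Bool.not_false] at hu hCs hd hGs hstep hd2 ⊢
        have hGsT : Measurable fun W : Matrix ι ι ℝ =>
            f (step k false s v (dirOrig snd Φ Wᵀ k s), Wᵀ) :=
          hGs.comp (Measurable.matrix_transpose measurable_id)
        have huo : ∀ j < k, u ⬝ᵥ dirs s false j = 0 := fun j hj => by
          rw [hu]; exact newDir_dotProduct (hζ.orth false) hj v
        have hT : ∫⁻ C, f (step k false s v (dirOrig snd Φ C k s), C) ∂μ' =
            ∫⁻ W, f (step k false s v (dirOrig snd Φ Wᵀ k s), Wᵀ) ∂(μ'.map fun W => Wᵀ) := by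
          rw [lintegral_map hGsT (by fun_prop)]
          simp
        have hp2 : IsProbabilityMeasure (μ'.map fun W => Wᵀ) :=
          Measure.isProbabilityMeasure_map (by fun_prop)
        rw [hT, (hl.transpose hc).lintegral_dice hc.transpose (hζ.orth true) (u := u) huo
          hGsT]
        have hF : Measurable fun a : Matrix ι ι ℝ × (ι → ℝ) =>
            f (step k false s v (dice (dirs s true) k u a.2),
              refl (a.1 *ᵥ dice (dirs s true) k u a.2) u * a.1) :=
          hf.comp (hstep.prodMk (by fun_prop))
        have hae : ∀ᵐ W ∂(μ'.map fun W => Wᵀ), ∫⁻ z,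
            f (step k false s v (dirOrig snd Φ (refl (W *ᵥ u) (dice (dirs s true) k u z) * W)ᵀ k s),
              (refl (W *ᵥ u) (dice (dirs s true) k u z) * W)ᵀ) ∂(stdG ι) =
            ∫⁻ z, f (step k false s v (dice (dirs s true) k u z),
              refl (Wᵀ *ᵥ dice (dirs s true) k u z) u * Wᵀ) ∂(stdG ι) := by
          filter_upwards [hc.transpose] with W hW
          refine lintegral_congr_ae ?_
          filter_upwards [ae_dice_dotProduct_self (p := dirs s true) hW.1 hW.2 (u := u) huo] with z hz
          have e1 : (refl (W *ᵥ u) (dice (dirs s true) k u z) * W)ᵀ =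
              refl (Wᵀ *ᵥ dice (dirs s true) k u z) u * Wᵀ := by
            rw [Matrix.transpose_mul, refl_transpose, hW.1.transpose.mul_refl,
              hW.1.transpose_mulVec, refl_comm]
          rw [e1]
          congr 3
          rw [dirOrig, hs]
          simp only [Bool.false_eq_true, if_false]
          rw [← e1, Matrix.transpose_transpose, ← hu, ← Matrix.mulVec_mulVec]
          exact refl_apply_left (by rw [hW.1.dotProduct, hz])
        refine Eq.trans ?_ (lintegral_congr_ae hae).symm
        have hF' : Measurable fun C : Matrix ι ι ℝ => ∫⁻ z,
            f (step k false s v (dice (dirs s true) k u z),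
              refl (C *ᵥ dice (dirs s true) k u z) u * C) ∂(stdG ι) :=
          Measurable.lintegral_prod_right hF
        have hF'' : Measurable fun W : Matrix ι ι ℝ => ∫⁻ z,
            f (step k false s v (dice (dirs s true) k u z),
              refl (Wᵀ *ᵥ dice (dirs s true) k u z) u * Wᵀ) ∂(stdG ι) :=
          hF'.comp (Measurable.matrix_transpose measurable_id)
        rw [lintegral_map hF'' (by fun_prop)]
        simp only [Matrix.transpose_transpose]
        rw [hsw (fun C z => f (step k false s v (dice (dirs s true) k u z),
              refl (C *ᵥ dice (dirs s true) k u z) u * C)) hF]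
        refine lintegral_congr fun z => lintegral_congr fun V => ?_
        have e2 : dirs (step k false s v (dice (dirs s true) k u z)) true k =
          dice (dirs s true) k u z := dirs_step_not _ _ _ _ _
        rw [Cmat, hCs, e2, dirs_step_self, ← hu]
      · -- side `true` sends: the revelation lemma applies as it stands
        simp only [hs, Bool.not_true] at hu hCs hd hGs hstep hd2 ⊢
        have huo : ∀ j < k, u ⬝ᵥ dirs s true j = 0 := fun j hj => by
          rw [hu]; exact newDir_dotProduct (hζ.orth true) hj v
        rw [hl.lintegral_dice hc (hζ.orth false) (u := u) huo hGs]
        have hF : Measurable fun a : Matrix ι ι ℝ × (ι → ℝ) =>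
            f (step k true s v (dice (dirs s false) k u a.2),
              refl (a.1 *ᵥ u) (dice (dirs s false) k u a.2) * a.1) :=
          hf.comp (hstep.prodMk (by fun_prop))
        have hae : ∀ᵐ C ∂μ', ∫⁻ z,
            f (step k true s v (dirOrig snd Φ (refl (C *ᵥ u) (dice (dirs s false) k u z) * C) k s),
              refl (C *ᵥ u) (dice (dirs s false) k u z) * C) ∂(stdG ι) =
            ∫⁻ z, f (step k true s v (dice (dirs s false) k u z),
              refl (C *ᵥ u) (dice (dirs s false) k u z) * C) ∂(stdG ι) := by
          filter_upwards [hc] with C hCC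
          refine lintegral_congr_ae ?_
          filter_upwards [ae_dice_dotProduct_self (p := dirs s false) hCC.1 hCC.2 (u := u) huo] with z hz
          congr 3
          rw [dirOrig, hs]
          simp only [if_true]
          rw [← hu, ← Matrix.mulVec_mulVec]
          exact refl_apply_left (by rw [hCC.1.dotProduct, hz])
        rw [lintegral_congr_ae hae, hsw (fun C z => f (step k true s v (dice (dirs s false) k u z),
              refl (C *ᵥ u) (dice (dirs s false) k u z) * C)) hF]
        refine lintegral_congr fun z => lintegral_congr fun V => ?_
        have e2 : dirs (step k true s v (dice (dirs s false) k u z)) false k =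
          dice (dirs s false) k u z := dirs_step_not _ _ _ _ _
        rw [Cmat, hCs, e2, dirs_step_self, ← hu]

/-- If `V` is Haar distributed and independent of `Y`, then `Y` and the state of a process that
depends on `V` and `Y` have the same joint law as `Y` and the simulated state. -/
lemma lintegral_runOrig {Ω α : Type*} [MeasurableSpace Ω] [MeasurableSpace α] {P : Measure Ω}
    [IsProbabilityMeasure P] {V : Ω → Matrix ι ι ℝ} {Y : Ω → α} (hV : Measurable V)
    (hY : Measurable Y) (hind : IndepFun V Y P) (horth : ∀ᵐ ω ∂P, IsOrth (V ω))
    (hinv : ∀ U, IsOrth U → P.map (fun ω => U * V ω) = P.map V)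
    {Φ : α → ℕ → MsgState ι → ι → ℝ}
    (hΦ : ∀ k, Measurable fun p : α × MsgState ι => Φ p.1 k p.2) (k : ℕ)
    {f : α × MsgState ι → ℝ≥0∞} (hf : Measurable f) :
    ∫⁻ ω, f (Y ω, runOrig snd (Φ (Y ω)) (V ω) k) ∂P =
      ∫⁻ a, f (Y a.1, runHat snd (Φ (Y a.1)) a.2 k) ∂(P.prod (noise ι)) := by
  have hμ : IsProbabilityMeasure (P.map V) := Measure.isProbabilityMeasure_map hV.aemeasurable
  have hY' : IsProbabilityMeasure (P.map Y) := Measure.isProbabilityMeasure_map hY.aemeasurable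
  have hO := measurable_runOrig snd hΦ k
  have hH := measurable_runHat snd hΦ k
  have hF1 : Measurable fun a : α × Matrix ι ι ℝ => f (a.1, runOrig snd (Φ a.1) a.2 k) :=
    hf.comp (measurable_fst.prodMk hO)
  have hF2 : Measurable fun a : α × (ι → ℕ → ℝ) => f (a.1, runHat snd (Φ a.1) a.2 k) :=
    hf.comp (measurable_fst.prodMk hH)
  have h1 := (indepFun_iff_map_prod_eq_prod_map_map hY.aemeasurable hV.aemeasurable).1 hind.symm
  have horth' : ∀ᵐ W ∂(P.map V), IsOrth W := by
    have hms : MeasurableSet {W : Matrix ι ι ℝ | IsOrth W} := by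
      simpa using measurableSet_coset (ι := ι) (fun _ => 0) (fun _ => 0) 0
    rwa [ae_map_iff hV.aemeasurable hms]
  have hinv' : ∀ U, IsOrth U → (P.map V).map (fun W => U * W) = P.map V := by
    intro U hU
    rw [Measure.map_map (by fun_prop) hV, ← hinv U hU]
    rfl
  have h2 : ∫⁻ ω, f (Y ω, runOrig snd (Φ (Y ω)) (V ω) k) ∂P =
      ∫⁻ y, ∫⁻ W, f (y, runOrig snd (Φ y) W k) ∂(P.map V) ∂(P.map Y) := by
    rw [← lintegral_prod (f := fun a => f (a.1, runOrig snd (Φ a.1) a.2 k)) hF1.aemeasurable, ← h1,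
      lintegral_map hF1 (hY.prodMk hV)]
  have h3 : ∀ y, ∫⁻ W, f (y, runOrig snd (Φ y) W k) ∂(P.map V) =
      ∫⁻ ζ, f (y, runHat snd (Φ y) ζ k) ∂(noise ι) := by
    intro y
    have hΦy : ∀ k, Measurable (Φ y k) := fun k => (hΦ k).comp measurable_prodMk_left
    have hg : Measurable fun a : MsgState ι × Matrix ι ι ℝ => f (y, a.1) :=
      hf.comp (measurable_const.prodMk measurable_fst)
    rw [lintegral_runOrig_matrix snd horth' hinv' hΦy k hg]
    simp
  rw [h2]
  simp only [h3]
  have h4 : Measurable fun y => ∫⁻ ζ, f (y, runHat snd (Φ y) ζ k) ∂(noise ι) :=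
    hF2.lintegral_prod_right'
  rw [lintegral_map h4 hY]
  have h5 : Measurable fun a : Ω × (ι → ℕ → ℝ) => f (Y a.1, runHat snd (Φ (Y a.1)) a.2 k) :=
    hF2.comp ((hY.comp measurable_fst).prodMk measurable_snd)
  rw [lintegral_prod _ h5.aemeasurable]

/-- The simulation is exact jointly with any random object `Y` that is independent of the matrix,
even if `Y` enters the rule of the process. -/
lemma map_runOrig {Ω α : Type*} [MeasurableSpace Ω] [MeasurableSpace α] {P : Measure Ω}
    [IsProbabilityMeasure P] {V : Ω → Matrix ι ι ℝ} {Y : Ω → α} (hV : Measurable V)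
    (hY : Measurable Y) (hind : IndepFun V Y P) (horth : ∀ᵐ ω ∂P, IsOrth (V ω))
    (hinv : ∀ U, IsOrth U → P.map (fun ω => U * V ω) = P.map V)
    {Φ : α → ℕ → MsgState ι → ι → ℝ}
    (hΦ : ∀ k, Measurable fun p : α × MsgState ι => Φ p.1 k p.2) (k : ℕ) :
    P.map (fun ω => (Y ω, runOrig snd (Φ (Y ω)) (V ω) k)) =
      (P.prod (noise ι)).map fun a => (Y a.1, runHat snd (Φ (Y a.1)) a.2 k) := by
  have hO := measurable_runOrig snd hΦ k
  have hH := measurable_runHat snd hΦ k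
  have h1 : Measurable fun ω => (Y ω, runOrig snd (Φ (Y ω)) (V ω) k) :=
    hY.prodMk (hO.comp (hY.prodMk hV))
  have h2 : Measurable fun a : Ω × (ι → ℕ → ℝ) => (Y a.1, runHat snd (Φ (Y a.1)) a.2 k) :=
    (hY.comp measurable_fst).prodMk (hH.comp ((hY.comp measurable_fst).prodMk measurable_snd))
  refine Measure.ext_of_lintegral _ fun f hf => ?_
  rw [lintegral_map hf h1, lintegral_map hf h2,
    lintegral_runOrig snd hV hY hind horth hinv hΦ k hf]

end ProcessLaw

end OAMP


namespace OAMP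

open Filter Topology
open scoped ENNReal

/-! ### Convergence in probability as convergence along a filter -/

section Whp

variable {I : Type*} {Ω : I → Type*} [∀ i, MeasurableSpace (Ω i)] {P : ∀ i, Measure (Ω i)}
  {l : Filter I}

/-- The filter of the events which occur with high probability: the probability of the complement
tends to zero along `l`. Convergence in probability to a constant, for random variables on
varying probability spaces, is convergence along this filter. -/
def whp (P : ∀ i, Measure (Ω i)) (l : Filter I) : Filter (Σ i, Ω i) where
  sets := {S | Tendsto (fun i => P i {ω | (⟨i, ω⟩ : Σ i, Ω i) ∉ S}) l (𝓝 0)}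
  univ_sets := by simpa using tendsto_const_nhds
  sets_of_superset := by
    intro S T hS hST
    refine tendsto_of_tendsto_of_tendsto_of_le_of_le tendsto_const_nhds hS (fun _ => zero_le)
      fun i => measure_mono fun ω hω h => hω (hST h)
  inter_sets := by
    intro S T hS hT
    have := Tendsto.add hS hT
    rw [add_zero] at this
    refine tendsto_of_tendsto_of_tendsto_of_le_of_le tendsto_const_nhds this (fun _ => zero_le)
      fun i => le_trans (measure_mono fun ω hω => ?_) (measure_union_le _ _)
    by_contra h
    simp only [Set.mem_union, not_or, Set.mem_ofPred_eq, not_not] at h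
    exact hω ⟨h.1, h.2⟩

lemma eventually_whp {p : (Σ i, Ω i) → Prop} :
    (∀ᶠ x in whp P l, p x) ↔ Tendsto (fun i => P i {ω | ¬ p ⟨i, ω⟩}) l (𝓝 0) := Iff.rfl

lemma whp_neBot [l.NeBot] [∀ i, IsProbabilityMeasure (P i)] : (whp P l).NeBot := by
  refine ⟨fun h => ?_⟩
  have : ∀ᶠ x in whp P l, False := by rw [h]; exact Filter.eventually_bot
  rw [eventually_whp] at this
  simp only [not_false_eq_true, Set.ofPred_true, measure_univ] at this
  exact one_ne_zero (tendsto_nhds_unique tendsto_const_nhds this)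

lemma eventually_whp_of_ae {p : (Σ i, Ω i) → Prop} (h : ∀ᶠ i in l, ∀ᵐ ω ∂(P i), p ⟨i, ω⟩) :
    ∀ᶠ x in whp P l, p x := by
  rw [eventually_whp]
  refine tendsto_const_nhds.congr' ?_
  filter_upwards [h] with i hi using hi.symm

/-- Deterministic convergence along `l` is convergence with high probability. -/
lemma tendsto_fst_whp : Tendsto (fun x : Σ i, Ω i => x.1) (whp P l) l := by
  intro s hs
  refine eventually_whp_of_ae (p := fun x => x.1 ∈ s) ?_
  filter_upwards [hs] with i hi using Eventually.of_forall fun _ => hi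

lemma tendsto_zero_of_lintegral {f : ∀ i, Ω i → ℝ} (hf : ∀ i, AEMeasurable (f i) (P i))
    (h : Tendsto (fun i => ∫⁻ ω, ENNReal.ofReal |f i ω| ∂(P i)) l (𝓝 0)) :
    Tendsto (fun x : Σ i, Ω i => f x.1 x.2) (whp P l) (𝓝 0) := by
  rw [Metric.tendsto_nhds]
  intro ε hε
  rw [eventually_whp]
  have h1 : Tendsto (fun i => (∫⁻ ω, ENNReal.ofReal |f i ω| ∂(P i)) / ENNReal.ofReal ε) l (𝓝 0) := by
    have := ENNReal.Tendsto.div_const h (b := ENNReal.ofReal ε) (Or.inr (by simpa using hε))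
    simpa using this
  refine tendsto_of_tendsto_of_tendsto_of_le_of_le tendsto_const_nhds h1 (fun _ => zero_le)
    fun i => ?_
  have hm : AEMeasurable (fun ω => ENNReal.ofReal |f i ω|) (P i) :=
    ENNReal.measurable_ofReal.comp_aemeasurable (continuous_abs.measurable.comp_aemeasurable (hf i))
  refine le_trans (measure_mono fun ω hω => ?_)
    (meas_ge_le_lintegral_div hm (by simpa using hε) ENNReal.ofReal_ne_top)
  have : ε ≤ |f i ω| := by simpa [Real.dist_eq] using hω
  exact ENNReal.ofReal_le_ofReal this

/-- Tightness of a family of random variables. -/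
def Tight (P : ∀ i, Measure (Ω i)) (l : Filter I) (f : (Σ i, Ω i) → ℝ) : Prop :=
  ∀ δ : ℝ≥0∞, 0 < δ → ∃ K : ℝ, ∀ᶠ i in l, P i {ω | K < |f ⟨i, ω⟩|} ≤ δ

lemma Tight.mul_tendsto_zero {f g : (Σ i, Ω i) → ℝ} (hf : Tight P l f)
    (hg : Tendsto g (whp P l) (𝓝 0)) : Tendsto (fun x => f x * g x) (whp P l) (𝓝 0) := by
  rw [Metric.tendsto_nhds]
  intro ε hε
  rw [eventually_whp, ENNReal.tendsto_nhds_zero]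
  intro δ hδ
  obtain ⟨K, hK⟩ := hf (δ / 2) (ENNReal.half_pos hδ.ne')
  have hg' := Metric.tendsto_nhds.1 hg (ε / (|K| + 1)) (by positivity)
  rw [eventually_whp, ENNReal.tendsto_nhds_zero] at hg'
  filter_upwards [hK, hg' (δ / 2) (ENNReal.half_pos hδ.ne')] with i h1 h2
  refine le_trans (measure_mono (t := {ω | K < |f ⟨i, ω⟩|} ∪
    {ω | ¬ dist (g ⟨i, ω⟩) 0 < ε / (|K| + 1)}) fun ω hω => ?_) (le_trans (measure_union_le _ _)
      (le_trans (add_le_add h1 h2) (ENNReal.add_halves δ).le))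
  by_contra h
  simp only [Set.mem_union, not_or, Set.mem_ofPred_eq, not_lt, dist_zero_right,
    Real.norm_eq_abs] at h
  simp only [dist_zero_right, Real.norm_eq_abs, Set.mem_ofPred_eq, not_lt] at hω
  have h3 : |f ⟨i, ω⟩| * |g ⟨i, ω⟩| < ε := by
    have h4 : |f ⟨i, ω⟩| ≤ |K| := h.1.trans (le_abs_self K)
    have h5 := (lt_div_iff₀ (by positivity : (0 : ℝ) < |K| + 1)).1 (not_le.1 h.2)
    nlinarith [abs_nonneg (g ⟨i, ω⟩), abs_nonneg (f ⟨i, ω⟩)]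
  rw [abs_mul] at hω
  linarith

/-- A family with a common law is tight. -/
lemma tight_of_map_eq {f : ∀ i, Ω i → ℝ} (hf : ∀ i, AEMeasurable (f i) (P i)) {m : Measure ℝ}
    [IsFiniteMeasure m] (h : ∀ i, (P i).map (f i) = m) : Tight P l fun x => f x.1 x.2 := by
  intro δ hδ
  have h1 : Tendsto (fun n : ℕ => m {y | (n : ℝ) < |y|}) atTop (𝓝 0) := by
    have := tendsto_measure_iInter_atTop (μ := m) (s := fun n : ℕ => {y : ℝ | (n : ℝ) < |y|})
      (fun n => (measurableSet_lt measurable_const continuous_abs.measurable).nullMeasurableSet)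
      (fun a b hab y (hy : (b : ℝ) < |y|) => lt_of_le_of_lt (Nat.cast_le.2 hab) hy) ⟨0, measure_ne_top _ _⟩
    have he : ⋂ n : ℕ, {y : ℝ | (n : ℝ) < |y|} = ∅ := by
      ext y
      simp only [Set.mem_iInter, Set.mem_ofPred_eq, Set.mem_empty_iff_false, iff_false, not_forall,
        not_lt]
      exact exists_nat_ge |y|
    rwa [he, measure_empty] at this
  obtain ⟨n, hn⟩ := ((ENNReal.tendsto_nhds_zero.1 h1) δ hδ).exists
  refine ⟨n, Eventually.of_forall fun i => ?_⟩
  rw [← h i, Measure.map_apply_of_aemeasurable (hf i)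
    (measurableSet_lt measurable_const continuous_abs.measurable)] at hn
  exact hn

/-- Bounded convergence. -/
lemma tendsto_lintegral_of_whp [∀ i, IsProbabilityMeasure (P i)] {f : ∀ i, Ω i → ℝ} {C : ℝ}
    (hC : ∀ i ω, |f i ω| ≤ C) (h : Tendsto (fun x : Σ i, Ω i => f x.1 x.2) (whp P l) (𝓝 0)) :
    Tendsto (fun i => ∫⁻ ω, ENNReal.ofReal |f i ω| ∂(P i)) l (𝓝 0) := by
  rw [ENNReal.tendsto_nhds_zero]
  intro δ hδ
  by_cases hδ' : δ = ∞
  · exact Eventually.of_forall fun i => by rw [hδ']; exact le_top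
  have hd : 0 < (δ / 2).toReal :=
    ENNReal.toReal_pos (ENNReal.half_pos hδ.ne').ne' (by simp [ENNReal.div_eq_top, hδ'])
  have h1 := Metric.tendsto_nhds.1 h _ hd
  rw [eventually_whp, ENNReal.tendsto_nhds_zero] at h1
  have h2 : 0 < δ / 2 / (ENNReal.ofReal |C| + 1) :=
    ENNReal.div_pos (ENNReal.half_pos hδ.ne').ne' (by simp)
  filter_upwards [h1 _ h2] with i hi
  set S := toMeasurable (P i) {ω | ¬ dist (f i ω) 0 < (δ / 2).toReal}
  have hS : MeasurableSet S := measurableSet_toMeasurable _ _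
  have hpt : ∀ ω, ENNReal.ofReal |f i ω| ≤ δ / 2 + S.indicator (fun _ => ENNReal.ofReal |C|) ω := by
    intro ω
    by_cases hω : dist (f i ω) 0 < (δ / 2).toReal
    · refine le_trans ?_ le_self_add
      rw [dist_zero_right, Real.norm_eq_abs] at hω
      exact ENNReal.ofReal_le_of_le_toReal hω.le
    · have hωS : ω ∈ S := subset_toMeasurable _ _ hω
      rw [Set.indicator_of_mem hωS]
      refine le_trans ?_ le_add_self
      exact ENNReal.ofReal_le_ofReal ((hC i ω).trans (le_abs_self C))
  refine (lintegral_mono hpt).trans ?_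
  rw [lintegral_add_left measurable_const, lintegral_indicator_const hS, lintegral_const,
    measure_univ, mul_one]
  refine le_trans (add_le_add le_rfl ?_) (ENNReal.add_halves δ).le
  rw [measure_toMeasurable]
  refine (mul_le_mul (le_self_add (b := 1)) hi zero_le zero_le).trans ?_
  rw [ENNReal.mul_div_cancel (by simp) (by simp)]

end Whp

/-! ### Uniform square integrability -/

section UI

variable {I : Type*} {Ω : I → Type*} [∀ i, MeasurableSpace (Ω i)] {P : ∀ i, Measure (Ω i)}
  {l : Filter I}

/-- Uniform square integrability of a family of random variables. -/
def UnifSq (P : ∀ i, Measure (Ω i)) (f : ∀ i, Ω i → ℝ) : Prop :=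
  ∀ ε > (0 : ℝ), ∃ K : ℝ, ∀ i,
    ∫⁻ ω in {ω | K < |f i ω|}, ENNReal.ofReal ((f i ω) ^ 2) ∂(P i) ≤ ENNReal.ofReal ε

lemma UnifSq.setLIntegral_le {f : ∀ i, Ω i → ℝ} (hf : ∀ i, Measurable (f i)) {K : ℝ} {i : I}
    {ε : ℝ≥0∞} (h : ∫⁻ ω in {ω | K < |f i ω|}, ENNReal.ofReal ((f i ω) ^ 2) ∂(P i) ≤ ε)
    {S : Set (Ω i)} (hS : MeasurableSet S) :
    ∫⁻ ω in S, ENNReal.ofReal ((f i ω) ^ 2) ∂(P i) ≤ ε + ENNReal.ofReal (K ^ 2) * P i S := by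
  have hms : MeasurableSet {ω | K < |f i ω|} :=
    measurableSet_lt measurable_const (continuous_abs.measurable.comp (hf i))
  have hpt : ∀ ω, S.indicator (fun ω => ENNReal.ofReal ((f i ω) ^ 2)) ω ≤
      {ω | K < |f i ω|}.indicator (fun ω => ENNReal.ofReal ((f i ω) ^ 2)) ω +
        S.indicator (fun _ => ENNReal.ofReal (K ^ 2)) ω := by
    intro ω
    by_cases hω : ω ∈ S
    · rw [Set.indicator_of_mem hω, Set.indicator_of_mem hω]
      by_cases h' : K < |f i ω|
      · rw [Set.indicator_of_mem (by exact h')]; exact le_self_add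
      · refine le_trans ?_ le_add_self
        refine ENNReal.ofReal_le_ofReal ?_
        rw [← sq_abs]
        exact pow_le_pow_left₀ (abs_nonneg _) (not_lt.1 h') 2
    · rw [Set.indicator_of_notMem hω]; exact zero_le
  rw [← lintegral_indicator hS]
  refine (lintegral_mono hpt).trans ?_
  have hfm := hf i
  rw [lintegral_add_left (Measurable.indicator (by fun_prop) hms), lintegral_indicator hms,
    lintegral_indicator_const hS]
  gcongr

lemma UnifSq.bdd [∀ i, IsProbabilityMeasure (P i)] {f : ∀ i, Ω i → ℝ}
    (hf : ∀ i, Measurable (f i)) (h : UnifSq P f) :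
    ∃ M : ℝ, 0 ≤ M ∧ ∀ i, ∫⁻ ω, ENNReal.ofReal ((f i ω) ^ 2) ∂(P i) ≤ ENNReal.ofReal M := by
  obtain ⟨K, hK⟩ := h 1 one_pos
  refine ⟨1 + K ^ 2, by positivity, fun i => ?_⟩
  have := UnifSq.setLIntegral_le hf (hK i) MeasurableSet.univ
  rw [setLIntegral_univ, measure_univ, mul_one] at this
  rwa [ENNReal.ofReal_add zero_le_one (by positivity)]

lemma UnifSq.unif_cont {f : ∀ i, Ω i → ℝ}
    (hf : ∀ i, Measurable (f i)) (h : UnifSq P f) {ε : ℝ≥0∞} (hε : 0 < ε) :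
    ∃ δ : ℝ≥0∞, 0 < δ ∧ ∀ i, ∀ S, MeasurableSet S → P i S ≤ δ →
      ∫⁻ ω in S, ENNReal.ofReal ((f i ω) ^ 2) ∂(P i) ≤ ε := by
  by_cases hε' : ε = ∞
  · exact ⟨1, one_pos, fun i S _ _ => by rw [hε']; exact le_top⟩
  have h2 : 0 < (ε / 2).toReal :=
    ENNReal.toReal_pos (ENNReal.half_pos hε.ne').ne' (by simp [ENNReal.div_eq_top, hε'])
  obtain ⟨K, hK⟩ := h _ h2
  refine ⟨ε / 2 / (ENNReal.ofReal (K ^ 2) + 1),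
    ENNReal.div_pos (ENNReal.half_pos hε.ne').ne' (by simp), fun i S hS hPS => ?_⟩
  refine (UnifSq.setLIntegral_le hf (hK i) hS).trans ?_
  rw [ENNReal.ofReal_toReal (by simp [ENNReal.div_eq_top, hε'])]
  refine le_trans (add_le_add le_rfl ?_) (ENNReal.add_halves ε).le
  refine (mul_le_mul (le_self_add (b := 1)) hPS zero_le zero_le).trans ?_
  rw [ENNReal.mul_div_cancel (by simp) (by simp)]

lemma unifSq_of_map_eq {f : ∀ i, Ω i → ℝ} (hf : ∀ i, Measurable (f i)) {m : Measure ℝ}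
    (h : ∀ i, (P i).map (f i) = m) (hm : ∫⁻ y, ENNReal.ofReal (y ^ 2) ∂m ≠ ∞) : UnifSq P f := by
  intro ε hε
  have hms : ∀ n : ℕ, MeasurableSet {y : ℝ | (n : ℝ) < |y|} := fun n =>
    measurableSet_lt measurable_const continuous_abs.measurable
  have h1 : Tendsto (fun n : ℕ => ∫⁻ y in {y | (n : ℝ) < |y|}, ENNReal.ofReal (y ^ 2) ∂m) atTop
      (𝓝 0) := by
    have h2 : ∀ n : ℕ, ∫⁻ y in {y | (n : ℝ) < |y|}, ENNReal.ofReal (y ^ 2) ∂m =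
        (m.withDensity fun y => ENNReal.ofReal (y ^ 2)) {y | (n : ℝ) < |y|} := fun n => by
      rw [withDensity_apply _ (hms n)]
    simp only [h2]
    have := tendsto_measure_iInter_atTop (μ := m.withDensity fun y => ENNReal.ofReal (y ^ 2))
      (s := fun n : ℕ => {y : ℝ | (n : ℝ) < |y|}) (fun n => (hms n).nullMeasurableSet)
      (fun a b hab y (hy : (b : ℝ) < |y|) => lt_of_le_of_lt (Nat.cast_le.2 hab) hy)
      ⟨0, ((measure_mono (Set.subset_univ _)).trans_lt (by
        rw [withDensity_apply _ MeasurableSet.univ, setLIntegral_univ]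
        exact hm.lt_top)).ne⟩
    have he : ⋂ n : ℕ, {y : ℝ | (n : ℝ) < |y|} = ∅ := by
      ext y
      simp only [Set.mem_iInter, Set.mem_ofPred_eq, Set.mem_empty_iff_false, iff_false, not_forall,
        not_lt]
      exact exists_nat_ge |y|
    rwa [he, measure_empty] at this
  obtain ⟨n, hn⟩ := ((ENNReal.tendsto_nhds_zero.1 h1) (ENNReal.ofReal ε) (by simpa using hε)).exists
  refine ⟨n, fun i => ?_⟩
  rw [← h i, setLIntegral_map (hms n) (by fun_prop) (hf i)] at hn
  exact hn

/-- If a uniformly square integrable family is close in probability to a family of identically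
distributed variables, then the latter are square integrable and the families are close in the
mean square. -/
lemma UnifSq.tendsto_sq_dist [l.NeBot] [∀ i, IsProbabilityMeasure (P i)] {f g : ∀ i, Ω i → ℝ}
    (hf : ∀ i, Measurable (f i)) (hg : ∀ i, Measurable (g i)) (h : UnifSq P f) {m : Measure ℝ}
    (hm : ∀ i, (P i).map (g i) = m)
    (hfg : Tendsto (fun x : Σ i, Ω i => f x.1 x.2 - g x.1 x.2) (whp P l) (𝓝 0)) :
    ∫⁻ y, ENNReal.ofReal (y ^ 2) ∂m ≠ ∞ ∧
      Tendsto (fun i => ∫⁻ ω, ENNReal.ofReal ((f i ω - g i ω) ^ 2) ∂(P i)) l (𝓝 0) := by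
  have hms : ∀ (i) (c : ℝ), MeasurableSet {ω | c ≤ |f i ω - g i ω|} := fun i c =>
    measurableSet_le measurable_const (continuous_abs.measurable.comp ((hf i).sub (hg i)))
  have hpr : ∀ c > (0 : ℝ), Tendsto (fun i => P i {ω | c ≤ |f i ω - g i ω|}) l (𝓝 0) := by
    intro c hc
    have := Metric.tendsto_nhds.1 hfg c hc
    rw [eventually_whp] at this
    simpa using this
  obtain ⟨M, hM0, hM⟩ := h.bdd hf
  have hfin : ∫⁻ y, ENNReal.ofReal (y ^ 2) ∂m ≤ ENNReal.ofReal (2 * M + 3) := by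
    -- truncate the second moment of the limit and pass to the limit in the truncation
    have htr : ∀ L : ℕ, ∫⁻ y, min (ENNReal.ofReal (y ^ 2)) (L : ℝ≥0∞) ∂m ≤
        ENNReal.ofReal (2 * M + 3) := by
      intro L
      have h1 := (ENNReal.tendsto_nhds_zero.1 (hpr 1 one_pos)) (1 / (L + 1)) (by simp)
      obtain ⟨i, hi⟩ := h1.exists
      have hgi := hg i
      have hfi := hf i
      rw [← hm i, lintegral_map (by fun_prop) (hg i)]
      have hpt : ∀ ω, min (ENNReal.ofReal ((g i ω) ^ 2)) (L : ℝ≥0∞) ≤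
          ENNReal.ofReal (2 * (f i ω) ^ 2 + 2) +
            {ω | 1 ≤ |f i ω - g i ω|}.indicator (fun _ => (L : ℝ≥0∞)) ω := by
        intro ω
        by_cases hω : 1 ≤ |f i ω - g i ω|
        · rw [Set.indicator_of_mem (by exact hω)]
          exact (min_le_right _ _).trans le_add_self
        · refine (min_le_left _ _).trans (le_trans ?_ le_self_add)
          refine ENNReal.ofReal_le_ofReal ?_
          have := (abs_lt.1 (not_le.1 hω))
          nlinarith [sq_nonneg (f i ω + (f i ω - g i ω))]
      refine (lintegral_mono hpt).trans ?_
      rw [lintegral_add_left (by fun_prop), lintegral_indicator_const (hms i 1)]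
      have h3 : ∫⁻ ω, ENNReal.ofReal (2 * (f i ω) ^ 2 + 2) ∂(P i) ≤ ENNReal.ofReal (2 * M + 2) := by
        have : ∀ ω, ENNReal.ofReal (2 * (f i ω) ^ 2 + 2) =
            2 * ENNReal.ofReal ((f i ω) ^ 2) + 2 := by
          intro ω
          rw [ENNReal.ofReal_add (by positivity) (by norm_num), ENNReal.ofReal_mul (by norm_num)]
          simp
        simp only [this]
        rw [lintegral_add_right _ measurable_const, lintegral_const_mul _ (by fun_prop),
          lintegral_const, measure_univ, mul_one,
          ENNReal.ofReal_add (by positivity) (by norm_num), ENNReal.ofReal_mul (by norm_num)]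
        simp only [ENNReal.ofReal_ofNat]
        gcongr
        exact hM i
      have h4 : (L : ℝ≥0∞) * P i {ω | 1 ≤ |f i ω - g i ω|} ≤ 1 := by
        refine (mul_le_mul le_self_add hi zero_le zero_le).trans (b := ((L : ℝ≥0∞) + 1) *
          (1 / (L + 1))) ?_
        rw [ENNReal.mul_div_cancel (by simp) (by simp)]
      refine (add_le_add h3 h4).trans ?_
      rw [← ENNReal.ofReal_one, ← ENNReal.ofReal_add (by positivity) zero_le_one]
      exact ENNReal.ofReal_le_ofReal (by linarith)
    have hsup : ∀ y : ℝ, ENNReal.ofReal (y ^ 2) =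
        ⨆ L : ℕ, min (ENNReal.ofReal (y ^ 2)) (L : ℝ≥0∞) := by
      intro y
      refine le_antisymm ?_ (iSup_le fun L => min_le_left _ _)
      obtain ⟨L, hL⟩ := exists_nat_ge (y ^ 2)
      refine le_iSup_of_le L (le_min le_rfl ?_)
      rw [← ENNReal.ofReal_natCast]
      exact ENNReal.ofReal_le_ofReal hL
    rw [lintegral_congr hsup, lintegral_iSup
      (f := fun (L : ℕ) (y : ℝ) => min (ENNReal.ofReal (y ^ 2)) (L : ℝ≥0∞))
      (fun L => Measurable.min (by fun_prop) measurable_const)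
      fun a b hab y => min_le_min le_rfl (by simpa using hab)]
    exact iSup_le htr
  have hfin' := (hfin.trans_lt ENNReal.ofReal_lt_top).ne
  refine ⟨hfin', ?_⟩
  have hgU : UnifSq P g := unifSq_of_map_eq hg hm hfin'
  rw [ENNReal.tendsto_nhds_zero]
  intro ε hε
  by_cases hε' : ε = ∞
  · exact Eventually.of_forall fun i => by rw [hε']; exact le_top
  have h2 : 0 < (ε / 2).toReal :=
    ENNReal.toReal_pos (ENNReal.half_pos hε.ne').ne' (by simp [ENNReal.div_eq_top, hε'])
  have h8 : 0 < ε / 8 := ENNReal.div_pos hε.ne' (by simp)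
  obtain ⟨δ1, hδ1, h1⟩ := h.unif_cont hf h8
  obtain ⟨δ2, hδ2, h2'⟩ := hgU.unif_cont hg h8
  have hsq : 0 < Real.sqrt (ε / 2).toReal := Real.sqrt_pos.2 h2
  filter_upwards [(ENNReal.tendsto_nhds_zero.1 (hpr _ hsq)) (min δ1 δ2) (lt_min hδ1 hδ2)] with i hi
  set S := {ω | Real.sqrt (ε / 2).toReal ≤ |f i ω - g i ω|} with hSdef
  have hS : MeasurableSet S := hms i _
  have hgi := hg i
  have hfi := hf i
  have hpt : ∀ ω, ENNReal.ofReal ((f i ω - g i ω) ^ 2) ≤ ε / 2 +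
      S.indicator (fun ω => 2 * ENNReal.ofReal ((f i ω) ^ 2) + 2 * ENNReal.ofReal ((g i ω) ^ 2))
        ω := by
    intro ω
    by_cases hω : ω ∈ S
    · rw [Set.indicator_of_mem hω]
      refine le_trans ?_ le_add_self
      have : (2 : ℝ≥0∞) = ENNReal.ofReal 2 := by simp
      rw [this, ← ENNReal.ofReal_mul (by norm_num), ← ENNReal.ofReal_mul (by norm_num),
        ← ENNReal.ofReal_add (by positivity) (by positivity)]
      refine ENNReal.ofReal_le_ofReal ?_
      nlinarith [sq_nonneg (f i ω + g i ω)]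
    · refine le_trans ?_ le_self_add
      refine ENNReal.ofReal_le_of_le_toReal ?_
      have h3 : |f i ω - g i ω| < Real.sqrt (ε / 2).toReal := not_le.1 hω
      rw [← sq_abs, ← Real.sq_sqrt h2.le]
      exact pow_le_pow_left₀ (abs_nonneg _) h3.le 2
  refine (lintegral_mono hpt).trans ?_
  rw [lintegral_add_left measurable_const, lintegral_const, measure_univ, mul_one,
    lintegral_indicator hS, lintegral_add_left (by fun_prop), lintegral_const_mul _ (by fun_prop),
    lintegral_const_mul _ (by fun_prop)]
  have e1 := h1 i S hS (hi.trans (min_le_left _ _))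
  have e2 := h2' i S hS (hi.trans (min_le_right _ _))
  calc ε / 2 + (2 * ∫⁻ ω in S, ENNReal.ofReal ((f i ω) ^ 2) ∂(P i) +
        2 * ∫⁻ ω in S, ENNReal.ofReal ((g i ω) ^ 2) ∂(P i))
      ≤ ε / 2 + (2 * (ε / 8) + 2 * (ε / 8)) := by gcongr
    _ = ε := by
        have h4 : 2 * (ε / 8) = ε / 4 := by
          rw [← mul_div_assoc, show (8 : ℝ≥0∞) = 2 * 4 by norm_num,
            ENNReal.mul_div_mul_left _ _ (by simp) (by simp)]
        have h5 : ε / 4 + ε / 4 = ε / 2 := by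
          rw [← ENNReal.add_div, ← two_mul, show (4 : ℝ≥0∞) = 2 * 2 by norm_num,
            ENNReal.mul_div_mul_left _ _ (by simp) (by simp)]
        rw [h4, h5, ENNReal.add_halves]

end UI

end OAMP


namespace OAMP

open Filter Topology
open scoped ENNReal

/-! ### Normalized inner products -/

section IP

variable {N : ℕ}

/-- The normalized inner product `aᵀ b / N`. -/
noncomputable def ip (a b : Fin N → ℝ) : ℝ := (a ⬝ᵥ b) / N

lemma ip_eq_sum (a b : Fin N → ℝ) : ip a b = (∑ n, a n * b n) / N := rfl

lemma ip_comm (a b : Fin N → ℝ) : ip a b = ip b a := by rw [ip, ip, dotProduct_comm]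

lemma ip_add_left (a b c : Fin N → ℝ) : ip (a + b) c = ip a c + ip b c := by
  rw [ip, ip, ip, add_dotProduct, add_div]

lemma ip_add_right (a b c : Fin N → ℝ) : ip c (a + b) = ip c a + ip c b := by
  rw [ip_comm, ip_add_left, ip_comm a, ip_comm b]

lemma ip_sub_left (a b c : Fin N → ℝ) : ip (a - b) c = ip a c - ip b c := by
  rw [ip, ip, ip, sub_dotProduct, sub_div]

lemma ip_sub_right (a b c : Fin N → ℝ) : ip c (a - b) = ip c a - ip c b := by
  rw [ip_comm, ip_sub_left, ip_comm a, ip_comm b]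

lemma ip_smul_left (r : ℝ) (a b : Fin N → ℝ) : ip (r • a) b = r * ip a b := by
  rw [ip, ip, smul_dotProduct, smul_eq_mul, mul_div_assoc]

lemma ip_smul_right (r : ℝ) (a b : Fin N → ℝ) : ip a (r • b) = r * ip a b := by
  rw [ip_comm, ip_smul_left, ip_comm]

lemma ip_self_nonneg (a : Fin N → ℝ) : 0 ≤ ip a a :=
  div_nonneg (dotProduct_self_nonneg' a) (Nat.cast_nonneg N)

lemma ip_sq_le (a b : Fin N → ℝ) : (ip a b) ^ 2 ≤ ip a a * ip b b := by
  rw [ip, ip, ip, div_pow, div_mul_div_comm, sq (N : ℝ)]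
  refine div_le_div_of_nonneg_right ?_ (by positivity)
  simp only [dotProduct, ← sq]
  exact Finset.sum_mul_sq_le_sq_mul_sq _ _ _

lemma abs_ip_le (a b : Fin N → ℝ) : |ip a b| ≤ √(ip a a) * √(ip b b) := by
  rw [← Real.sqrt_mul (ip_self_nonneg a)]
  exact Real.abs_le_sqrt (ip_sq_le a b)

lemma abs_ip_le_add (a b : Fin N → ℝ) : |ip a b| ≤ ip a a + ip b b := by
  refine (abs_ip_le a b).trans ?_
  nlinarith [Real.sq_sqrt (ip_self_nonneg a), Real.sq_sqrt (ip_self_nonneg b),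
    sq_nonneg (√(ip a a) - √(ip b b)), ip_self_nonneg a, ip_self_nonneg b]

lemma ip_add_self_le (a b : Fin N → ℝ) : ip (a + b) (a + b) ≤ 2 * ip a a + 2 * ip b b := by
  have := ip_self_nonneg (a - b)
  simp only [ip_sub_left, ip_sub_right, ip_add_left, ip_add_right] at *
  linarith

end IP

/-! ### Independent identically distributed rows -/

section Rows

set_option linter.unusedSectionVars false

variable {Ω : ℕ → Type*} [∀ N, MeasurableSpace (Ω N)] (P : ∀ N, Measure (Ω N))
  {α : Type*} [MeasurableSpace α]

/-- The filter of the events of high probability as `N → ∞`. -/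
abbrev glob : Filter (Σ N, Ω N) := whp P atTop

/-- The filter on the pairs `(N, n)`, `n < N`, along which `N → ∞`, uniformly in `n`. -/
def rowFilter : Filter (Σ N, Fin N) := comap Sigma.fst atTop

/-- The filter of the events, depending on a row `n < N`, whose probability tends to one as
`N → ∞`, uniformly in the row. -/
abbrev rows : Filter (Σ p : (Σ N, Fin N), Ω p.1) := whp (fun p : (Σ N, Fin N) => P p.1) rowFilter

lemma eventually_rowFilter {Q : (Σ N, Fin N) → Prop} :
    (∀ᶠ p in rowFilter, Q p) ↔ ∃ N₀, ∀ N ≥ N₀, ∀ n : Fin N, Q ⟨N, n⟩ := by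
  rw [rowFilter, eventually_comap, eventually_atTop]
  constructor
  · rintro ⟨N₀, h⟩; exact ⟨N₀, fun N hN n => h N hN ⟨N, n⟩ rfl⟩
  · rintro ⟨N₀, h⟩; exact ⟨N₀, fun N hN p hp => h p.1 (hp ▸ hN) p.2⟩

instance rowFilter_neBot : rowFilter.NeBot := by
  refine ⟨fun h => ?_⟩
  have : ∀ᶠ p in rowFilter, False := by rw [h]; exact eventually_bot
  obtain ⟨N₀, h⟩ := eventually_rowFilter.1 this
  exact h (N₀ + 1) (Nat.le_succ _) 0

instance glob_neBot [∀ N, IsProbabilityMeasure (P N)] : (glob P).NeBot := whp_neBot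

/-- Forgetting the row. -/
def toGlob (y : Σ p : (Σ N, Fin N), Ω p.1) : Σ N, Ω N := ⟨y.1.1, y.2⟩

lemma tendsto_toGlob : Tendsto (toGlob (Ω := Ω)) (rows P) (glob P) := by
  intro s hs
  have h1 : Tendsto (fun N => P N {ω | (⟨N, ω⟩ : Σ N, Ω N) ∉ s}) atTop (𝓝 0) := hs
  exact h1.comp (tendsto_comap (f := Sigma.fst) (x := atTop))

/-- The rows `y N ω n`, `n < N`, are independent with law `m`. -/
structure IIDRows (y : ∀ N, Ω N → Fin N → α) (m : Measure α) : Prop where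
  measurable : ∀ N, Measurable (y N)
  law : ∀ N, (P N).map (y N) = Measure.pi fun _ => m

variable {P}
variable {y : ∀ N, Ω N → Fin N → α} {m : Measure α} [IsProbabilityMeasure m]

lemma IIDRows.measurable_row (h : IIDRows P y m) (N : ℕ) (n : Fin N) :
    Measurable fun ω => y N ω n := (measurable_pi_apply n).comp (h.measurable N)

lemma IIDRows.law_row (h : IIDRows P y m) (N : ℕ) (n : Fin N) :
    (P N).map (fun ω => y N ω n) = m := by
  have : (fun ω => y N ω n) = (fun z : Fin N → α => z n) ∘ y N := rfl
  rw [this, ← Measure.map_map (measurable_pi_apply n) (h.measurable N), h.law N]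
  exact (measurePreserving_eval (fun _ => m) n).map_eq

lemma IIDRows.law_comp (h : IIDRows P y m) {f : α → ℝ} (hf : Measurable f) (p : Σ N, Fin N) :
    (P p.1).map (fun ω => f (y p.1 ω p.2)) = m.map f := by
  have : (fun ω => f (y p.1 ω p.2)) = f ∘ fun ω => y p.1 ω p.2 := rfl
  rw [this, ← Measure.map_map hf (h.measurable_row _ _), h.law_row]

lemma infinitePi_map_fin (m : Measure α) [IsProbabilityMeasure m] (N : ℕ) :
    (Measure.infinitePi fun _ : ℕ => m).map (fun g (i : Fin N) => g i) =
      Measure.pi fun _ => m := by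
  rw [← Measure.infinitePi_eq_pi]
  exact Measure.map_infinitePi_infinitePi_of_inj (P := fun _ : ℕ => m)
    (f := fun i : Fin N => (i : ℕ)) Fin.val_injective

lemma measurable_avg {f : α → ℝ} (hf : Measurable f) (N : ℕ) :
    Measurable fun z : Fin N → α => (∑ n, f (z n)) / N :=
  (Finset.measurable_sum _ fun n _ => hf.comp (measurable_pi_apply n)).div_const _

/-- The weak law of large numbers. -/
lemma IIDRows.lln (h : IIDRows P y m) {f : α → ℝ} (hfm : Measurable f) (hf : Integrable f m) :
    Tendsto (fun x : Σ N, Ω N => (∑ n, f (y x.1 x.2 n)) / x.1) (glob P) (𝓝 (∫ a, f a ∂m)) := by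
  let Q := Measure.infinitePi fun _ : ℕ => m
  have hev : ∀ i : ℕ, Q.map (fun g => g i) = m := fun i =>
    (measurePreserving_eval_infinitePi (fun _ : ℕ => m) i).map_eq
  have hint : Integrable (fun g : ℕ → α => f (g 0)) Q := by
    have := (measurePreserving_eval_infinitePi (fun _ : ℕ => m) 0)
    exact (this.integrable_comp hf.aestronglyMeasurable).2 hf
  have hind : iIndepFun (fun i (g : ℕ → α) => f (g i)) Q :=
    iIndepFun_infinitePi (P := fun _ : ℕ => m) (X := fun _ => f) (fun _ => hfm)
  have hs := strong_law_ae_real (μ := Q) (fun i g => f (g i)) hint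
    (fun i j hij => hind.indepFun hij) (fun i => ⟨(hfm.comp (measurable_pi_apply i)).aemeasurable,
      (hfm.comp (measurable_pi_apply 0)).aemeasurable, by
        have h1 : ∀ j : ℕ, Q.map (fun g => f (g j)) = m.map f := fun j => by
          have : (fun g : ℕ → α => f (g j)) = f ∘ fun g => g j := rfl
          rw [this, ← Measure.map_map hfm (measurable_pi_apply j), hev]
        rw [h1, h1]⟩)
  have hlim : ∫ g, f (g 0) ∂Q = ∫ a, f a ∂m := by
    rw [← hev 0, integral_map (measurable_pi_apply 0).aemeasurable]
    rw [hev 0]; exact hf.aestronglyMeasurable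
  rw [hlim] at hs
  have ht := tendstoInMeasure_of_tendsto_ae (fun N => ((Finset.measurable_sum _ fun i _ =>
    hfm.comp (measurable_pi_apply i)).div_const _).aestronglyMeasurable) hs
  rw [Metric.tendsto_nhds]
  intro ε hε
  rw [eventually_whp]
  refine (ht (ENNReal.ofReal ε) (by simpa using hε)).congr fun N => ?_
  set A : Set (Fin N → α) := {z | ε ≤ |(∑ n, f (z n)) / N - ∫ a, f a ∂m|} with hA
  have hAm : MeasurableSet A := measurableSet_le measurable_const
    (continuous_abs.measurable.comp ((measurable_avg hfm N).sub_const _))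
  have e1 : {g : ℕ → α | ENNReal.ofReal ε ≤ edist ((∑ i ∈ Finset.range N, f (g i)) / (N : ℝ))
      (∫ a, f a ∂m)} = (fun (g : ℕ → α) (i : Fin N) => g i) ⁻¹' A := by
    ext g
    simp only [Set.mem_ofPred_eq, Set.mem_preimage, hA, edist_dist, Real.dist_eq,
      ENNReal.ofReal_le_ofReal_iff (abs_nonneg _)]
    rw [Finset.sum_range]
  have e2 : {ω : Ω N | ¬ dist ((∑ n, f (y N ω n)) / (N : ℝ)) (∫ a, f a ∂m) < ε} =
      y N ⁻¹' A := by
    ext ω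
    simp [hA, Real.dist_eq]
  refine (congrArg Q e1).trans (Eq.trans ?_ (congrArg (P N) e2).symm)
  rw [← Measure.map_apply (measurable_pi_lambda _ fun i => measurable_pi_apply _) hAm,
    infinitePi_map_fin, ← h.law N, Measure.map_apply (h.measurable N) hAm]

lemma IIDRows.lln_ip (h : IIDRows P y m) {f g : α → ℝ} (hfm : Measurable f) (hgm : Measurable g)
    (hf : MemLp f 2 m) (hg : MemLp g 2 m) :
    Tendsto (fun x : Σ N, Ω N => ip (fun n => f (y x.1 x.2 n)) fun n => g (y x.1 x.2 n))
      (glob P) (𝓝 (∫ a, f a * g a ∂m)) :=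
  h.lln (f := fun a => f a * g a) (hfm.mul hgm) (hf.integrable_mul hg)

lemma memLp_two_of_lintegral {f : α → ℝ} (hf : Measurable f)
    (h : ∫⁻ a, ENNReal.ofReal (f a ^ 2) ∂m ≠ ∞) : MemLp f 2 m := by
  rw [memLp_two_iff_integrable_sq hf.aestronglyMeasurable]
  refine ⟨(hf.pow_const 2).aestronglyMeasurable, ?_⟩
  rw [hasFiniteIntegral_iff_ofReal (Eventually.of_forall fun a => sq_nonneg _)]
  exact h.lt_top

lemma lintegral_of_memLp_two {f : α → ℝ} (h : MemLp f 2 m) :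
    ∫⁻ a, ENNReal.ofReal (f a ^ 2) ∂m ≠ ∞ := by
  have := h.integrable_sq.hasFiniteIntegral
  rw [hasFiniteIntegral_iff_ofReal (Eventually.of_forall fun a => sq_nonneg _)] at this
  exact this.ne

/-- The largest of `N` independent square integrable variables is `o(√N)`. -/
lemma IIDRows.max_le [∀ N, IsProbabilityMeasure (P N)] (h : IIDRows P y m) {f : α → ℝ}
    (hfm : Measurable f) (hf : MemLp f 2 m)
    {ε : ℝ} (hε : 0 < ε) : ∀ᶠ x in glob P, ∀ n, (f (y x.1 x.2 n)) ^ 2 ≤ ε * x.1 := by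
  -- Union bound over the rows, with Chebyshev's inequality for the truncated second moment:
  -- `ε N m {f² > ε N} ≤ ∫_{|f| > K} f²` as soon as `K² ≤ ε N`.
  have hU : UnifSq (fun _ : Unit => m) (fun _ => f) :=
    unifSq_of_map_eq (fun _ => hfm) (m := m.map f) (fun _ => rfl) (by
      rw [lintegral_map (by fun_prop) hfm]; exact lintegral_of_memLp_two hf)
  rw [eventually_whp, ENNReal.tendsto_nhds_zero]
  intro δ hδ
  by_cases hδ' : δ = ∞
  · exact Eventually.of_forall fun i => by rw [hδ']; exact le_top
  have hd : 0 < δ.toReal := ENNReal.toReal_pos hδ.ne' hδ'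
  obtain ⟨K, hK⟩ := hU (ε * δ.toReal) (by positivity)
  specialize hK ()
  obtain ⟨N₀, hN₀⟩ := exists_nat_ge (K ^ 2 / ε)
  filter_upwards [eventually_ge_atTop N₀] with N hN
  set A : Set α := {a | ε * N < f a ^ 2} with hA
  have hAm : MeasurableSet A := measurableSet_lt measurable_const (hfm.pow_const 2)
  have hAK : A ⊆ {a | K < |f a|} := by
    intro a ha
    have h1 : K ^ 2 ≤ ε * N := by
      rw [div_le_iff₀ hε] at hN₀
      have : (N₀ : ℝ) ≤ N := Nat.cast_le.2 hN
      nlinarith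
    have h2 : |K| < |f a| := sq_lt_sq.1 (lt_of_le_of_lt h1 ha)
    exact lt_of_le_of_lt (le_abs_self K) h2
  have h1 : ENNReal.ofReal (ε * N) * m A ≤ ENNReal.ofReal (ε * δ.toReal) := by
    refine le_trans ?_ ((lintegral_mono_set hAK).trans hK)
    rw [← setLIntegral_const]
    exact setLIntegral_mono (by fun_prop) fun a ha => ENNReal.ofReal_le_ofReal (le_of_lt ha)
  have h2 : (N : ℝ≥0∞) * m A ≤ δ := by
    rw [ENNReal.ofReal_mul hε.le, ENNReal.ofReal_mul hε.le, mul_assoc, ENNReal.ofReal_toReal hδ',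
      ENNReal.mul_le_mul_iff_right (by simpa using hε) ENNReal.ofReal_ne_top] at h1
    simpa using h1
  refine le_trans ?_ h2
  have h3 : {ω : Ω N | ¬ ∀ n, (f (y N ω n)) ^ 2 ≤ ε * N} ⊆ ⋃ n, {ω | y N ω n ∈ A} := by
    intro ω hω
    simp only [Set.mem_ofPred_eq, not_forall, not_le] at hω
    simpa [hA] using hω
  refine (measure_mono h3).trans ((measure_iUnion_le _).trans ?_)
  have h4 : ∀ n : Fin N, P N {ω | y N ω n ∈ A} = m A := fun n => by
    rw [← h.law_row N n, Measure.map_apply (h.measurable_row N n) hAm]; rfl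
  simp [h4]

variable (P y m) in
/-- The random vectors `a N` are asymptotically given by the function `f` of the rows `y N ω n`:
they are close in the mean square over the entries, and uniformly in each entry in probability. -/
structure Approx (a : ∀ N, Ω N → Fin N → ℝ) (f : α → ℝ) : Prop where
  measurable : Measurable f
  memLp : MemLp f 2 m
  avg : Tendsto (fun x : Σ N, Ω N => ip (fun n => a x.1 x.2 n - f (y x.1 x.2 n))
    fun n => a x.1 x.2 n - f (y x.1 x.2 n)) (glob P) (𝓝 0)
  row : Tendsto (fun z : Σ p : (Σ N, Fin N), Ω p.1 =>
    a z.1.1 z.2 z.1.2 - f (y z.1.1 z.2 z.1.2)) (rows P) (𝓝 0)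

variable {a a' : ∀ N, Ω N → Fin N → ℝ} {f f' : α → ℝ}

lemma Approx.self (hf : Measurable f) (h2 : MemLp f 2 m) :
    Approx P y m (fun N ω n => f (y N ω n)) f where
  measurable := hf
  memLp := h2
  avg := by simpa [ip] using tendsto_const_nhds
  row := by simpa using tendsto_const_nhds

lemma Approx.zero : Approx P y m (fun _ _ _ => 0) (fun _ => 0) :=
  Approx.self measurable_const MemLp.zero

lemma Approx.add (h : Approx P y m a f) (h' : Approx P y m a' f') :
    Approx P y m (fun N ω n => a N ω n + a' N ω n) (fun b => f b + f' b) where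
  measurable := h.measurable.add h'.measurable
  memLp := h.memLp.add h'.memLp
  avg := by
    have h1 := (h.avg.const_mul 2).add (h'.avg.const_mul 2)
    simp only [mul_zero, add_zero] at h1
    refine tendsto_of_tendsto_of_tendsto_of_le_of_le tendsto_const_nhds h1
      (fun x => ip_self_nonneg _) fun x => ?_
    refine le_trans (le_of_eq ?_) (ip_add_self_le _ _)
    congr 1 <;> (ext n; simp only [Pi.add_apply]; ring)
  row := by
    have h1 := h.row.add h'.row
    simp only [add_zero] at h1
    refine h1.congr fun x => ?_
    ring

lemma Approx.smul [∀ N, IsProbabilityMeasure (P N)] (hy : IIDRows P y m) (h : Approx P y m a f)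
    {c : ∀ N, Ω N → ℝ} {c₀ : ℝ} (hc : Tendsto (fun x : Σ N, Ω N => c x.1 x.2) (glob P) (𝓝 c₀)) :
    Approx P y m (fun N ω n => c N ω * a N ω n) (fun b => c₀ * f b) where
  measurable := h.measurable.const_mul _
  memLp := h.memLp.const_mul _
  avg := by
    have h2 := hy.lln_ip h.measurable h.measurable h.memLp h.memLp
    have h1 := (((hc.pow 2).mul h.avg).const_mul 2).add
      ((((hc.sub_const c₀).pow 2).mul h2).const_mul 2)
    simp only [mul_zero, sub_self, ne_eq, OfNat.ofNat_ne_zero, not_false_eq_true, zero_pow,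
      zero_mul, add_zero] at h1
    refine tendsto_of_tendsto_of_tendsto_of_le_of_le tendsto_const_nhds h1
      (fun x => ip_self_nonneg _) fun x => ?_
    have e : (fun n => c x.1 x.2 * a x.1 x.2 n - c₀ * f (y x.1 x.2 n)) =
        c x.1 x.2 • (fun n => a x.1 x.2 n - f (y x.1 x.2 n)) +
          (c x.1 x.2 - c₀) • fun n => f (y x.1 x.2 n) := by
      ext n; simp only [Pi.add_apply, Pi.smul_apply, smul_eq_mul]; ring
    rw [e]
    refine (ip_add_self_le _ _).trans (le_of_eq ?_)
    simp only [ip_smul_left, ip_smul_right]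
    ring
  row := by
    have ht : Tight (fun p : (Σ N, Fin N) => P p.1) rowFilter
        (fun z : Σ p : (Σ N, Fin N), Ω p.1 => f (y z.1.1 z.2 z.1.2)) :=
      tight_of_map_eq (f := fun (p : Σ N, Fin N) (ω : Ω p.1) => f (y p.1 ω p.2)) (m := m.map f)
        (fun p => (h.measurable.comp (hy.measurable_row _ _)).aemeasurable)
        fun p => hy.law_comp h.measurable p
    have hc' := hc.comp (tendsto_toGlob P)
    have h0 := hc'.sub_const c₀
    rw [sub_self] at h0
    have h1 := (hc'.mul h.row).add (ht.mul_tendsto_zero h0)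
    simp only [mul_zero, add_zero] at h1
    refine h1.congr fun x => ?_
    simp only [Function.comp_apply, toGlob]
    ring

lemma Approx.sum [∀ N, IsProbabilityMeasure (P N)] (hy : IIDRows P y m) {J : Type*}
    (s : Finset J) {a : J → ∀ N, Ω N → Fin N → ℝ} {f : J → α → ℝ}
    (h : ∀ j, Approx P y m (a j) (f j)) {c : J → ∀ N, Ω N → ℝ} {c₀ : J → ℝ}
    (hc : ∀ j, Tendsto (fun x : Σ N, Ω N => c j x.1 x.2) (glob P) (𝓝 (c₀ j))) :
    Approx P y m (fun N ω n => ∑ j ∈ s, c j N ω * a j N ω n) (fun b => ∑ j ∈ s, c₀ j * f j b) := by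
  classical
  induction s using Finset.induction_on with
  | empty => simpa using Approx.zero
  | insert i s hi ih =>
    simp only [Finset.sum_insert hi]
    exact ((h i).smul hy (hc i)).add ih

lemma Approx.sub [∀ N, IsProbabilityMeasure (P N)] (hy : IIDRows P y m) (h : Approx P y m a f)
    (h' : Approx P y m a' f') :
    Approx P y m (fun N ω n => a N ω n - a' N ω n) (fun b => f b - f' b) := by
  have := h.add (h'.smul hy (c := fun _ _ => -1) (tendsto_const_nhds))
  simpa only [neg_mul, one_mul, ← sub_eq_add_neg] using this

lemma Approx.congr (h : Approx P y m a f)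
    (he : ∀ᶠ x in glob P, a x.1 x.2 = a' x.1 x.2) : Approx P y m a' f where
  measurable := h.measurable
  memLp := h.memLp
  avg := h.avg.congr' (he.mono fun x hx => by rw [hx])
  row := h.row.congr' (((tendsto_toGlob P).eventually he).mono fun x hx => by
    have : a x.1.1 x.2 = a' x.1.1 x.2 := hx
    rw [this])

lemma tendsto_ip_of_close {X : Type*} {l : Filter X} {d : X → ℕ} {a b a₀ b₀ : ∀ x, Fin (d x) → ℝ}
    {A B c : ℝ} (ha : Tendsto (fun x => ip (a x - a₀ x) (a x - a₀ x)) l (𝓝 0))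
    (hb : Tendsto (fun x => ip (b x - b₀ x) (b x - b₀ x)) l (𝓝 0))
    (hA : Tendsto (fun x => ip (a₀ x) (a₀ x)) l (𝓝 A))
    (hB : Tendsto (fun x => ip (b₀ x) (b₀ x)) l (𝓝 B))
    (hc : Tendsto (fun x => ip (a₀ x) (b₀ x)) l (𝓝 c)) :
    Tendsto (fun x => ip (a x) (b x)) l (𝓝 c) := by
  have key : ∀ {u v : ∀ x, Fin (d x) → ℝ} {C : ℝ}, Tendsto (fun x => ip (u x) (u x)) l (𝓝 0) →
      Tendsto (fun x => ip (v x) (v x)) l (𝓝 C) → Tendsto (fun x => ip (u x) (v x)) l (𝓝 0) := by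
    intro u v C hu hv
    rw [tendsto_zero_iff_abs_tendsto_zero]
    have h1 := hu.sqrt.mul hv.sqrt
    rw [Real.sqrt_zero, zero_mul] at h1
    exact tendsto_of_tendsto_of_tendsto_of_le_of_le tendsto_const_nhds h1
      (fun x => abs_nonneg _) fun x => abs_ip_le _ _
  have h1 := (((key ha hb).add (key ha hB)).add (key hb hA)).add hc
  simp only [zero_add] at h1
  refine h1.congr fun x => ?_
  rw [ip_comm (b x - b₀ x)]
  simp only [ip_sub_left, ip_sub_right]
  ring

/-- Inner products of asymptotically described vectors converge to the covariances of the
limits. -/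
lemma Approx.tendsto_ip (hy : IIDRows P y m) (h : Approx P y m a f) (h' : Approx P y m a' f') :
    Tendsto (fun x : Σ N, Ω N => ip (a x.1 x.2) (a' x.1 x.2)) (glob P) (𝓝 (∫ b, f b * f' b ∂m)) :=
  tendsto_ip_of_close (d := fun x : Σ N, Ω N => x.1) (a := fun x => a x.1 x.2)
    (b := fun x => a' x.1 x.2) (a₀ := fun x n => f (y x.1 x.2 n)) (b₀ := fun x n => f' (y x.1 x.2 n))
    h.avg h'.avg (hy.lln_ip h.measurable h.measurable h.memLp h.memLp)
    (hy.lln_ip h'.measurable h'.measurable h'.memLp h'.memLp)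
    (hy.lln_ip h.measurable h'.measurable h.memLp h'.memLp)

lemma Approx.max_le [∀ N, IsProbabilityMeasure (P N)] (hy : IIDRows P y m) (h : Approx P y m a f)
    {ε : ℝ} (hε : 0 < ε) : ∀ᶠ x in glob P, ∀ n, (a x.1 x.2 n) ^ 2 ≤ ε * x.1 := by
  have h1 := hy.max_le h.measurable h.memLp (show 0 < ε / 4 by positivity)
  have h2 := (tendsto_order.1 h.avg).2 (ε / 4) (by positivity)
  filter_upwards [h1, h2] with x h1 h2 n
  have hN : 0 < (x.1 : ℝ) := Nat.cast_pos.2 (Nat.lt_of_le_of_lt (Nat.zero_le _) n.2)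
  rw [ip, div_lt_iff₀ hN, dotProduct] at h2
  have h3 : (a x.1 x.2 n - f (y x.1 x.2 n)) * (a x.1 x.2 n - f (y x.1 x.2 n)) ≤
      ∑ i, (a x.1 x.2 i - f (y x.1 x.2 i)) * (a x.1 x.2 i - f (y x.1 x.2 i)) :=
    Finset.single_le_sum (f := fun i => (a x.1 x.2 i - f (y x.1 x.2 i)) *
      (a x.1 x.2 i - f (y x.1 x.2 i))) (fun i _ => mul_self_nonneg _) (Finset.mem_univ n)
  nlinarith [h1 n, sq_nonneg (a x.1 x.2 n - 2 * f (y x.1 x.2 n))]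

/-- Entrywise closeness in probability of uniformly square integrable vectors implies closeness
in the mean square. -/
lemma Approx.of_row [∀ N, IsProbabilityMeasure (P N)] (hy : IIDRows P y m)
    (ha : ∀ N, Measurable (a N)) (hf : Measurable f)
    (hU : UnifSq (fun p : (Σ N, Fin N) => P p.1) fun p ω => a p.1 ω p.2)
    (hrow : Tendsto (fun z : Σ p : (Σ N, Fin N), Ω p.1 =>
      a z.1.1 z.2 z.1.2 - f (y z.1.1 z.2 z.1.2)) (rows P) (𝓝 0)) :
    Approx P y m a f := by
  have ham : ∀ N n, Measurable fun ω => a N ω n := fun N n => (measurable_pi_apply n).comp (ha N)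
  have hfm : ∀ N n, Measurable fun ω => f (y N ω n) := fun N n => hf.comp (hy.measurable_row N n)
  obtain ⟨h1, h2⟩ := hU.tendsto_sq_dist (l := rowFilter) (m := m.map f)
    (g := fun (p : Σ N, Fin N) (ω : Ω p.1) => f (y p.1 ω p.2)) (fun p => ham _ _)
    (fun p => hfm _ _) (fun p => hy.law_comp hf p) hrow
  rw [lintegral_map (by fun_prop) hf] at h1
  refine ⟨hf, memLp_two_of_lintegral hf h1, ?_, hrow⟩
  refine tendsto_zero_of_lintegral (P := P) (f := fun N ω =>
    ip (fun n => a N ω n - f (y N ω n)) fun n => a N ω n - f (y N ω n)) (fun N => ?_) ?_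
  · exact ((Finset.measurable_sum _ fun n _ => ((ham N n).sub (hfm N n)).mul
      ((ham N n).sub (hfm N n))).div_const _).aemeasurable
  · rw [ENNReal.tendsto_nhds_zero] at h2 ⊢
    intro ε hε
    obtain ⟨N₀, hN₀⟩ := eventually_rowFilter.1 (h2 ε hε)
    filter_upwards [eventually_ge_atTop N₀] with N hN
    by_cases hN0 : N = 0
    · subst hN0
      simp [ip]
    have e : ∀ ω, ENNReal.ofReal |ip (fun n => a N ω n - f (y N ω n))
        fun n => a N ω n - f (y N ω n)| =
        (∑ n, ENNReal.ofReal ((a N ω n - f (y N ω n)) ^ 2)) * (N : ℝ≥0∞)⁻¹ := by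
      intro ω
      rw [abs_of_nonneg (ip_self_nonneg _), ip_eq_sum, ENNReal.ofReal_div_of_pos
        (Nat.cast_pos.2 (Nat.pos_of_ne_zero hN0)), ENNReal.ofReal_sum_of_nonneg
        (fun n _ => mul_self_nonneg _), ENNReal.ofReal_natCast, div_eq_mul_inv]
      simp only [sq]
    simp only [e]
    have hmm : ∀ n, Measurable fun ω => ENNReal.ofReal ((a N ω n - f (y N ω n)) ^ 2) := fun n =>
      (((ham N n).sub (hfm N n)).pow_const 2).ennreal_ofReal
    rw [lintegral_mul_const _ (Finset.measurable_sum _ fun n _ => hmm n),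
      lintegral_finsetSum _ fun n _ => hmm n]
    calc (∑ n, ∫⁻ ω, ENNReal.ofReal ((a N ω n - f (y N ω n)) ^ 2) ∂(P N)) * (N : ℝ≥0∞)⁻¹
        ≤ (∑ _n : Fin N, ε) * (N : ℝ≥0∞)⁻¹ := by
          gcongr with n
          exact hN₀ N hN n
      _ = ε := by
          rw [Finset.sum_const, Finset.card_univ, Fintype.card_fin, nsmul_eq_mul, mul_comm,
            ← mul_assoc, ENNReal.inv_mul_cancel (by simpa using hN0) (by simp), one_mul]

end Rows

end OAMP


namespace OAMP

open Filter Topology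
open scoped ENNReal

/-! ### Composition with discontinuous functions -/

section Comp

variable {I : Type*} {Ω : I → Type*} [∀ i, MeasurableSpace (Ω i)] {P : ∀ i, Measure (Ω i)}
  {l : Filter I} {E : Type*} [MeasurableSpace E]

/-- The rows whose first `k` entries are bounded by `K`. -/
def box (E : Type*) (k : ℕ) (K : ℝ) : Set (E × (ℕ → ℝ)) := {p | ∀ j < k, |p.2 j| ≤ K}

lemma measurableSet_box (k : ℕ) (K : ℝ) : MeasurableSet (box E k K) := by
  have : box E k K = ⋂ j, ⋂ (_ : j < k), {p | |p.2 j| ≤ K} := by ext; simp [box]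
  rw [this]
  refine MeasurableSet.iInter fun j => MeasurableSet.iInter fun _ => ?_
  exact measurableSet_le (continuous_abs.measurable.comp
    ((measurable_pi_apply j).comp measurable_snd)) measurable_const

lemma tendsto_measure_compl_box (ν : Measure (E × (ℕ → ℝ))) [IsFiniteMeasure ν] (k : ℕ) :
    Tendsto (fun K : ℕ => ν (box E k K)ᶜ) atTop (𝓝 0) := by
  have := tendsto_measure_iInter_atTop (μ := ν) (s := fun K : ℕ => (box E k K)ᶜ)
    (fun K => (measurableSet_box k K).compl.nullMeasurableSet)
    (fun a b hab => Set.compl_subset_compl.2 fun p hp j hj =>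
      (hp j hj).trans (Nat.cast_le.2 hab)) ⟨0, measure_ne_top _ _⟩
  have he : ⋂ K : ℕ, (box E k K)ᶜ = ∅ := by
    ext p
    simp only [Set.mem_iInter, Set.mem_compl_iff, Set.mem_empty_iff_false, iff_false, not_forall,
      not_not]
    obtain ⟨K, hK⟩ := exists_nat_ge (∑ j ∈ Finset.range k, |p.2 j|)
    exact ⟨K, fun j hj => (Finset.single_le_sum (f := fun j => |p.2 j|)
      (fun i _ => abs_nonneg _) (Finset.mem_range.2 hj)).trans hK⟩
  rwa [he, measure_empty] at this

/-- Rows `R` which are close in probability to rows `R'` with a fixed law `ν`. Up to an event of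
small probability, the laws of the rows `R` are dominated by a fixed measure which is finite on
boxes. -/
structure CloseRows (P : ∀ i, Measure (Ω i)) (l : Filter I) (R R' : ∀ i, Ω i → E × (ℕ → ℝ))
    (ν lam : Measure (E × (ℕ → ℝ))) (k : ℕ) : Prop where
  measurable : ∀ i, Measurable (R i)
  measurable' : ∀ i, Measurable (R' i)
  law : ∀ i, (P i).map (R' i) = ν
  base : ∀ i ω, (R i ω).1 = (R' i ω).1
  close : ∀ j, Tendsto (fun x : Σ i, Ω i => (R x.1 x.2).2 j - (R' x.1 x.2).2 j) (whp P l) (𝓝 0)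
  box_lt : ∀ K, lam (box E k K) < ∞
  dom : ∃ (S : ∀ i, Set (Ω i)) (C : ℝ≥0∞), C ≠ ∞ ∧ (∀ i, MeasurableSet (S i)) ∧
    (∀ᶠ x in whp P l, x.2 ∈ S x.1) ∧ ∀ i, ((P i).restrict (S i)).map (R i) ≤ C • lam

variable {R R' : ∀ i, Ω i → E × (ℕ → ℝ)} {ν lam : Measure (E × (ℕ → ℝ))} {k : ℕ}

lemma CloseRows.measure_eq (h : CloseRows P l R R' ν lam k) {A : Set (E × (ℕ → ℝ))}
    (hA : MeasurableSet A) (i : I) : P i {ω | R' i ω ∈ A} = ν A := by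
  rw [← h.law i, Measure.map_apply (h.measurable' i) hA]; rfl

lemma CloseRows.tight [IsFiniteMeasure ν] (h : CloseRows P l R R' ν lam k) {δ : ℝ≥0∞}
    (hδ : 0 < δ) : ∃ K : ℕ, ∀ᶠ i in l, P i {ω | R i ω ∉ box E k K} ≤ δ := by
  obtain ⟨K, hK⟩ := ((ENNReal.tendsto_nhds_zero.1 (tendsto_measure_compl_box ν k)) (δ / 2)
    (ENNReal.half_pos hδ.ne')).exists
  have h1 : ∀ᶠ x in whp P l, ∀ j ∈ Finset.range k,
      |(R x.1 x.2).2 j - (R' x.1 x.2).2 j| < 1 := by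
    rw [eventually_all_finset]
    intro j _
    simpa [Real.dist_eq] using Metric.tendsto_nhds.1 (h.close j) 1 one_pos
  rw [eventually_whp, ENNReal.tendsto_nhds_zero] at h1
  refine ⟨K + 1, ?_⟩
  filter_upwards [h1 (δ / 2) (ENNReal.half_pos hδ.ne')] with i hi
  rw [← ENNReal.add_halves δ]
  refine (measure_mono (t := {ω | R' i ω ∈ (box E k K)ᶜ} ∪ _) fun ω hω => ?_).trans
    ((measure_union_le _ _).trans (add_le_add
      ((h.measure_eq (measurableSet_box k K).compl i).trans_le hK) hi))
  by_contra hcon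
  simp only [Set.mem_union, not_or, Set.mem_ofPred_eq, Set.mem_compl_iff, not_not] at hcon
  refine hω fun j hj => ?_
  have e1 := hcon.1 j hj
  have e2 := hcon.2 j (Finset.mem_range.2 hj)
  push_cast
  rw [abs_le] at *
  rw [abs_lt] at e2
  constructor <;> linarith [e1.1, e1.2, e2.1, e2.2]

/-- Along a sequence of sets that decreases to the empty set, the rows `R` are unlikely to meet
the sets. -/
lemma CloseRows.exists_small [IsFiniteMeasure ν] (h : CloseRows P l R R' ν lam k)
    {D : ℕ → Set (E × (ℕ → ℝ))} (hD : ∀ n, MeasurableSet (D n)) (hanti : Antitone D)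
    (hemp : ⋂ n, D n = ∅) {δ : ℝ≥0∞} (hδ : 0 < δ) :
    ∃ n, (∀ᶠ i in l, P i {ω | R i ω ∈ D n} ≤ δ) ∧ ∀ i, P i {ω | R' i ω ∈ D n} ≤ δ := by
  obtain ⟨S, C, hC, hSm, hS, hdom⟩ := h.dom
  have h3 : 0 < δ / 3 := ENNReal.div_pos hδ.ne' (by simp)
  obtain ⟨K, hK⟩ := h.tight h3
  have t1 : Tendsto (fun n => ν (D n)) atTop (𝓝 0) := by
    have := tendsto_measure_iInter_atTop (μ := ν) (s := D)
      (fun n => (hD n).nullMeasurableSet) hanti ⟨0, measure_ne_top _ _⟩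
    rwa [hemp, measure_empty] at this
  have t2 : Tendsto (fun n => C * lam (D n ∩ box E k K)) atTop (𝓝 0) := by
    have := tendsto_measure_iInter_atTop (μ := lam) (s := fun n => D n ∩ box E k K)
      (fun n => ((hD n).inter (measurableSet_box k K)).nullMeasurableSet)
      (fun a b hab => Set.inter_subset_inter_left _ (hanti hab))
      ⟨0, ((measure_mono Set.inter_subset_right).trans_lt (h.box_lt K)).ne⟩
    rw [← Set.iInter_inter, hemp, Set.empty_inter, measure_empty] at this
    simpa using ENNReal.Tendsto.const_mul this (Or.inr hC)
  obtain ⟨n, hn1, hn2⟩ := (((ENNReal.tendsto_nhds_zero.1 t1) δ hδ).and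
    ((ENNReal.tendsto_nhds_zero.1 t2) (δ / 3) h3)).exists
  refine ⟨n, ?_, fun i => (h.measure_eq (hD n) i).trans_le hn1⟩
  rw [eventually_whp, ENNReal.tendsto_nhds_zero] at hS
  filter_upwards [hK, hS (δ / 3) h3] with i hi1 hi2
  have hsub : {ω | R i ω ∈ D n} ⊆ ({ω | ω ∉ S i} ∪ {ω | R i ω ∉ box E k K}) ∪
      (R i ⁻¹' (D n ∩ box E k K) ∩ S i) := by
    intro ω hω
    by_contra hcon
    simp only [Set.mem_union, not_or, Set.mem_ofPred_eq, not_not] at hcon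
    exact hcon.2 ⟨⟨hω, hcon.1.2⟩, hcon.1.1⟩
  have hm := (hD n).inter (measurableSet_box (E := E) k K)
  have h4 : P i (R i ⁻¹' (D n ∩ box E k K) ∩ S i) ≤ δ / 3 := by
    rw [← Measure.restrict_apply (h.measurable i hm), ← Measure.map_apply (h.measurable i) hm]
    refine (hdom i _).trans ?_
    simpa using hn2
  calc P i {ω | R i ω ∈ D n} ≤ (δ / 3 + δ / 3) + δ / 3 :=
        (measure_mono hsub).trans ((measure_union_le _ _).trans
          (add_le_add ((measure_union_le _ _).trans (add_le_add hi2 hi1)) h4))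
    _ = δ := ENNReal.add_thirds δ

/-- The σ-algebra of the sets whose indicators asymptotically agree on the two rows. -/
@[reducible] def CloseRows.space [IsFiniteMeasure ν] (h : CloseRows P l R R' ν lam k) :
    MeasurableSpace (E × (ℕ → ℝ)) where
  MeasurableSet' A := MeasurableSet A ∧ ∀ᶠ x in whp P l, (R x.1 x.2 ∈ A ↔ R' x.1 x.2 ∈ A)
  measurableSet_empty := ⟨MeasurableSet.empty, by simp⟩
  measurableSet_compl A hA := ⟨hA.1.compl, hA.2.mono fun x (hx : R x.1 x.2 ∈ A ↔ R' x.1 x.2 ∈ A) => not_congr hx⟩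
  measurableSet_iUnion A hA := by
    refine ⟨MeasurableSet.iUnion fun i => (hA i).1, ?_⟩
    rw [eventually_whp, ENNReal.tendsto_nhds_zero]
    intro δ hδ
    have h3 : 0 < δ / 3 := ENNReal.div_pos hδ.ne' (by simp)
    obtain ⟨n, hn1, hn2⟩ := h.exists_small (D := fun n => (⋃ i, A i) \ ⋃ i ∈ Finset.range n, A i)
      (fun n => (MeasurableSet.iUnion fun i => (hA i).1).diff
        (Finset.measurableSet_biUnion _ fun i _ => (hA i).1))
      (fun a b hab => Set.sdiff_subset_sdiff_right
        (Set.biUnion_subset_biUnion_left (Finset.range_mono hab))) (by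
        refine Set.eq_empty_of_forall_notMem fun p hp => ?_
        rw [Set.mem_iInter] at hp
        obtain ⟨i, hi⟩ := Set.mem_iUnion.1 (hp 0).1
        exact (hp (i + 1)).2 (Set.mem_biUnion (by simp) hi)) h3
    have h1 : ∀ᶠ x in whp P l, ∀ i ∈ Finset.range n, (R x.1 x.2 ∈ A i ↔ R' x.1 x.2 ∈ A i) := by
      rw [eventually_all_finset]
      exact fun i _ => (hA i).2
    rw [eventually_whp, ENNReal.tendsto_nhds_zero] at h1
    filter_upwards [hn1, h1 _ h3] with i hi1 hi2
    rw [← ENNReal.add_thirds δ]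
    refine (measure_mono ?_).trans ((measure_union_le _ _).trans (add_le_add
      ((measure_union_le _ _).trans (add_le_add hi1 (hn2 i))) hi2))
    intro ω hω
    by_contra hcon
    simp only [Set.mem_union, not_or, Set.mem_ofPred_eq, not_not, Set.mem_sdiff, Set.mem_iUnion,
      not_and, Finset.mem_range, exists_prop] at hcon hω
    obtain ⟨⟨c1, c2⟩, c3⟩ := hcon
    refine hω ⟨fun h => ?_, fun h => ?_⟩
    · obtain ⟨j, hj, hj'⟩ := c1 h
      exact ⟨j, (c3 j hj).1 hj'⟩
    · obtain ⟨j, hj, hj'⟩ := c2 h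
      exact ⟨j, (c3 j hj).2 hj'⟩

/-- Threshold events agree with high probability at every level which the common law of the limit
rows does not charge. -/
lemma CloseRows.eventually_Ioi [IsFiniteMeasure ν] (h : CloseRows P l R R' ν lam k) {j : ℕ} {c : ℝ}
    (hc : ν {p | p.2 j = c} = 0) :
    ∀ᶠ x in whp P l, (c < (R x.1 x.2).2 j ↔ c < (R' x.1 x.2).2 j) := by
  have hmj : Measurable fun p : E × (ℕ → ℝ) => p.2 j :=
    (measurable_pi_apply j).comp measurable_snd
  have hms : ∀ n : ℕ, MeasurableSet {p : E × (ℕ → ℝ) | |p.2 j - c| ≤ 1 / ((n : ℝ) + 1)} := fun n =>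
    measurableSet_le (continuous_abs.measurable.comp (hmj.sub_const c)) measurable_const
  have t : Tendsto (fun n : ℕ => ν {p | |p.2 j - c| ≤ 1 / ((n : ℝ) + 1)}) atTop (𝓝 0) := by
    have := tendsto_measure_iInter_atTop (μ := ν)
      (s := fun n : ℕ => {p : E × (ℕ → ℝ) | |p.2 j - c| ≤ 1 / ((n : ℝ) + 1)})
      (fun n => (hms n).nullMeasurableSet)
      (fun a b hab p (hp : |p.2 j - c| ≤ 1 / ((b : ℝ) + 1)) =>
        hp.trans (one_div_le_one_div_of_le (by positivity) (by simpa using hab)))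
      ⟨0, measure_ne_top _ _⟩
    have he : ⋂ n : ℕ, {p : E × (ℕ → ℝ) | |p.2 j - c| ≤ 1 / ((n : ℝ) + 1)} =
        {p | p.2 j = c} := by
      ext p
      simp only [Set.mem_iInter, Set.mem_ofPred_eq]
      constructor
      · intro hp
        have := ge_of_tendsto' (tendsto_one_div_add_atTop_nhds_zero_nat (𝕜 := ℝ)) hp
        exact sub_eq_zero.1 (abs_nonpos_iff.1 this)
      · intro hp n
        rw [hp, sub_self, abs_zero]; positivity
    rwa [he, hc] at this
  rw [eventually_whp, ENNReal.tendsto_nhds_zero]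
  intro δ hδ
  obtain ⟨n, hn⟩ := ((ENNReal.tendsto_nhds_zero.1 t) _ (ENNReal.half_pos hδ.ne')).exists
  have h1 := Metric.tendsto_nhds.1 (h.close j) (1 / ((n : ℝ) + 1)) (by positivity)
  rw [eventually_whp, ENNReal.tendsto_nhds_zero] at h1
  filter_upwards [h1 _ (ENNReal.half_pos hδ.ne')] with i hi
  rw [← ENNReal.add_halves δ]
  refine (measure_mono ?_).trans ((measure_union_le _ _).trans (add_le_add
    ((h.measure_eq (hms n) i).trans_le hn) hi))
  intro ω hω
  by_contra hcon
  simp only [Set.mem_union, not_or, Set.mem_ofPred_eq, not_not, dist_zero_right,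
    Real.norm_eq_abs, not_le] at hcon hω
  obtain ⟨c1, c2⟩ := hcon
  refine hω ⟨fun h => ?_, fun h => ?_⟩
  · by_contra h'
    rw [abs_of_nonpos (by linarith [not_lt.1 h'])] at c1
    linarith [(abs_lt.1 c2).2]
  · by_contra h'
    rw [abs_of_pos (by linarith)] at c1
    linarith [(abs_lt.1 c2).1, not_lt.1 h']

lemma CloseRows.le_space [IsFiniteMeasure ν] (h : CloseRows P l R R' ν lam k) :
    (inferInstance : MeasurableSpace (E × (ℕ → ℝ))) ≤ h.space := by
  have h1 : @Measurable _ _ h.space _ (fun p : E × (ℕ → ℝ) => p.1) := by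
    intro A hA
    exact ⟨measurable_fst hA, Eventually.of_forall fun x => by
      simp only [Set.mem_preimage, h.base]⟩
  have h2 : ∀ j, @Measurable _ _ h.space _ (fun p : E × (ℕ → ℝ) => p.2 j) := by
    intro j
    have hmj : Measurable fun p : E × (ℕ → ℝ) => p.2 j :=
      (measurable_pi_apply j).comp measurable_snd
    refine @measurable_of_Ioi ℝ (E × (ℕ → ℝ)) _ _ _ h.space _ _ _ _ fun c => ?_
    -- approximate the level from above by levels of probability zero
    have hcount := Measure.countable_meas_level_set_pos (μ := ν) hmj
    have hdense := hcount.dense_compl ℝ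
    have hex : ∀ n : ℕ, ∃ d, ν {p | p.2 j = d} = 0 ∧ c < d ∧ d < c + 1 / ((n : ℝ) + 1) := by
      intro n
      obtain ⟨d, hd, hd'⟩ := hdense.exists_between (show c < c + 1 / ((n : ℝ) + 1) by
        have : (0 : ℝ) < 1 / ((n : ℝ) + 1) := by positivity
        linarith)
      exact ⟨d, by simpa using hd, hd'⟩
    choose d hd0 hd1 hd2 using hex
    have e : (fun p : E × (ℕ → ℝ) => p.2 j) ⁻¹' Set.Ioi c =
        ⋃ n, (fun p : E × (ℕ → ℝ) => p.2 j) ⁻¹' Set.Ioi (d n) := by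
      ext p
      simp only [Set.mem_preimage, Set.mem_Ioi, Set.mem_iUnion]
      constructor
      · intro hp
        obtain ⟨n, hn⟩ := exists_nat_one_div_lt (show 0 < p.2 j - c by linarith)
        exact ⟨n, by linarith [hd2 n]⟩
      · rintro ⟨n, hn⟩
        linarith [hd1 n]
    rw [e]
    exact @MeasurableSet.iUnion _ _ h.space _ _ fun n =>
      ⟨hmj measurableSet_Ioi, h.eventually_Ioi (hd0 n)⟩
  have h3 : @Measurable _ _ h.space _ (fun p : E × (ℕ → ℝ) => p) :=
    @Measurable.prodMk (E × (ℕ → ℝ)) h.space E (ℕ → ℝ) _ _ Prod.fst Prod.snd h1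
      (@measurable_pi_lambda (E × (ℕ → ℝ)) ℕ (fun _ => ℝ) h.space _ Prod.snd h2)
  intro A hA
  exact h3 hA

/-- A merely measurable function preserves the closeness of the rows. -/
lemma CloseRows.comp [IsFiniteMeasure ν] (h : CloseRows P l R R' ν lam k)
    {Θ : E × (ℕ → ℝ) → ℝ} (hΘ : Measurable Θ) :
    Tendsto (fun x : Σ i, Ω i => Θ (R x.1 x.2) - Θ (R' x.1 x.2)) (whp P l) (𝓝 0) := by
  rw [Metric.tendsto_nhds]
  intro ε hε
  have hA : ∀ q : ℤ, MeasurableSet {p | ⌊Θ p / ε⌋ = q} := fun q =>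
    (Int.measurable_floor.comp (hΘ.div_const ε)) (measurableSet_singleton q)
  rw [eventually_whp, ENNReal.tendsto_nhds_zero]
  intro δ hδ
  have h2 := ENNReal.half_pos hδ.ne'
  have hDm : ∀ n : ℕ, MeasurableSet {p | (n : ℤ) < |⌊Θ p / ε⌋|} := fun n =>
    (Int.measurable_floor.comp (hΘ.div_const ε))
      (show MeasurableSet {q : ℤ | (n : ℤ) < |q|} from MeasurableSet.of_discrete)
  obtain ⟨n, -, hn⟩ := h.exists_small (D := fun n : ℕ => {p | (n : ℤ) < |⌊Θ p / ε⌋|}) hDm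
    (fun a b hab p (hp : (b : ℤ) < _) => lt_of_le_of_lt (Nat.cast_le.2 hab) hp) (by
      ext p
      simp only [Set.mem_iInter, Set.mem_ofPred_eq, Set.mem_empty_iff_false, iff_false,
        not_forall, not_lt]
      exact ⟨|⌊Θ p / ε⌋|.toNat, Int.self_le_toNat _⟩) h2
  have h1 : ∀ᶠ x in whp P l, ∀ q ∈ Finset.Icc (-(n : ℤ)) n,
      (⌊Θ (R x.1 x.2) / ε⌋ = q ↔ ⌊Θ (R' x.1 x.2) / ε⌋ = q) := by
    rw [eventually_all_finset]
    exact fun q _ => (h.le_space _ (hA q)).2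
  rw [eventually_whp, ENNReal.tendsto_nhds_zero] at h1
  filter_upwards [h1 _ h2] with i hi
  rw [← ENNReal.add_halves δ]
  refine (measure_mono ?_).trans ((measure_union_le _ _).trans (add_le_add (hn i) hi))
  intro ω hω
  by_contra hcon
  simp only [Set.mem_union, not_or, Set.mem_ofPred_eq, not_not, dist_zero_right,
    Real.norm_eq_abs, not_lt, Finset.mem_Icc] at hcon hω
  obtain ⟨c1, c2⟩ := hcon
  have e1 := (c2 _ (abs_le.1 c1)).2 rfl
  have e2 := Int.abs_sub_lt_one_of_floor_eq_floor e1
  rw [← sub_div, abs_div, abs_of_pos hε, div_lt_one hε] at e2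
  linarith

end Comp

end OAMP


namespace OAMP

open Filter Topology
open scoped ENNReal

/-! ### The density of an entry of a random direction -/

section Density

lemma volume_le_of_antilipschitz {T A : Set ℝ} {f : ℝ → ℝ} {K : ℝ≥0}
    (h : ∀ s ∈ T, ∀ s' ∈ T, |s - s'| ≤ K * |f s - f s'|) (hA : ∀ s ∈ T, f s ∈ A) :
    volume T ≤ K * volume A := by
  have hinj : Set.InjOn f T := by
    intro s hs s' hs' he
    have := h s hs s' hs'
    rw [he, sub_self, abs_zero, mul_zero] at this
    exact sub_eq_zero.1 (abs_nonpos_iff.1 this)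
  have hl : LipschitzOnWith K (Function.invFunOn f T) (f '' T) := by
    refine LipschitzOnWith.of_dist_le_mul ?_
    rintro _ ⟨s, hs, rfl⟩ _ ⟨s', hs', rfl⟩
    rw [hinj.leftInvOn_invFunOn hs, hinj.leftInvOn_invFunOn hs', Real.dist_eq, Real.dist_eq]
    exact h s hs s' hs'
  have h1 := hl.hausdorffMeasure_image_le zero_le_one
  rw [hausdorffMeasure_real, hinj.leftInvOn_invFunOn.image_image, ENNReal.rpow_one] at h1
  refine h1.trans ?_
  gcongr
  rintro _ ⟨s, hs, rfl⟩
  exact hA s hs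

lemma gaussianReal_le_volume : gaussianReal 0 1 ≤ volume := by
  rw [gaussianReal_of_var_ne_zero _ one_ne_zero]
  refine Measure.le_iff.2 fun A hA => ?_
  rw [withDensity_apply _ hA]
  calc ∫⁻ x in A, gaussianPDF 0 1 x ≤ ∫⁻ _ in A, 1 := by
        refine lintegral_mono fun x => ?_
        rw [gaussianPDF, ← ENNReal.ofReal_one]
        refine ENNReal.ofReal_le_ofReal ?_
        rw [gaussianPDFReal]
        have h1 : 1 ≤ √(2 * Real.pi * ((1 : ℝ≥0) : ℝ)) := by
          rw [Real.one_le_sqrt]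
          have := Real.pi_gt_three
          simp only [NNReal.coe_one]
          linarith
        refine mul_le_one₀ (inv_le_one_of_one_le₀ h1) (Real.exp_nonneg _) ?_
        rw [Real.exp_le_one_iff, neg_div]
        exact neg_nonpos.2 (by positivity)
    _ = volume A := by simp

variable {N : ℕ}

lemma proj_add (p : ℕ → Fin N → ℝ) (k : ℕ) (v w : Fin N → ℝ) :
    proj p k (v + w) = proj p k v + proj p k w := by
  simp only [proj, add_dotProduct, add_smul, Finset.sum_add_distrib]
  abel

lemma proj_smul (p : ℕ → Fin N → ℝ) (k : ℕ) (c : ℝ) (v : Fin N → ℝ) :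
    proj p k (c • v) = c • proj p k v := by
  simp only [proj, smul_dotProduct, smul_eq_mul, mul_smul, smul_sub, Finset.smul_sum]

lemma OrthZero.proj_dotProduct_proj {p : ℕ → Fin N → ℝ} {k : ℕ} (h : OrthZero p k)
    (v w : Fin N → ℝ) : proj p k v ⬝ᵥ proj p k w = proj p k v ⬝ᵥ w := by
  conv_lhs => rw [proj.eq_1 p k w]
  rw [dotProduct_sub, dotProduct_sum, Finset.sum_eq_zero, sub_zero]
  intro j hj
  rw [dotProduct_smul, h.proj_dotProduct (Finset.mem_range.1 hj), smul_zero]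

/-- The position `s` of a coordinate is a Lipschitz function of the direction `θ = Y / √Q`, where
`Y = w + s π` is the entry of the projected vector and `Q` is its squared length. -/
lemma abs_sub_le_of_direction {w W π Y Y' Q Q' θ θ' s s' B : ℝ} (hπ : 1 / 2 ≤ π)
    (hY : Y = w + s * π) (hY' : Y' = w + s' * π)
    (hQ : Q = W + 2 * s * w + s ^ 2 * π) (hQ' : Q' = W + 2 * s' * w + s' ^ 2 * π)
    (h0 : 0 ≤ Q) (h0' : 0 ≤ Q') (hθ : Y = √Q * θ) (hθ' : Y' = √Q' * θ')
    (h2 : |θ| ≤ 1 / 2) (h2' : |θ'| ≤ 1 / 2) (hB : Q ≤ B) :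
    |s - s'| ≤ 4 * √B * |θ - θ'| := by
  have hS := Real.sqrt_nonneg Q
  have hS' := Real.sqrt_nonneg Q'
  have eQ : √Q ^ 2 = Q := Real.sq_sqrt h0
  have eQ' : √Q' ^ 2 = Q' := Real.sq_sqrt h0'
  set S := √Q
  set S' := √Q'
  have e1 : π * (S ^ 2 - S' ^ 2) = Y ^ 2 - Y' ^ 2 := by
    rw [eQ, eQ', hQ, hQ', hY, hY']; ring
  have hYY : |Y + Y'| ≤ 1 / 2 * (S + S') := by
    rw [hθ, hθ']
    refine (abs_add_le _ _).trans ?_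
    rw [abs_mul, abs_mul, abs_of_nonneg hS, abs_of_nonneg hS']
    nlinarith
  have hSS : |S - S'| ≤ |Y - Y'| := by
    by_cases hz : S + S' = 0
    · have h3 : S = 0 := by linarith
      have h4 : S' = 0 := by linarith
      rw [h3, h4, sub_self, abs_zero]; exact abs_nonneg _
    have hpos : 0 < S + S' := lt_of_le_of_ne (by linarith) (Ne.symm hz)
    have e2 : π * (|S - S'| * (S + S')) = |Y - Y'| * |Y + Y'| := by
      have e3 := congrArg abs (show π * ((S - S') * (S + S')) = (Y - Y') * (Y + Y') by
        linear_combination e1)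
      rwa [abs_mul, abs_mul, abs_mul, abs_of_pos hpos, abs_of_pos (show 0 < π by linarith)] at e3
    have h5 : |Y - Y'| * |Y + Y'| ≤ |Y - Y'| * (1 / 2 * (S + S')) :=
      mul_le_mul_of_nonneg_left hYY (abs_nonneg _)
    have h6 : 1 / 2 * (|S - S'| * (S + S')) ≤ π * (|S - S'| * (S + S')) :=
      mul_le_mul_of_nonneg_right hπ (mul_nonneg (abs_nonneg _) hpos.le)
    have h7 : |S - S'| * (S + S') ≤ |Y - Y'| * (S + S') := by linarith
    exact le_of_mul_le_mul_right h7 hpos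
  have h8 : |Y - Y'| ≤ |θ - θ'| * S + 1 / 2 * |Y - Y'| := by
    have e3 : Y - Y' = (θ - θ') * S + θ' * (S - S') := by rw [hθ, hθ']; ring
    calc |Y - Y'| = |(θ - θ') * S + θ' * (S - S')| := by rw [← e3]
      _ ≤ |(θ - θ') * S| + |θ' * (S - S')| := abs_add_le _ _
      _ = |θ - θ'| * S + |θ'| * |S - S'| := by rw [abs_mul, abs_mul, abs_of_nonneg hS]
      _ ≤ _ := by
        gcongr
  have h9 : |Y - Y'| = |s - s'| * π := by
    rw [show Y - Y' = (s - s') * π by rw [hY, hY']; ring, abs_mul,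
      abs_of_pos (show 0 < π by linarith)]
  have h10 : |θ - θ'| * S ≤ |θ - θ'| * √B :=
    mul_le_mul_of_nonneg_left (Real.sqrt_le_sqrt hB) (abs_nonneg _)
  nlinarith [abs_nonneg (s - s')]

/-- An affine image of an entry of the direction of a projected Gaussian vector has, on the event
that the direction is not concentrated on this entry, a density of order `√N / r`. -/
lemma OrthZero.stdG_direction_le {p : ℕ → Fin N → ℝ} {k : ℕ} (hp : OrthZero p k) {n : Fin N}
    (hπ : ∑ j ∈ Finset.range k, (p j n) ^ 2 ≤ 1 / 2) {a r : ℝ} (hr : 0 < r) {A : Set ℝ}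
    (hA : MeasurableSet A) :
    stdG (Fin N) {z | proj p k z ⬝ᵥ proj p k z ≤ 2 * N ∧ |nrm (proj p k z) n| ≤ 1 / 2 ∧
      a + r * nrm (proj p k z) n ∈ A} ≤ ENNReal.ofReal (6 * √N / r) * volume A := by
  set B : Set (Fin N → ℝ) := {z | proj p k z ⬝ᵥ proj p k z ≤ 2 * N ∧ |nrm (proj p k z) n| ≤ 1 / 2 ∧
      a + r * nrm (proj p k z) n ∈ A} with hBdef
  have hpm : Measurable fun z => proj p k z :=
    Measurable.proj k (fun j => measurable_const) measurable_id
  have hnm : Measurable fun z => nrm (proj p k z) n :=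
    (measurable_pi_apply n).comp (Measurable.nrm hpm)
  have hB : MeasurableSet B := by
    refine (measurableSet_le (Measurable.dotProduct hpm hpm) measurable_const).inter
      ((measurableSet_le (continuous_abs.measurable.comp hnm) measurable_const).inter ?_)
    exact ((hnm.const_mul r).const_add a) hA
  -- Only coordinate `n` is integrated: its density is at most `1`, and on the event it is a
  -- Lipschitz function of the entry of the direction.
  rw [← lintegral_indicator_one hB, lintegral_stdG_resample n (measurable_one.indicator hB)]
  have hkey : ∀ z : Fin N → ℝ, ∫⁻ s, B.indicator 1 (Function.update z n s) ∂(gaussianReal 0 1) ≤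
      ENNReal.ofReal (6 * √N / r) * volume A := by
    intro z
    set T : Set ℝ := {s | Function.update z n s ∈ B} with hT
    have e1 : (fun s => B.indicator (1 : (Fin N → ℝ) → ℝ≥0∞) (Function.update z n s)) =
        T.indicator 1 := by ext s; simp only [Set.indicator, hT, Set.mem_ofPred_eq, Pi.one_apply]; rfl
    have hTm : MeasurableSet T := by
      refine (?_ : Measurable fun s : ℝ => Function.update z n s) hB
      exact measurable_update z
    rw [e1, lintegral_indicator_one hTm]
    refine (gaussianReal_le_volume T).trans ?_
    refine volume_le_of_antilipschitz (K := (6 * √N / r).toNNReal)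
      (f := fun s => a + r * nrm (proj p k (Function.update z n s)) n) ?_ fun s hs => hs.2.2
    -- As a function of coordinate `n` the projected vector is the line `w + s q`.
    set w := proj p k (Function.update z n 0)
    set q := proj p k (Pi.single n 1)
    have hdec : ∀ s, proj p k (Function.update z n s) = w + s • q := by
      intro s
      rw [← proj_smul, ← proj_add]
      congr 1
      ext i
      by_cases hi : i = n
      · subst hi; simp
      · simp [hi]
    have hqn : q n = 1 - ∑ j ∈ Finset.range k, (p j n) ^ 2 := by
      simp [q, proj, sq]
    have hqq : q ⬝ᵥ q = q n := by
      rw [hp.proj_dotProduct_proj]; simp [q]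
    have hwq : w ⬝ᵥ q = w n := by
      rw [hp.proj_dotProduct_proj]; simp [w]
    have hQ : ∀ s, (w + s • q) ⬝ᵥ (w + s • q) = w ⬝ᵥ w + 2 * s * w n + s ^ 2 * q n := by
      intro s
      simp only [add_dotProduct, dotProduct_add, smul_dotProduct, dotProduct_smul, smul_eq_mul,
        hqq, hwq, dotProduct_comm q w]
      ring
    intro s hs s' hs'
    have h1 := hs.1
    have h2 := hs.2.1
    have h2' := hs'.2.1
    simp only [hdec] at h1 h2 h2' ⊢
    have hY : ∀ s : ℝ, (w + s • q) n = √((w + s • q) ⬝ᵥ (w + s • q)) * nrm (w + s • q) n := by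
      intro s
      conv_lhs => rw [← sqrt_smul_nrm (w + s • q)]
      rfl
    have := abs_sub_le_of_direction (w := w n) (W := w ⬝ᵥ w) (π := q n) (s := s) (s' := s')
      (by rw [hqn]; linarith) (by simp) (by simp) (hQ s) (hQ s') (dotProduct_self_nonneg' _)
      (dotProduct_self_nonneg' _) (hY s) (hY s') h2 h2' h1
    refine this.trans ?_
    rw [Real.coe_toNNReal _ (by positivity)]
    have e2 : a + r * nrm (w + s • q) n - (a + r * nrm (w + s' • q) n) =
        r * (nrm (w + s • q) n - nrm (w + s' • q) n) := by ring
    rw [e2, abs_mul, abs_of_pos hr, ← mul_assoc, div_mul_cancel₀ _ hr.ne']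
    refine mul_le_mul_of_nonneg_right ?_ (abs_nonneg _)
    -- the constant: `4 √(2N) ≤ 4 · (3/2) √N`
    have h3 : √(2 * N : ℝ) ≤ 3 / 2 * √N := by
      rw [Real.sqrt_mul (by norm_num)]
      refine mul_le_mul_of_nonneg_right ?_ (Real.sqrt_nonneg _)
      rw [Real.sqrt_le_left (by norm_num)]
      norm_num
    linarith
  calc _ ≤ ∫⁻ _, ENNReal.ofReal (6 * √N / r) * volume A ∂(stdG (Fin N)) := lintegral_mono hkey
    _ = _ := by
      rw [lintegral_const]
      simp [stdG]

end Density

end OAMP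


namespace OAMP

open Filter Topology
open scoped ENNReal

/-! ### Domination of the laws of the rows -/

section Domination

set_option linter.unusedSectionVars false

variable {E : Type*} [MeasurableSpace E]

/-- Append the entry `s` in position `k` of a row. -/
def upd (k : ℕ) (p : E × (ℕ → ℝ)) (s : ℝ) : E × (ℕ → ℝ) := (p.1, Function.update p.2 k s)

lemma measurable_upd (k : ℕ) : Measurable fun a : (E × (ℕ → ℝ)) × ℝ => upd k a.1 a.2 := by
  refine (measurable_fst.comp measurable_fst).prodMk (measurable_pi_iff.2 fun i => ?_)
  by_cases h : i = k
  · subst h; simp only [Function.update_self]; exact measurable_snd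
  · simp only [Function.update_of_ne h]
    exact (measurable_pi_apply i).comp (measurable_snd.comp measurable_fst)

lemma upd_mem_box {k : ℕ} {p : E × (ℕ → ℝ)} {s K : ℝ} (h : upd k p s ∈ box E (k + 1) K) :
    p ∈ box E k K ∧ |s| ≤ K := by
  refine ⟨fun j hj => ?_, ?_⟩
  · have := h j (by omega)
    simpa only [upd, Function.update_of_ne hj.ne] using this
  · have := h k (by omega)
    simpa only [upd, Function.update_self] using this

variable {Ω : ℕ → Type*} [∀ N, MeasurableSpace (Ω N)] (P : ∀ N, Measure (Ω N))
  [∀ N, IsProbabilityMeasure (P N)]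

/-- The sample space of the process simulated by Gaussian noise. -/
abbrev HatΩ (Ω : ℕ → Type*) (N : ℕ) : Type _ := Ω N × (Fin N → ℕ → ℝ)

/-- The law on the sample space of the process simulated by Gaussian noise. -/
noncomputable abbrev hatP (N : ℕ) : Measure (HatΩ Ω N) := (P N).prod (noise (Fin N))

lemma lintegral_hatP_resample {N : ℕ} (k : ℕ) {f : HatΩ Ω N → ℝ≥0∞} (hf : Measurable f) :
    ∫⁻ a, f a ∂(hatP P N) =
      ∫⁻ a, ∫⁻ z, f (a.1, setCol a.2 k z) ∂(stdG (Fin N)) ∂(hatP P N) := by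
  have hm : Measurable fun a : HatΩ Ω N => ∫⁻ z, f (a.1, setCol a.2 k z) ∂(stdG (Fin N)) := by
    refine Measurable.lintegral_prod_right' (f := fun q : HatΩ Ω N × (Fin N → ℝ) =>
      f (q.1.1, setCol q.1.2 k q.2)) (hf.comp ?_)
    exact (measurable_fst.comp measurable_fst).prodMk ((measurable_setCol k).comp
      ((measurable_snd.comp measurable_fst).prodMk measurable_snd))
  rw [lintegral_prod _ hf.aemeasurable, lintegral_prod _ hm.aemeasurable]
  exact lintegral_congr fun ω => lintegral_noise_resample k (hf.comp measurable_prodMk_left)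

/-- A property or quantity which does not depend on the noise of the steps from `k` on. -/
def Past {N : ℕ} {β : Type*} (k : ℕ) (f : HatΩ Ω N → β) : Prop :=
  ∀ ω ζ j z, k ≤ j → f (ω, setCol ζ j z) = f (ω, ζ)

/-- The rows `R N a n`, whose entries from `k` on do not matter, have laws that are dominated on an
event of high probability by a fixed measure, which is absolutely continuous with respect to the
limit law `ν` and finite on boxes. -/
def Dom (k : ℕ) (R : ∀ N, HatΩ Ω N → Fin N → E × (ℕ → ℝ)) (ν : Measure (E × (ℕ → ℝ))) : Prop :=
  ∃ (lam : Measure (E × (ℕ → ℝ))) (S : ∀ N, Set (HatΩ Ω N)) (C : ℝ≥0∞),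
    SFinite lam ∧ lam ≪ ν ∧ (∀ K, lam (box E k K) < ∞) ∧ C ≠ ∞ ∧ (∀ N, MeasurableSet (S N)) ∧
    (∀ᶠ x in glob (hatP P), x.2 ∈ S x.1) ∧ (∀ N, Past k fun a => a ∈ S N) ∧
    ∀ N n, ((hatP P N).restrict (S N)).map (fun a => R N a n) ≤ C • lam

variable {P}
variable {k : ℕ} {R R' : ∀ N, HatΩ Ω N → Fin N → E × (ℕ → ℝ)} {ν ν' : Measure (E × (ℕ → ℝ))}

lemma Dom.closeRows (h : Dom P k R ν) (hR : ∀ N n, Measurable fun a => R N a n)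
    (hR' : ∀ N n, Measurable fun a => R' N a n)
    (hlaw : ∀ N n, (hatP P N).map (fun a => R' N a n) = ν)
    (hbase : ∀ N a n, (R N a n).1 = (R' N a n).1)
    (hclose : ∀ j, Tendsto (fun z : Σ p : (Σ N, Fin N), HatΩ Ω p.1 =>
      (R z.1.1 z.2 z.1.2).2 j - (R' z.1.1 z.2 z.1.2).2 j) (rows (hatP P)) (𝓝 0)) :
    ∃ lam, CloseRows (fun p : (Σ N, Fin N) => hatP P p.1) rowFilter (fun p a => R p.1 a p.2)
      (fun p a => R' p.1 a p.2) ν lam k := by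
  obtain ⟨lam, S, C, -, -, hbox, hC, hSm, hS, -, hdom⟩ := h
  exact ⟨lam, fun p => hR _ _, fun p => hR' _ _, fun p => hlaw _ _, fun p a => hbase _ _ _,
    hclose, hbox, fun p => S p.1, C, hC, fun p => hSm _, (tendsto_toGlob _).eventually hS,
    fun p => hdom _ _⟩

lemma Dom.eventually_of_ae (h : Dom P k R ν) (hR : ∀ N n, Measurable fun a => R N a n)
    {A : Set (E × (ℕ → ℝ))} (hA : MeasurableSet A) (hν : ν Aᶜ = 0) :
    ∀ᶠ x in glob (hatP P), ∀ n, R x.1 x.2 n ∈ A := by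
  obtain ⟨lam, S, C, -, hac, hbox, hC, hSm, hS, -, hdom⟩ := h
  have h1 : ∀ᶠ x in glob (hatP P), x.2 ∈ S x.1 → ∀ n, R x.1 x.2 n ∈ A := by
    refine eventually_whp_of_ae (Eventually.of_forall fun N => ?_)
    have h2 : ∀ n, ∀ᵐ a ∂(hatP P N), a ∈ S N → R N a n ∈ A := by
      intro n
      rw [← ae_restrict_iff' (hSm N)]
      have h3 : ((hatP P N).restrict (S N)).map (fun a => R N a n) Aᶜ = 0 := by
        refine le_antisymm ((hdom N n _).trans ?_) zero_le
        simp [hac hν]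
      rw [Measure.map_apply (hR N n) hA.compl] at h3
      exact h3
    filter_upwards [ae_all_iff.2 h2] with a ha hS n using ha n hS
  filter_upwards [hS, h1] with x hx1 hx2 using hx2 hx1

/-- Appending a function of the row. -/
lemma Dom.append (h : Dom P k R ν) (hR : ∀ N n, Measurable fun a => R N a n)
    {g : E × (ℕ → ℝ) → ℝ} (hg : Measurable g) {S' : ∀ N, Set (HatΩ Ω N)}
    (hS'm : ∀ N, MeasurableSet (S' N)) (hS' : ∀ᶠ x in glob (hatP P), x.2 ∈ S' x.1)
    (hS'p : ∀ N, Past (k + 1) fun a => a ∈ S' N)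
    (hR' : ∀ N, ∀ a ∈ S' N, ∀ n, R' N a n = upd k (R N a n) (g (R N a n)))
    (hν : ν' = ν.map fun p => upd k p (g p)) (hR'm : ∀ N n, Measurable fun a => R' N a n) :
    Dom P (k + 1) R' ν' := by
  obtain ⟨lam, S, C, hsf, hac, hbox, hC, hSm, hS, hSp, hdom⟩ := h
  have hgm : Measurable fun p : E × (ℕ → ℝ) => upd k p (g p) :=
    (measurable_upd k).comp (measurable_id.prodMk hg)
  refine ⟨lam.map fun p => upd k p (g p), fun N => S N ∩ S' N, C, inferInstance, ?_, fun K => ?_,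
    hC, fun N => (hSm N).inter (hS'm N), hS.and hS', fun N ω ζ j z hj => ?_, fun N n => ?_⟩
  · rw [hν]; exact hac.map hgm
  · rw [Measure.map_apply hgm (measurableSet_box _ _)]
    exact (measure_mono fun p hp => (upd_mem_box hp).1).trans_lt (hbox K)
  · have h1 := hSp N ω ζ j z (by omega)
    have h2 := hS'p N ω ζ j z hj
    simp only [eq_iff_iff, Set.mem_inter_iff] at h1 h2 ⊢
    rw [h1, h2]
  · refine Measure.le_iff.2 fun D hD => ?_
    have h1 := hdom N n ((fun p => upd k p (g p)) ⁻¹' D)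
    rw [Measure.map_apply (hR N n) (hgm hD), Measure.restrict_apply (hR N n (hgm hD))] at h1
    rw [Measure.map_apply (hR'm N n) hD, Measure.restrict_apply (hR'm N n hD)]
    refine le_trans (measure_mono ?_) (h1.trans ?_)
    · rintro a ⟨ha, haS, haS'⟩
      refine ⟨?_, haS⟩
      rw [Set.mem_preimage, hR' N a haS' n] at ha
      exact ha
    · rw [Measure.smul_apply, Measure.smul_apply, Measure.map_apply hgm hD]

/-- Appending an entry with a density: an affine function of an entry of a random direction. -/
lemma Dom.append_noise (h : Dom P k R ν) (hR : ∀ N n, Measurable fun a => R N a n)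
    (hRp : ∀ N, Past k (R N)) {p : ∀ N, HatΩ Ω N → ℕ → Fin N → ℝ} (hp : ∀ N, Past k (p N))
    {A : ∀ N, HatΩ Ω N → Fin N → ℝ} (hA : ∀ N, Past k (A N))
    {B : ∀ N, HatΩ Ω N → ℝ} (hB : ∀ N, Past k (B N)) {c : ℝ} (hc : 0 < c)
    {S' : ∀ N, Set (HatΩ Ω N)}
    (hS'm : ∀ N, MeasurableSet (S' N)) (hS' : ∀ᶠ x in glob (hatP P), x.2 ∈ S' x.1)
    (hS'p : ∀ N, Past (k + 1) fun a => a ∈ S' N)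
    (h1 : ∀ N, ∀ a ∈ S' N, OrthZero (p N a) k)
    (h2 : ∀ N, ∀ a ∈ S' N, c * √N ≤ B N a)
    (h3 : ∀ N, ∀ a ∈ S' N, ∀ n, ∑ j ∈ Finset.range k, (p N a j n) ^ 2 ≤ 1 / 2)
    (h4 : ∀ N, ∀ a ∈ S' N,
      proj (p N a) k (fun n => a.2 n k) ⬝ᵥ proj (p N a) k (fun n => a.2 n k) ≤ 2 * N)
    (h5 : ∀ N, ∀ a ∈ S' N, ∀ n, |nrm (proj (p N a) k fun n => a.2 n k) n| ≤ 1 / 2)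
    (hR' : ∀ N, ∀ a ∈ S' N, ∀ n, R' N a n =
      upd k (R N a n) (A N a n + B N a * nrm (proj (p N a) k fun n => a.2 n k) n))
    (hν : ∀ D, MeasurableSet D → ν' D = 0 → ν {q | volume {s | upd k q s ∈ D} ≠ 0} = 0)
    (hR'm : ∀ N n, Measurable fun a => R' N a n) :
    Dom P (k + 1) R' ν' := by
  obtain ⟨lam, S, C, hsf, hac, hbox, hC, hSm, hS, hSp, hdom⟩ := h
  refine ⟨(lam.prod volume).map fun a => upd k a.1 a.2, fun N => S N ∩ S' N,
    ENNReal.ofReal (6 / c) * C, inferInstance, ?_, fun K => ?_,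
    ENNReal.mul_ne_top ENNReal.ofReal_ne_top hC, fun N => (hSm N).inter (hS'm N), hS.and hS',
    fun N ω ζ j z hj => ?_, fun N n => ?_⟩
  · refine Measure.AbsolutelyContinuous.mk fun D hD hD0 => ?_
    rw [Measure.map_apply (measurable_upd k) hD, Measure.prod_apply (measurable_upd k hD),
      lintegral_eq_zero_iff (measurable_measure_prodMk_left (measurable_upd k hD))]
    exact hac (hν D hD hD0)
  · rw [Measure.map_apply (measurable_upd k) (measurableSet_box _ _)]
    refine (measure_mono (t := box E k K ×ˢ Set.Icc (-K) K) fun a ha => ?_).trans_lt ?_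
    · exact ⟨(upd_mem_box ha).1, abs_le.1 (upd_mem_box ha).2⟩
    · rw [Measure.prod_prod]
      exact ENNReal.mul_lt_top (hbox K) (by simp)
  · have h1 := hSp N ω ζ j z (by omega)
    have h2 := hS'p N ω ζ j z hj
    simp only [eq_iff_iff, Set.mem_inter_iff] at h1 h2 ⊢
    rw [h1, h2]
  · refine Measure.le_iff.2 fun D hD => ?_
    have hN : 0 < √(N : ℝ) := Real.sqrt_pos.2 (Nat.cast_pos.2 (Nat.lt_of_le_of_lt (Nat.zero_le _) n.2))
    have hset : MeasurableSet ((fun a => R' N a n) ⁻¹' D ∩ (S N ∩ S' N)) :=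
      (hR'm N n hD).inter ((hSm N).inter (hS'm N))
    have hvm : Measurable fun q : E × (ℕ → ℝ) => volume {s : ℝ | upd k q s ∈ D} :=
      measurable_measure_prodMk_left (measurable_upd k hD)
    rw [Measure.map_apply (hR'm N n) hD, Measure.restrict_apply (hR'm N n hD),
      ← lintegral_indicator_one hset,
      lintegral_hatP_resample P k (measurable_one.indicator hset)]
    -- Given all noise before column `k`, the new entry is an affine function of an entry of a
    -- random direction, with slope `B ≥ c √N`; its density is at most `6 √N / B ≤ 6 / c`.
    have hkey : ∀ a : HatΩ Ω N, ∫⁻ z, ((fun a => R' N a n) ⁻¹' D ∩ (S N ∩ S' N)).indicator 1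
        (a.1, setCol a.2 k z) ∂(stdG (Fin N)) ≤
        (S N).indicator (fun a => ENNReal.ofReal (6 / c) * volume {s | upd k (R N a n) s ∈ D})
          a := by
      rintro ⟨ω, ζ⟩
      set T : Set (Fin N → ℝ) :=
        {z | (ω, setCol ζ k z) ∈ (fun a => R' N a n) ⁻¹' D ∩ (S N ∩ S' N)} with hT
      have hTm : MeasurableSet T := by
        refine (?_ : Measurable fun z : Fin N → ℝ => (ω, setCol ζ k z)) hset
        exact measurable_const.prodMk ((measurable_setCol k).comp
          (measurable_const.prodMk measurable_id))
      have e1 : (fun z => ((fun a => R' N a n) ⁻¹' D ∩ (S N ∩ S' N)).indicator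
          (1 : HatΩ Ω N → ℝ≥0∞) (ω, setCol ζ k z)) = T.indicator 1 := by
        ext z; simp only [Set.indicator, hT, Set.mem_ofPred_eq, Pi.one_apply]; rfl
      rw [e1, lintegral_indicator_one hTm]
      by_cases hne : T.Nonempty
      · obtain ⟨z₀, hz₀⟩ := hne
        have hSω : (ω, ζ) ∈ S N := (hSp N ω ζ k z₀ le_rfl).mp hz₀.2.1
        have q1 := h1 N _ hz₀.2.2
        have q2 := h2 N _ hz₀.2.2
        have q3 := h3 N _ hz₀.2.2 n
        rw [hp N ω ζ k z₀ le_rfl] at q1 q3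
        rw [hB N ω ζ k z₀ le_rfl] at q2
        have hBpos : 0 < B N (ω, ζ) := lt_of_lt_of_le (by positivity) q2
        rw [Set.indicator_of_mem hSω]
        have hDm : MeasurableSet {s | upd k (R N (ω, ζ) n) s ∈ D} :=
          ((measurable_upd k).comp measurable_prodMk_left) hD
        refine (measure_mono ?_).trans ((q1.stdG_direction_le q3 (a := A N (ω, ζ) n) hBpos hDm).trans
          ?_)
        · intro z hz
          have hcol : (fun n => setCol ζ k z n k) = z := by ext i; simp [setCol]
          have q4 := h4 N _ hz.2.2
          have q5 := h5 N _ hz.2.2 n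
          have q6 := hz.1
          simp only [Set.mem_preimage] at q6
          rw [hR' N _ hz.2.2 n] at q6
          simp only [hp N ω ζ k z le_rfl, hB N ω ζ k z le_rfl, hA N ω ζ k z le_rfl,
            hRp N ω ζ k z le_rfl, hcol] at q4 q5 q6
          exact ⟨q4, q5, q6⟩
        · refine mul_le_mul_left (ENNReal.ofReal_le_ofReal ?_) _
          rw [div_le_div_iff₀ hBpos hc]
          linarith
      · rw [Set.not_nonempty_iff_eq_empty.1 hne, measure_empty]
        exact zero_le
    refine (lintegral_mono hkey).trans ?_
    rw [lintegral_indicator (hSm N), lintegral_const_mul (f := fun a => volume {s : ℝ | upd k (R N a n) s ∈ D}) _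
        (hvm.comp (hR N n)),
      ← lintegral_map (f := fun q => volume {s : ℝ | upd k q s ∈ D}) hvm (hR N n)]
    rw [Measure.smul_apply, smul_eq_mul, mul_assoc, Measure.map_apply (measurable_upd k) hD,
      Measure.prod_apply (measurable_upd k hD)]
    refine mul_le_mul_right ?_ _
    refine (lintegral_mono' (hdom N n) le_rfl).trans ?_
    rw [lintegral_smul_measure, smul_eq_mul]
    exact le_rfl

lemma dom_zero [IsFiniteMeasure ν]
    (hlaw : ∀ N n, (hatP P N).map (fun a => R N a n) = ν) : Dom P 0 R ν := by
  refine ⟨ν, fun _ => Set.univ, 1, inferInstance, Measure.AbsolutelyContinuous.rfl,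
    fun K => measure_lt_top _ _, by simp, fun _ => MeasurableSet.univ, by simp,
    fun N ω ζ j z hj => by simp, fun N n => ?_⟩
  rw [Measure.restrict_univ, hlaw, one_smul]

end Domination

end OAMP


namespace OAMP

open Filter Topology
open scoped ENNReal

/-! ### The limit of the process -/

section Limit

set_option linter.unusedSectionVars false

variable {E : Type*} [MeasurableSpace E]

/-- The law of a row of the primitives together with the Gaussian noise of all steps. -/
noncomputable abbrev rowLaw (ρ : Measure E) : Measure (E × (ℕ → ℝ)) := ρ.prod seqG

lemma rowLaw_resample (ρ : Measure E) [IsProbabilityMeasure ρ] (k : ℕ) :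
    ((rowLaw ρ).prod (gaussianReal 0 1)).map (fun a => upd k a.1 a.2) = rowLaw ρ := by
  have hm : Measurable fun a : (ℕ → ℝ) × ℝ => Function.update a.1 k a.2 := by
    refine measurable_pi_iff.2 fun i => ?_
    by_cases h : i = k
    · subst h; simp only [Function.update_self]; fun_prop
    · simp only [Function.update_of_ne h]; fun_prop
  have h1 : MeasurePreserving (fun a : (ℕ → ℝ) × ℝ => Function.update a.1 k a.2)
      (seqG.prod (gaussianReal 0 1)) seqG := ⟨hm, seqG_resample k⟩
  have h2 := ((MeasurePreserving.id ρ).prod h1).comp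
    (measurePreserving_prodAssoc ρ seqG (gaussianReal 0 1))
  exact h2.map_eq

lemma lintegral_rowLaw_resample (ρ : Measure E) [IsProbabilityMeasure ρ] (k : ℕ)
    {f : E × (ℕ → ℝ) → ℝ≥0∞} (hf : Measurable f) :
    ∫⁻ a, f a ∂(rowLaw ρ) = ∫⁻ a, ∫⁻ z, f (upd k a z) ∂(gaussianReal 0 1) ∂(rowLaw ρ) := by
  conv_lhs => rw [← rowLaw_resample ρ k]
  rw [lintegral_map hf (measurable_upd k), lintegral_prod]
  exact (hf.comp (measurable_upd k)).aemeasurable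

lemma measurable_col (k : ℕ) : Measurable fun a : E × (ℕ → ℝ) => a.2 k :=
  (measurable_pi_apply k).comp measurable_snd

lemma rowLaw_map_col (ρ : Measure E) [IsProbabilityMeasure ρ] (k : ℕ) :
    (rowLaw ρ).map (fun a => a.2 k) = gaussianReal 0 1 := by
  have h : (fun a : E × (ℕ → ℝ) => a.2 k) = (fun g : ℕ → ℝ => g k) ∘ Prod.snd := rfl
  rw [h, ← Measure.map_map (measurable_pi_apply k) measurable_snd, Measure.map_snd_prod,
    measure_univ, one_smul]
  exact (measurePreserving_eval_infinitePi (fun _ : ℕ => gaussianReal 0 1) k).map_eq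

lemma memLp_col (ρ : Measure E) [IsProbabilityMeasure ρ] (k : ℕ) :
    MemLp (fun a : E × (ℕ → ℝ) => a.2 k) 2 (rowLaw ρ) := by
  have h := memLp_id_gaussianReal (μ := 0) (v := 1) 2
  rw [← rowLaw_map_col ρ k, memLp_map_measure_iff aestronglyMeasurable_id
    (measurable_col k).aemeasurable] at h
  exact h

lemma integral_col_sq (ρ : Measure E) [IsProbabilityMeasure ρ] (k : ℕ) :
    ∫ a : E × (ℕ → ℝ), a.2 k * a.2 k ∂(rowLaw ρ) = 1 := by
  have h : ∫ y : ℝ, y * y ∂(gaussianReal 0 1) = 1 := by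
    have := variance_of_integral_eq_zero (μ := gaussianReal 0 1) (X := id) aemeasurable_id (by simp)
    rw [variance_id_gaussianReal] at this
    simpa [sq] using this.symm
  rw [← h, ← rowLaw_map_col ρ k, integral_map (measurable_col k).aemeasurable]
  exact (by fun_prop : Measurable fun y : ℝ => y * y).aestronglyMeasurable

/-- The noise of a step is uncorrelated with everything that does not depend on it. -/
lemma integral_col_mul (ρ : Measure E) [IsProbabilityMeasure ρ] (k : ℕ) {f : E × (ℕ → ℝ) → ℝ}
    (hf : MemLp f 2 (rowLaw ρ)) (hfm : Measurable f) (hp : ∀ a z, f (upd k a z) = f a) :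
    ∫ a, a.2 k * f a ∂(rowLaw ρ) = 0 := by
  have hm : Measurable fun a : E × (ℕ → ℝ) => a.2 k * f a := (measurable_col k).mul hfm
  have hint : Integrable (fun a : E × (ℕ → ℝ) => a.2 k * f a) (rowLaw ρ) :=
    (memLp_col ρ k).integrable_mul hf
  have hint' := hint
  rw [← rowLaw_resample ρ k, integrable_map_measure hm.aestronglyMeasurable
    (measurable_upd k).aemeasurable] at hint'
  conv_lhs => rw [← rowLaw_resample ρ k]
  rw [integral_map (measurable_upd k).aemeasurable hm.aestronglyMeasurable]
  have e : ∀ a : (E × (ℕ → ℝ)) × ℝ, (upd k a.1 a.2).2 k * f (upd k a.1 a.2) = a.2 * f a.1 := by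
    intro a
    rw [hp]; simp [upd]
  simp only [Function.comp_def, e] at hint' ⊢
  rw [integral_prod _ hint']
  refine (integral_congr_ae (Eventually.of_forall fun a => ?_)).trans (integral_zero _ _)
  simp only [integral_mul_const]
  simp

/-- The limits of the messages (first components) and of the directions (second components), as
functions of a row of the primitives and of the Gaussian noise. -/
abbrev LimState (E : Type*) := ℕ → Bool → (E × (ℕ → ℝ) → ℝ) × (E × (ℕ → ℝ) → ℝ)

/-- The limit of a row of the primitives and the messages. -/
def lrow (s : LimState E) (b : Bool) (a : E × (ℕ → ℝ)) : E × (ℕ → ℝ) :=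
  (a.1, fun j => (s j b).1 a)

variable (snd : ℕ → Bool) (Θ : ℕ → E × (ℕ → ℝ) → ℝ) (ρ : Bool → Measure E)

/-- The limit of the message sent in step `k`. -/
def lsent (k : ℕ) (s : LimState E) (a : E × (ℕ → ℝ)) : ℝ := Θ k (lrow s (snd k) a)

/-- The limiting coordinates of the message sent in step `k` along the previous directions. -/
noncomputable def lcoef (k : ℕ) (s : LimState E) (j : ℕ) : ℝ :=
  ∫ a, lsent snd Θ k s a * (s j (snd k)).2 a ∂(rowLaw (ρ (snd k)))

/-- The limiting residual of the message sent in step `k`. -/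
noncomputable def lres (k : ℕ) (s : LimState E) (a : E × (ℕ → ℝ)) : ℝ :=
  lsent snd Θ k s a - ∑ j ∈ Finset.range k, lcoef snd Θ ρ k s j * (s j (snd k)).2 a

/-- The limiting norm of the residual of the message sent in step `k`. -/
noncomputable def lnorm (k : ℕ) (s : LimState E) : ℝ :=
  √(∫ a, lres snd Θ ρ k s a * lres snd Θ ρ k s a ∂(rowLaw (ρ (snd k))))

open Classical in
/-- The limit of the direction received in step `k`: a fresh Gaussian variable, unless the residual
vanishes. -/
noncomputable def lnoise (k : ℕ) (s : LimState E) (a : E × (ℕ → ℝ)) : ℝ :=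
  if lnorm snd Θ ρ k s = 0 then 0 else a.2 k

/-- The step `k` of the limit process. -/
noncomputable def lstep (k : ℕ) (s : LimState E) : LimState E :=
  Function.update s k fun c => if c = snd k then
    (lsent snd Θ k s, fun a => (lnorm snd Θ ρ k s)⁻¹ * lres snd Θ ρ k s a)
  else (fun a => ∑ j ∈ Finset.range k, lcoef snd Θ ρ k s j * (s j c).2 a +
    lnorm snd Θ ρ k s * lnoise snd Θ ρ k s a, lnoise snd Θ ρ k s)

/-- The limit process. -/
noncomputable def lrun : ℕ → LimState E
  | 0 => fun _ _ => (fun _ => 0, fun _ => 0)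
  | k + 1 => lstep snd Θ ρ k (lrun k)

variable {snd Θ ρ}

lemma lstep_of_ne {k j : ℕ} (h : j ≠ k) (s : LimState E) : lstep snd Θ ρ k s j = s j := by
  rw [lstep, Function.update_of_ne h]

lemma lstep_self (k : ℕ) (s : LimState E) : lstep snd Θ ρ k s k (snd k) =
    (lsent snd Θ k s, fun a => (lnorm snd Θ ρ k s)⁻¹ * lres snd Θ ρ k s a) := by
  rw [lstep, Function.update_self, if_pos rfl]

lemma lstep_not (k : ℕ) (s : LimState E) : lstep snd Θ ρ k s k (!snd k) =
    (fun a => ∑ j ∈ Finset.range k, lcoef snd Θ ρ k s j * (s j (!snd k)).2 a +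
    lnorm snd Θ ρ k s * lnoise snd Θ ρ k s a, lnoise snd Θ ρ k s) := by
  rw [lstep, Function.update_self, if_neg (by simp)]

lemma lrow_lstep (k : ℕ) (s : LimState E) (b : Bool) (a : E × (ℕ → ℝ)) :
    lrow (lstep snd Θ ρ k s) b a = upd k (lrow s b a) ((lstep snd Θ ρ k s k b).1 a) := by
  refine Prod.ext rfl (funext fun j => ?_)
  by_cases h : j = k
  · subst h; simp [lrow, upd]
  · simp [lrow, upd, lstep_of_ne h, h]

end Limit

/-! ### State evolution -/

section Evolution

set_option linter.unusedSectionVars false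

variable {E : Type*} [MeasurableSpace E] {Ω : ℕ → Type*} [∀ N, MeasurableSpace (Ω N)]
  (P : ∀ N, Measure (Ω N)) [∀ N, IsProbabilityMeasure (P N)]
  (e : Bool → ∀ N, Ω N → Fin N → E) (ρ : Bool → Measure E) [∀ b, IsProbabilityMeasure (ρ b)]
  (snd : ℕ → Bool) (Θ : ℕ → E × (ℕ → ℝ) → ℝ)

/-- The separable message functions: the entries of the message sent in step `k` are functions of
the rows of the primitives and the previous messages on the same side. -/
def sender {N : ℕ} (e : Bool → Fin N → E) (k : ℕ) (s : MsgState (Fin N)) : Fin N → ℝ :=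
  fun n => Θ k (e (snd k) n, fun j => msgs s (snd k) j n)

/-- The state of the simulated process before step `k`. -/
noncomputable def hst (k N : ℕ) (a : HatΩ Ω N) : MsgState (Fin N) :=
  runHat snd (sender snd Θ fun b => e b N a.1) a.2 k

/-- The message sent in step `k` of the simulated process. -/
noncomputable def hsent (k N : ℕ) (a : HatΩ Ω N) : Fin N → ℝ :=
  sender snd Θ (fun b => e b N a.1) k (hst e snd Θ k N a)

/-- The rows of the primitives and the messages of the simulated process. -/
noncomputable def hrow (k : ℕ) (b : Bool) (N : ℕ) (a : HatΩ Ω N) (n : Fin N) : E × (ℕ → ℝ) :=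
  (e b N a.1 n, fun j => msgs (hst e snd Θ k N a) b j n)

/-- The rows of the primitives and the noise. -/
def nrow (b : Bool) (N : ℕ) (a : HatΩ Ω N) (n : Fin N) : E × (ℕ → ℝ) := (e b N a.1 n, a.2 n)

/-- The hypothesis that the state before step `k` is asymptotically described by `s`. -/
structure Evol (k : ℕ) (s : LimState E) : Prop where
  approx_dirs : ∀ j b, Approx (hatP P) (nrow e b) (rowLaw (ρ b))
    (fun N a n => √N * dirs (hst e snd Θ k N a) b j n) (s j b).2
  approx_msgs : ∀ j b, Approx (hatP P) (nrow e b) (rowLaw (ρ b))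
    (fun N a n => msgs (hst e snd Θ k N a) b j n) (s j b).1
  /-- The directions are the same combinations of the messages on both sides. -/
  rep : ∃ T : ℕ → ℕ → ℝ, ∀ j b a, (s j b).2 a = ∑ i ∈ Finset.range k, T j i * (s i b).1 a
  past : ∀ j b a z i, k ≤ i →
    (s j b).1 (upd i a z) = (s j b).1 a ∧ (s j b).2 (upd i a z) = (s j b).2 a
  dom : ∀ b, Dom P k (hrow e snd Θ k b) ((rowLaw (ρ b)).map (lrow s b))

variable {P e ρ snd Θ}

lemma iidRows_nrow {b : Bool} (he : IIDRows P (e b) (ρ b)) :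
    IIDRows (hatP P) (nrow e b) (rowLaw (ρ b)) where
  measurable N := by
    have h1 : Measurable fun a : HatΩ Ω N => (e b N a.1, a.2) :=
      ((he.measurable N).comp measurable_fst).prodMk measurable_snd
    refine measurable_pi_iff.2 fun n => Measurable.prodMk ?_ ?_
    · exact (he.measurable_row N n).comp measurable_fst
    · exact (measurable_pi_apply n).comp measurable_snd
  law N := by
    have h1 := (measurePreserving_arrowProdEquivProdArrow E (ℕ → ℝ) (Fin N) (fun _ => ρ b)
      (fun _ => seqG)).symm
    have h2 : MeasurePreserving (e b N) (P N) (Measure.pi fun _ => ρ b) :=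
      ⟨he.measurable N, he.law N⟩
    exact (h1.comp (h2.prod (MeasurePreserving.id (noise (Fin N))))).map_eq

variable (P e ρ Θ) in
/-- The message functions are measurable, and on each side the rows of the primitives are
independent and identically distributed. -/
structure Model : Prop where
  measurable : ∀ k, Measurable (Θ k)
  iid : ∀ b, IIDRows P (e b) (ρ b)

lemma Model.measurable_sender (M : Model P e ρ Θ) (N k : ℕ) :
    Measurable fun p : Ω N × MsgState (Fin N) => sender snd Θ (fun b => e b N p.1) k p.2 := by
  refine measurable_pi_iff.2 fun n => (M.measurable k).comp (Measurable.prodMk ?_ ?_)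
  · exact ((M.iid (snd k)).measurable_row N n).comp measurable_fst
  · exact measurable_pi_iff.2 fun j =>
      (measurable_pi_apply n).comp (measurable_msgs measurable_snd _ j)

lemma Model.measurable_hst (M : Model P e ρ Θ) (k N : ℕ) : Measurable (hst e snd Θ k N) :=
  measurable_runHat (α := Ω N) snd (Φ := fun ω => sender snd Θ fun b => e b N ω)
    (fun k => M.measurable_sender N k) k

lemma Model.measurable_hsent (M : Model P e ρ Θ) (k N : ℕ) : Measurable (hsent e snd Θ k N) :=
  (M.measurable_sender (snd := snd) N k).comp (measurable_fst.prodMk (M.measurable_hst k N))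

lemma Model.measurable_hrow (M : Model P e ρ Θ) (k : ℕ) (b : Bool) (N : ℕ) (n : Fin N) :
    Measurable fun a => hrow e snd Θ k b N a n :=
  (((M.iid b).measurable_row N n).comp measurable_fst).prodMk (measurable_pi_iff.2 fun j =>
    (measurable_pi_apply n).comp (measurable_msgs (M.measurable_hst k N) _ j))

lemma past_hst (k m N : ℕ) (h : m ≤ k) : Past k (hst e snd Θ m N) := fun _ ζ _ z hj =>
  runHat_setCol snd _ ζ z (h.trans hj)

lemma past_hsent (k m N : ℕ) (h : m ≤ k) : Past k (hsent e snd Θ m N) := fun ω ζ j z hj => by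
  rw [hsent, hsent, past_hst k m N h ω ζ j z hj]

lemma hst_succ (k N : ℕ) (a : HatΩ Ω N) : hst e snd Θ (k + 1) N a =
    step k (snd k) (hst e snd Θ k N a) (hsent e snd Θ k N a)
      (dice (dirs (hst e snd Θ k N a) (!snd k)) k
        (newDir (hst e snd Θ k N a) k (snd k) (hsent e snd Θ k N a)) fun n => a.2 n k) := rfl

lemma hrow_succ (k : ℕ) (b : Bool) (N : ℕ) (a : HatΩ Ω N) (n : Fin N) :
    hrow e snd Θ (k + 1) b N a n =
      upd k (hrow e snd Θ k b N a n) (msgs (hst e snd Θ (k + 1) N a) b k n) := by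
  refine Prod.ext rfl (funext fun j => ?_)
  by_cases h : j = k
  · subst h; simp [hrow, upd]
  · simp only [hrow, upd, Function.update_of_ne h]
    rw [hst_succ, msgs_step_of_ne _ _ _ _ _ _ h]

lemma Model.ae_good (M : Model P e ρ Θ) (k N : ℕ) :
    ∀ᵐ a ∂(hatP P N), Good (hst e snd Θ k N a) k := by
  have h : ∀ ω, ∀ᵐ ζ ∂(noise (Fin N)), Good (hst e snd Θ k N (ω, ζ)) k := fun ω =>
    ae_good_runHat snd (fun k => (M.measurable_sender N k).comp measurable_prodMk_left) k
  have hm : MeasurableSet {a : HatΩ Ω N | ∀ j < k,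
      dirs (hst e snd Θ k N a) true j ⬝ᵥ dirs (hst e snd Θ k N a) true j =
        dirs (hst e snd Θ k N a) false j ⬝ᵥ dirs (hst e snd Θ k N a) false j} := by
    simp only [Set.ofPred_forall]
    refine MeasurableSet.iInter fun j => MeasurableSet.iInter fun _ => ?_
    have h1 := measurable_dirs (M.measurable_hst (snd := snd) k N) true j
    have h2 := measurable_dirs (M.measurable_hst (snd := snd) k N) false j
    exact measurableSet_eq_fun (by fun_prop) (by fun_prop)
  have h2 := (Measure.ae_prod_iff_ae_ae (μ := P N) (ν := noise (Fin N)) (p := fun a =>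
    ∀ j < k, dirs (hst e snd Θ k N a) true j ⬝ᵥ dirs (hst e snd Θ k N a) true j =
      dirs (hst e snd Θ k N a) false j ⬝ᵥ dirs (hst e snd Θ k N a) false j) hm).2
    (Eventually.of_forall fun ω => (h ω).mono fun ζ hζ => hζ.norm)
  filter_upwards [h2] with a ha using good_runHat_of_norm snd a.2 ha

end Evolution

end OAMP


namespace OAMP

open Filter Topology
open scoped ENNReal

section ApproxProj

set_option linter.unusedSectionVars false

variable {Ω : ℕ → Type*} [∀ N, MeasurableSpace (Ω N)] {P : ∀ N, Measure (Ω N)}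
  [∀ N, IsProbabilityMeasure (P N)]
  {α : Type*} [MeasurableSpace α] {y : ∀ N, Ω N → Fin N → α} {m : Measure α}
  [IsProbabilityMeasure m]

lemma sqrt_mul_nrm {N : ℕ} (r : Fin N → ℝ) (n : Fin N) :
    √N * nrm r n = (√(ip r r))⁻¹ * r n := by
  have hN : 0 < √(N : ℝ) := Real.sqrt_pos.2 (Nat.cast_pos.2 (Nat.lt_of_le_of_lt (Nat.zero_le _) n.2))
  rw [ip, Real.sqrt_div' _ (Nat.cast_nonneg N), nrm, Pi.smul_apply, smul_eq_mul]
  field_simp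

lemma sqrt_dotProduct_eq {N : ℕ} (r : Fin N → ℝ) : √(r ⬝ᵥ r) = √N * √(ip r r) := by
  rcases Nat.eq_zero_or_pos N with rfl | hN
  · simp
  · have h1 : 0 < √(N : ℝ) := Real.sqrt_pos.2 (Nat.cast_pos.2 hN)
    rw [ip, Real.sqrt_div' _ (Nat.cast_nonneg N)]
    field_simp

lemma ip_mul_eq {N : ℕ} (v u w : Fin N → ℝ) (n : Fin N) :
    ip v (fun i => √N * u i) * (√N * w n) = (v ⬝ᵥ u) * w n := by
  have hN : 0 < (N : ℝ) := Nat.cast_pos.2 (Nat.lt_of_le_of_lt (Nat.zero_le _) n.2)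
  have h1 : (fun i => √N * u i) = √(N : ℝ) • u := rfl
  have h2 : √(N : ℝ) * √N = N := Real.mul_self_sqrt hN.le
  rw [h1, ip_smul_right, ip]
  calc √(N : ℝ) * ((v ⬝ᵥ u) / N) * (√N * w n) = (√(N : ℝ) * √N) * ((v ⬝ᵥ u) / N) * w n := by ring
    _ = _ := by rw [h2]; field_simp

lemma Approx.nrm (hy : IIDRows P y m) {r : ∀ N, Ω N → Fin N → ℝ} {f : α → ℝ}
    (h : Approx P y m r f) {τ : ℝ} (hτ : 0 < τ) (h2 : ∫ a, f a * f a ∂m = τ ^ 2) :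
    Approx P y m (fun N ω n => √N * nrm (r N ω) n) (fun a => τ⁻¹ * f a) := by
  have h1 := (h.tendsto_ip hy h).sqrt
  rw [h2, Real.sqrt_sq hτ.le] at h1
  have h3 := h.smul hy (c := fun N ω => (√(ip (r N ω) (r N ω)))⁻¹) (h1.inv₀ hτ.ne')
  refine h3.congr (Eventually.of_forall fun x => funext fun n => ?_)
  rw [sqrt_mul_nrm]

lemma Approx.proj (hy : IIDRows P y m) {v : ∀ N, Ω N → Fin N → ℝ} {f : α → ℝ}
    {U : ∀ N, Ω N → ℕ → Fin N → ℝ} {g : ℕ → α → ℝ} (h : Approx P y m v f)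
    (hU : ∀ j, Approx P y m (fun N ω n => √N * U N ω j n) (g j)) (k : ℕ) :
    Approx P y m (fun N ω n => proj (U N ω) k (v N ω) n)
      (fun a => f a - ∑ j ∈ Finset.range k, (∫ b, f b * g j b ∂m) * g j a) := by
  have h0 : Approx P y m (fun N ω n => ∑ j ∈ Finset.range k,
      (ip (v N ω) fun n => √N * U N ω j n) * (√N * U N ω j n))
      (fun a => ∑ j ∈ Finset.range k, (∫ b, f b * g j b ∂m) * g j a) :=
    Approx.sum hy (Finset.range k) (a := fun j N ω n => √N * U N ω j n) hU
      (c := fun j N ω => ip (v N ω) fun n => √N * U N ω j n) fun j =>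
        Approx.tendsto_ip (a := v) (a' := fun N ω n => √N * U N ω j n) hy h (hU j)
  refine (h.sub hy h0).congr (Eventually.of_forall fun x => funext fun n => ?_)
  simp only [ip_mul_eq, OAMP.proj, Pi.sub_apply, Finset.sum_apply, Pi.smul_apply, smul_eq_mul]

lemma OrthZero.proj_sum {N : ℕ} {U : ℕ → Fin N → ℝ} {k : ℕ} (h : OrthZero U k) (d : ℕ → ℝ) {j : ℕ}
    (hj : j < k) : (∑ i ∈ Finset.range k, d i • U i) ⬝ᵥ U j = d j * (U j ⬝ᵥ U j) := by
  rw [sum_dotProduct, Finset.sum_eq_single_of_mem j (Finset.mem_range.2 hj), smul_dotProduct,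
    smul_eq_mul]
  intro i hi hij
  rw [smul_dotProduct, h.1 i (Finset.mem_range.1 hi) j hj hij, smul_zero]

/-- A message which is a combination of previous messages has no residual, and it is received as
the same combination. -/
lemma Good.of_combination {N : ℕ} {s : MsgState (Fin N)} {k : ℕ} (h : Good s k) {κ : ℕ → ℝ} {b : Bool}
    {v : Fin N → ℝ} (hv : v = ∑ i ∈ Finset.range k, κ i • msgs s b i) :
    proj (dirs s b) k v = 0 ∧ ∀ d, received s k b v d = ∑ i ∈ Finset.range k, κ i • msgs s (!b) i := by
  obtain ⟨c, hc⟩ := h.rep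
  have hcomb : ∀ b', ∑ i ∈ Finset.range k, κ i • msgs s b' i =
      ∑ m ∈ Finset.range k, (∑ i ∈ Finset.range k, κ i * c i m) • dirs s b' m := by
    intro b'
    simp only [Finset.sum_smul]
    rw [Finset.sum_comm]
    refine Finset.sum_congr rfl fun i hi => ?_
    rw [hc i (Finset.mem_range.1 hi) b', Finset.smul_sum]
    simp only [smul_smul]
  have hn : ∀ j < k, dirs s b j ⬝ᵥ dirs s b j = dirs s (!b) j ⬝ᵥ dirs s (!b) j := by
    intro j hj
    cases b
    · exact (h.norm j hj).symm
    · exact h.norm j hj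
  have hco : ∀ j < k, v ⬝ᵥ dirs s b j =
      (∑ i ∈ Finset.range k, κ i * c i j) * (dirs s b j ⬝ᵥ dirs s b j) := by
    intro j hj
    rw [hv, hcomb, (h.orth b).proj_sum _ hj]
  have hproj : proj (dirs s b) k v = 0 := by
    rw [proj, sub_eq_zero]
    conv_lhs => rw [hv, hcomb]
    refine Finset.sum_congr rfl fun j hj => ?_
    have hj := Finset.mem_range.1 hj
    rw [hco j hj, mul_smul, (h.orth b).smul_self hj]
  refine ⟨hproj, fun d => ?_⟩
  rw [received, hproj, dotProduct_zero, Real.sqrt_zero, zero_smul, add_zero, hcomb]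
  refine Finset.sum_congr rfl fun j hj => ?_
  have hj := Finset.mem_range.1 hj
  rw [hco j hj, hn j hj, mul_smul, (h.orth (!b)).smul_self hj]

end ApproxProj

section EvolutionStep

set_option linter.unusedSectionVars false

variable {E : Type*} [MeasurableSpace E] {Ω : ℕ → Type*} [∀ N, MeasurableSpace (Ω N)]
  {P : ∀ N, Measure (Ω N)} [∀ N, IsProbabilityMeasure (P N)]
  {e : Bool → ∀ N, Ω N → Fin N → E} {ρ : Bool → Measure E} [∀ b, IsProbabilityMeasure (ρ b)]
  {snd : ℕ → Bool} {Θ : ℕ → E × (ℕ → ℝ) → ℝ} {k : ℕ} {s : LimState E}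

lemma Evol.measurable_lrow (h : Evol P e ρ snd Θ k s) (b : Bool) : Measurable (lrow s b) :=
  measurable_fst.prodMk (measurable_pi_iff.2 fun j => (h.approx_msgs j b).measurable)

/-- Since the message functions are merely measurable, the domination of the laws of the rows
enters here. -/
lemma Evol.sent (h : Evol P e ρ snd Θ k s) (M : Model P e ρ Θ)
    (hU : UnifSq (fun p : (Σ N, Fin N) => hatP P p.1) fun p a => hsent e snd Θ k p.1 a p.2) :
    Approx (hatP P) (nrow e (snd k)) (rowLaw (ρ (snd k))) (hsent e snd Θ k) (lsent snd Θ k s) := by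
  have hy := iidRows_nrow (M.iid (snd k))
  have hlm := h.measurable_lrow (snd k)
  obtain ⟨lam, hc⟩ := (h.dom (snd k)).closeRows
    (R' := fun N a n => lrow s (snd k) (nrow e (snd k) N a n)) (M.measurable_hrow k _)
    (fun N n => hlm.comp (hy.measurable_row N n)) (fun N n => by
      rw [← hy.law_row N n, Measure.map_map hlm (hy.measurable_row N n)]; rfl)
    (fun N a n => rfl) (fun j => (h.approx_msgs j (snd k)).row)
  have : IsProbabilityMeasure ((rowLaw (ρ (snd k))).map (lrow s (snd k))) :=
    Measure.isProbabilityMeasure_map hlm.aemeasurable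
  exact Approx.of_row hy (M.measurable_hsent k) ((M.measurable k).comp hlm) hU
    (hc.comp (M.measurable k))

lemma Evol.res (h : Evol P e ρ snd Θ k s) (M : Model P e ρ Θ)
    (hv : Approx (hatP P) (nrow e (snd k)) (rowLaw (ρ (snd k))) (hsent e snd Θ k)
      (lsent snd Θ k s)) :
    Approx (hatP P) (nrow e (snd k)) (rowLaw (ρ (snd k)))
      (fun N a n => proj (dirs (hst e snd Θ k N a) (snd k)) k (hsent e snd Θ k N a) n)
      (lres snd Θ ρ k s) :=
  hv.proj (iidRows_nrow (M.iid (snd k))) (fun j => h.approx_dirs j (snd k)) k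

lemma Evol.noise (h : Evol P e ρ snd Θ k s) (M : Model P e ρ Θ) (b : Bool) :
    Approx (hatP P) (nrow e b) (rowLaw (ρ b))
      (fun N a n => proj (dirs (hst e snd Θ k N a) b) k (fun n => a.2 n k) n) (fun a => a.2 k) := by
  have h1 : Approx (hatP P) (nrow e b) (rowLaw (ρ b)) (fun N a n => a.2 n k) (fun a => a.2 k) :=
    Approx.self (measurable_col k) (memLp_col _ k)
  have h2 := h1.proj (iidRows_nrow (M.iid b)) (fun j => h.approx_dirs j b) k
  have h3 : ∀ j, ∫ a : E × (ℕ → ℝ), a.2 k * (s j b).2 a ∂(rowLaw (ρ b)) = 0 := fun j =>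
    integral_col_mul _ k (h.approx_dirs j b).memLp (h.approx_dirs j b).measurable
      fun a z => (h.past j b a z k le_rfl).2
  simpa only [h3, zero_mul, Finset.sum_const_zero, sub_zero] using h2

lemma lnorm_sq : ∫ a, lres snd Θ ρ k s a * lres snd Θ ρ k s a ∂(rowLaw (ρ (snd k))) =
    (lnorm snd Θ ρ k s) ^ 2 := by
  rw [lnorm, Real.sq_sqrt (integral_nonneg fun a => mul_self_nonneg _)]

lemma lnorm_nonneg : 0 ≤ lnorm snd Θ ρ k s := Real.sqrt_nonneg _

/-- If the limiting residual vanishes, the message sent is, up to an event of small probability,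
exactly a combination of the previous messages. -/
lemma Evol.degenerate (h : Evol P e ρ snd Θ k s) (M : Model P e ρ Θ)
    (hr : MemLp (lres snd Θ ρ k s) 2 (rowLaw (ρ (snd k)))) (h0 : lnorm snd Θ ρ k s = 0) :
    ∃ κ : ℕ → ℝ, (∀ᶠ x in glob (hatP P), hsent e snd Θ k x.1 x.2 =
      ∑ i ∈ Finset.range k, κ i • msgs (hst e snd Θ k x.1 x.2) (snd k) i) ∧
      ∀ b a, ∑ j ∈ Finset.range k, lcoef snd Θ ρ k s j * (s j b).2 a =
        ∑ i ∈ Finset.range k, κ i * (s i b).1 a := by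
  obtain ⟨T, hT⟩ := h.rep
  have hκ : ∀ b a, ∑ j ∈ Finset.range k, lcoef snd Θ ρ k s j * (s j b).2 a =
      ∑ i ∈ Finset.range k, (∑ j ∈ Finset.range k, lcoef snd Θ ρ k s j * T j i) * (s i b).1 a := by
    intro b a
    simp only [hT _ b a, Finset.mul_sum, Finset.sum_mul]
    rw [Finset.sum_comm]
    refine Finset.sum_congr rfl fun i _ => Finset.sum_congr rfl fun j _ => by ring
  refine ⟨_, ?_, hκ⟩
  set κ : ℕ → ℝ := fun i => ∑ j ∈ Finset.range k, lcoef snd Θ ρ k s j * T j i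
  have hae : ∀ᵐ a ∂(rowLaw (ρ (snd k))), lres snd Θ ρ k s a = 0 := by
    have h1 : ∫ a, lres snd Θ ρ k s a * lres snd Θ ρ k s a ∂(rowLaw (ρ (snd k))) = 0 := by
      rw [lnorm_sq, h0]; simp
    rw [integral_eq_zero_iff_of_nonneg (fun a => mul_self_nonneg _) (hr.integrable_mul hr)] at h1
    filter_upwards [h1] with a ha using mul_self_eq_zero.1 ha
  set A : Set (E × (ℕ → ℝ)) := {p | Θ k p = ∑ i ∈ Finset.range k, κ i * p.2 i} with hA
  have hAm : MeasurableSet A := measurableSet_eq_fun (M.measurable k)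
    (Finset.measurable_sum _ fun i _ => (measurable_col i).const_mul _)
  have hAν : ((rowLaw (ρ (snd k))).map (lrow s (snd k))) Aᶜ = 0 := by
    rw [Measure.map_apply (h.measurable_lrow _) hAm.compl]
    have h2 : ∀ᵐ a ∂(rowLaw (ρ (snd k))), lrow s (snd k) a ∈ A := by
      filter_upwards [hae] with a ha
      rw [lres, sub_eq_zero, hκ] at ha
      exact ha
    exact h2
  filter_upwards [(h.dom (snd k)).eventually_of_ae (M.measurable_hrow k _) hAm hAν] with x hx
  ext n
  have := hx n
  rw [hA, Set.mem_ofPred_eq] at this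
  rw [Finset.sum_apply]
  exact this

end EvolutionStep

end OAMP


namespace OAMP

open Filter Topology
open scoped ENNReal

section EvolutionStep

set_option linter.unusedSectionVars false

variable {E : Type*} [MeasurableSpace E] {Ω : ℕ → Type*} [∀ N, MeasurableSpace (Ω N)]
  {P : ∀ N, Measure (Ω N)} [∀ N, IsProbabilityMeasure (P N)]
  {e : Bool → ∀ N, Ω N → Fin N → E} {ρ : Bool → Measure E} [∀ b, IsProbabilityMeasure (ρ b)]
  {snd : ℕ → Bool} {Θ : ℕ → E × (ℕ → ℝ) → ℝ} {k : ℕ} {s : LimState E}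

variable (e snd Θ) in
/-- The residual of the message sent in step `k`. -/
noncomputable def hres (k N : ℕ) (a : HatΩ Ω N) : Fin N → ℝ :=
  proj (dirs (hst e snd Θ k N a) (snd k)) k (hsent e snd Θ k N a)

variable (e snd Θ) in
/-- The projected noise of step `k`. -/
noncomputable def hnoise (k N : ℕ) (a : HatΩ Ω N) : Fin N → ℝ :=
  proj (dirs (hst e snd Θ k N a) (!snd k)) k fun n => a.2 n k

variable (e snd Θ) in
/-- The direction received in step `k`. -/
noncomputable def hdice (k N : ℕ) (a : HatΩ Ω N) : Fin N → ℝ :=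
  √(nrm (hres e snd Θ k N a) ⬝ᵥ nrm (hres e snd Θ k N a)) • nrm (hnoise e snd Θ k N a)

variable (e snd Θ) in
/-- The message received in step `k`. -/
noncomputable def hrec (k N : ℕ) (a : HatΩ Ω N) : Fin N → ℝ :=
  received (hst e snd Θ k N a) k (snd k) (hsent e snd Θ k N a) (hdice e snd Θ k N a)

lemma hst_succ' (k N : ℕ) (a : HatΩ Ω N) : hst e snd Θ (k + 1) N a =
    step k (snd k) (hst e snd Θ k N a) (hsent e snd Θ k N a) (hdice e snd Θ k N a) := rfl

lemma hrec_apply (k N : ℕ) (a : HatΩ Ω N) (n : Fin N) : hrec e snd Θ k N a n =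
    ∑ j ∈ Finset.range k, (hsent e snd Θ k N a ⬝ᵥ dirs (hst e snd Θ k N a) (snd k) j) *
      dirs (hst e snd Θ k N a) (!snd k) j n +
    √(hres e snd Θ k N a ⬝ᵥ hres e snd Θ k N a) * hdice e snd Θ k N a n := by
  simp only [hrec, received, Pi.add_apply, Finset.sum_apply, Pi.smul_apply, smul_eq_mul]
  rfl

/-- What is known after the message of step `k` is sent. -/
structure EvolSent (P : ∀ N, Measure (Ω N)) (e : Bool → ∀ N, Ω N → Fin N → E)
    (ρ : Bool → Measure E) (snd : ℕ → Bool) (Θ : ℕ → E × (ℕ → ℝ) → ℝ) (k : ℕ)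
    (s : LimState E) : Prop where
  model : Model P e ρ Θ
  evol : Evol P e ρ snd Θ k s
  sent : Approx (hatP P) (nrow e (snd k)) (rowLaw (ρ (snd k))) (hsent e snd Θ k) (lsent snd Θ k s)

lemma EvolSent.res (h : EvolSent P e ρ snd Θ k s) : Approx (hatP P) (nrow e (snd k))
    (rowLaw (ρ (snd k))) (hres e snd Θ k) (lres snd Θ ρ k s) :=
  h.evol.res h.model h.sent

lemma EvolSent.noise (h : EvolSent P e ρ snd Θ k s) : Approx (hatP P) (nrow e (!snd k))
    (rowLaw (ρ (!snd k))) (hnoise e snd Θ k) (fun a => a.2 k) :=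
  h.evol.noise h.model (!snd k)

lemma EvolSent.tendsto_res (h : EvolSent P e ρ snd Θ k s) :
    Tendsto (fun x : Σ N, HatΩ Ω N => ip (hres e snd Θ k x.1 x.2) (hres e snd Θ k x.1 x.2))
      (glob (hatP P)) (𝓝 (lnorm snd Θ ρ k s ^ 2)) := by
  rw [← lnorm_sq]
  exact h.res.tendsto_ip (iidRows_nrow (h.model.iid _)) h.res

lemma EvolSent.tendsto_noise (h : EvolSent P e ρ snd Θ k s) :
    Tendsto (fun x : Σ N, HatΩ Ω N => ip (hnoise e snd Θ k x.1 x.2) (hnoise e snd Θ k x.1 x.2))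
      (glob (hatP P)) (𝓝 1) := by
  rw [← integral_col_sq (ρ (!snd k)) k]
  exact h.noise.tendsto_ip (iidRows_nrow (h.model.iid _)) h.noise

lemma EvolSent.good (h : EvolSent P e ρ snd Θ k s) :
    ∀ᶠ x in glob (hatP P), Good (hst e snd Θ k x.1 x.2) k :=
  eventually_whp_of_ae (Eventually.of_forall fun N => h.model.ae_good k N)

/-- In the degenerate case the message received is the same combination of previous messages as
the message sent. -/
lemma EvolSent.degenerate (h : EvolSent P e ρ snd Θ k s) (h0 : lnorm snd Θ ρ k s = 0) :
    ∃ κ : ℕ → ℝ, (∀ᶠ x in glob (hatP P), hres e snd Θ k x.1 x.2 = 0 ∧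
      ∀ n, hrec e snd Θ k x.1 x.2 n =
        ∑ i ∈ Finset.range k, κ i * msgs (hst e snd Θ k x.1 x.2) (!snd k) i n) ∧
      ∀ b a, ∑ j ∈ Finset.range k, lcoef snd Θ ρ k s j * (s j b).2 a =
        ∑ i ∈ Finset.range k, κ i * (s i b).1 a := by
  obtain ⟨κ, h1, h2⟩ := h.evol.degenerate h.model h.res.memLp h0
  refine ⟨κ, ?_, h2⟩
  filter_upwards [h.good, h1] with x hg hx
  obtain ⟨h3, h4⟩ := hg.of_combination hx
  refine ⟨h3, fun n => ?_⟩
  rw [hrec, h4]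
  simp

lemma EvolSent.eventually_nrm (h : EvolSent P e ρ snd Θ k s) (h0 : 0 < lnorm snd Θ ρ k s) :
    ∀ᶠ x in glob (hatP P), nrm (hres e snd Θ k x.1 x.2) ⬝ᵥ nrm (hres e snd Θ k x.1 x.2) = 1 := by
  filter_upwards [(tendsto_order.1 h.tendsto_res).1 0 (by positivity)] with x hx
  refine nrm_dotProduct_self fun hr => ?_
  rw [hr] at hx
  simp [ip] at hx

lemma EvolSent.dir_sent (h : EvolSent P e ρ snd Θ k s) :
    Approx (hatP P) (nrow e (snd k)) (rowLaw (ρ (snd k)))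
      (fun N a n => √N * nrm (hres e snd Θ k N a) n)
      (fun a => (lnorm snd Θ ρ k s)⁻¹ * lres snd Θ ρ k s a) := by
  rcases eq_or_ne (lnorm snd Θ ρ k s) 0 with h0 | h0
  · obtain ⟨κ, h1, -⟩ := h.degenerate h0
    simp only [h0, inv_zero, zero_mul]
    refine Approx.zero.congr (h1.mono fun x hx => ?_)
    ext n
    simp [hx.1, nrm_zero]
  · exact h.res.nrm (iidRows_nrow (h.model.iid _)) (lt_of_le_of_ne lnorm_nonneg h0.symm) lnorm_sq

lemma EvolSent.dir_received (h : EvolSent P e ρ snd Θ k s) :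
    Approx (hatP P) (nrow e (!snd k)) (rowLaw (ρ (!snd k)))
      (fun N a n => √N * hdice e snd Θ k N a n) (lnoise snd Θ ρ k s) := by
  rcases eq_or_ne (lnorm snd Θ ρ k s) 0 with h0 | h0
  · obtain ⟨κ, h1, -⟩ := h.degenerate h0
    have e0 : lnoise snd Θ ρ k s = fun _ => 0 := by ext a; rw [lnoise, if_pos h0]
    rw [e0]
    refine Approx.zero.congr (h1.mono fun x hx => ?_)
    ext n
    simp [hdice, hx.1, nrm_zero]
  · have e0 : lnoise snd Θ ρ k s = fun a => (1 : ℝ)⁻¹ * a.2 k := by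
      ext a; rw [lnoise, if_neg h0, inv_one, one_mul]
    rw [e0]
    have h1 := h.noise.nrm (iidRows_nrow (h.model.iid _)) one_pos
      (by rw [integral_col_sq]; norm_num)
    refine h1.congr ((h.eventually_nrm (lt_of_le_of_ne lnorm_nonneg h0.symm)).mono fun x hx => ?_)
    ext n
    rw [hdice, hx, Real.sqrt_one, one_smul]

/-- The message received is asymptotically a combination of the directions received earlier and,
with weight the norm of the residual, of the fresh noise. -/
lemma EvolSent.msg_received (h : EvolSent P e ρ snd Θ k s) :
    Approx (hatP P) (nrow e (!snd k)) (rowLaw (ρ (!snd k))) (hrec e snd Θ k)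
      (fun a => ∑ j ∈ Finset.range k, lcoef snd Θ ρ k s j * (s j (!snd k)).2 a +
        lnorm snd Θ ρ k s * lnoise snd Θ ρ k s a) := by
  have hy := iidRows_nrow (h.model.iid (!snd k))
  have h0 : Approx (hatP P) (nrow e (!snd k)) (rowLaw (ρ (!snd k)))
      (fun N a n => ∑ j ∈ Finset.range k,
        (ip (hsent e snd Θ k N a) fun n => √N * dirs (hst e snd Θ k N a) (snd k) j n) *
          (√N * dirs (hst e snd Θ k N a) (!snd k) j n))
      (fun a => ∑ j ∈ Finset.range k, lcoef snd Θ ρ k s j * (s j (!snd k)).2 a) :=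
    Approx.sum hy (Finset.range k)
      (a := fun j N a n => √N * dirs (hst e snd Θ k N a) (!snd k) j n)
      (fun j => h.evol.approx_dirs j _)
      (c := fun j N a => ip (hsent e snd Θ k N a) fun n => √N * dirs (hst e snd Θ k N a) (snd k) j n)
      fun j => Approx.tendsto_ip (a := hsent e snd Θ k)
        (a' := fun N a n => √N * dirs (hst e snd Θ k N a) (snd k) j n)
        (iidRows_nrow (h.model.iid _)) h.sent (h.evol.approx_dirs j _)
  have h1 := h.tendsto_res.sqrt
  rw [Real.sqrt_sq lnorm_nonneg] at h1
  have h2 := h.dir_received.smul hy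
    (c := fun N a => √(ip (hres e snd Θ k N a) (hres e snd Θ k N a))) h1
  refine (h0.add h2).congr (Eventually.of_forall fun x => funext fun n => ?_)
  simp only [ip_mul_eq]
  rw [hrec_apply, sqrt_dotProduct_eq (hres e snd Θ k x.1 x.2)]
  ring

lemma measurable_upd_comp {g : E × (ℕ → ℝ) → ℝ} (hg : Measurable g) :
    Measurable fun p => upd k p (g p) := (measurable_upd k).comp (measurable_id.prodMk hg)

lemma lstep_fst_not (k : ℕ) (s : LimState E) : (lstep snd Θ ρ k s k (!snd k)).1 =
    fun a => ∑ j ∈ Finset.range k, lcoef snd Θ ρ k s j * (s j (!snd k)).2 a +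
      lnorm snd Θ ρ k s * lnoise snd Θ ρ k s a := by rw [lstep_not]

lemma EvolSent.measurable_lrow (h : EvolSent P e ρ snd Θ k s) (b : Bool) : Measurable (lrow s b) :=
  h.evol.measurable_lrow b

lemma EvolSent.dom_sent (h : EvolSent P e ρ snd Θ k s) :
    Dom P (k + 1) (hrow e snd Θ (k + 1) (snd k))
      ((rowLaw (ρ (snd k))).map (lrow (lstep snd Θ ρ k s) (snd k))) := by
  have hΘ := h.model.measurable k
  refine (h.evol.dom (snd k)).append (h.model.measurable_hrow k _) hΘ (S' := fun _ => Set.univ)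
    (fun _ => MeasurableSet.univ) (by simp) (fun _ _ _ _ _ _ => by simp) (fun N a _ n => ?_) ?_
    (h.model.measurable_hrow (k + 1) _)
  · rw [hrow_succ, hst_succ', msgs_step_self]; rfl
  · rw [Measure.map_map (measurable_upd_comp hΘ) (h.measurable_lrow _)]
    congr 1
    ext a : 1
    rw [lrow_lstep, lstep_self]; rfl

/-- If the residual vanishes in the limit, it vanishes for finite `N` with high probability, so the
message received is a fixed combination of the earlier ones and domination is inherited. -/
lemma EvolSent.dom_received_of_degenerate (h : EvolSent P e ρ snd Θ k s)
    (h0 : lnorm snd Θ ρ k s = 0) :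
    Dom P (k + 1) (hrow e snd Θ (k + 1) (!snd k))
      ((rowLaw (ρ (!snd k))).map (lrow (lstep snd Θ ρ k s) (!snd k))) := by
  obtain ⟨κ, h1, h2⟩ := h.degenerate h0
  have hg : Measurable fun p : E × (ℕ → ℝ) => ∑ i ∈ Finset.range k, κ i * p.2 i :=
    Finset.measurable_sum _ fun i _ => (measurable_col i).const_mul _
  refine (h.evol.dom (!snd k)).append (h.model.measurable_hrow k _) hg
    (S' := fun N => {a | ∀ n, msgs (hst e snd Θ (k + 1) N a) (!snd k) k n =
      ∑ i ∈ Finset.range k, κ i * msgs (hst e snd Θ k N a) (!snd k) i n})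
    (fun N => ?_) ?_ (fun N ω ζ j z hj => ?_) (fun N a ha n => ?_) ?_
    (h.model.measurable_hrow (k + 1) _)
  · simp only [Set.ofPred_forall]
    refine MeasurableSet.iInter fun n => measurableSet_eq_fun ?_ ?_
    · exact (measurable_pi_apply n).comp (measurable_msgs (h.model.measurable_hst _ N) _ _)
    · exact Finset.measurable_sum _ fun i _ => ((measurable_pi_apply n).comp
        (measurable_msgs (h.model.measurable_hst _ N) _ _)).const_mul _
  · filter_upwards [h1] with x hx n
    rw [hst_succ', msgs_step_not]
    exact hx.2 n
  · simp only [Set.mem_ofPred_eq]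
    rw [past_hst (k + 1) (k + 1) N le_rfl ω ζ j z hj, past_hst (k + 1) k N (by omega) ω ζ j z hj]
  · rw [hrow_succ, ha n]; rfl
  · rw [Measure.map_map (measurable_upd_comp hg) (h.measurable_lrow _)]
    congr 1
    ext a : 1
    rw [lrow_lstep, lstep_fst_not]
    simp only [h0, zero_mul, add_zero, h2]
    rfl

lemma measurableSet_orthZero {α : Type*} [MeasurableSpace α] {N : ℕ} {p : α → ℕ → Fin N → ℝ}
    (hp : ∀ j, Measurable fun a => p a j) (k : ℕ) : MeasurableSet {a | OrthZero (p a) k} := by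
  simp only [OrthZero, Set.ofPred_and, Set.ofPred_forall]
  have hm : ∀ i j, Measurable fun a => p a i ⬝ᵥ p a j := fun i j =>
    Measurable.dotProduct (hp i) (hp j)
  refine MeasurableSet.inter ?_ ?_
  · refine MeasurableSet.iInter fun i => MeasurableSet.iInter fun _ => MeasurableSet.iInter fun j =>
      MeasurableSet.iInter fun _ => MeasurableSet.iInter fun _ => ?_
    exact measurableSet_eq_fun (hm i j) measurable_const
  · refine MeasurableSet.iInter fun i => MeasurableSet.iInter fun _ => ?_
    simp only [Set.ofPred_or]
    exact (measurableSet_eq_fun (hm i i) measurable_const).union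
      (measurableSet_eq_fun (hm i i) measurable_const)

/-- A measure which charges an affine image of a fresh Gaussian variable charges the whole line. -/
lemma volume_null_of_affine_gaussian {A : E × (ℕ → ℝ) → ℝ} {τ : ℝ} (hτ : τ ≠ 0) (hA : Measurable A)
    (hAp : ∀ a z, A (upd k a z) = A a) {L : E × (ℕ → ℝ) → E × (ℕ → ℝ)} (hL : Measurable L)
    (hLp : ∀ a z, L (upd k a z) = L a) {μ : Measure E} [IsProbabilityMeasure μ]
    {D : Set (E × (ℕ → ℝ))} (hD : MeasurableSet D)
    (h : (rowLaw μ).map (fun a => upd k (L a) (A a + τ * a.2 k)) D = 0) :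
    ((rowLaw μ).map L) {q | volume {s : ℝ | upd k q s ∈ D} ≠ 0} = 0 := by
  have hm : Measurable fun a : E × (ℕ → ℝ) => upd k (L a) (A a + τ * a.2 k) :=
    (measurable_upd k).comp (hL.prodMk (hA.add ((measurable_col k).const_mul τ)))
  have hvm : Measurable fun q : E × (ℕ → ℝ) => volume {s : ℝ | upd k q s ∈ D} :=
    measurable_measure_prodMk_left (measurable_upd k hD)
  have hset : MeasurableSet {q : E × (ℕ → ℝ) | volume {s : ℝ | upd k q s ∈ D} ≠ 0} :=
    (measurableSet_eq_fun hvm measurable_const).compl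
  rw [Measure.map_apply hm hD, ← lintegral_indicator_one (hm hD),
    lintegral_rowLaw_resample μ k (measurable_one.indicator (hm hD))] at h
  have hres : ∀ a, ∫⁻ z, ((fun a => upd k (L a) (A a + τ * a.2 k)) ⁻¹' D).indicator 1 (upd k a z)
      ∂(gaussianReal 0 1) = gaussianReal 0 1 {z | upd k (L a) (A a + τ * z) ∈ D} := by
    intro a
    have hTm : MeasurableSet {z : ℝ | upd k (L a) (A a + τ * z) ∈ D} := by
      refine (?_ : Measurable fun z : ℝ => upd k (L a) (A a + τ * z)) hD
      exact (measurable_upd k).comp (measurable_const.prodMk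
        ((measurable_id.const_mul τ).const_add (A a)))
    rw [← lintegral_indicator_one hTm]
    refine lintegral_congr fun z => ?_
    have e1 : (upd k a z).2 k = z := by simp [upd]
    have e2 : upd k a z ∈ (fun a => upd k (L a) (A a + τ * a.2 k)) ⁻¹' D ↔
        z ∈ {z : ℝ | upd k (L a) (A a + τ * z) ∈ D} := by
      simp only [Set.mem_preimage, hLp, hAp, e1, Set.mem_ofPred_eq]
    by_cases hc : z ∈ {z : ℝ | upd k (L a) (A a + τ * z) ∈ D}
    · rw [Set.indicator_of_mem (e2.2 hc), Set.indicator_of_mem hc]; rfl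
    · rw [Set.indicator_of_notMem fun h => hc (e2.1 h), Set.indicator_of_notMem hc]
  have hzm : Measurable fun a : E × (ℕ → ℝ) =>
      gaussianReal 0 1 {z | upd k (L a) (A a + τ * z) ∈ D} := by
    refine measurable_measure_prodMk_left (ν := gaussianReal 0 1)
      (s := {q : (E × (ℕ → ℝ)) × ℝ | upd k (L q.1) (A q.1 + τ * q.2) ∈ D}) ?_
    refine (?_ : Measurable fun q : (E × (ℕ → ℝ)) × ℝ => upd k (L q.1) (A q.1 + τ * q.2)) hD
    exact (measurable_upd k).comp ((hL.comp measurable_fst).prodMk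
      ((hA.comp measurable_fst).add (measurable_snd.const_mul τ)))
  rw [lintegral_congr hres, lintegral_eq_zero_iff hzm] at h
  rw [Measure.map_apply hL hset]
  have h2 : ∀ᵐ a ∂(rowLaw μ), volume {s : ℝ | upd k (L a) s ∈ D} = 0 := by
    filter_upwards [h] with a ha
    have h3 : volume {z : ℝ | upd k (L a) (A a + τ * z) ∈ D} = 0 :=
      gaussianReal_absolutelyContinuous' 0 one_ne_zero ha
    have e2 : {z : ℝ | upd k (L a) (A a + τ * z) ∈ D} =
        (τ * ·) ⁻¹' ((A a + ·) ⁻¹' {s : ℝ | upd k (L a) s ∈ D}) := rfl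
    rw [e2, Real.volume_preimage_mul_left hτ, measure_preimage_add, mul_eq_zero] at h3
    rcases h3 with h3 | h3
    · exact absurd h3 (by simpa using hτ)
    · exact h3
  have h4 : ∀ᵐ a ∂(rowLaw μ), ¬ (a ∈ L ⁻¹' {q | volume {s : ℝ | upd k q s ∈ D} ≠ 0}) := by
    filter_upwards [h2] with a ha hcon using hcon ha
  simpa [ae_iff] using h4

lemma past_hres (k N : ℕ) : Past k (hres e snd Θ k N) := fun ω ζ j z hj => by
  rw [hres, hres, past_hst k k N le_rfl ω ζ j z hj, past_hsent k k N le_rfl ω ζ j z hj]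

lemma past_hnoise (k N : ℕ) : Past (k + 1) (hnoise e snd Θ k N) := fun ω ζ j z hj => by
  have : (fun n => setCol ζ j z n k) = fun n => ζ n k := by
    ext n; rw [setCol, Function.update_of_ne (by omega)]
  simp only [hnoise, this]
  rw [past_hst k k N le_rfl ω ζ j z (by omega)]

variable (e snd Θ) in
/-- The event on which the direction received in step `k` has a tame density. -/
def tameSet (k : ℕ) (c : ℝ) (N : ℕ) : Set (HatΩ Ω N) :=
  {a | OrthZero (dirs (hst e snd Θ k N a) (!snd k)) k} ∩
  ({a | c * √N ≤ √(hres e snd Θ k N a ⬝ᵥ hres e snd Θ k N a)} ∩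
  ({a | ∀ n, ∑ j ∈ Finset.range k, (dirs (hst e snd Θ k N a) (!snd k) j n) ^ 2 ≤ 1 / 2} ∩
  ({a | hnoise e snd Θ k N a ⬝ᵥ hnoise e snd Θ k N a ≤ 2 * N} ∩
  ({a | ∀ n, |nrm (hnoise e snd Θ k N a) n| ≤ 1 / 2} ∩
  {a | nrm (hres e snd Θ k N a) ⬝ᵥ nrm (hres e snd Θ k N a) = 1}))))

lemma Model.measurableSet_tameSet (M : Model P e ρ Θ) (k : ℕ) (c : ℝ) (N : ℕ) :
    MeasurableSet (tameSet e snd Θ k c N) := by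
  have hst := M.measurable_hst (snd := snd) k N
  have hd : ∀ b j, Measurable fun a => dirs (OAMP.hst e snd Θ k N a) b j := fun b j =>
    measurable_dirs hst b j
  have hrm : Measurable (hres e snd Θ k N) :=
    Measurable.proj k (hd _) (M.measurable_hsent (snd := snd) k N)
  have hnm : Measurable (hnoise e snd Θ k N) :=
    Measurable.proj k (hd _) (measurable_pi_iff.2 fun n =>
      (measurable_pi_apply k).comp ((measurable_pi_apply n).comp measurable_snd))
  have hnn : Measurable fun a => nrm (hnoise e snd Θ k N a) := Measurable.nrm hnm
  have hrn : Measurable fun a => nrm (hres e snd Θ k N a) := Measurable.nrm hrm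
  refine (measurableSet_orthZero (fun j => hd _ j) k).inter (MeasurableSet.inter ?_
    (MeasurableSet.inter ?_ (MeasurableSet.inter ?_ (MeasurableSet.inter ?_ ?_))))
  · exact measurableSet_le measurable_const (Measurable.dotProduct hrm hrm).sqrt
  · simp only [Set.ofPred_forall]
    exact MeasurableSet.iInter fun n => measurableSet_le (Finset.measurable_sum _ fun j _ =>
      ((measurable_pi_apply n).comp (hd _ j)).pow_const 2) measurable_const
  · exact measurableSet_le (Measurable.dotProduct hnm hnm) measurable_const
  · simp only [Set.ofPred_forall]
    exact MeasurableSet.iInter fun n => measurableSet_le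
      (continuous_abs.measurable.comp ((measurable_pi_apply n).comp hnn)) measurable_const
  · exact measurableSet_eq_fun (Measurable.dotProduct hrn hrn) measurable_const

/-- The conditions under which the entries of the message received have a bounded density hold
with high probability, since the maxima of rows with finite second moments are `o(√N)`. -/
lemma EvolSent.eventually_tameSet (h : EvolSent P e ρ snd Θ k s) (h0 : 0 < lnorm snd Θ ρ k s) :
    ∀ᶠ x in glob (hatP P), x.2 ∈ tameSet e snd Θ k (lnorm snd Θ ρ k s / 2) x.1 := by
  have hy := iidRows_nrow (h.model.iid (!snd k))
  set τ := lnorm snd Θ ρ k s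
  have h1 := h.tendsto_res.sqrt
  rw [Real.sqrt_sq lnorm_nonneg] at h1
  have h2 : ∀ᶠ x in glob (hatP P), ∀ j ∈ Finset.range k, ∀ n,
      (√x.1 * dirs (hst e snd Θ k x.1 x.2) (!snd k) j n) ^ 2 ≤ 1 / (2 * (k + 1)) * x.1 := by
    rw [eventually_all_finset]
    exact fun j _ => (h.evol.approx_dirs j (!snd k)).max_le hy (by positivity)
  have h3 := (h.noise.nrm hy one_pos (by rw [integral_col_sq]; norm_num)).max_le hy
    (show (0 : ℝ) < 1 / 4 by norm_num)
  filter_upwards [h.good, (tendsto_order.1 h1).1 (τ / 2) (half_lt_self h0), h2,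
    (tendsto_order.1 h.tendsto_noise).2 2 one_lt_two, h3, h.eventually_nrm h0]
    with x g1 g2 g3 g4 g5 g6
  have hN : ∀ n : Fin x.1, 0 < (x.1 : ℝ) := fun n =>
    Nat.cast_pos.2 (Nat.lt_of_le_of_lt (Nat.zero_le _) n.2)
  refine ⟨g1.orth _, ?_, fun n => ?_, ?_, fun n => ?_, g6⟩
  · rw [Set.mem_ofPred_eq, sqrt_dotProduct_eq, mul_comm]
    exact mul_le_mul_of_nonneg_left g2.le (Real.sqrt_nonneg _)
  · have h4 : ∀ j ∈ Finset.range k, (dirs (hst e snd Θ k x.1 x.2) (!snd k) j n) ^ 2 ≤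
        1 / (2 * ((k : ℝ) + 1)) := by
      intro j hj
      have := g3 j hj n
      rw [mul_pow, Real.sq_sqrt (hN n).le, mul_comm] at this
      exact le_of_mul_le_mul_right this (hN n)
    refine (Finset.sum_le_sum h4).trans ?_
    rw [Finset.sum_const, Finset.card_range, nsmul_eq_mul, mul_one_div, div_le_div_iff₀
      (by positivity) (by norm_num)]
    linarith
  · rw [Set.mem_ofPred_eq]
    rcases Nat.eq_zero_or_pos x.1 with h0 | hpos
    · have : hnoise e snd Θ k x.1 x.2 ⬝ᵥ hnoise e snd Θ k x.1 x.2 = 0 :=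
        Finset.sum_eq_zero fun i _ => absurd i.2 (by omega)
      rw [this]; positivity
    · rw [ip, div_lt_iff₀ (Nat.cast_pos.2 hpos)] at g4
      exact g4.le
  · have h4 := g5 n
    rw [mul_pow, Real.sq_sqrt (hN n).le, mul_comm] at h4
    have h5 := le_of_mul_le_mul_right h4 (hN n)
    refine abs_le_of_sq_le_sq (h5.trans (by norm_num)) (by norm_num)

/-- If the residual does not vanish in the limit, the message received contains a multiple of a
fresh random direction, whose entries have a bounded density. -/
lemma EvolSent.dom_received (h : EvolSent P e ρ snd Θ k s) (h0 : 0 < lnorm snd Θ ρ k s) :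
    Dom P (k + 1) (hrow e snd Θ (k + 1) (!snd k))
      ((rowLaw (ρ (!snd k))).map (lrow (lstep snd Θ ρ k s) (!snd k))) := by
  refine (h.evol.dom (!snd k)).append_noise (h.model.measurable_hrow k _)
    (fun N ω ζ j z hj => ?_) (p := fun N a => dirs (hst e snd Θ k N a) (!snd k))
    (fun N ω ζ j z hj => ?_) (A := fun N a n => ∑ j ∈ Finset.range k,
      (hsent e snd Θ k N a ⬝ᵥ dirs (hst e snd Θ k N a) (snd k) j) *
        dirs (hst e snd Θ k N a) (!snd k) j n) (fun N ω ζ j z hj => ?_)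
    (B := fun N a => √(hres e snd Θ k N a ⬝ᵥ hres e snd Θ k N a)) (fun N ω ζ j z hj => ?_)
    (half_pos h0) (h.model.measurableSet_tameSet k _) (h.eventually_tameSet h0)
    (fun N ω ζ j z hj => ?_) (fun N a ha => ha.1) (fun N a ha => ha.2.1) (fun N a ha => ha.2.2.1)
    (fun N a ha => ha.2.2.2.1) (fun N a ha => ha.2.2.2.2.1) (fun N a ha n => ?_)
    (fun D hD hD0 => ?_) (h.model.measurable_hrow (k + 1) _)
  · ext n : 1
    simp only [hrow, past_hst k k N le_rfl ω ζ j z hj]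
  · simp only [past_hst k k N le_rfl ω ζ j z hj]
  · simp only [past_hst k k N le_rfl ω ζ j z hj, past_hsent k k N le_rfl ω ζ j z hj]
  · simp only [past_hres k N ω ζ j z hj]
  · simp only [tameSet, Set.mem_inter_iff, Set.mem_ofPred_eq,
      past_hst k k N le_rfl ω ζ j z (by omega), past_hres k N ω ζ j z (by omega),
      past_hnoise k N ω ζ j z hj]
  · have h1 : nrm (hres e snd Θ k N a) ⬝ᵥ nrm (hres e snd Θ k N a) = 1 := ha.2.2.2.2.2
    rw [hrow_succ, hst_succ', msgs_step_not]
    congr 1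
    refine (hrec_apply k N a n).trans ?_
    rw [hdice, h1, Real.sqrt_one, one_smul]
    rfl
  · refine volume_null_of_affine_gaussian (A := fun a => ∑ j ∈ Finset.range k,
      lcoef snd Θ ρ k s j * (s j (!snd k)).2 a) h0.ne' ?_ (fun a z => ?_) (h.measurable_lrow _)
      (fun a z => ?_) hD ?_
    · exact Finset.measurable_sum _ fun j _ => (h.evol.approx_dirs j _).measurable.const_mul _
    · simp only [(h.evol.past _ _ a z k le_rfl).2]
    · refine Prod.ext rfl (funext fun j => ?_)
      exact (h.evol.past j _ a z k le_rfl).1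
    · have e1 : lrow (lstep snd Θ ρ k s) (!snd k) = fun a => upd k (lrow s (!snd k) a)
          (∑ j ∈ Finset.range k, lcoef snd Θ ρ k s j * (s j (!snd k)).2 a +
            lnorm snd Θ ρ k s * a.2 k) := by
        ext a : 1
        rw [lrow_lstep, lstep_fst_not]
        simp only [lnoise, if_neg h0.ne']
      rwa [e1] at hD0

lemma bool_eq_or (b c : Bool) : b = c ∨ b = !c := by cases b <;> cases c <;> simp

/-- One step of state evolution. -/
lemma EvolSent.succ (h : EvolSent P e ρ snd Θ k s) : Evol P e ρ snd Θ (k + 1) (lstep snd Θ ρ k s) where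
  approx_dirs j b := by
    by_cases hj : j = k
    · subst hj
      rcases bool_eq_or b (snd j) with rfl | rfl
      · rw [lstep_self]
        simp only [hst_succ', dirs_step_self]
        exact h.dir_sent
      · rw [lstep_not]
        simp only [hst_succ', dirs_step_not]
        exact h.dir_received
    · rw [lstep_of_ne hj]
      simp only [hst_succ', dirs_step_of_ne _ _ _ _ _ _ hj]
      exact h.evol.approx_dirs j b
  approx_msgs j b := by
    by_cases hj : j = k
    · subst hj
      rcases bool_eq_or b (snd j) with rfl | rfl
      · rw [lstep_self]
        simp only [hst_succ', msgs_step_self]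
        exact h.sent
      · rw [lstep_not]
        simp only [hst_succ', msgs_step_not]
        exact h.msg_received
    · rw [lstep_of_ne hj]
      simp only [hst_succ', msgs_step_of_ne _ _ _ _ _ _ hj]
      exact h.evol.approx_msgs j b
  rep := by
    obtain ⟨T, hT⟩ := h.evol.rep
    -- The new direction is the message minus its components along the earlier directions, divided
    -- by the norm of the residual.
    refine ⟨fun j i => if j = k then (lnorm snd Θ ρ k s)⁻¹ * (if i = k then 1 else
      - ∑ m ∈ Finset.range k, lcoef snd Θ ρ k s m * T m i) else if i = k then 0 else T j i,
      fun j b a => ?_⟩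
    rw [Finset.sum_range_succ]
    by_cases hj : j = k
    · subst hj
      simp only [if_true]
      have e1 : ∀ i ∈ Finset.range j, (lnorm snd Θ ρ j s)⁻¹ * (if i = j then 1 else
          - ∑ m ∈ Finset.range j, lcoef snd Θ ρ j s m * T m i) * (lstep snd Θ ρ j s i b).1 a =
          - ((lnorm snd Θ ρ j s)⁻¹ * ∑ m ∈ Finset.range j,
            lcoef snd Θ ρ j s m * T m i * (s i b).1 a) := by
        intro i hi
        have hij : i ≠ j := (Finset.mem_range.1 hi).ne
        rw [if_neg hij, lstep_of_ne hij, ← Finset.sum_mul]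
        ring
      have e2 : ∑ i ∈ Finset.range j, ∑ m ∈ Finset.range j,
          lcoef snd Θ ρ j s m * T m i * (s i b).1 a =
          ∑ m ∈ Finset.range j, lcoef snd Θ ρ j s m * (s m b).2 a := by
        rw [Finset.sum_comm]
        refine Finset.sum_congr rfl fun m _ => ?_
        rw [hT m b a, Finset.mul_sum]
        exact Finset.sum_congr rfl fun i _ => by ring
      rw [Finset.sum_congr rfl e1, Finset.sum_neg_distrib, ← Finset.mul_sum, e2]
      rcases bool_eq_or b (snd j) with rfl | rfl
      · rw [lstep_self]
        simp only [lres]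
        ring
      · rw [lstep_not]
        simp only [lnoise]
        split_ifs with h0
        · simp [h0]
        · field_simp
          ring
    · simp only [lstep_of_ne hj, hT j b a, hj, if_false, if_true, zero_mul, add_zero]
      refine Finset.sum_congr rfl fun i hi => ?_
      have hik : i ≠ k := (Finset.mem_range.1 hi).ne
      rw [if_neg hik, lstep_of_ne hik]
  past j b a z i hi := by
    have hp := fun j b => h.evol.past j b a z i (by omega)
    have hsent : lsent snd Θ k s (upd i a z) = lsent snd Θ k s a := by
      rw [lsent, lsent]
      congr 1
      exact Prod.ext rfl (funext fun j => (hp j _).1)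
    by_cases hj : j = k
    · subst hj
      rcases bool_eq_or b (snd j) with rfl | rfl
      · rw [lstep_self]
        simp only [lres, hsent, (hp _ _).2, and_self]
      · rw [lstep_not]
        have e1 : (upd i a z).2 j = a.2 j := by
          rw [upd]; exact Function.update_of_ne (by omega) _ _
        simp only [lnoise, e1, (hp _ _).2, and_self]
    · rw [lstep_of_ne hj]
      exact hp j b
  dom b := by
    rcases bool_eq_or b (snd k) with rfl | rfl
    · exact h.dom_sent
    · rcases eq_or_ne (lnorm snd Θ ρ k s) 0 with h0 | h0
      · exact h.dom_received_of_degenerate h0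
      · exact h.dom_received (lt_of_le_of_ne lnorm_nonneg h0.symm)

lemma evol_zero (M : Model P e ρ Θ) : Evol P e ρ snd Θ 0 (lrun snd Θ ρ 0) where
  approx_dirs j b := by
    have e1 : (fun (N : ℕ) (a : HatΩ Ω N) n => √N * dirs (hst e snd Θ 0 N a) b j n) =
        fun _ _ _ => 0 := by
      ext N a n
      exact mul_zero _
    rw [e1]
    exact Approx.zero
  approx_msgs j b := Approx.zero
  rep := ⟨0, fun j b a => by simp [lrun]⟩
  past j b a z i _ := ⟨rfl, rfl⟩
  dom b := by
    have hy := iidRows_nrow (M.iid b)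
    have hm : Measurable (lrow (lrun snd Θ ρ 0 : LimState E) b) :=
      measurable_fst.prodMk (measurable_pi_iff.2 fun j => measurable_const)
    have : IsProbabilityMeasure ((rowLaw (ρ b)).map (lrow (lrun snd Θ ρ 0) b)) :=
      Measure.isProbabilityMeasure_map hm.aemeasurable
    refine dom_zero fun N n => ?_
    rw [← hy.law_row N n, Measure.map_map hm (hy.measurable_row N n)]
    rfl

/-- State evolution: as long as the messages sent are uniformly square integrable, the process is
asymptotically described by the limit process. -/
theorem evol_run (M : Model P e ρ Θ) (k : ℕ)
    (hU : ∀ j < k, UnifSq (fun p : (Σ N, Fin N) => hatP P p.1)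
      fun p a => hsent e snd Θ j p.1 a p.2) :
    Evol P e ρ snd Θ k (lrun snd Θ ρ k) := by
  induction k with
  | zero => exact evol_zero M
  | succ k ih =>
    have h := ih fun j hj => hU j (by omega)
    exact (⟨M, h, h.sent M (hU k (by omega))⟩ : EvolSent P e ρ snd Θ k _).succ

end EvolutionStep

end OAMP


namespace OAMP

open Filter Topology
open scoped ENNReal

/-! ### Linear forms in Gaussian noise -/

section LinearForms

/-- The linear form in the first `K` coordinates with coefficients `c`. -/
def lin (K : ℕ) (c : ℕ → ℝ) (ζ : ℕ → ℝ) : ℝ := ∑ i ∈ Finset.range K, c i * ζ i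

lemma measurable_lin (K : ℕ) (c : ℕ → ℝ) : Measurable (lin K c) := by
  unfold lin; fun_prop

lemma seqG_hasGaussianLaw (K : ℕ) : HasGaussianLaw (fun (ζ : ℕ → ℝ) (i : Fin K) => ζ i) seqG := by
  have h1 : iIndepFun (fun (i : ℕ) (ζ : ℕ → ℝ) => ζ i) seqG :=
    iIndepFun_infinitePi (P := fun _ : ℕ => gaussianReal 0 1) (X := fun _ => id)
      fun _ => measurable_id
  refine (h1.precomp (g := fun i : Fin K => (i : ℕ)) Fin.val_injective).hasGaussianLaw fun i => ?_
  refine ⟨?_⟩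
  have : seqG.map (fun ζ => ζ (i : ℕ)) = gaussianReal 0 1 :=
    (measurePreserving_eval_infinitePi (fun _ : ℕ => gaussianReal 0 1) i).map_eq
  rw [this]; infer_instance

lemma seqG_map_eval (i : ℕ) : seqG.map (fun ζ => ζ i) = gaussianReal 0 1 :=
  (measurePreserving_eval_infinitePi (fun _ : ℕ => gaussianReal 0 1) i).map_eq

lemma memLp_seqG_eval (i : ℕ) : MemLp (fun ζ : ℕ → ℝ => ζ i) 2 seqG := by
  have h := memLp_id_gaussianReal (μ := 0) (v := 1) 2
  rw [← seqG_map_eval i] at h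
  exact h.comp_measurePreserving ⟨measurable_pi_apply i, rfl⟩

lemma integral_seqG_eval (i : ℕ) : ∫ ζ, ζ i ∂seqG = 0 := by
  have h := integral_id_gaussianReal (μ := 0) (v := 1)
  rw [← seqG_map_eval i] at h
  have hm : Measurable fun ζ : ℕ → ℝ => ζ i := measurable_pi_apply i
  rwa [integral_map hm.aemeasurable (by fun_prop)] at h

lemma covariance_seqG_eval (i j : ℕ) :
    cov[fun ζ => ζ i, fun ζ => ζ j; seqG] = if i = j then 1 else 0 := by
  split_ifs with h
  · subst h
    rw [covariance_self (measurable_pi_apply i).aemeasurable]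
    have := variance_map (μ := seqG) (X := id) (Y := fun ζ : ℕ → ℝ => ζ i) aemeasurable_id
      (measurable_pi_apply i).aemeasurable
    rw [seqG_map_eval, variance_id_gaussianReal] at this
    exact this.symm
  · have h1 : iIndepFun (fun (i : ℕ) (ζ : ℕ → ℝ) => ζ i) seqG :=
      iIndepFun_infinitePi (P := fun _ : ℕ => gaussianReal 0 1) (X := fun _ => id)
        fun _ => measurable_id
    exact (h1.indepFun h).covariance_eq_zero (memLp_seqG_eval i) (memLp_seqG_eval j)

lemma integral_lin (K : ℕ) (c : ℕ → ℝ) : ∫ ζ, lin K c ζ ∂seqG = 0 := by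
  unfold lin
  rw [integral_finsetSum _ fun i _ => ((memLp_seqG_eval i).integrable one_le_two).const_mul _]
  simp [integral_const_mul, integral_seqG_eval]

lemma covariance_lin (K : ℕ) (c d : ℕ → ℝ) :
    cov[lin K c, lin K d; seqG] = ∑ i ∈ Finset.range K, c i * d i := by
  unfold lin
  rw [covariance_fun_sum_fun_sum' (fun i _ => (memLp_seqG_eval i).const_mul _)
    (fun i _ => (memLp_seqG_eval i).const_mul _)]
  refine Finset.sum_congr rfl fun i hi => ?_
  simp only [covariance_const_mul_left, covariance_const_mul_right, covariance_seqG_eval]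
  rw [Finset.sum_eq_single_of_mem i hi fun j _ hj => by rw [if_neg (Ne.symm hj)]; ring]
  rw [if_pos rfl]; ring

/-- The linear form as a continuous linear map. -/
noncomputable def linCLM (K : ℕ) (c : ℕ → ℝ) : (Fin K → ℝ) →L[ℝ] ℝ :=
  ∑ i : Fin K, c i • ContinuousLinearMap.proj i

lemma linCLM_apply (K : ℕ) (c : ℕ → ℝ) (ζ : ℕ → ℝ) :
    linCLM K c (fun i => ζ i) = lin K c ζ := by
  simp [linCLM, lin, Finset.sum_range]

/-- A linear form is independent of the pair formed by two linear forms orthogonal to it. -/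
lemma indepFun_lin (K : ℕ) {c d t : ℕ → ℝ} (hc : ∑ i ∈ Finset.range K, c i * t i = 0)
    (hd : ∑ i ∈ Finset.range K, d i * t i = 0) :
    IndepFun (fun ζ => (lin K c ζ, lin K d ζ)) (lin K t) seqG := by
  let X : Fin 2 → (ℕ → ℝ) → ℝ := ![lin K c, lin K d]
  let Y : Fin 1 → (ℕ → ℝ) → ℝ := fun _ => lin K t
  have hG : HasGaussianLaw (fun ζ => (fun i => X i ζ, fun j => Y j ζ)) seqG := by
    have := (seqG_hasGaussianLaw K).map
      ((ContinuousLinearMap.pi ![linCLM K c, linCLM K d]).prod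
        (ContinuousLinearMap.pi fun _ : Fin 1 => linCLM K t))
    refine this.congr (Eventually.of_forall fun ζ => Prod.ext (funext fun i => ?_)
      (funext fun j => linCLM_apply K t ζ))
    fin_cases i
    · exact linCLM_apply K c ζ
    · exact linCLM_apply K d ζ
  have hI := hG.indepFun_of_covariance_eval fun i j => by
    fin_cases i
    · exact (covariance_lin K c t).trans hc
    · exact (covariance_lin K d t).trans hd
  exact hI.comp (φ := fun x : Fin 2 → ℝ => (x 0, x 1)) (ψ := fun y : Fin 1 → ℝ => y 0)
    (by fun_prop) (by fun_prop)

variable {E : Type*} [MeasurableSpace E] (ρ : Measure E) [IsProbabilityMeasure ρ]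

lemma memLp_lin_row (K : ℕ) (c : ℕ → ℝ) :
    MemLp (fun a : E × (ℕ → ℝ) => lin K c a.2) 2 (rowLaw ρ) :=
  memLp_finsetSum _ fun i _ => (memLp_col ρ i).const_mul _

/-- The correlation of a noise variable with a function of the linear form `lin K c`, of the noise
`0` and of the primitives is carried by the correlation with the linear form. -/
lemma integral_mul_lin {K : ℕ} {c : ℕ → ℝ} (c0 : c 0 = 0) {h : E × ℝ × ℝ → ℝ} (hm : Measurable h)
    (hL : MemLp (fun a : E × (ℕ → ℝ) => h (a.1, a.2 0, lin K c a.2)) 2 (rowLaw ρ)) {j : ℕ}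
    (hj0 : j ≠ 0) (hj : j < K) :
    (∑ i ∈ Finset.range K, c i * c i) *
        ∫ a : E × (ℕ → ℝ), h (a.1, a.2 0, lin K c a.2) * a.2 j ∂(rowLaw ρ) =
      c j * ∫ a : E × (ℕ → ℝ), h (a.1, a.2 0, lin K c a.2) * lin K c a.2 ∂(rowLaw ρ) := by
  set q : ℝ := ∑ i ∈ Finset.range K, c i * c i with hq
  -- `lin K t` is `q` times the component of coordinate `j` orthogonal to `lin K c`; it is
  -- independent of `lin K c` and of coordinate `0`.
  set t : ℕ → ℝ := fun i => (if i = j then q else 0) - c j * c i with ht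
  have hK0 : 0 ∈ Finset.range K := Finset.mem_range.2 (Nat.lt_of_le_of_lt (Nat.zero_le _) hj)
  have e0 : ∀ ζ : ℕ → ℝ, lin K (fun i => if i = 0 then 1 else 0) ζ = ζ 0 := fun ζ => by
    rw [lin, Finset.sum_eq_single_of_mem 0 hK0 fun i _ hi => by rw [if_neg hi, zero_mul]]
    simp
  have et : ∀ ζ : ℕ → ℝ, lin K t ζ = q * ζ j - c j * lin K c ζ := fun ζ => by
    simp only [lin, ht, sub_mul, Finset.sum_sub_distrib, Finset.mul_sum, mul_assoc]
    rw [Finset.sum_eq_single_of_mem j (Finset.mem_range.2 hj)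
      fun i _ hi => by rw [if_neg hi, zero_mul], if_pos rfl]
  have hind := indepFun_lin K (c := fun i => if i = 0 then 1 else 0) (d := c) (t := t) (by
      rw [Finset.sum_eq_single_of_mem 0 hK0 fun i _ hi => by rw [if_neg hi, zero_mul]]
      simp [ht, c0, hj0.symm]) (by
      simp only [ht, mul_sub, Finset.sum_sub_distrib]
      rw [Finset.sum_eq_single_of_mem j (Finset.mem_range.2 hj)
        fun i _ hi => by rw [if_neg hi, mul_zero], if_pos rfl, hq, Finset.mul_sum,
        ← Finset.sum_sub_distrib]
      exact Finset.sum_eq_zero fun i _ => by ring)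
  have hi1 : Integrable (fun a : E × (ℕ → ℝ) => h (a.1, a.2 0, lin K c a.2) * a.2 j) (rowLaw ρ) :=
    hL.integrable_mul (memLp_col ρ j)
  have hi2 : Integrable (fun a : E × (ℕ → ℝ) => h (a.1, a.2 0, lin K c a.2) * lin K c a.2)
    (rowLaw ρ) := hL.integrable_mul (memLp_lin_row ρ K c)
  have key : ∫ a : E × (ℕ → ℝ), h (a.1, a.2 0, lin K c a.2) * lin K t a.2 ∂(rowLaw ρ) = 0 := by
    have hi3 : Integrable (fun a : E × (ℕ → ℝ) => h (a.1, a.2 0, lin K c a.2) * lin K t a.2)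
      (rowLaw ρ) := hL.integrable_mul (memLp_lin_row ρ K t)
    rw [integral_prod _ hi3]
    refine (integral_congr_ae (Eventually.of_forall fun x => ?_)).trans (integral_zero _ _)
    simp only [e0] at hind
    have hi : IndepFun (fun ζ : ℕ → ℝ => h (x, ζ 0, lin K c ζ)) (lin K t) seqG :=
      hind.comp (φ := fun y => h (x, y)) (hm.comp measurable_prodMk_left) measurable_id
    have h1 := hi.integral_fun_mul_eq_mul_integral
      ((hm.comp ((measurable_const (a := x)).prodMk ((measurable_pi_apply 0).prodMk
        (measurable_lin K c)))).aestronglyMeasurable) (measurable_lin K t).aestronglyMeasurable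
    rw [integral_lin, mul_zero] at h1
    exact h1
  have e1 : (fun a : E × (ℕ → ℝ) => h (a.1, a.2 0, lin K c a.2) * lin K t a.2) = fun a =>
      q * (h (a.1, a.2 0, lin K c a.2) * a.2 j) -
        c j * (h (a.1, a.2 0, lin K c a.2) * lin K c a.2) := by
    ext a; rw [et]; ring
  rw [e1, integral_sub (hi1.const_mul _) (hi2.const_mul _), integral_const_mul,
    integral_const_mul] at key
  linarith

end LinearForms

end OAMP


namespace OAMP

open Filter Topology
open scoped ENNReal

/-! ### The limit process under the orthogonality condition -/

section LimitOrthogonal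

lemma integrable_mul_of_memLp {α : Type*} [MeasurableSpace α] {μ : Measure α} {f g : α → ℝ}
    (hf : MemLp f 2 μ) (hg : MemLp g 2 μ) : Integrable (fun a => f a * g a) μ :=
  hf.integrable_mul hg

set_option linter.unusedSectionVars false

variable {E : Type*} [MeasurableSpace E] {snd : ℕ → Bool} {Θ : ℕ → E × (ℕ → ℝ) → ℝ}
  {ρ : Bool → Measure E}

lemma lrun_of_lt {j K : ℕ} (h : j < K) : lrun snd Θ ρ K j = lrun snd Θ ρ (j + 1) j := by
  induction K with
  | zero => omega
  | succ K ih =>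
    rcases Nat.lt_succ_iff_lt_or_eq.1 h with h | rfl
    · rw [← ih h]; exact lstep_of_ne h.ne _
    · rfl

/-- The message functions of a process which starts by sending the signal `σ` from side `true` and
in which, afterwards, an entry of the message sent in step `k` depends only on the primitives,
the signal and the message received in step `prev k`, if this is not zero. -/
structure Scheme (snd : ℕ → Bool) (Θ : ℕ → E × (ℕ → ℝ) → ℝ) (σ : E → ℝ) (prev : ℕ → ℕ) : Prop where
  snd_zero : snd 0 = true
  measurable_signal : Measurable σ
  first : ∀ p, Θ 0 p = σ p.1
  prev_lt : ∀ k ≥ 1, prev k < k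
  snd_prev : ∀ k ≥ 1, prev k ≠ 0 → snd (prev k) = !snd k
  memory : ∀ k ≥ 1, ∃ h : E × ℝ × ℝ → ℝ, Measurable h ∧ ∀ p, Θ k p = h (p.1, p.2 0, p.2 (prev k))

/-- The limit of the signal: the signal itself on side `true`, and Gaussian noise on side
`false`. -/
def lsig (σ : E → ℝ) (b : Bool) (a : E × (ℕ → ℝ)) : ℝ := if b then σ a.1 else a.2 0

lemma measurable_lsig {σ : E → ℝ} (hσ : Measurable σ) (b : Bool) : Measurable (lsig σ b) := by
  cases b
  · exact measurable_col 0
  · exact hσ.comp measurable_fst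

lemma lsig_upd (σ : E → ℝ) (b : Bool) {i : ℕ} (hi : i ≠ 0) (a : E × (ℕ → ℝ)) (z : ℝ) :
    lsig σ b (upd i a z) = lsig σ b a := by
  cases b <;> simp [lsig, upd, hi.symm]

variable {σ : E → ℝ} {prev : ℕ → ℕ} [∀ b, IsProbabilityMeasure (ρ b)]

lemma integral_lsig_sq (h1 : ∫ y, σ y ^ 2 ∂(ρ true) = 1) (hσ : Measurable σ) (b : Bool) :
    ∫ a, lsig σ b a * lsig σ b a ∂(rowLaw (ρ b)) = 1 := by
  cases b
  · exact integral_col_sq (ρ false) 0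
  · have e : ∀ a : E × (ℕ → ℝ), lsig σ true a * lsig σ true a = (fun y => σ y ^ 2) a.1 := fun a => by
      simp [lsig, sq]
    simp only [e]
    rw [← h1]
    have h2 := (measurePreserving_fst (μ := ρ true) (ν := seqG)).map_eq
    conv_rhs => rw [← h2]
    rw [integral_map measurable_fst.aemeasurable (hσ.pow_const 2).aestronglyMeasurable]

lemma memLp_lsig (h1 : ∫ y, σ y ^ 2 ∂(ρ true) = 1) (hσ : Measurable σ) (b : Bool) :
    MemLp (lsig σ b) 2 (rowLaw (ρ b)) := by
  rw [memLp_two_iff_integrable_sq (measurable_lsig hσ b).aestronglyMeasurable]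
  by_contra h
  have h2 := integral_lsig_sq h1 hσ b
  simp only [← sq] at h2
  rw [integral_undef h] at h2
  exact zero_ne_one h2

/-- The signal is uncorrelated with the noise of the later steps. -/
lemma integral_lsig_mul_lin (h1 : ∫ y, σ y ^ 2 ∂(ρ true) = 1) (hσ : Measurable σ) (b : Bool)
    (K : ℕ) {c : ℕ → ℝ} (c0 : c 0 = 0) :
    ∫ a, lsig σ b a * lin K c a.2 ∂(rowLaw (ρ b)) = 0 := by
  have e : ∀ a : E × (ℕ → ℝ), lsig σ b a * lin K c a.2 =
      ∑ i ∈ Finset.range K, c i * (a.2 i * lsig σ b a) := fun a => by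
    rw [lin, Finset.mul_sum]
    exact Finset.sum_congr rfl fun i _ => by ring
  simp only [e]
  have hL := memLp_lsig h1 hσ b
  rw [integral_finsetSum _ fun i _ =>
    (integrable_mul_of_memLp (memLp_col (ρ b) i) hL).const_mul _]
  refine Finset.sum_eq_zero fun i _ => ?_
  rw [integral_const_mul]
  by_cases hi : i = 0
  · rw [hi, c0, zero_mul]
  · rw [integral_col_mul (ρ b) i hL (measurable_lsig hσ b) fun a z => lsig_upd σ b hi a z, mul_zero]

lemma Scheme.lrun_zero (S : Scheme snd Θ σ prev) (h1 : ∫ y, σ y ^ 2 ∂(ρ true) = 1) (b : Bool) {K : ℕ}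
    (hK : 0 < K) : lrun snd Θ ρ K 0 b = (lsig σ b, lsig σ b) := by
  have hs : lsent snd Θ 0 (lrun snd Θ ρ 0) = lsig σ true := by
    ext a; simp [lsent, S.first, lrow, lsig]
  have hr : lres snd Θ ρ 0 (lrun snd Θ ρ 0) = lsig σ true := by
    ext a; simp [lres, hs]
  have hn : lnorm snd Θ ρ 0 (lrun snd Θ ρ 0) = 1 := by
    rw [lnorm, hr, S.snd_zero, integral_lsig_sq h1 S.measurable_signal, Real.sqrt_one]
  rw [lrun_of_lt hK]
  cases b
  · have := lstep_not (snd := snd) (Θ := Θ) (ρ := ρ) 0 (lrun snd Θ ρ 0)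
    rw [S.snd_zero] at this
    refine this.trans ?_
    refine Prod.ext (funext fun a => ?_) (funext fun a => ?_) <;> simp [hn, lnoise, lsig]
  · have := lstep_self (snd := snd) (Θ := Θ) (ρ := ρ) 0 (lrun snd Θ ρ 0)
    rw [S.snd_zero] at this
    refine this.trans ?_
    rw [hs, hr, hn]
    simp

lemma lrun_received (k : ℕ) : lrun snd Θ ρ (k + 1) k (!snd k) =
    (fun a => ∑ j ∈ Finset.range k, lcoef snd Θ ρ k (lrun snd Θ ρ k) j *
        (lrun snd Θ ρ k j (!snd k)).2 a +
      lnorm snd Θ ρ k (lrun snd Θ ρ k) * lnoise snd Θ ρ k (lrun snd Θ ρ k) a,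
      lnoise snd Θ ρ k (lrun snd Θ ρ k)) := lstep_not k _

lemma exists_lnoise (k : ℕ) (s : LimState E) :
    ∃ ν : ℝ, ∀ a, lnoise snd Θ ρ k s a = ν * a.2 k := by
  by_cases h : lnorm snd Θ ρ k s = 0
  · exact ⟨0, fun a => by simp [lnoise, h]⟩
  · exact ⟨1, fun a => by simp [lnoise, h]⟩

/-- In the limit, the errors of the previously received message and of the message sent are
uncorrelated. -/
def LimOrth (snd : ℕ → Bool) (Θ : ℕ → E × (ℕ → ℝ) → ℝ) (ρ : Bool → Measure E) (σ : E → ℝ)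
    (prev : ℕ → ℕ) (k : ℕ) : Prop :=
  ∫ a, ((lrun snd Θ ρ (k + 1) k (snd k)).1 a - (∫ a', lsig σ (snd k) a' *
      (lrun snd Θ ρ (k + 1) k (snd k)).1 a' ∂(rowLaw (ρ (snd k)))) * lsig σ (snd k) a) *
    ((lrun snd Θ ρ (k + 1) (prev k) (snd k)).1 a - (∫ a', lsig σ (snd k) a' *
      (lrun snd Θ ρ (k + 1) (prev k) (snd k)).1 a' ∂(rowLaw (ρ (snd k)))) * lsig σ (snd k) a)
    ∂(rowLaw (ρ (snd k))) = 0

/-- Under the orthogonality condition the message sent is uncorrelated with the noise in the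
messages received. -/
lemma Scheme.lcoef_eq_zero (S : Scheme snd Θ σ prev) (h1 : ∫ y, σ y ^ 2 ∂(ρ true) = 1) {k : ℕ}
    (hk : 1 ≤ k) (hL : MemLp (lsent snd Θ k (lrun snd Θ ρ k)) 2 (rowLaw (ρ (snd k))))
    (hm : Measurable (lsent snd Θ k (lrun snd Θ ρ k)))
    (hO : prev k ≠ 0 → LimOrth snd Θ ρ σ prev k)
    (ih : prev k ≠ 0 → ∃ (l : ℝ) (c : ℕ → ℝ), c 0 = 0 ∧
      ∀ a, (lrun snd Θ ρ (prev k + 1) (prev k) (snd k)).1 a = l * lsig σ (snd k) a + lin k c a.2)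
    {j : ℕ} (hj0 : j ≠ 0) (hj : j < k) (hjk : snd k = !snd j) :
    lcoef snd Θ ρ k (lrun snd Θ ρ k) j = 0 := by
  have hσ := S.measurable_signal
  obtain ⟨h, hhm, hh⟩ := S.memory k hk
  obtain ⟨ν, hν⟩ := exists_lnoise (snd := snd) (Θ := Θ) (ρ := ρ) j (lrun snd Θ ρ j)
  have hD : ∀ a, (lrun snd Θ ρ k j (snd k)).2 a = ν * a.2 j := fun a => by
    rw [lrun_of_lt hj, hjk, lrun_received]; exact hν a
  have hlr : ∀ a i, (lrow (lrun snd Θ ρ k) (snd k) a).2 i = (lrun snd Θ ρ k i (snd k)).1 a :=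
    fun a i => rfl
  have hSe : ∀ a, lsent snd Θ k (lrun snd Θ ρ k) a = h (a.1, lsig σ (snd k) a,
      (lrun snd Θ ρ k (prev k) (snd k)).1 a) := fun a => by
    rw [lsent, hh, hlr, hlr, S.lrun_zero h1 _ hk]; rfl
  have hcoef : lcoef snd Θ ρ k (lrun snd Θ ρ k) j =
      ν * ∫ a, lsent snd Θ k (lrun snd Θ ρ k) a * a.2 j ∂(rowLaw (ρ (snd k))) := by
    rw [lcoef, ← integral_const_mul]
    exact integral_congr_ae (Eventually.of_forall fun a => by simp only [hD]; ring)
  -- it remains to show that the message sent is uncorrelated with the noise of step `j`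
  have main : ∫ a, lsent snd Θ k (lrun snd Θ ρ k) a * a.2 j ∂(rowLaw (ρ (snd k))) = 0 := by
    have triv : (∀ a z, lsent snd Θ k (lrun snd Θ ρ k) (upd j a z) =
        lsent snd Θ k (lrun snd Θ ρ k) a) →
        ∫ a, lsent snd Θ k (lrun snd Θ ρ k) a * a.2 j ∂(rowLaw (ρ (snd k))) = 0 := fun hp => by
      simp only [mul_comm (lsent snd Θ k (lrun snd Θ ρ k) _)]
      exact integral_col_mul _ j hL hm hp
    by_cases hp : prev k = 0
    · refine triv fun a z => ?_
      rw [hSe, hSe, hp, S.lrun_zero h1 _ hk]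
      simp only [lsig_upd σ _ hj0]
      rfl
    obtain ⟨l, c, c0, hc⟩ := ih hp
    have hX : ∀ a, (lrun snd Θ ρ k (prev k) (snd k)).1 a = l * lsig σ (snd k) a + lin k c a.2 :=
      fun a => by rw [lrun_of_lt (S.prev_lt k hk), hc]
    by_cases hq : ∑ i ∈ Finset.range k, c i * c i = 0
    · have hci : ∀ i ∈ Finset.range k, c i = 0 := fun i hi =>
        mul_self_eq_zero.1 ((Finset.sum_eq_zero_iff_of_nonneg fun i _ => mul_self_nonneg (c i)).1 hq
          i hi)
      have hl0 : ∀ ζ, lin k c ζ = 0 := fun ζ =>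
        Finset.sum_eq_zero fun i hi => by rw [hci i hi, zero_mul]
      refine triv fun a z => ?_
      rw [hSe, hSe, hX, hX]
      simp only [lsig_upd σ _ hj0, hl0]
      rfl
    · let g : E × ℝ × ℝ → ℝ := fun p => h (p.1, if snd k then σ p.1 else p.2.1,
        l * (if snd k then σ p.1 else p.2.1) + p.2.2)
      have hgm : Measurable g := by
        have h3 : Measurable fun p : E × ℝ × ℝ => if snd k then σ p.1 else p.2.1 := by
          split_ifs
          · exact hσ.comp measurable_fst
          · fun_prop
        exact hhm.comp (measurable_fst.prodMk (h3.prodMk ((h3.const_mul l).add (by fun_prop))))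
      have hg : ∀ a, lsent snd Θ k (lrun snd Θ ρ k) a = g (a.1, a.2 0, lin k c a.2) := fun a => by
        rw [hSe, hX]; rfl
      have hg' : lsent snd Θ k (lrun snd Θ ρ k) = fun a => g (a.1, a.2 0, lin k c a.2) := funext hg
      have key := integral_mul_lin (ρ (snd k)) c0 hgm (hg' ▸ hL) hj0 hj
      simp only [← hg] at key
      -- the orthogonality condition
      have hO' := hO hp
      have hs : lrun snd Θ ρ (k + 1) k (snd k) = _ := lstep_self k _
      have hpr : ∀ a, (lrun snd Θ ρ (k + 1) (prev k) (snd k)).1 a =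
          l * lsig σ (snd k) a + lin k c a.2 := fun a => by
        rw [lrun_of_lt (Nat.lt_succ_of_lt (S.prev_lt k hk)), hc]
      have hLs := memLp_lsig (ρ := ρ) h1 hσ (snd k)
      have hLl := memLp_lin_row (ρ (snd k)) k c
      have hz := integral_lsig_mul_lin (ρ := ρ) h1 hσ (snd k) k c0
      have hl : ∫ a', lsig σ (snd k) a' * (lrun snd Θ ρ (k + 1) (prev k) (snd k)).1 a'
          ∂(rowLaw (ρ (snd k))) = l := by
        simp only [hpr, mul_add, mul_left_comm _ l]
        rw [integral_add ((integrable_mul_of_memLp hLs hLs).const_mul l)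
          (integrable_mul_of_memLp hLs hLl),
          integral_const_mul, integral_lsig_sq h1 hσ, hz]
        ring
      rw [LimOrth, hl, hs] at hO'
      simp only [hpr, add_sub_cancel_left, sub_mul, mul_assoc] at hO'
      rw [integral_sub (integrable_mul_of_memLp hL hLl)
        ((integrable_mul_of_memLp hLs hLl).const_mul _),
        integral_const_mul, hz, mul_zero, sub_zero] at hO'
      rw [hO', mul_zero] at key
      exact (mul_eq_zero.1 key).resolve_left hq
  rw [hcoef, main, mul_zero]

/-- Under the orthogonality condition the limits of the messages received are combinations of the
signal and of Gaussian noise independent of the signal. -/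
theorem Scheme.received_eq (S : Scheme snd Θ σ prev) (h1 : ∫ y, σ y ^ 2 ∂(ρ true) = 1)
    (hL : ∀ k, MemLp (lsent snd Θ k (lrun snd Θ ρ k)) 2 (rowLaw (ρ (snd k))))
    (hm : ∀ k, Measurable (lsent snd Θ k (lrun snd Θ ρ k)))
    (hO : ∀ k ≥ 1, prev k ≠ 0 → LimOrth snd Θ ρ σ prev k) (k : ℕ) (hk : 1 ≤ k) :
    ∃ (l : ℝ) (c : ℕ → ℝ), c 0 = 0 ∧ (∀ i > k, c i = 0) ∧ ∀ K > k,
      ∀ a, (lrun snd Θ ρ (k + 1) k (!snd k)).1 a = l * lsig σ (!snd k) a + lin K c a.2 := by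
  induction k using Nat.strong_induction_on with
  | _ k ih =>
    have hz : ∀ j, j ≠ 0 → j < k → snd k = !snd j → lcoef snd Θ ρ k (lrun snd Θ ρ k) j = 0 := by
      intro j hj0 hj hjk
      refine S.lcoef_eq_zero h1 hk (hL k) (hm k) (hO k hk) (fun hp => ?_) hj0 hj hjk
      obtain ⟨l, c, c0, -, hc⟩ := ih _ (S.prev_lt k hk) (Nat.pos_of_ne_zero hp)
      have e : snd k = !snd (prev k) := by rw [S.snd_prev k hk hp, Bool.not_not]
      refine ⟨l, c, c0, fun a => ?_⟩
      rw [e]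
      exact hc k (S.prev_lt k hk) a
    choose ν hν using fun j => exists_lnoise (snd := snd) (Θ := Θ) (ρ := ρ) j (lrun snd Θ ρ j)
    -- Noise `i` enters through the direction of step `i`. The coefficient of the message along that
    -- direction vanishes if side `!snd k` sent it, and along direction `0` it multiplies the signal.
    let c : ℕ → ℝ := fun i => if i = 0 then 0 else if i < k then
        (if snd k = !snd i then 0 else lcoef snd Θ ρ k (lrun snd Θ ρ k) i * ν i)
      else if i = k then lnorm snd Θ ρ k (lrun snd Θ ρ k) * ν k else 0
    have hk0 : k ≠ 0 := by omega
    have hcz : ∀ i > k, c i = 0 := fun i hi => by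
      simp only [c]
      rw [if_neg (by omega), if_neg (by omega), if_neg (by omega)]
    refine ⟨lcoef snd Θ ρ k (lrun snd Θ ρ k) 0, c, by simp [c], hcz, fun K hK a => ?_⟩
    have hlin : lin K c a.2 = lin (k + 1) c a.2 := by
      refine (Finset.sum_subset (Finset.range_subset_range.2 hK) fun i _ hi => ?_).symm
      rw [hcz i (by simpa using hi), zero_mul]
    rw [hlin, lin, Finset.sum_range_succ, lrun_received]
    have hck : c k = lnorm snd Θ ρ k (lrun snd Θ ρ k) * ν k := by simp [c, hk0]
    simp only
    rw [hck, hν k a, mul_assoc, ← add_assoc]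
    congr 1
    have hd : ∀ j ∈ Finset.range k, lcoef snd Θ ρ k (lrun snd Θ ρ k) j *
        (lrun snd Θ ρ k j (!snd k)).2 a - c j * a.2 j =
        if j = 0 then lcoef snd Θ ρ k (lrun snd Θ ρ k) 0 * lsig σ (!snd k) a else 0 := by
      intro j hj
      have hj := Finset.mem_range.1 hj
      by_cases hj0 : j = 0
      · subst hj0
        rw [if_pos rfl, S.lrun_zero h1 _ hj]
        simp [c]
      · rw [if_neg hj0]
        by_cases hjk : snd k = !snd j
        · rw [hz j hj0 hj hjk]
          simp only [c]
          rw [if_neg hj0, if_pos hj, if_pos hjk]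
          ring
        · have hjk' : snd k = snd j := by
            cases h3 : snd k <;> cases h4 : snd j <;> simp_all
          simp only [c]
          rw [if_neg hj0, if_pos hj, if_neg hjk, hjk', lrun_of_lt hj, lrun_received]
          simp only [hν j a]
          ring
    have := Finset.sum_congr rfl hd
    rw [Finset.sum_sub_distrib, Finset.sum_ite_eq' , if_pos (Finset.mem_range.2 hk)] at this
    linarith

end LimitOrthogonal

end OAMP


namespace OAMP

open Filter Topology
open scoped ENNReal

/-! ### Convergence of expectations and asymptotic orthogonality -/

section Expectations

variable {Ω : ℕ → Type*} [∀ N, MeasurableSpace (Ω N)] {P : ∀ N, Measure (Ω N)}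

lemma measurable_ip {N : ℕ} {α : Type*} [MeasurableSpace α] {a b : α → Fin N → ℝ}
    (ha : Measurable a) (hb : Measurable b) : Measurable fun ω => ip (a ω) (b ω) :=
  (Measurable.dotProduct ha hb).div_const _

/-- The powers of a vector with uniformly square integrable entries are uniformly integrable. -/
lemma UnifSq.ip_unif_cont {a : ∀ N, Ω N → Fin N → ℝ} (ha : ∀ N, Measurable (a N))
    (hU : UnifSq (fun p : (Σ N, Fin N) => P p.1) fun p ω => a p.1 ω p.2) {ε : ℝ≥0∞} (hε : 0 < ε) :
    ∃ δ : ℝ≥0∞, 0 < δ ∧ ∀ N, ∀ S, MeasurableSet S → P N S ≤ δ →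
      ∫⁻ ω in S, ENNReal.ofReal (ip (a N ω) (a N ω)) ∂(P N) ≤ ε := by
  have ham : ∀ N n, Measurable fun ω => a N ω n := fun N n => (measurable_pi_apply n).comp (ha N)
  obtain ⟨δ, hδ, h⟩ := hU.unif_cont (fun p => ham p.1 p.2) hε
  refine ⟨δ, hδ, fun N S hS hPS => ?_⟩
  by_cases hN0 : N = 0
  · subst hN0; simp [ip]
  have e : ∀ ω, ENNReal.ofReal (ip (a N ω) (a N ω)) =
      (∑ n, ENNReal.ofReal ((a N ω n) ^ 2)) * (N : ℝ≥0∞)⁻¹ := by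
    intro ω
    rw [ip_eq_sum, ENNReal.ofReal_div_of_pos (Nat.cast_pos.2 (Nat.pos_of_ne_zero hN0)),
      ENNReal.ofReal_sum_of_nonneg (fun n _ => mul_self_nonneg _), ENNReal.ofReal_natCast,
      div_eq_mul_inv]
    simp only [sq]
  simp only [e]
  have hmm : ∀ n, Measurable fun ω => ENNReal.ofReal ((a N ω n) ^ 2) := fun n =>
    ((ham N n).pow_const 2).ennreal_ofReal
  rw [lintegral_mul_const _ (Finset.measurable_sum _ fun n _ => hmm n),
    lintegral_finsetSum _ fun n _ => hmm n]
  calc (∑ n, ∫⁻ ω in S, ENNReal.ofReal ((a N ω n) ^ 2) ∂(P N)) * (N : ℝ≥0∞)⁻¹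
      ≤ (∑ _n : Fin N, ε) * (N : ℝ≥0∞)⁻¹ := by
        gcongr with n
        exact h ⟨N, n⟩ S hS hPS
    _ = ε := by
        rw [Finset.sum_const, Finset.card_univ, Fintype.card_fin, nsmul_eq_mul, mul_comm,
          ← mul_assoc, ENNReal.inv_mul_cancel (by simpa using hN0) (by simp), one_mul]

variable [∀ N, IsProbabilityMeasure (P N)]

/-- Convergence in probability of variables dominated by the powers of vectors with uniformly
square integrable entries implies convergence of the expectations. -/
lemma tendsto_integral_of_dominated {T : ∀ N, Ω N → ℝ} {c C : ℝ} {a b : ∀ N, Ω N → Fin N → ℝ}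
    (hT : ∀ N, Measurable (T N)) (ha : ∀ N, Measurable (a N)) (hb : ∀ N, Measurable (b N))
    (hUa : UnifSq (fun p : (Σ N, Fin N) => P p.1) fun p ω => a p.1 ω p.2)
    (hUb : UnifSq (fun p : (Σ N, Fin N) => P p.1) fun p ω => b p.1 ω p.2)
    (hC : 0 ≤ C) (hdom : ∀ᶠ N in atTop, ∀ᵐ ω ∂(P N),
      |T N ω| ≤ C * (ip (a N ω) (a N ω) + ip (b N ω) (b N ω)))
    (hlim : Tendsto (fun x : Σ N, Ω N => T x.1 x.2) (glob P) (𝓝 c)) :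
    Tendsto (fun N => ∫ ω, T N ω ∂(P N)) atTop (𝓝 c) := by
  -- Convergence in `L¹`: `|T - c| ≤ ε/4` off an event `S` of small probability, and the integrals
  -- over `S` of the two bounds and of the constant `|c|` are at most `ε/4` each.
  have key : Tendsto (fun N => ∫⁻ ω, ENNReal.ofReal |T N ω - c| ∂(P N)) atTop (𝓝 0) := by
    rw [ENNReal.tendsto_nhds_zero]
    intro ε hε
    by_cases hε' : ε = ∞
    · exact Eventually.of_forall fun i => by rw [hε']; exact le_top
    have h4 : 0 < ε / 4 := ENNReal.div_pos hε.ne' (by simp)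
    have h4' : ε / 4 ≠ ∞ := by simp [ENNReal.div_eq_top, hε']
    have hc4 : 0 < ε / 4 / (ENNReal.ofReal C + 1) := ENNReal.div_pos h4.ne' (by simp)
    obtain ⟨δ₁, hδ₁, h₁⟩ := hUa.ip_unif_cont ha hc4
    obtain ⟨δ₂, hδ₂, h₂⟩ := hUb.ip_unif_cont hb hc4
    have hc5 : 0 < ε / 4 / (ENNReal.ofReal |c| + 1) := ENNReal.div_pos h4.ne' (by simp)
    have hη : 0 < (ε / 4).toReal := ENNReal.toReal_pos h4.ne' h4'
    have hS := Metric.tendsto_nhds.1 hlim _ hη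
    rw [eventually_whp, ENNReal.tendsto_nhds_zero] at hS
    filter_upwards [hS (min (min δ₁ δ₂) (ε / 4 / (ENNReal.ofReal |c| + 1)))
      (lt_min (lt_min hδ₁ hδ₂) hc5), hdom] with N hN hd
    set S : Set (Ω N) := {ω | ¬ dist (T N ω) c < (ε / 4).toReal} with hSdef
    have hSm : MeasurableSet S := by
      have : Measurable fun ω => dist (T N ω) c := (hT N).dist measurable_const
      exact (measurableSet_lt this measurable_const).compl
    have hma : Measurable fun ω => ENNReal.ofReal (ip (a N ω) (a N ω)) :=
      (measurable_ip (ha N) (ha N)).ennreal_ofReal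
    have hmb : Measurable fun ω => ENNReal.ofReal (ip (b N ω) (b N ω)) :=
      (measurable_ip (hb N) (hb N)).ennreal_ofReal
    have hcan : ∀ r : ℝ≥0∞, r ≠ ∞ → r * (ε / 4 / (r + 1)) ≤ ε / 4 := fun r hr => by
      rw [← mul_div_assoc, mul_comm, mul_div_assoc]
      refine mul_le_of_le_one_right' ?_
      exact ENNReal.div_le_of_le_mul (by rw [one_mul]; exact le_self_add)
    have hpt : ∀ᵐ ω ∂(P N), ENNReal.ofReal |T N ω - c| ≤ ε / 4 + S.indicator (fun ω =>
        ENNReal.ofReal C * (ENNReal.ofReal (ip (a N ω) (a N ω)) +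
          ENNReal.ofReal (ip (b N ω) (b N ω))) + ENNReal.ofReal |c|) ω := by
      filter_upwards [hd] with ω hω
      by_cases hωS : ω ∈ S
      · rw [Set.indicator_of_mem hωS, ← ENNReal.ofReal_add (ip_self_nonneg _) (ip_self_nonneg _),
          ← ENNReal.ofReal_mul hC, ← ENNReal.ofReal_add (mul_nonneg hC (add_nonneg
            (ip_self_nonneg _) (ip_self_nonneg _))) (abs_nonneg _)]
        refine le_trans (ENNReal.ofReal_le_ofReal ?_) le_add_self
        exact (abs_sub _ _).trans (by linarith)
      · rw [Set.indicator_of_notMem hωS, add_zero]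
        have : |T N ω - c| < (ε / 4).toReal := by
          rw [← Real.dist_eq]; exact not_not.1 hωS
        exact (ENNReal.ofReal_le_ofReal this.le).trans (ENNReal.ofReal_toReal h4').le
    calc ∫⁻ ω, ENNReal.ofReal |T N ω - c| ∂(P N)
        ≤ ∫⁻ ω, (ε / 4 + S.indicator (fun ω =>
        ENNReal.ofReal C * (ENNReal.ofReal (ip (a N ω) (a N ω)) +
          ENNReal.ofReal (ip (b N ω) (b N ω))) + ENNReal.ofReal |c|) ω) ∂(P N) :=
          lintegral_mono_ae hpt
      _ = ε / 4 + (ENNReal.ofReal C * (∫⁻ ω in S, ENNReal.ofReal (ip (a N ω) (a N ω)) ∂(P N) +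
          ∫⁻ ω in S, ENNReal.ofReal (ip (b N ω) (b N ω)) ∂(P N)) +
            ENNReal.ofReal |c| * P N S) := by
          rw [lintegral_add_left measurable_const, lintegral_const, measure_univ, mul_one,
            lintegral_indicator hSm, lintegral_add_right _ measurable_const, setLIntegral_const,
            lintegral_const_mul' _ _ ENNReal.ofReal_ne_top, lintegral_add_left hma]
      _ ≤ ε / 4 + ((ε / 4 + ε / 4) + ε / 4) := by
          have g1 := h₁ N S hSm (hN.trans ((min_le_left _ _).trans (min_le_left _ _)))
          have g2 := h₂ N S hSm (hN.trans ((min_le_left _ _).trans (min_le_right _ _)))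
          have g3 := hN.trans (min_le_right _ _)
          gcongr
          · rw [mul_add]
            gcongr
            · exact (mul_le_mul_right g1 _).trans (hcan _ ENNReal.ofReal_ne_top)
            · exact (mul_le_mul_right g2 _).trans (hcan _ ENNReal.ofReal_ne_top)
          · exact (mul_le_mul_right g3 _).trans (hcan _ ENNReal.ofReal_ne_top)
      _ = ε := by
          have : ε / 4 + ((ε / 4 + ε / 4) + ε / 4) = 4 * (ε / 4) := by ring
          rw [this, ENNReal.mul_div_cancel (by simp) (by simp)]
  rw [tendsto_iff_dist_tendsto_zero]
  have h2 := (ENNReal.tendsto_toReal ENNReal.zero_ne_top).comp key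
  rw [ENNReal.toReal_zero] at h2
  refine tendsto_of_tendsto_of_tendsto_of_le_of_le' tendsto_const_nhds h2
    (Eventually.of_forall fun _ => dist_nonneg) ?_
  filter_upwards [(ENNReal.tendsto_nhds_zero.1 key) 1 one_pos] with N hN
  have hm : Measurable fun ω => T N ω - c := (hT N).sub_const c
  have hi : Integrable (fun ω => T N ω - c) (P N) := by
    refine ⟨hm.aestronglyMeasurable, ?_⟩
    rw [hasFiniteIntegral_iff_norm]
    exact lt_of_le_of_lt hN ENNReal.one_lt_top
  have hi' : Integrable (T N) (P N) :=
    (hi.add (integrable_const c)).congr (Eventually.of_forall fun ω => by simp)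
  have e : ∫ ω, T N ω ∂(P N) - c = ∫ ω, (T N ω - c) ∂(P N) := by
    rw [integral_sub hi' (integrable_const c)]; simp
  rw [Real.dist_eq, e]
  refine (abs_integral_le_integral_abs).trans (le_of_eq ?_)
  rw [integral_eq_lintegral_of_nonneg_ae (Eventually.of_forall fun _ => abs_nonneg _)
    (continuous_abs.measurable.comp hm).aestronglyMeasurable]
  rfl

/-- If the inner products of two random vectors converge, the limit vanishes if the vectors are
orthogonal in the sense of the law of large numbers. -/
lemma eq_zero_of_llnOrthogonal {p q : ∀ N, Ω N → Fin N → ℝ} {A B c : ℝ}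
    (hp : ∀ N, Measurable (p N)) (hq : ∀ N, Measurable (q N))
    (hA : Tendsto (fun x : Σ N, Ω N => ip (p x.1 x.2) (p x.1 x.2)) (glob P) (𝓝 A))
    (hB : Tendsto (fun x : Σ N, Ω N => ip (q x.1 x.2) (q x.1 x.2)) (glob P) (𝓝 B))
    (hc : Tendsto (fun x : Σ N, Ω N => ip (p x.1 x.2) (q x.1 x.2)) (glob P) (𝓝 c))
    (hEA : Tendsto (fun N => ∫ ω, ip (p N ω) (p N ω) ∂(P N)) atTop (𝓝 A))
    (hEB : Tendsto (fun N => ∫ ω, ip (q N ω) (q N ω) ∂(P N)) atTop (𝓝 B))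
    (hL : LLNOrthogonal P p q) : c = 0 := by
  have hcs : c ^ 2 ≤ A * B := le_of_tendsto_of_tendsto (hc.pow 2) (hA.mul hB)
    (Eventually.of_forall fun x => ip_sq_le _ _)
  -- If a limit of the squared norms vanishes, Cauchy–Schwarz suffices; otherwise the normalized
  -- quotient converges both to `c² / (A B)` and to `0`.
  by_cases hAB : A * B = 0
  · rw [hAB] at hcs
    exact pow_eq_zero_iff two_ne_zero |>.1 (le_antisymm hcs (sq_nonneg c))
  have h1 : Tendsto (fun x : Σ N, Ω N => (ip (p x.1 x.2) (q x.1 x.2)) ^ 2 /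
      ((∫ ω, ip (p x.1 ω) (p x.1 ω) ∂(P x.1)) * ∫ ω, ip (q x.1 ω) (q x.1 ω) ∂(P x.1)))
      (glob P) (𝓝 (c ^ 2 / (A * B))) :=
    (hc.pow 2).div ((hEA.mul hEB).comp tendsto_fst_whp) hAB
  have h2 : Tendsto (fun x : Σ N, Ω N => (ip (p x.1 x.2) (q x.1 x.2)) ^ 2 /
      ((∫ ω, ip (p x.1 ω) (p x.1 ω) ∂(P x.1)) * ∫ ω, ip (q x.1 ω) (q x.1 ω) ∂(P x.1)))
      (glob P) (𝓝 0) := by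
    rw [Metric.tendsto_nhds]
    intro ε hε
    rw [eventually_whp, ENNReal.tendsto_nhds_zero]
    intro δ hδ
    by_cases hδ' : δ = ∞
    · exact Eventually.of_forall fun i => by rw [hδ']; exact le_top
    obtain ⟨N', hN'⟩ := hL δ.toReal (ENNReal.toReal_pos hδ.ne' hδ') ε hε
    filter_upwards [eventually_gt_atTop N'] with N hN
    have hN0 : (N : ℝ) ≠ 0 := Nat.cast_ne_zero.2 (by omega)
    have hm : ∀ ω, (ip (p N ω) (q N ω)) ^ 2 /
        ((∫ ω, ip (p N ω) (p N ω) ∂(P N)) * ∫ ω, ip (q N ω) (q N ω) ∂(P N)) =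
        (p N ω ⬝ᵥ q N ω) ^ 2 / ((∫ ω', p N ω' ⬝ᵥ p N ω' ∂(P N)) *
          (∫ ω', q N ω' ⬝ᵥ q N ω' ∂(P N))) := fun ω => by
      simp only [ip, integral_div]
      field_simp
    set A : Set (Ω N) := {ω | (p N ω ⬝ᵥ q N ω) ^ 2 / ((∫ ω', p N ω' ⬝ᵥ p N ω' ∂(P N)) *
          (∫ ω', q N ω' ⬝ᵥ q N ω' ∂(P N))) < ε} with hAdef
    have hAm : MeasurableSet A := by
      refine measurableSet_lt ?_ measurable_const
      exact ((Measurable.dotProduct (hp N) (hq N)).pow_const 2).div_const _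
    have hsub : {ω : Ω N | ¬ dist ((ip (p N ω) (q N ω)) ^ 2 /
        ((∫ ω, ip (p N ω) (p N ω) ∂(P N)) * ∫ ω, ip (q N ω) (q N ω) ∂(P N))) 0 < ε} = Aᶜ := by
      ext ω
      have h0 : 0 ≤ (p N ω ⬝ᵥ q N ω) ^ 2 / ((∫ ω', p N ω' ⬝ᵥ p N ω' ∂(P N)) *
          (∫ ω', q N ω' ⬝ᵥ q N ω' ∂(P N))) := by
        refine div_nonneg (sq_nonneg _) (mul_nonneg ?_ ?_) <;>
          exact integral_nonneg fun _ => dotProduct_self_nonneg' _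
      simp only [Set.mem_ofPred_eq, Set.mem_compl_iff, hm, Real.dist_eq, sub_zero,
        abs_of_nonneg h0, hAdef]
    have h3 := hN' N hN
    rw [hsub, ← ENNReal.ofReal_toReal (measure_ne_top (P N) Aᶜ), ← ENNReal.ofReal_toReal hδ']
    refine ENNReal.ofReal_le_ofReal ?_
    have h4 := probReal_compl_eq_one_sub (μ := P N) hAm
    rw [Measure.real] at h4
    rw [h4]
    linarith
  have h3 := tendsto_nhds_unique h1 h2
  rw [div_eq_zero_iff] at h3
  exact pow_eq_zero_iff two_ne_zero |>.1 (h3.resolve_right hAB)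

end Expectations

end OAMP


namespace OAMP

open Filter Topology
open scoped ENNReal

/-! ### Message passing through a Haar distributed matrix -/

section Original

set_option linter.unusedSectionVars false

variable {E : Type*} [MeasurableSpace E] {Ω : ℕ → Type*} [∀ N, MeasurableSpace (Ω N)]
  (P : ∀ N, Measure (Ω N)) [∀ N, IsProbabilityMeasure (P N)]
  (e : Bool → ∀ N, Ω N → Fin N → E) (ρ : Bool → Measure E) [∀ b, IsProbabilityMeasure (ρ b)]
  (snd : ℕ → Bool) (Θ : ℕ → E × (ℕ → ℝ) → ℝ)
  {Z : ℕ → Type*} [∀ N, MeasurableSpace (Z N)] (z : ∀ N, Ω N → Z N)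
  (V : ∀ N, Ω N → Matrix (Fin N) (Fin N) ℝ)

/-- The primitives of both sides and a further random object `z`. -/
def given (N : ℕ) (ω : Ω N) : (Bool → Fin N → E) × Z N := (fun b => e b N ω, z N ω)

/-- `V` is Haar distributed and independent of the primitives and of `z`. -/
structure Haar : Prop where
  measurable : ∀ N, Measurable (V N)
  measurable_extra : ∀ N, Measurable (z N)
  orth : ∀ N, ∀ᵐ ω ∂(P N), IsOrth (V N ω)
  invariant : ∀ N U, IsOrth U → (P N).map (fun ω => U * V N ω) = (P N).map (V N)
  indep : ∀ N, IndepFun (V N) (given e z N) (P N)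

/-- The state before step `k` of the process with transform `V`. -/
noncomputable def ost (k N : ℕ) (ω : Ω N) : MsgState (Fin N) :=
  runOrig snd (sender snd Θ fun b => e b N ω) (V N ω) k

variable {P e ρ snd Θ z V}

lemma Model.measurable_given (M : Model P e ρ Θ) (hz : ∀ N, Measurable (z N)) (N : ℕ) :
    Measurable (given e z N) :=
  (measurable_pi_iff.2 fun b => (M.iid b).measurable N).prodMk (hz N)

lemma Model.measurable_ost (M : Model P e ρ Θ) (H : Haar P e z V) (k N : ℕ) :
    Measurable (ost e snd Θ V k N) :=
  (measurable_runOrig (α := Ω N) snd (Φ := fun ω => sender snd Θ fun b => e b N ω)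
    (fun k => M.measurable_sender N k) k).comp (measurable_id.prodMk (H.measurable N))

/-- The process with a Haar distributed transform has the same law as the simulated one, jointly
with the primitives and `z`. -/
lemma map_ost (M : Model P e ρ Θ) (H : Haar P e z V) (k N : ℕ) :
    (P N).map (fun ω => (given e z N ω, ost e snd Θ V k N ω)) =
      (hatP P N).map fun a => (given e z N a.1, hst e snd Θ k N a) :=
  map_runOrig snd (H.measurable N) (M.measurable_given H.measurable_extra N) (H.indep N) (H.orth N)
    (H.invariant N) (Φ := fun y => sender snd Θ y.1) (fun k => measurable_pi_iff.2 fun n =>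
      (M.measurable k).comp (Measurable.prodMk (by fun_prop) (measurable_pi_iff.2 fun j =>
        (measurable_pi_apply n).comp (measurable_msgs measurable_snd _ j)))) k

lemma map_ost_state (M : Model P e ρ Θ) (H : Haar P e z V) (k N : ℕ) :
    (P N).map (ost e snd Θ V k N) = (hatP P N).map (hst e snd Θ k N) := by
  have h := congrArg (Measure.map Prod.snd) (map_ost (snd := snd) M H k N)
  have hg := M.measurable_given H.measurable_extra N
  have h1 : Measurable fun a : HatΩ Ω N => (given e z N a.1, hst e snd Θ k N a) :=
    (hg.comp measurable_fst).prodMk (M.measurable_hst k N)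
  rw [Measure.map_map measurable_snd (hg.prodMk (M.measurable_ost H k N)),
    Measure.map_map measurable_snd h1] at h
  exact h

lemma tendsto_ost (M : Model P e ρ Θ) (H : Haar P e z V) {k : ℕ}
    {F : ∀ N, MsgState (Fin N) → ℝ} (hF : ∀ N, Measurable (F N)) {c : ℝ}
    (h : Tendsto (fun x : Σ N, HatΩ Ω N => F x.1 (hst e snd Θ k x.1 x.2)) (glob (hatP P)) (𝓝 c)) :
    Tendsto (fun x : Σ N, Ω N => F x.1 (ost e snd Θ V k x.1 x.2)) (glob P) (𝓝 c) := by
  rw [Metric.tendsto_nhds] at h ⊢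
  intro ε hε
  have := h ε hε
  rw [eventually_whp] at this ⊢
  refine this.congr fun N => ?_
  have hm : MeasurableSet {s : MsgState (Fin N) | ¬ dist (F N s) c < ε} := by
    have : Measurable fun s => dist (F N s) c := (hF N).dist measurable_const
    exact (measurableSet_lt this measurable_const).compl
  have h1 := Measure.map_apply (μ := hatP P N) (M.measurable_hst (snd := snd) k N) hm
  have h2 := Measure.map_apply (μ := P N) (M.measurable_ost (snd := snd) H k N) hm
  rw [map_ost_state M H] at h2
  exact h1.symm.trans h2

lemma unifSq_congr_map {I : Type*} {Ω₁ Ω₂ : I → Type*} [∀ i, MeasurableSpace (Ω₁ i)]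
    [∀ i, MeasurableSpace (Ω₂ i)] {P₁ : ∀ i, Measure (Ω₁ i)} {P₂ : ∀ i, Measure (Ω₂ i)}
    {f₁ : ∀ i, Ω₁ i → ℝ} {f₂ : ∀ i, Ω₂ i → ℝ} (h₁ : ∀ i, Measurable (f₁ i))
    (h₂ : ∀ i, Measurable (f₂ i)) (h : ∀ i, (P₁ i).map (f₁ i) = (P₂ i).map (f₂ i))
    (hU : UnifSq P₁ f₁) : UnifSq P₂ f₂ := by
  intro ε hε
  obtain ⟨K, hK⟩ := hU ε hε
  refine ⟨K, fun i => ?_⟩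
  have hms : MeasurableSet {y : ℝ | K < |y|} :=
    measurableSet_lt measurable_const continuous_abs.measurable
  have hg : Measurable fun y : ℝ => ENNReal.ofReal (y ^ 2) := by fun_prop
  have e1 := setLIntegral_map (μ := P₁ i) hms hg (h₁ i)
  have e2 := setLIntegral_map (μ := P₂ i) hms hg (h₂ i)
  rw [h i] at e1
  exact e2.symm.trans_le (e1.trans_le (hK i))

variable (P e snd Θ V) in
/-- The vectors `m b k`, the messages of step `k` seen on side `b`, follow the message passing
process: the message sent is computed entrywise from the previous messages on the same side, and
it is received multiplied by the transform. -/
structure Passing (m : Bool → ℕ → ∀ N, Ω N → Fin N → ℝ) : Prop where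
  measurable : ∀ b k N, Measurable (m b k N)
  sent : ∀ k N ω n, m (snd k) k N ω n =
    Θ k (e (snd k) N ω n, fun j => if j < k then m (snd k) j N ω n else 0)
  forward : ∀ k N ω, snd k = true → m false k N ω = V N ω *ᵥ m true k N ω
  backward : ∀ k N ω, snd k = false → m true k N ω = (V N ω)ᵀ *ᵥ m false k N ω

variable {m : Bool → ℕ → ∀ N, Ω N → Fin N → ℝ}

lemma Passing.forward' (h : Passing e snd Θ V m) (k : ℕ) {N : ℕ} {ω : Ω N} (hV : IsOrth (V N ω)) :
    m false k N ω = V N ω *ᵥ m true k N ω := by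
  cases hs : snd k
  · rw [h.backward k N ω hs, hV.mulVec_transpose]
  · exact h.forward k N ω hs

/-- For an orthogonal transform the messages of the process are those recorded in its states. -/
lemma Passing.msgs_ost (h : Passing e snd Θ V m) {N : ℕ} {ω : Ω N} (hV : IsOrth (V N ω)) (k : ℕ) :
    (∀ j < k, ∀ b, msgs (ost e snd Θ V k N ω) b j = m b j N ω) ∧
      (∀ j < k, V N ω *ᵥ dirs (ost e snd Θ V k N ω) true j = dirs (ost e snd Θ V k N ω) false j) ∧
      ∀ j, k ≤ j → ∀ b, msgs (ost e snd Θ V k N ω) b j = 0 := by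
  induction k with
  | zero => exact ⟨fun j hj => by omega, fun j hj => by omega, fun j _ b => rfl⟩
  | succ k ih =>
    obtain ⟨h1, h2, h3⟩ := ih
    set s := ost e snd Θ V k N ω with hs
    set v := sender snd Θ (fun b => e b N ω) k s with hv
    set d := dirOrig snd (sender snd Θ fun b => e b N ω) (V N ω) k s with hd
    have hst : ost e snd Θ V (k + 1) N ω = step k (snd k) s v d := rfl
    have hsent : v = m (snd k) k N ω := by
      ext n
      rw [h.sent, hv, sender]
      congr 2
      ext j
      by_cases hj : j < k
      · rw [if_pos hj, h1 j hj]
      · rw [if_neg hj, h3 j (by omega)]; rfl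
    -- the message received is the image of the message sent
    have hcomb : ∀ (W : Matrix (Fin N) (Fin N) ℝ), (∀ j < k, W *ᵥ dirs s (snd k) j =
        dirs s (!snd k) j) → d = W *ᵥ newDir s k (snd k) v → received s k (snd k) v d = W *ᵥ v := by
      intro W hW hdW
      have hvs : v = ∑ j ∈ Finset.range k, (v ⬝ᵥ dirs s (snd k) j) • dirs s (snd k) j +
          Real.sqrt (proj (dirs s (snd k)) k v ⬝ᵥ proj (dirs s (snd k)) k v) •
            newDir s k (snd k) v := by
        rw [newDir, sqrt_smul_nrm, proj]; abel
      conv_rhs => rw [hvs]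
      rw [received, hdW, Matrix.mulVec_add, Matrix.mulVec_sum, Matrix.mulVec_smul]
      congr 1
      refine Finset.sum_congr rfl fun j hj => ?_
      rw [Matrix.mulVec_smul, hW j (Finset.mem_range.1 hj)]
    have hback : ∀ j < k, (V N ω)ᵀ *ᵥ dirs s false j = dirs s true j := fun j hj => by
      rw [← h2 j hj, hV.transpose_mulVec]
    have hrec : received s k (snd k) v d = m (!snd k) k N ω := by
      cases hk : snd k
      · rw [hk] at hsent hcomb
        rw [Bool.not_false, h.backward k N ω hk, ← hsent]
        refine hcomb _ hback ?_
        rw [hd, dirOrig, hk]; simp [hv]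
      · rw [hk] at hsent hcomb
        rw [Bool.not_true, h.forward k N ω hk, ← hsent]
        refine hcomb _ h2 ?_
        rw [hd, dirOrig, hk]; simp [hv]
    refine ⟨fun j hj b => ?_, fun j hj => ?_, fun j hj b => ?_⟩
    · rw [hst]
      rcases Nat.lt_succ_iff_lt_or_eq.1 hj with hj | rfl
      · rw [msgs_step_of_ne _ _ _ _ _ _ hj.ne, h1 j hj]
      · rcases bool_eq_or b (snd j) with rfl | rfl
        · rw [msgs_step_self, hsent]
        · rw [msgs_step_not, hrec]
    · rw [hst]
      rcases Nat.lt_succ_iff_lt_or_eq.1 hj with hj | rfl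
      · rw [dirs_step_of_ne _ _ _ _ _ _ hj.ne, dirs_step_of_ne _ _ _ _ _ _ hj.ne, h2 j hj]
      · have hd' : d = (if snd j then V N ω else (V N ω)ᵀ) *ᵥ newDir s j (snd j) v := rfl
        cases hk : snd j
        · rw [hk] at hd'
          rw [dirs_step_self, show true = !false from rfl, dirs_step_not, hd']
          simp [hV.mulVec_transpose]
        · rw [hk] at hd'
          rw [dirs_step_self, show false = !true from rfl, dirs_step_not, hd']
          simp
    · rw [hst, msgs_step_of_ne _ _ _ _ _ _ (by omega), h3 j (by omega)]

lemma Passing.ip_eq (h : Passing e snd Θ V m) (i j : ℕ) {N : ℕ} {ω : Ω N} (hV : IsOrth (V N ω))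
    (b b' : Bool) : ip (m b i N ω) (m b j N ω) = ip (m b' i N ω) (m b' j N ω) := by
  have : ip (m false i N ω) (m false j N ω) = ip (m true i N ω) (m true j N ω) := by
    rw [h.forward' i hV, h.forward' j hV, ip, hV.dotProduct, ip]
  cases b <;> cases b' <;> simp [this]

/-- State evolution, from the uniform square integrability of the messages sent. -/
lemma Passing.evol (h : Passing e snd Θ V m) (M : Model P e ρ Θ) (H : Haar P e z V)
    (hU : ∀ k, UnifSq (fun p : (Σ N, Fin N) => P p.1) fun p ω => m (snd k) k p.1 ω p.2) (k : ℕ) :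
    Evol P e ρ snd Θ k (lrun snd Θ ρ k) := by
  refine evol_run M k fun j _ => ?_
  have hm : ∀ p : (Σ N, Fin N), Measurable fun s : MsgState (Fin p.1) =>
      msgs s (snd j) j p.2 := fun p =>
    (measurable_pi_apply p.2).comp (measurable_msgs measurable_id _ j)
  refine unifSq_congr_map (f₁ := fun (p : Σ N, Fin N) (ω : Ω p.1) => m (snd j) j p.1 ω p.2)
    (fun p => (measurable_pi_apply p.2).comp (h.measurable _ _ _))
    (fun p => (measurable_pi_apply p.2).comp (M.measurable_hsent j p.1)) (fun p => ?_) (hU j)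
  have e1 : (fun ω => m (snd j) j p.1 ω p.2) =ᵐ[P p.1]
      (fun s => msgs s (snd j) j p.2) ∘ ost e snd Θ V (j + 1) p.1 := by
    filter_upwards [H.orth p.1] with ω hω
    simp only [Function.comp_apply]
    rw [(h.msgs_ost hω (j + 1)).1 j (Nat.lt_succ_self j)]
  have e2 : (fun a => hsent e snd Θ j p.1 a p.2) =
      (fun s => msgs s (snd j) j p.2) ∘ hst e snd Θ (j + 1) p.1 := by
    ext a
    simp only [Function.comp_apply]
    rw [hst_succ, msgs_step_self]
  rw [Measure.map_congr e1, e2, ← Measure.map_map (hm p) (M.measurable_ost H _ _),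
    ← Measure.map_map (hm p) (M.measurable_hst _ _), map_ost_state M H]

end Original

end OAMP


namespace OAMP

open Filter Topology
open scoped ENNReal

/-! ### The errors of the messages -/

section Errors

set_option linter.unusedSectionVars false

variable {E : Type*} [MeasurableSpace E] {Ω : ℕ → Type*} [∀ N, MeasurableSpace (Ω N)]
  (P : ∀ N, Measure (Ω N)) [∀ N, IsProbabilityMeasure (P N)]
  (e : Bool → ∀ N, Ω N → Fin N → E) (ρ : Bool → Measure E) [∀ b, IsProbabilityMeasure (ρ b)]
  (snd : ℕ → Bool) (Θ : ℕ → E × (ℕ → ℝ) → ℝ) (σ : E → ℝ) (prev : ℕ → ℕ)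
  {Z : ℕ → Type*} [∀ N, MeasurableSpace (Z N)] (z : ∀ N, Ω N → Z N)
  (V : ∀ N, Ω N → Matrix (Fin N) (Fin N) ℝ) (m : Bool → ℕ → ∀ N, Ω N → Fin N → ℝ)

/-- The standing assumptions on a message passing process `m`. -/
structure Regular : Prop where
  model : Model P e ρ Θ
  haar : Haar P e z V
  scheme : Scheme snd Θ σ prev
  normalized : ∫ y, σ y ^ 2 ∂(ρ true) = 1
  passing : Passing e snd Θ V m
  unifSq : ∀ k, UnifSq (fun p : (Σ N, Fin N) => P p.1) fun p ω => m (snd k) k p.1 ω p.2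

/-- The limit of the message of step `i` on side `b`. -/
noncomputable def lmsg (i : ℕ) (b : Bool) : E × (ℕ → ℝ) → ℝ := (lrun snd Θ ρ (i + 1) i b).1

/-- The limit of the Gram-Schmidt coefficient of the message of step `i` on side `b`. -/
noncomputable def lgs (i : ℕ) (b : Bool) : ℝ :=
  ∫ a, lsig σ b a * lmsg ρ snd Θ i b a ∂(rowLaw (ρ b))

/-- The limit of the Gram-Schmidt error of the message of step `i` on side `b`. -/
noncomputable def lerr (i : ℕ) (b : Bool) (a : E × (ℕ → ℝ)) : ℝ :=
  lmsg ρ snd Θ i b a - lgs ρ snd Θ σ i b * lsig σ b a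

/-- The difference of the message of step `i` on side `b` and `α` times the signal. -/
def serr {N : ℕ} (b : Bool) (i : ℕ) (α : ℝ) (s : MsgState (Fin N)) : Fin N → ℝ :=
  msgs s b i - α • msgs s b 0

variable {P e ρ snd Θ σ prev z V m}

lemma measurable_serr {N : ℕ} (b : Bool) (i : ℕ) (α : ℝ) :
    Measurable (serr (N := N) b i α) :=
  (measurable_msgs measurable_id b i).sub ((measurable_msgs measurable_id b 0).const_smul α)

lemma Regular.evol (R : Regular P e ρ snd Θ σ prev z V m) (k : ℕ) :
    Evol P e ρ snd Θ k (lrun snd Θ ρ k) := R.passing.evol R.model R.haar R.unifSq k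

lemma Regular.approx_msg (R : Regular P e ρ snd Θ σ prev z V m) (b : Bool) {i K : ℕ} (hi : i < K) :
    Approx (hatP P) (nrow e b) (rowLaw (ρ b)) (fun N a n => msgs (hst e snd Θ K N a) b i n)
      (lmsg ρ snd Θ i b) := by
  have h := (R.evol K).approx_msgs i b
  rwa [lrun_of_lt hi] at h

lemma Regular.lmsg_zero (R : Regular P e ρ snd Θ σ prev z V m) (b : Bool) :
    lmsg ρ snd Θ 0 b = lsig σ b := by
  rw [lmsg, R.scheme.lrun_zero R.normalized b (Nat.succ_pos 0)]

lemma Regular.approx_err (R : Regular P e ρ snd Θ σ prev z V m) (b : Bool) {i K : ℕ} (hi : i < K)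
    {α : ℕ → ℝ} (hα : Tendsto α atTop (𝓝 (lgs ρ snd Θ σ i b))) :
    Approx (hatP P) (nrow e b) (rowLaw (ρ b)) (fun N a => serr b i (α N) (hst e snd Θ K N a))
      (lerr ρ snd Θ σ i b) := by
  have hy := iidRows_nrow (R.model.iid b)
  have h0 := R.approx_msg b (Nat.lt_of_le_of_lt (Nat.zero_le i) hi)
  rw [R.lmsg_zero] at h0
  exact (R.approx_msg b hi).sub hy (h0.smul hy (c := fun N _ => α N) (hα.comp tendsto_fst_whp))

lemma Regular.tendsto_ip_msg (R : Regular P e ρ snd Θ σ prev z V m) (b : Bool) (i j : ℕ) :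
    Tendsto (fun x : Σ N, Ω N => ip (m b i x.1 x.2) (m b j x.1 x.2)) (glob P)
      (𝓝 (∫ a, lmsg ρ snd Θ i b a * lmsg ρ snd Θ j b a ∂(rowLaw (ρ b)))) := by
  have hi : i < max i j + 1 := by omega
  have hj : j < max i j + 1 := by omega
  have h1 := Approx.tendsto_ip
    (a := fun N a n => msgs (hst e snd Θ (max i j + 1) N a) b i n)
    (a' := fun N a n => msgs (hst e snd Θ (max i j + 1) N a) b j n)
    (iidRows_nrow (R.model.iid b)) (R.approx_msg b hi) (R.approx_msg b hj)
  refine (tendsto_ost R.model R.haar (F := fun N s => ip (msgs s b i) (msgs s b j)) (fun N =>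
    measurable_ip (measurable_msgs measurable_id b i) (measurable_msgs measurable_id b j))
    h1).congr' ?_
  refine eventually_whp_of_ae (Eventually.of_forall fun N => ?_)
  filter_upwards [R.haar.orth N] with ω hω
  rw [(R.passing.msgs_ost hω _).1 i hi, (R.passing.msgs_ost hω _).1 j hj]

lemma Regular.tendsto_gsCoeff (R : Regular P e ρ snd Θ σ prev z V m) (b : Bool) (i : ℕ) :
    Tendsto (gsCoeff P (m b 0) (m b i)) atTop (𝓝 (lgs ρ snd Θ σ i b)) := by
  have h := R.tendsto_ip_msg b 0 i
  rw [R.lmsg_zero] at h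
  refine (tendsto_integral_of_dominated (C := 1)
    (fun N => measurable_ip (R.passing.measurable b 0 N) (R.passing.measurable b i N))
    (R.passing.measurable (snd 0) 0) (R.passing.measurable (snd i) i) (R.unifSq 0) (R.unifSq i)
    zero_le_one (Eventually.of_forall fun N => ?_) h).congr fun N => ?_
  · filter_upwards [R.haar.orth N] with ω hω
    rw [one_mul, R.passing.ip_eq 0 0 hω (snd 0) b, R.passing.ip_eq i i hω (snd i) b]
    exact abs_ip_le_add _ _
  · rw [gsCoeff, one_div_mul_eq_div]
    simp only [ip, integral_div, dotProduct_comm]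

lemma Regular.gsError_eq (R : Regular P e ρ snd Θ σ prev z V m) (b : Bool) {i K : ℕ} (hi : i < K)
    {N : ℕ} {ω : Ω N} (hω : IsOrth (V N ω)) :
    gsError P (m b 0) (m b i) N ω =
      serr b i (gsCoeff P (m b 0) (m b i) N) (ost e snd Θ V K N ω) := by
  rw [serr, (R.passing.msgs_ost hω K).1 i hi, (R.passing.msgs_ost hω K).1 0 (by omega), gsError]

lemma Regular.measurable_gsError (R : Regular P e ρ snd Θ σ prev z V m) (b : Bool) (i N : ℕ) :
    Measurable (gsError P (m b 0) (m b i) N) :=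
  (R.passing.measurable b i N).sub
    ((R.passing.measurable b 0 N).const_smul (gsCoeff P (m b 0) (m b i) N))

lemma Regular.tendsto_ip_err (R : Regular P e ρ snd Θ σ prev z V m) (b : Bool) (i j : ℕ) :
    Tendsto (fun x : Σ N, Ω N => ip (gsError P (m b 0) (m b i) x.1 x.2)
      (gsError P (m b 0) (m b j) x.1 x.2)) (glob P)
      (𝓝 (∫ a, lerr ρ snd Θ σ i b a * lerr ρ snd Θ σ j b a ∂(rowLaw (ρ b)))) := by
  have hi : i < max i j + 1 := by omega
  have hj : j < max i j + 1 := by omega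
  have h1 := Approx.tendsto_ip
    (a := fun N a => serr b i (gsCoeff P (m b 0) (m b i) N) (hst e snd Θ (max i j + 1) N a))
    (a' := fun N a => serr b j (gsCoeff P (m b 0) (m b j) N) (hst e snd Θ (max i j + 1) N a))
    (iidRows_nrow (R.model.iid b)) (R.approx_err b hi (R.tendsto_gsCoeff b i))
    (R.approx_err b hj (R.tendsto_gsCoeff b j))
  refine (tendsto_ost R.model R.haar (F := fun N s =>
    ip (serr b i (gsCoeff P (m b 0) (m b i) N) s) (serr b j (gsCoeff P (m b 0) (m b j) N) s))
    (fun N => measurable_ip (measurable_serr b i _) (measurable_serr b j _)) h1).congr' ?_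
  refine eventually_whp_of_ae (Eventually.of_forall fun N => ?_)
  filter_upwards [R.haar.orth N] with ω hω
  rw [R.gsError_eq b hi hω, R.gsError_eq b hj hω]

lemma Regular.tendsto_integral_err (R : Regular P e ρ snd Θ σ prev z V m) (b : Bool) (i : ℕ) :
    Tendsto (fun N => ∫ ω, ip (gsError P (m b 0) (m b i) N ω)
      (gsError P (m b 0) (m b i) N ω) ∂(P N)) atTop
      (𝓝 (∫ a, lerr ρ snd Θ σ i b a * lerr ρ snd Θ σ i b a ∂(rowLaw (ρ b)))) := by
  set α := gsCoeff P (m b 0) (m b i) with hα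
  have hlim := R.tendsto_gsCoeff b i
  have h1 := (tendsto_order.1 (hlim.pow 2)).2 (lgs ρ snd Θ σ i b ^ 2 + 1) (by linarith)
  refine tendsto_integral_of_dominated (C := 2 + 2 * (lgs ρ snd Θ σ i b ^ 2 + 1))
    (fun N => measurable_ip (R.measurable_gsError b i N) (R.measurable_gsError b i N))
    (R.passing.measurable (snd 0) 0) (R.passing.measurable (snd i) i) (R.unifSq 0) (R.unifSq i)
    (by positivity) ?_ (R.tendsto_ip_err b i i)
  filter_upwards [h1] with N hN
  filter_upwards [R.haar.orth N] with ω hω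
  rw [R.passing.ip_eq 0 0 hω (snd 0) b, R.passing.ip_eq i i hω (snd i) b,
    abs_of_nonneg (ip_self_nonneg _), gsError, sub_eq_add_neg, ← neg_smul]
  refine (ip_add_self_le _ _).trans ?_
  rw [ip_smul_left, ip_smul_right]
  nlinarith [ip_self_nonneg (m b 0 N ω), ip_self_nonneg (m b i N ω), sq_nonneg (lgs ρ snd Θ σ i b),
    mul_le_mul_of_nonneg_right hN.le (ip_self_nonneg (m b 0 N ω)),
    mul_nonneg (sq_nonneg (lgs ρ snd Θ σ i b)) (ip_self_nonneg (m b i N ω))]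

/-- Orthogonality of the errors in the sense of the law of large numbers passes to the limit. -/
lemma Regular.limOrth (R : Regular P e ρ snd Θ σ prev z V m) {k : ℕ} (hk : 1 ≤ k)
    (hL : LLNOrthogonal P (gsError P (m (snd k) 0) (m (snd k) (prev k)))
      (gsError P (m (snd k) 0) (m (snd k) k))) : LimOrth snd Θ ρ σ prev k := by
  have h := eq_zero_of_llnOrthogonal (R.measurable_gsError _ _) (R.measurable_gsError _ _)
    (R.tendsto_ip_err (snd k) (prev k) (prev k)) (R.tendsto_ip_err (snd k) k k)
    (R.tendsto_ip_err (snd k) (prev k) k) (R.tendsto_integral_err (snd k) (prev k))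
    (R.tendsto_integral_err (snd k) k) hL
  rw [LimOrth, lrun_of_lt (Nat.lt_succ_of_lt (R.scheme.prev_lt k hk))]
  simp only [mul_comm (lerr ρ snd Θ σ (prev k) (snd k) _)] at h
  exact h

/-- The limits of the errors of the messages received are Gaussian noise. -/
lemma Regular.lerr_eq (R : Regular P e ρ snd Θ σ prev z V m)
    (hO : ∀ k ≥ 1, prev k ≠ 0 → LLNOrthogonal P (gsError P (m (snd k) 0) (m (snd k) (prev k)))
      (gsError P (m (snd k) 0) (m (snd k) k))) {k : ℕ} (hk : 1 ≤ k) :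
    ∃ c : ℕ → ℝ, c 0 = 0 ∧ ∀ K > k, ∀ a, lerr ρ snd Θ σ k (!snd k) a = lin K c a.2 := by
  have hσ := R.scheme.measurable_signal
  have hsent : ∀ j, Approx (hatP P) (nrow e (snd j)) (rowLaw (ρ (snd j)))
      (fun N a n => msgs (hst e snd Θ (j + 1) N a) (snd j) j n)
      (lsent snd Θ j (lrun snd Θ ρ j)) := fun j => by
    have h := (R.evol (j + 1)).approx_msgs j (snd j)
    have e1 : (lrun snd Θ ρ (j + 1) j (snd j)).1 = lsent snd Θ j (lrun snd Θ ρ j) :=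
      congrArg Prod.fst (lstep_self j _)
    rwa [e1] at h
  obtain ⟨l, c, c0, -, hc⟩ := R.scheme.received_eq R.normalized (fun j => (hsent j).memLp)
    (fun j => (hsent j).measurable) (fun j hj hp => R.limOrth hj (hO j hj hp)) k hk
  refine ⟨c, c0, fun K hK a => ?_⟩
  have hm : ∀ a, lmsg ρ snd Θ k (!snd k) a = l * lsig σ (!snd k) a + lin K c a.2 := hc K hK
  have hLs := memLp_lsig (ρ := ρ) R.normalized hσ (!snd k)
  have hl : lgs ρ snd Θ σ k (!snd k) = l := by
    rw [lgs]
    simp only [hm, mul_add, mul_left_comm _ l]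
    rw [integral_add ((integrable_mul_of_memLp hLs hLs).const_mul l)
      (integrable_mul_of_memLp hLs (memLp_lin_row _ K c)), integral_const_mul,
      integral_lsig_sq R.normalized hσ, integral_lsig_mul_lin R.normalized hσ _ K c0]
    ring
  rw [lerr, hl, hm]
  ring

end Errors

end OAMP


namespace OAMP

open Filter Topology
open scoped ENNReal

/-! ### Weak convergence of the rows -/

section WeakConvergence

set_option linter.unusedSectionVars false

/-- Continuous mapping: as the law of `g` is fixed, both sequences stay in a compact set up to small
probability, and a continuous function is uniformly continuous there. -/
lemma tendsto_sub_comp_of_map_eq {I : Type*} {Ω : I → Type*} [∀ i, MeasurableSpace (Ω i)]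
    {P : ∀ i, Measure (Ω i)} {l : Filter I} {F : Type*} [NormedAddCommGroup F] [ProperSpace F]
    [MeasurableSpace F] [BorelSpace F] {f g : ∀ i, Ω i → F} (hg : ∀ i, Measurable (g i))
    {ν : Measure F} [IsFiniteMeasure ν] (hν : ∀ i, (P i).map (g i) = ν)
    (hfg : Tendsto (fun x : Σ i, Ω i => f x.1 x.2 - g x.1 x.2) (whp P l) (𝓝 0)) {h : F → ℝ}
    (hh : Continuous h) :
    Tendsto (fun x : Σ i, Ω i => h (f x.1 x.2) - h (g x.1 x.2)) (whp P l) (𝓝 0) := by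
  rw [Metric.tendsto_nhds]
  intro ε hε
  rw [eventually_whp, ENNReal.tendsto_nhds_zero]
  intro δ hδ
  have hms : ∀ n : ℕ, MeasurableSet {y : F | (n : ℝ) < ‖y‖} := fun n =>
    measurableSet_lt measurable_const measurable_norm
  have h1 : Tendsto (fun n : ℕ => ν {y | (n : ℝ) < ‖y‖}) atTop (𝓝 0) := by
    have := tendsto_measure_iInter_atTop (μ := ν) (s := fun n : ℕ => {y : F | (n : ℝ) < ‖y‖})
      (fun n => (hms n).nullMeasurableSet)
      (fun a b hab y (hy : (b : ℝ) < ‖y‖) => lt_of_le_of_lt (Nat.cast_le.2 hab) hy)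
      ⟨0, measure_ne_top _ _⟩
    have he : ⋂ n : ℕ, {y : F | (n : ℝ) < ‖y‖} = ∅ := by
      ext y
      simp only [Set.mem_iInter, Set.mem_ofPred_eq, Set.mem_empty_iff_false, iff_false, not_forall,
        not_lt]
      exact exists_nat_ge ‖y‖
    rwa [he, measure_empty] at this
  obtain ⟨R, hR⟩ := (ENNReal.tendsto_nhds_zero.1 h1 (δ / 2) (ENNReal.half_pos hδ.ne')).exists
  have hu := (isCompact_closedBall (0 : F) (R + 1)).uniformContinuousOn_of_continuous
    hh.continuousOn
  obtain ⟨η, hη, hu⟩ := Metric.uniformContinuousOn_iff.1 hu ε hε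
  have h2 := Metric.tendsto_nhds.1 hfg (min η 1) (lt_min hη one_pos)
  rw [eventually_whp, ENNReal.tendsto_nhds_zero] at h2
  filter_upwards [h2 (δ / 2) (ENNReal.half_pos hδ.ne')] with i hi
  have hR' : P i {ω | (R : ℝ) < ‖g i ω‖} ≤ δ / 2 := by
    have h3 := Measure.map_apply (μ := P i) (hg i) (hms R)
    rw [hν i] at h3
    exact h3.symm.trans_le hR
  refine le_trans (measure_mono (t := {ω | ¬ dist (f i ω - g i ω) 0 < min η 1} ∪
    {ω | (R : ℝ) < ‖g i ω‖}) fun ω hω => ?_) ((measure_union_le _ _).trans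
      ((add_le_add hi hR').trans (ENNReal.add_halves δ).le))
  by_contra hcon
  simp only [Set.mem_union, Set.mem_ofPred_eq, not_or, not_lt, dist_zero_right] at hcon hω
  obtain ⟨c1, c2⟩ := hcon
  rw [not_le] at c1
  have c3 : ‖f i ω‖ ≤ R + 1 := by
    have := norm_add_le (f i ω - g i ω) (g i ω)
    rw [sub_add_cancel] at this
    linarith [lt_of_lt_of_le c1 (min_le_right η 1)]
  have := hu (f i ω) (by simpa using c3) (g i ω) (by simp; linarith)
    (by rw [dist_eq_norm]; exact lt_of_lt_of_le c1 (min_le_left η 1))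
  rw [Real.dist_eq] at this
  exact absurd this (by simpa using hω)

/-- The filter on the choices of `M` distinct rows along which `N → ∞`, uniformly in the choice. -/
def embFilter (M : ℕ) : Filter (Σ N, Fin M ↪ Fin N) := comap Sigma.fst atTop

lemma eventually_embFilter {M : ℕ} {Q : (Σ N, Fin M ↪ Fin N) → Prop} :
    (∀ᶠ p in embFilter M, Q p) ↔ ∃ N₀, ∀ N ≥ N₀, ∀ idx : Fin M ↪ Fin N, Q ⟨N, idx⟩ := by
  rw [embFilter, eventually_comap, eventually_atTop]
  constructor
  · rintro ⟨N₀, h⟩; exact ⟨N₀, fun N hN n => h N hN ⟨N, n⟩ rfl⟩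
  · rintro ⟨N₀, h⟩; exact ⟨N₀, fun N hN p hp => h p.1 (hp ▸ hN) p.2⟩

variable {Ω : ℕ → Type*} [∀ N, MeasurableSpace (Ω N)] {P : ∀ N, Measure (Ω N)}
  [∀ N, IsProbabilityMeasure (P N)] {α : Type*} [MeasurableSpace α]
  {y : ∀ N, Ω N → Fin N → α} {μ : Measure α} [IsProbabilityMeasure μ]

lemma pi_map_emb (μ : Measure α) [IsProbabilityMeasure μ] {M N : ℕ} (idx : Fin M ↪ Fin N) :
    (Measure.pi fun _ : Fin N => μ).map (fun w i => w (idx i)) = Measure.pi fun _ => μ := by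
  rw [← Measure.infinitePi_eq_pi, ← Measure.infinitePi_eq_pi]
  exact Measure.map_infinitePi_infinitePi_of_inj (P := fun _ : Fin N => μ) idx.injective

/-- Functions of distinct rows are independent. -/
lemma IIDRows.map_emb (h : IIDRows P y μ) {β : Type*} [MeasurableSpace β] {g : α → β}
    (hg : Measurable g) {M N : ℕ} (idx : Fin M ↪ Fin N) :
    (P N).map (fun ω i => g (y N ω (idx i))) = Measure.pi fun _ => μ.map g := by
  have : IsProbabilityMeasure (μ.map g) := Measure.isProbabilityMeasure_map hg.aemeasurable
  have h1 : Measurable fun (w : Fin N → α) i => w (idx i) := by fun_prop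
  have h2 : Measurable fun (w : Fin M → α) i => g (w i) := by fun_prop
  have e1 : (fun ω i => g (y N ω (idx i))) =
      (fun (w : Fin M → α) i => g (w i)) ∘ (fun (w : Fin N → α) i => w (idx i)) ∘ y N := rfl
  rw [e1, ← Measure.map_map h2 (h1.comp (h.measurable N)), ← Measure.map_map h1 (h.measurable N),
    h.law, pi_map_emb, Measure.pi_map_pi fun _ => hg.aemeasurable]

/-- If the rows of a random matrix are close to functions of independent rows, then expectations
of continuous functions of any `M` distinct rows are close. -/
lemma IIDRows.tendsto_lintegral_emb (h : IIDRows P y μ) {t : ℕ}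
    {G : ∀ N, Ω N → Fin N → Fin t → ℝ} {g : α → Fin t → ℝ} (hg : Measurable g)
    (hGg : ∀ s, Tendsto (fun x : Σ p : (Σ N, Fin N), Ω p.1 =>
      G x.1.1 x.2 x.1.2 s - g (y x.1.1 x.2 x.1.2) s) (rows P) (𝓝 0)) {M : ℕ}
    (φ : (Fin M → Fin t → ℝ) →ᵇ ℝ) :
    Tendsto (fun p : (Σ N, Fin M ↪ Fin N) => ∫⁻ ω, ENNReal.ofReal
      |φ (fun i => G p.1 ω (p.2 i)) - φ fun i => g (y p.1 ω (p.2 i))| ∂(P p.1))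
      (embFilter M) (𝓝 0) := by
  have hprob : IsProbabilityMeasure (μ.map g) := Measure.isProbabilityMeasure_map hg.aemeasurable
  refine tendsto_lintegral_of_whp (P := fun p : (Σ N, Fin M ↪ Fin N) => P p.1) (C := ‖φ‖ + ‖φ‖)
    (f := fun p ω => φ (fun i => G p.1 ω (p.2 i)) - φ fun i => g (y p.1 ω (p.2 i)))
    (fun p ω => ?_) ?_
  · exact (abs_sub _ _).trans (add_le_add (φ.norm_coe_le_norm _) (φ.norm_coe_le_norm _))
  refine tendsto_sub_comp_of_map_eq (P := fun p : (Σ N, Fin M ↪ Fin N) => P p.1)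
    (f := fun p ω i => G p.1 ω (p.2 i)) (g := fun p ω i => g (y p.1 ω (p.2 i)))
    (fun p => measurable_pi_iff.2 fun i => hg.comp (h.measurable_row _ _))
    (ν := Measure.pi fun _ => μ.map g) (fun p => h.map_emb hg p.2) ?_ φ.continuous
  refine tendsto_pi_nhds.2 fun i => tendsto_pi_nhds.2 fun s => ?_
  have ht : Tendsto (fun x : Σ p : (Σ N, Fin M ↪ Fin N), Ω p.1 =>
      (⟨⟨x.1.1, x.1.2 i⟩, x.2⟩ : Σ p : (Σ N, Fin N), Ω p.1))
      (whp (fun p : (Σ N, Fin M ↪ Fin N) => P p.1) (embFilter M)) (rows P) := by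
    intro S hS
    have h1 : Tendsto (fun p : (Σ N, Fin N) => P p.1 {ω | (⟨p, ω⟩ : Σ p : (Σ N, Fin N), Ω p.1) ∉ S})
      rowFilter (𝓝 0) := hS
    have h2 : Tendsto (fun p : (Σ N, Fin M ↪ Fin N) => (⟨p.1, p.2 i⟩ : Σ N, Fin N)) (embFilter M)
        rowFilter := tendsto_comap_iff.2 (tendsto_comap (f := Sigma.fst) (x := atTop))
    exact h1.comp h2
  exact (hGg s).comp ht

/-- Closeness of expectations in terms of the Bochner integral. -/
lemma abs_integral_mul_sub_le {Ω' : Type*} [MeasurableSpace Ω'] {Q : Measure Ω'}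
    [IsProbabilityMeasure Q] {f g k : Ω' → ℝ} (hf : Measurable f) (hg : Measurable g)
    (hk : Measurable k) {C : ℝ} (hfC : ∀ ω, |f ω| ≤ C) (hgC : ∀ ω, |g ω| ≤ C)
    (hk1 : ∀ ω, |k ω| ≤ 1) {ε : ℝ} (hε : 0 ≤ ε)
    (h : ∫⁻ ω, ENNReal.ofReal |f ω - g ω| ∂Q ≤ ENNReal.ofReal ε) :
    |∫ ω, f ω * k ω ∂Q - ∫ ω, g ω * k ω ∂Q| ≤ ε := by
  have hb : ∀ {f : Ω' → ℝ}, Measurable f → (∀ ω, |f ω| ≤ C) →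
      Integrable (fun ω => f ω * k ω) Q := fun {f} hf hfC =>
    Integrable.of_bound (hf.mul hk).aestronglyMeasurable C (Eventually.of_forall fun ω => by
      rw [Real.norm_eq_abs, abs_mul]
      exact (mul_le_of_le_one_right (abs_nonneg _) (hk1 ω)).trans (hfC ω))
  have hm : Measurable fun ω => |f ω * k ω - g ω * k ω| :=
    continuous_abs.measurable.comp ((hf.mul hk).sub (hg.mul hk))
  rw [← integral_sub (hb hf hfC) (hb hg hgC)]
  refine abs_integral_le_integral_abs.trans ?_
  rw [integral_eq_lintegral_of_nonneg_ae (Eventually.of_forall fun _ => abs_nonneg _)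
    hm.aestronglyMeasurable]
  refine ENNReal.toReal_le_of_le_ofReal hε (le_trans (lintegral_mono fun ω => ?_) h)
  refine ENNReal.ofReal_le_ofReal ?_
  rw [← sub_mul, abs_mul]
  exact mul_le_of_le_one_right (abs_nonneg _) (hk1 ω)

end WeakConvergence

/-! ### Independence -/

section Independence

/-- A function of `A` and of a further independent object is uncorrelated with functions of `B`,
if `A` and `B` are independent. -/
lemma integral_mul_of_indep_prod {X Y α β : Type*} [MeasurableSpace X] [MeasurableSpace Y]
    [MeasurableSpace α] [MeasurableSpace β] {μ : Measure X} {ν : Measure Y} [IsProbabilityMeasure μ]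
    [IsProbabilityMeasure ν] {A : X → α} {B : X → β} (hAB : IndepFun A B μ) (hA : Measurable A)
    (hB : Measurable B) {F : α × Y → ℝ} (hF : Measurable F) {k : β → ℝ} (hk : Measurable k) {C : ℝ}
    (hFC : ∀ p, |F p| ≤ C) (hk1 : ∀ b, |k b| ≤ 1) :
    ∫ p : X × Y, F (A p.1, p.2) * k (B p.1) ∂(μ.prod ν) =
      (∫ p : X × Y, F (A p.1, p.2) ∂(μ.prod ν)) * ∫ x, k (B x) ∂μ := by
  have hFm : Measurable fun p : X × Y => F (A p.1, p.2) :=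
    hF.comp ((hA.comp measurable_fst).prodMk measurable_snd)
  have hkm : Measurable fun p : X × Y => k (B p.1) := hk.comp (hB.comp measurable_fst)
  have hi1 : Integrable (fun p : X × Y => F (A p.1, p.2)) (μ.prod ν) :=
    Integrable.of_bound hFm.aestronglyMeasurable C (Eventually.of_forall fun p => hFC _)
  have hi2 : Integrable (fun p : X × Y => F (A p.1, p.2) * k (B p.1)) (μ.prod ν) :=
    Integrable.of_bound (hFm.mul hkm).aestronglyMeasurable C (Eventually.of_forall fun p => by
      rw [Real.norm_eq_abs, abs_mul]
      exact (mul_le_of_le_one_right (abs_nonneg _) (hk1 _)).trans (hFC _))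
  rw [integral_prod_symm _ hi2, integral_prod_symm _ hi1, ← integral_mul_const]
  refine integral_congr_ae (Eventually.of_forall fun q => ?_)
  have hind : IndepFun (fun x => F (A x, q)) (fun x => k (B x)) μ :=
    hAB.comp (hF.comp measurable_prodMk_right) hk
  exact hind.integral_fun_mul_eq_mul_integral
    (hF.comp (hA.prodMk measurable_const)).aestronglyMeasurable (hk.comp hB).aestronglyMeasurable

lemma indepFun_comp_measurePreserving {X Y α β : Type*} [MeasurableSpace X] [MeasurableSpace Y]
    [MeasurableSpace α] [MeasurableSpace β] {μ : Measure X} {ν : Measure Y} [IsProbabilityMeasure μ]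
    [IsProbabilityMeasure ν] {f : X → Y} (hf : MeasurePreserving f μ ν) {A : Y → α} {B : Y → β}
    (hA : Measurable A) (hB : Measurable B) :
    IndepFun (fun x => A (f x)) (fun x => B (f x)) μ ↔ IndepFun A B ν := by
  have hm : Measurable fun y => (A y, B y) := hA.prodMk hB
  have h : IdentDistrib (fun x => (A (f x), B (f x))) (fun y => (A y, B y)) μ ν :=
    ⟨(hm.comp hf.measurable).aemeasurable, hm.aemeasurable, by
      rw [← hf.map_eq, Measure.map_map hm hf.measurable]; rfl⟩
  exact ⟨fun hi => indepFun_of_identDistrib_pair hi h,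
    fun hi => indepFun_of_identDistrib_pair hi h.symm⟩

end Independence

end OAMP


namespace OAMP

open Filter Topology
open scoped ENNReal

/-! ### Asymptotics of the rows of the errors -/

section Conclusion

set_option linter.unusedSectionVars false

variable {E : Type*} [MeasurableSpace E] {Ω : ℕ → Type*} [∀ N, MeasurableSpace (Ω N)]
  (P : ∀ N, Measure (Ω N)) [∀ N, IsProbabilityMeasure (P N)]
  (e : Bool → ∀ N, Ω N → Fin N → E) (ρ : Bool → Measure E) [∀ b, IsProbabilityMeasure (ρ b)]
  (snd : ℕ → Bool) (Θ : ℕ → E × (ℕ → ℝ) → ℝ) (σ : E → ℝ) {prev : ℕ → ℕ}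
  {Z : ℕ → Type*} [∀ N, MeasurableSpace (Z N)] (z : ∀ N, Ω N → Z N)
  {V : ∀ N, Ω N → Matrix (Fin N) (Fin N) ℝ} (m : Bool → ℕ → ∀ N, Ω N → Fin N → ℝ)
  (u : E → ℝ) (b : Bool) {t : ℕ} (col : Fin t → ℕ)

/-- The errors on side `b`: column `s` is the Gram-Schmidt error of the message of step `col s`,
where `col s = 0` stands for the initial error, the function `u` of the primitives. -/
noncomputable def errG (N : ℕ) (ω : Ω N) (n : Fin N) (s : Fin t) : ℝ :=
  if col s = 0 then u (e b N ω n) else gsError P (m b 0) (m b (col s)) N ω n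

/-- The errors as functions of the primitives and the state of the process. -/
noncomputable def simG (N : ℕ) (p : ((Bool → Fin N → E) × Z N) × MsgState (Fin N)) (n : Fin N)
    (s : Fin t) : ℝ :=
  if col s = 0 then u (p.1.1 b n)
  else serr b (col s) (gsCoeff P (m b 0) (m b (col s)) N) p.2 n

/-- The limit of the rows of the errors. -/
noncomputable def limG (a : E × (ℕ → ℝ)) (s : Fin t) : ℝ :=
  if col s = 0 then u a.1 else lerr ρ snd Θ σ (col s) b a

variable {P e ρ snd Θ σ z m u b col}

lemma measurable_simG (hu : Measurable u) (N : ℕ) :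
    Measurable (simG P (Z := Z) m u b col N) := by
  refine measurable_pi_iff.2 fun n => measurable_pi_iff.2 fun s => ?_
  simp only [simG]
  split_ifs
  · exact hu.comp (by fun_prop)
  · exact (measurable_pi_apply n).comp ((measurable_serr _ _ _).comp measurable_snd)

lemma Regular.errG_eq (R : Regular P e ρ snd Θ σ prev z V m) {K : ℕ} (hK : ∀ s, col s < K) {N : ℕ}
    {ω : Ω N} (hω : IsOrth (V N ω)) :
    errG P e m u b col N ω = simG P m u b col N (given e z N ω, ost e snd Θ V K N ω) := by
  ext n s
  rw [errG, simG]
  split_ifs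
  · rfl
  · rw [R.gsError_eq b (hK s) hω]

lemma Regular.measurable_limG (R : Regular P e ρ snd Θ σ prev z V m) (hu : Measurable u) :
    Measurable (limG ρ snd Θ σ u b col) := by
  refine measurable_pi_iff.2 fun s => ?_
  simp only [limG]
  split_ifs
  · exact hu.comp measurable_fst
  · exact (R.approx_err b (Nat.lt_succ_self _) (R.tendsto_gsCoeff b (col s))).measurable

/-- The signal and the extra random object, as functions of the state of the process. -/
def sigObs (b : Bool) {N : ℕ} (p : ((Bool → Fin N → E) × Z N) × MsgState (Fin N)) :
    (Fin N → ℝ) × Z N := (msgs p.2 b 0, p.1.2)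

lemma measurable_sigObs (N : ℕ) : Measurable (sigObs (E := E) (Z := Z) (N := N) b) :=
  (measurable_msgs measurable_snd b 0).prodMk (by fun_prop)

/-- The simulated process: primitives and state. -/
noncomputable def simState (e : Bool → ∀ N, Ω N → Fin N → E) (snd : ℕ → Bool)
    (Θ : ℕ → E × (ℕ → ℝ) → ℝ) (z : ∀ N, Ω N → Z N) (K N : ℕ) (a : HatΩ Ω N) :
    ((Bool → Fin N → E) × Z N) × MsgState (Fin N) :=
  (given e z N a.1, hst e snd Θ K N a)

lemma Regular.measurable_simState (R : Regular P e ρ snd Θ σ prev z V m) (K N : ℕ) :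
    Measurable (simState e snd Θ z K N) :=
  ((R.model.measurable_given R.haar.measurable_extra N).comp measurable_fst).prodMk
    (R.model.measurable_hst K N)

/-- Expectations of functions of the process agree with those for the simulated process. -/
lemma Regular.integral_state (R : Regular P e ρ snd Θ σ prev z V m) (K N : ℕ)
    {F : ((Bool → Fin N → E) × Z N) × MsgState (Fin N) → ℝ} (hF : Measurable F) :
    ∫ ω, F (given e z N ω, ost e snd Θ V K N ω) ∂(P N) =
      ∫ a, F (simState e snd Θ z K N a) ∂(hatP P N) := by
  have h1 := (R.model.measurable_given R.haar.measurable_extra N).prodMk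
    (R.model.measurable_ost (snd := snd) R.haar K N)
  rw [← integral_map (φ := fun ω => (given e z N ω, ost e snd Θ V K N ω)) h1.aemeasurable
    hF.aestronglyMeasurable, map_ost R.model R.haar K N]
  exact integral_map (R.measurable_simState K N).aemeasurable hF.aestronglyMeasurable

/-- Expectations of continuous functions of `M` distinct rows of the errors, weighted by bounded
functions of the signal and the extra object, approach those for the limit of the rows. -/
lemma Regular.eventually_integral_rows (R : Regular P e ρ snd Θ σ prev z V m) (hu : Measurable u)
    {K : ℕ} (hK0 : 0 < K) (hK : ∀ s, col s < K) {M : ℕ} (φ : (Fin M → Fin t → ℝ) →ᵇ ℝ) {ε : ℝ}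
    (hε : 0 < ε) :
    ∀ᶠ p in embFilter M, ∀ k : (Fin p.1 → ℝ) × Z p.1 → ℝ, Measurable k → (∀ y, |k y| ≤ 1) →
      |(∫ ω, φ (fun i => errG P e m u b col p.1 ω (p.2 i)) * k (m b 0 p.1 ω, z p.1 ω) ∂(P p.1)) -
        ∫ a, φ (fun i => limG ρ snd Θ σ u b col (nrow e b p.1 a (p.2 i))) *
          k (sigObs b (simState e snd Θ z K p.1 a)) ∂(hatP P p.1)| ≤ ε := by
  have hy := iidRows_nrow (R.model.iid b)
  have hg := R.measurable_limG (b := b) (col := col) hu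
  have h1 := hy.tendsto_lintegral_emb (M := M)
    (G := fun N a => simG P m u b col N (simState e snd Θ z K N a)) hg (fun s => ?_) φ
  · filter_upwards [ENNReal.tendsto_nhds_zero.1 h1 (ENNReal.ofReal ε) (by simpa using hε)]
      with ⟨N, idx⟩ hN k hk hk1
    have hGm : Measurable fun q : ((Bool → Fin N → E) × Z N) × MsgState (Fin N) =>
        φ fun i => simG P m u b col N q (idx i) :=
      φ.continuous.measurable.comp (measurable_pi_iff.2 fun i =>
        (measurable_pi_apply (idx i)).comp (measurable_simG hu N))
    have hF : Measurable fun q : ((Bool → Fin N → E) × Z N) × MsgState (Fin N) =>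
        φ (fun i => simG P m u b col N q (idx i)) * k (sigObs b q) :=
      hGm.mul (hk.comp (measurable_sigObs N))
    have e1 : ∫ ω, φ (fun i => errG P e m u b col N ω (idx i)) * k (m b 0 N ω, z N ω) ∂(P N) =
        ∫ a, φ (fun i => simG P m u b col N (simState e snd Θ z K N a) (idx i)) *
          k (sigObs b (simState e snd Θ z K N a)) ∂(hatP P N) := by
      refine Eq.trans (integral_congr_ae ?_) (R.integral_state K N hF)
      filter_upwards [R.haar.orth N] with ω hω
      rw [R.errG_eq hK hω, sigObs, (R.passing.msgs_ost hω K).1 0 hK0]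
      rfl
    rw [e1]
    exact abs_integral_mul_sub_le (hGm.comp (R.measurable_simState K N))
      (φ.continuous.measurable.comp (measurable_pi_iff.2 fun i =>
        hg.comp (hy.measurable_row N (idx i))))
      (hk.comp ((measurable_sigObs N).comp (R.measurable_simState K N)))
      (fun a => φ.norm_coe_le_norm _) (fun a => φ.norm_coe_le_norm _) (fun a => hk1 _) hε.le hN
  · simp only [simG, limG]
    split_ifs
    · exact tendsto_const_nhds.congr fun x => (sub_self _).symm
    · exact (R.approx_err b (hK s) (R.tendsto_gsCoeff b (col s))).row

/-- The limit of the rows of the errors is a linear function of the initial error and of the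
noise of the steps, without the noise which simulates the signal. -/
lemma Regular.limG_eq (R : Regular P e ρ snd Θ σ prev z V m)
    (hO : ∀ k ≥ 1, prev k ≠ 0 → LLNOrthogonal P (gsError P (m (snd k) 0) (m (snd k) (prev k)))
      (gsError P (m (snd k) 0) (m (snd k) k)))
    (hcol : ∀ s, col s ≠ 0 → snd (col s) = !b) {K : ℕ} (hK : ∀ s, col s < K) :
    ∃ (d : Fin t → ℝ) (c : Fin t → ℕ → ℝ), (∀ s, c s 0 = 0) ∧
      ∀ a s, limG ρ snd Θ σ u b col a s = d s * u a.1 + lin K (c s) a.2 := by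
  have h : ∀ s, ∃ (d : ℝ) (c : ℕ → ℝ), c 0 = 0 ∧
      ∀ a, limG ρ snd Θ σ u b col a s = d * u a.1 + lin K c a.2 := fun s => by
    by_cases h0 : col s = 0
    · exact ⟨1, 0, rfl, fun a => by simp [limG, h0, lin]⟩
    · obtain ⟨c, c0, hc⟩ := R.lerr_eq hO (Nat.one_le_iff_ne_zero.2 h0)
      rw [hcol s h0, Bool.not_not] at hc
      exact ⟨0, c, c0, fun a => by simp [limG, h0, hc K (hK s) a]⟩
  choose d c c0 hdc using h
  exact ⟨d, c, c0, fun a s => hdc s a⟩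

end Conclusion

end OAMP


namespace OAMP

open Filter Topology
open scoped ENNReal

/-! ### Gaussianity and independence of the limit of the errors -/

section Limit

set_option linter.unusedSectionVars false

variable {E : Type*} [MeasurableSpace E] {ρ : Measure E} [IsProbabilityMeasure ρ] {u : E → ℝ}
  {v : ℝ≥0} {t K : ℕ} {d : Fin t → ℝ} {c : Fin t → ℕ → ℝ}

/-- The limit row of the errors is jointly Gaussian: a linear image of the initial error and of the
independent Gaussian noise. -/
lemma hasGaussianLaw_limit (hu : Measurable u) (hv : ρ.map u = gaussianReal 0 v) :
    HasGaussianLaw (fun (a : E × (ℕ → ℝ)) s => d s * u a.1 + lin K (c s) a.2) (rowLaw ρ) := by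
  have hu1 : HasGaussianLaw (fun a : E × (ℕ → ℝ) => u a.1) (rowLaw ρ) := ⟨by
    have : (rowLaw ρ).map (fun a => u a.1) = gaussianReal 0 v := by
      rw [← hv, show (fun a : E × (ℕ → ℝ) => u a.1) = u ∘ Prod.fst from rfl,
        ← Measure.map_map hu measurable_fst, measurePreserving_fst.map_eq]
    rw [this]; infer_instance⟩
  have hζ : Measurable fun (ζ : ℕ → ℝ) (i : Fin K) => ζ i := by fun_prop
  have hz1 : HasGaussianLaw (fun (a : E × (ℕ → ℝ)) (i : Fin K) => a.2 i) (rowLaw ρ) := ⟨by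
    have : (rowLaw ρ).map (fun a (i : Fin K) => a.2 i) = seqG.map fun ζ (i : Fin K) => ζ i := by
      rw [show (fun (a : E × (ℕ → ℝ)) (i : Fin K) => a.2 i) =
        (fun (ζ : ℕ → ℝ) (i : Fin K) => ζ i) ∘ Prod.snd from rfl,
        ← Measure.map_map hζ measurable_snd, measurePreserving_snd.map_eq]
    rw [this]
    exact (seqG_hasGaussianLaw K).isGaussian_map⟩
  have h := IndepFun.hasGaussianLaw hu1 hz1 (indepFun_prod (μ := ρ) (ν := seqG) hu hζ)
  have h2 := h.map_fun (ContinuousLinearMap.pi fun s => d s • ContinuousLinearMap.fst ℝ ℝ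
    (Fin K → ℝ) + (linCLM K (c s)).comp (ContinuousLinearMap.snd ℝ ℝ (Fin K → ℝ)))
  have e : (fun (a : E × (ℕ → ℝ)) s => d s * u a.1 + lin K (c s) a.2) = fun a s =>
      d s * u a.1 + linCLM K (c s) (fun i => a.2 i) := by
    funext a s
    rw [linCLM_apply]
  rw [e]
  exact h2

lemma exists_map_limit_eq (hu : Measurable u) (hv : ρ.map u = gaussianReal 0 v) (s : Fin t) :
    ∃ v' : ℝ≥0, (rowLaw ρ).map (fun a => d s * u a.1 + lin K (c s) a.2) = gaussianReal 0 v' := by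
  have h := (hasGaussianLaw_limit (d := d) (c := c) (K := K) hu hv).eval s
  refine ⟨(Var[fun a => d s * u a.1 + lin K (c s) a.2; rowLaw ρ]).toNNReal,
    h.map_eq_gaussianReal.trans ?_⟩
  congr 1
  have hL : MemLp u 2 ρ := by
    have h2 := memLp_id_gaussianReal (μ := 0) (v := v) 2
    rw [← hv] at h2
    exact h2.comp_measurePreserving ⟨hu, rfl⟩
  have h0 : ∫ y, u y ∂ρ = 0 := by
    have h2 := integral_id_gaussianReal (μ := 0) (v := v)
    rwa [← hv, integral_map hu.aemeasurable (by fun_prop)] at h2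
  have i1 : Integrable (fun a : E × (ℕ → ℝ) => u a.1) (rowLaw ρ) :=
    (hL.integrable (by norm_num)).comp_fst _
  have i2 := (memLp_lin_row ρ K (c s)).integrable (by norm_num)
  rw [integral_add (i1.const_mul _) i2, integral_const_mul, integral_fun_fst, integral_fun_snd,
    h0, integral_lin]
  simp

lemma lin_update_zero {c : ℕ → ℝ} (c0 : c 0 = 0) (ζ : ℕ → ℝ) (y : ℝ) :
    lin K c (Function.update ζ 0 y) = lin K c ζ := by
  refine Finset.sum_congr rfl fun i _ => ?_
  by_cases h : i = 0
  · rw [h, c0, zero_mul, zero_mul]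
  · rw [Function.update_of_ne h]

end Limit

section Independence

set_option linter.unusedSectionVars false

variable {E : Type*} [MeasurableSpace E] {Ω : ℕ → Type*} [∀ N, MeasurableSpace (Ω N)]
  {P : ∀ N, Measure (Ω N)} [∀ N, IsProbabilityMeasure (P N)]
  {e : Bool → ∀ N, Ω N → Fin N → E} {ρ : Bool → Measure E} [∀ b, IsProbabilityMeasure (ρ b)]
  {snd : ℕ → Bool} {Θ : ℕ → E × (ℕ → ℝ) → ℝ} {σ : E → ℝ} {prev : ℕ → ℕ}
  {Z : ℕ → Type*} [∀ N, MeasurableSpace (Z N)] {z : ∀ N, Ω N → Z N}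
  {V : ∀ N, Ω N → Matrix (Fin N) (Fin N) ℝ} {m : Bool → ℕ → ∀ N, Ω N → Fin N → ℝ}
  {u : E → ℝ} {b : Bool} {t : ℕ} {col : Fin t → ℕ}

/-- In the simulated process the signal depends on the primitives and the noise of step `0`. -/
lemma msgs_hst_zero_congr {K N : ℕ} (hK : 0 < K) (ω : Ω N) {ζ ζ' : Fin N → ℕ → ℝ}
    (h : ∀ n, ζ n 0 = ζ' n 0) :
    msgs (hst e snd Θ K N (ω, ζ)) b 0 = msgs (hst e snd Θ K N (ω, ζ')) b 0 := by
  induction K with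
  | zero => exact absurd hK (lt_irrefl 0)
  | succ k ih =>
    rcases Nat.eq_zero_or_pos k with rfl | hk
    · rw [hst_succ, hst_succ]
      have hh : (fun n => ζ n 0) = fun n => ζ' n 0 := funext h
      change msgs (step 0 (snd 0) _ _ (dice _ 0 _ fun n => ζ n 0)) b 0 =
        msgs (step 0 (snd 0) _ _ (dice _ 0 _ fun n => ζ' n 0)) b 0
      rw [hh]
      rfl
    · rw [hst_succ, hst_succ, msgs_step_of_ne _ _ _ _ _ _ hk.ne,
        msgs_step_of_ne _ _ _ _ _ _ hk.ne]
      exact ih hk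


/-- Sampling the noise of step `0` separately. -/
def sampleZero {N : ℕ} (q : (Ω N × (Fin N → ℝ)) × (Fin N → ℕ → ℝ)) : HatΩ Ω N :=
  (q.1.1, setCol q.2 0 q.1.2)

lemma measurePreserving_sampleZero (N : ℕ) :
    MeasurePreserving (sampleZero (Ω := Ω) (N := N)) (((P N).prod (stdG (Fin N))).prod
      (noise (Fin N))) (hatP P N) := by
  have h1 : MeasurePreserving (fun a : (Fin N → ℝ) × (Fin N → ℕ → ℝ) => setCol a.2 0 a.1)
      ((stdG (Fin N)).prod (noise (Fin N))) (noise (Fin N)) :=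
    MeasurePreserving.comp (g := fun a : (Fin N → ℕ → ℝ) × (Fin N → ℝ) => setCol a.1 0 a.2)
      ⟨measurable_setCol 0, noise_resample 0⟩ Measure.measurePreserving_swap
  exact ((MeasurePreserving.id (P N)).prod h1).comp
    (measurePreserving_prodAssoc (P N) (stdG (Fin N)) (noise (Fin N)))

/-- If the initial error is independent of the signal and the extra object, then functions of the
limits of the rows are uncorrelated with functions of the signal and the extra object: the noise
involved is that of the steps `≥ 1`, and the signal is a function of the noise of step `0`. -/
lemma Regular.integral_limit_mul (R : Regular P e ρ snd Θ σ prev z V m) (hu : Measurable u)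
    {K N : ℕ} (hK : 0 < K)
    (hI : IndepFun (fun ω n => u (e b N ω n)) (fun ω => (m b 0 N ω, z N ω)) (P N))
    {d : Fin t → ℝ} {c : Fin t → ℕ → ℝ} (c0 : ∀ s, c s 0 = 0)
    (hdc : ∀ a s, limG ρ snd Θ σ u b col a s = d s * u a.1 + lin K (c s) a.2)
    {M : ℕ} (idx : Fin M ↪ Fin N) (φ : (Fin M → Fin t → ℝ) →ᵇ ℝ) {k : (Fin N → ℝ) × Z N → ℝ}
    (hk : Measurable k) (hk1 : ∀ y, |k y| ≤ 1) :
    ∫ a, φ (fun i => limG ρ snd Θ σ u b col (nrow e b N a (idx i))) *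
        k (sigObs b (simState e snd Θ z K N a)) ∂(hatP P N) =
      (∫ a, φ (fun i => limG ρ snd Θ σ u b col (nrow e b N a (idx i))) ∂(hatP P N)) *
        ∫ a, k (sigObs b (simState e snd Θ z K N a)) ∂(hatP P N) := by
  set A : HatΩ Ω N → Fin N → ℝ := fun a n => u (e b N a.1 n) with hA
  set B : HatΩ Ω N → (Fin N → ℝ) × Z N := fun a => sigObs b (simState e snd Θ z K N a) with hB
  have hue : Measurable fun ω n => u (e b N ω n) := measurable_pi_iff.2 fun n =>
    hu.comp ((R.model.iid b).measurable_row N n)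
  have hAm : Measurable A := hue.comp measurable_fst
  have hBm : Measurable B := (measurable_sigObs N).comp (R.measurable_simState K N)
  -- independence of the initial error, transferred to the simulated process
  have hAB : IndepFun A B (hatP P N) := by
    have hQ : Measurable fun q : ((Bool → Fin N → E) × Z N) × MsgState (Fin N) =>
        ((fun n => u (q.1.1 b n) : Fin N → ℝ), sigObs b q) :=
      Measurable.prodMk (measurable_pi_iff.2 fun n => hu.comp (by fun_prop)) (measurable_sigObs N)
    have h1 := (R.model.measurable_given R.haar.measurable_extra N).prodMk
      (R.model.measurable_ost (snd := snd) R.haar K N)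
    have hae : (fun ω => ((fun n => u (e b N ω n) : Fin N → ℝ), (m b 0 N ω, z N ω))) =ᵐ[P N]
        fun ω => ((fun n => u ((given e z N ω, ost e snd Θ V K N ω).1.1 b n) : Fin N → ℝ),
          sigObs b (given e z N ω, ost e snd Θ V K N ω)) := by
      filter_upwards [R.haar.orth N] with ω hω
      rw [sigObs, (R.passing.msgs_ost hω K).1 0 hK]
      rfl
    refine indepFun_of_identDistrib_pair hI ⟨?_, (hAm.prodMk hBm).aemeasurable, ?_⟩
    · exact (hQ.comp h1).aemeasurable.congr hae.symm
    · rw [Measure.map_congr hae, ← Function.comp_def (fun q : ((Bool → Fin N → E) × Z N) ×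
        MsgState (Fin N) => ((fun n => u (q.1.1 b n) : Fin N → ℝ), sigObs b q))
        (fun ω => (given e z N ω, ost e snd Θ V K N ω)), ← Measure.map_map hQ h1,
        map_ost R.model R.haar K N]
      exact Measure.map_map hQ (R.measurable_simState K N)
  set A₀ : Ω N × (Fin N → ℝ) → Fin N → ℝ := fun q n => u (e b N q.1 n) with hA₀
  set B₀ : Ω N × (Fin N → ℝ) → (Fin N → ℝ) × Z N := fun q => B (sampleZero (q, 0)) with hB₀
  have hT := measurePreserving_sampleZero (P := P) N
  have hA₀m : Measurable A₀ := hue.comp measurable_fst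
  have hB₀m : Measurable B₀ := hBm.comp (hT.measurable.comp (measurable_id.prodMk measurable_const))
  have hBT : ∀ q, B (sampleZero q) = B₀ q.1 := fun q => by
    simp only [hB, hB₀, sigObs, simState, sampleZero]
    rw [msgs_hst_zero_congr hK q.1.1 (ζ := setCol q.2 0 q.1.2) (ζ' := setCol 0 0 q.1.2)
      fun n => by simp [setCol]]
  have hI₀ : IndepFun A₀ B₀ ((P N).prod (stdG (Fin N))) := by
    refine (indepFun_comp_measurePreserving (μ := ((P N).prod (stdG (Fin N))).prod (noise (Fin N)))
      measurePreserving_fst hA₀m hB₀m).1 ?_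
    have h := (indepFun_comp_measurePreserving hT hAm hBm).2 hAB
    simp only [hBT] at h
    exact h
  set F : (Fin N → ℝ) × (Fin N → ℕ → ℝ) → ℝ := fun q =>
    φ fun i s => d s * q.1 (idx i) + lin K (c s) (q.2 (idx i)) with hF
  have hFm : Measurable F := by
    refine φ.continuous.measurable.comp (measurable_pi_iff.2 fun i => measurable_pi_iff.2 fun s => ?_)
    have := measurable_lin K (c s)
    fun_prop
  have hFT : ∀ q, φ (fun i => limG ρ snd Θ σ u b col (nrow e b N (sampleZero q) (idx i))) =
      F (A₀ q.1, q.2) := fun q => by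
    simp only [hF, hA₀]
    congr 1
    funext i s
    rw [hdc, nrow]
    simp only [sampleZero, setCol]
    rw [lin_update_zero (c0 s)]
  have hφm : Measurable fun a => φ fun i => limG ρ snd Θ σ u b col (nrow e b N a (idx i)) :=
    φ.continuous.measurable.comp (measurable_pi_iff.2 fun i => (R.measurable_limG hu).comp
      ((iidRows_nrow (R.model.iid b)).measurable_row N (idx i)))
  have hkB : Measurable fun a => k (B a) := hk.comp hBm
  have tr : ∀ {f : HatΩ Ω N → ℝ}, Measurable f → ∫ a, f a ∂(hatP P N) =
      ∫ q, f (sampleZero q) ∂(((P N).prod (stdG (Fin N))).prod (noise (Fin N))) := fun {f} hf => by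
    rw [← hT.map_eq, integral_map hT.measurable.aemeasurable hf.aestronglyMeasurable]
  have hprod : Measurable fun a => φ (fun i => limG ρ snd Θ σ u b col (nrow e b N a (idx i))) *
      k (B a) := hφm.mul hkB
  change ∫ a, φ (fun i => limG ρ snd Θ σ u b col (nrow e b N a (idx i))) * k (B a) ∂(hatP P N) =
    _ * ∫ a, k (B a) ∂(hatP P N)
  rw [tr hprod, tr hφm, tr hkB]
  simp only [hFT, hBT]
  rw [integral_mul_of_indep_prod hI₀ hA₀m hB₀m hFm hk (fun q => φ.norm_coe_le_norm _) hk1,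
    integral_fun_fst (μ := (P N).prod (stdG (Fin N))) (fun q => k (B₀ q))]
  simp

end Independence

end OAMP


namespace OAMP

open Filter Topology
open scoped ENNReal

/-! ### Asymptotic Gaussianity and independence of the errors -/

section Errors

set_option linter.unusedSectionVars false

variable {E : Type*} [MeasurableSpace E] {Ω : ℕ → Type*} [∀ N, MeasurableSpace (Ω N)]
  {P : ∀ N, Measure (Ω N)} [∀ N, IsProbabilityMeasure (P N)]
  {e : Bool → ∀ N, Ω N → Fin N → E} {ρ : Bool → Measure E} [∀ b, IsProbabilityMeasure (ρ b)]
  {snd : ℕ → Bool} {Θ : ℕ → E × (ℕ → ℝ) → ℝ} {σ : E → ℝ} {prev : ℕ → ℕ}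
  {Z : ℕ → Type*} [∀ N, MeasurableSpace (Z N)] {z : ∀ N, Ω N → Z N}
  {V : ∀ N, Ω N → Matrix (Fin N) (Fin N) ℝ} {m : Bool → ℕ → ∀ N, Ω N → Fin N → ℝ}
  {u : E → ℝ} {b : Bool} {t : ℕ} {col : Fin t → ℕ}

lemma Regular.integral_limit (R : Regular P e ρ snd Θ σ prev z V m) (hu : Measurable u) {M N : ℕ}
    (idx : Fin M ↪ Fin N) (φ : (Fin M → Fin t → ℝ) →ᵇ ℝ) :
    ∫ a, φ (fun i => limG ρ snd Θ σ u b col (nrow e b N a (idx i))) ∂(hatP P N) =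
      ∫ y, φ y ∂(Measure.pi fun _ => (rowLaw (ρ b)).map (limG ρ snd Θ σ u b col)) := by
  have hy := iidRows_nrow (R.model.iid b)
  have hg := R.measurable_limG (b := b) (col := col) hu
  have hm : Measurable fun a (i : Fin M) => limG ρ snd Θ σ u b col (nrow e b N a (idx i)) :=
    measurable_pi_iff.2 fun i => hg.comp (hy.measurable_row N (idx i))
  rw [← hy.map_emb hg idx]
  exact (integral_map hm.aemeasurable φ.continuous.measurable.aestronglyMeasurable).symm

/-- Any `M` distinct rows of the errors converge weakly to independent copies of the limit. -/
lemma Regular.weak_limit (R : Regular P e ρ snd Θ σ prev z V m) (hu : Measurable u) {M : ℕ}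
    (φ : (Fin M → Fin t → ℝ) →ᵇ ℝ) {ε : ℝ} (hε : 0 < ε) :
    ∃ N₀ : ℕ, ∀ N ≥ N₀, ∀ idx : Fin M ↪ Fin N,
      |(∫ ω, φ (fun i => errG P e m u b col N ω (idx i)) ∂(P N)) -
        ∫ y, φ y ∂(Measure.pi fun _ => (rowLaw (ρ b)).map (limG ρ snd Θ σ u b col))| ≤ ε := by
  have hK : ∀ s, col s < Finset.univ.sup col + 1 := fun s =>
    Nat.lt_succ_of_le (Finset.le_sup (f := col) (Finset.mem_univ s))
  have h := eventually_embFilter.1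
    (R.eventually_integral_rows hu (b := b) (Nat.succ_pos _) hK φ hε)
  obtain ⟨N₀, h⟩ := h
  refine ⟨N₀, fun N hN idx => ?_⟩
  have h1 := h N hN idx (fun _ => 1) measurable_const (fun _ => by simp)
  simp only [mul_one] at h1
  rwa [R.integral_limit hu idx φ] at h1

/-- The columns of the errors are pseudo-IID Gaussian and their rows are asymptotically jointly
Gaussian. -/
lemma Regular.isCPIIDGRJG (R : Regular P e ρ snd Θ σ prev z V m)
    (hO : ∀ k ≥ 1, prev k ≠ 0 → LLNOrthogonal P (gsError P (m (snd k) 0) (m (snd k) (prev k)))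
      (gsError P (m (snd k) 0) (m (snd k) k)))
    (hcol : ∀ s, col s ≠ 0 → snd (col s) = !b) (hu : Measurable u) {v : ℝ≥0}
    (hv : (ρ b).map u = gaussianReal 0 v) :
    IsCPIIDGRJG P fun N ω => Matrix.of fun n s => errG P e m u b col N ω n s := by
  have hK : ∀ s, col s < Finset.univ.sup col + 1 := fun s =>
    Nat.lt_succ_of_le (Finset.le_sup (f := col) (Finset.mem_univ s))
  obtain ⟨d, c, c0, hdc⟩ := R.limG_eq hO hcol hK
  have hg := R.measurable_limG (b := b) (col := col) hu
  have : IsProbabilityMeasure ((rowLaw (ρ b)).map (limG ρ snd Θ σ u b col)) :=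
    Measure.isProbabilityMeasure_map hg.aemeasurable
  refine ⟨fun s => ?_, (rowLaw (ρ b)).map (limG ρ snd Θ σ u b col), ?_, fun h ε hε => ?_⟩
  · obtain ⟨v', hv'⟩ := exists_map_limit_eq (d := d) (c := c) (K := Finset.univ.sup col + 1)
      hu hv s
    refine ⟨v', fun M h ε hε => ?_⟩
    have hs : Measurable fun (y : Fin M → Fin t → ℝ) i => y i s := by fun_prop
    obtain ⟨N₀, hN₀⟩ := R.weak_limit hu (b := b) (col := col)
      (h.compContinuous ⟨fun (y : Fin M → Fin t → ℝ) i => y i s, by fun_prop⟩) hε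
    refine ⟨N₀, fun N hN idx => ?_⟩
    have h1 := hN₀ N hN idx
    have e1 : (Measure.pi fun _ : Fin M => gaussianReal 0 v') =
        (Measure.pi fun _ : Fin M => (rowLaw (ρ b)).map (limG ρ snd Θ σ u b col)).map
          fun (y : Fin M → Fin t → ℝ) i => y i s := by
      have h2 := Measure.pi_map_pi (μ := fun _ : Fin M =>
        (rowLaw (ρ b)).map (limG ρ snd Θ σ u b col)) (f := fun _ (y : Fin t → ℝ) => y s)
        (fun _ => (measurable_pi_apply s).aemeasurable)
      rw [h2, Measure.map_map (measurable_pi_apply s) hg, ← hv']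
      congr 1
      funext i
      congr 1
      funext a
      exact (hdc a s).symm
    rw [e1, integral_map hs.aemeasurable h.continuous.measurable.aestronglyMeasurable]
    exact h1
  · have h1 := (hasGaussianLaw_limit (d := d) (c := c) (K := Finset.univ.sup col + 1)
      hu hv).isGaussian_map
    convert h1 using 2
    funext a s
    exact hdc a s
  · obtain ⟨N₀, hN₀⟩ := R.weak_limit hu (M := 1) (b := b) (col := col)
      (h.compContinuous ⟨fun y : Fin 1 → Fin t → ℝ => y 0, by fun_prop⟩) hε
    refine ⟨N₀, fun N hN n => ?_⟩
    have h1 := hN₀ N hN ⟨fun _ => n, Function.injective_of_subsingleton _⟩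
    have e1 := integral_map (μ := Measure.pi fun _ : Fin 1 =>
      (rowLaw (ρ b)).map (limG ρ snd Θ σ u b col)) (φ := fun y : Fin 1 → Fin t → ℝ => y 0)
      (measurable_pi_apply 0).aemeasurable (f := h) h.continuous.measurable.aestronglyMeasurable
    rw [(measurePreserving_eval (fun _ : Fin 1 =>
      (rowLaw (ρ b)).map (limG ρ snd Θ σ u b col)) 0).map_eq] at e1
    rw [e1]
    exact h1

/-- The errors are asymptotically independent of the signal and of the extra object, if the
initial errors are. -/
lemma Regular.asympIndep (R : Regular P e ρ snd Θ σ prev z V m)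
    (hO : ∀ k ≥ 1, prev k ≠ 0 → LLNOrthogonal P (gsError P (m (snd k) 0) (m (snd k) (prev k)))
      (gsError P (m (snd k) 0) (m (snd k) k)))
    (hcol : ∀ s, col s ≠ 0 → snd (col s) = !b) (hu : Measurable u)
    (hI : ∀ N, IndepFun (fun ω n => u (e b N ω n)) (fun ω => (m b 0 N ω, z N ω)) (P N)) :
    AsympIndep P (fun N ω => Matrix.of fun n s => errG P e m u b col N ω n s)
      fun N ω => (m b 0 N ω, z N ω) := by
  intro M φ k hk hk1 ε hε
  have hK : ∀ s, col s < Finset.univ.sup col + 1 := fun s =>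
    Nat.lt_succ_of_le (Finset.le_sup (f := col) (Finset.mem_univ s))
  obtain ⟨d, c, c0, hdc⟩ := R.limG_eq hO hcol hK
  obtain ⟨N₀, hN₀⟩ := eventually_embFilter.1
    (R.eventually_integral_rows hu (b := b) (Nat.succ_pos _) hK φ (half_pos hε))
  refine ⟨N₀, fun N hN idx => ?_⟩
  -- Both `E[h k]` and `E[h]` are within `ε/2` of their values for the limit rows, where the
  -- expectation of the product is the product of the expectations; and `|E[k]| ≤ 1`.
  have h1 := hN₀ N hN idx (k N) (hk N) (hk1 N)
  have h2 := hN₀ N hN idx (fun _ => 1) measurable_const (fun _ => by simp)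
  simp only [mul_one] at h2
  have h3 : ∫ a, k N (sigObs b (simState e snd Θ z (Finset.univ.sup col + 1) N a)) ∂(hatP P N) =
      ∫ ω, k N (m b 0 N ω, z N ω) ∂(P N) := by
    rw [← R.integral_state _ N (F := fun q => k N (sigObs b q))
      ((hk N).comp (measurable_sigObs N))]
    refine integral_congr_ae ?_
    filter_upwards [R.haar.orth N] with ω hω
    rw [sigObs, (R.passing.msgs_ost hω _).1 0 (Nat.succ_pos _)]
    rfl
  have h4 := R.integral_limit_mul hu (Nat.succ_pos _) (hI N) c0 hdc idx φ (hk N) (hk1 N)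
  rw [h4, h3] at h1
  have h5 : |∫ ω, k N (m b 0 N ω, z N ω) ∂(P N)| ≤ 1 := by
    have := norm_integral_le_of_norm_le_const (μ := P N) (f := fun ω => k N (m b 0 N ω, z N ω))
      (C := 1) (Eventually.of_forall fun ω => hk1 N _)
    simpa using this
  change |(∫ ω, φ (fun i => errG P e m u b col N ω (idx i)) * k N (m b 0 N ω, z N ω) ∂(P N)) -
    (∫ ω, φ (fun i => errG P e m u b col N ω (idx i)) ∂(P N)) *
      ∫ ω, k N (m b 0 N ω, z N ω) ∂(P N)| ≤ ε
  generalize (∫ ω, k N (m b 0 N ω, z N ω) ∂(P N)) = q at *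
  generalize (∫ ω, φ (fun i => errG P e m u b col N ω (idx i)) ∂(P N)) = p at *
  generalize (∫ a, φ (fun i => limG ρ snd Θ σ u b col (nrow e b N a (idx i))) ∂(hatP P N)) = r at *
  have h6 : |(p - r) * q| ≤ ε / 2 := by
    rw [abs_mul]
    exact (mul_le_of_le_one_right (abs_nonneg _) h5).trans h2
  have h7 := abs_sub_le (∫ ω, φ (fun i => errG P e m u b col N ω (idx i)) *
    k N (m b 0 N ω, z N ω) ∂(P N)) (r * q) (p * q)
  have h8 : |r * q - p * q| = |(p - r) * q| := by rw [abs_sub_comm, sub_mul]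
  linarith

end Errors

end OAMP


namespace OAMP

open Filter Topology
open scoped ENNReal

/-! ### The generic iterative process as a message passing process -/

section Rows

set_option linter.unusedSectionVars false

variable {Ω : ℕ → Type*} [∀ N, MeasurableSpace (Ω N)] {P : ∀ N, Measure (Ω N)}
  [∀ N, IsProbabilityMeasure (P N)]

lemma IIDRows.comp {α β : Type*} [MeasurableSpace α] [MeasurableSpace β]
    {y : ∀ N, Ω N → Fin N → α} {μ : Measure α} [IsProbabilityMeasure μ] (h : IIDRows P y μ)
    {g : α → β} (hg : Measurable g) : IIDRows P (fun N ω n => g (y N ω n)) (μ.map g) where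
  measurable N := measurable_pi_iff.2 fun n => hg.comp (h.measurable_row N n)
  law _ := h.map_emb hg (Function.Embedding.refl (Fin _))

lemma iidRows_of_iIndepFun {α : Type*} [MeasurableSpace α] {y : ∀ N, Ω N → Fin N → α}
    {μ : Measure α} (hm : ∀ N n, Measurable fun ω => y N ω n)
    (hi : ∀ N, iIndepFun (fun n ω => y N ω n) (P N))
    (hl : ∀ N n, (P N).map (fun ω => y N ω n) = μ) : IIDRows P y μ where
  measurable N := measurable_pi_iff.2 fun n => hm N n
  law N := by
    have h := (iIndepFun_iff_map_fun_eq_pi_map fun n => (hm N n).aemeasurable).1 (hi N)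
    simp only [hl] at h
    exact h

/-- The Gram-Schmidt error of `a s + g`, for a noise `g` independent of the normalized signal `s`,
is `g`. -/
lemma gsError_smul_add {s g : ∀ N, Ω N → Fin N → ℝ} (a : ℝ) {v : ℝ≥0} {N : ℕ}
    (hs : Measurable (s N)) (hg : Measurable (g N)) (hsq : ∫ ω, s N ω ⬝ᵥ s N ω ∂(P N) = N)
    (hG : ∀ n, (P N).map (fun ω => g N ω n) = gaussianReal 0 v)
    (hI : IndepFun (g N) (s N) (P N)) (ω : Ω N) :
    gsError P s (fun N ω => a • s N ω + g N ω) N ω = g N ω := by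
  rcases Nat.eq_zero_or_pos N with rfl | hN
  · exact funext fun n => n.elim0
  have hN' : (N : ℝ) ≠ 0 := Nat.cast_ne_zero.2 hN.ne'
  have hint : Integrable (fun ω => s N ω ⬝ᵥ s N ω) (P N) := by
    by_contra h
    rw [integral_undef h] at hsq
    exact hN' hsq.symm
  have hsn : ∀ n, Measurable fun ω => s N ω n := fun n => (measurable_pi_apply n).comp hs
  have hgn : ∀ n, Measurable fun ω => g N ω n := fun n => (measurable_pi_apply n).comp hg
  have hsi : ∀ n, Integrable (fun ω => s N ω n) (P N) := fun n => by
    have h2 : MemLp (fun ω => s N ω n) 2 (P N) := by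
      rw [memLp_two_iff_integrable_sq (hsn n).aestronglyMeasurable]
      refine hint.mono' ((hsn n).pow_const 2).aestronglyMeasurable (Eventually.of_forall fun ω => ?_)
      rw [Real.norm_eq_abs, abs_of_nonneg (sq_nonneg _), sq]
      exact Finset.single_le_sum (f := fun n => s N ω n * s N ω n)
        (fun i _ => mul_self_nonneg _) (Finset.mem_univ n)
    exact h2.integrable (by norm_num)
  have hgi : ∀ n, Integrable (fun ω => g N ω n) (P N) := fun n => by
    have h2 := memLp_id_gaussianReal (μ := 0) (v := v) 1
    rw [← hG n] at h2
    exact (h2.comp_measurePreserving ⟨hgn n, rfl⟩).integrable le_rfl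
  have hg0 : ∀ n, ∫ ω, g N ω n ∂(P N) = 0 := fun n => by
    have h2 := integral_id_gaussianReal (μ := 0) (v := v)
    rwa [← hG n, integral_map (hgn n).aemeasurable (by fun_prop)] at h2
  have hIn : ∀ n, IndepFun (fun ω => g N ω n) (fun ω => s N ω n) (P N) := fun n =>
    hI.comp (measurable_pi_apply n) (measurable_pi_apply n)
  have hgs : ∀ n, Integrable (fun ω => g N ω n * s N ω n) (P N) := fun n =>
    (hIn n).integrable_mul (hgi n) (hsi n)
  have hgd : Integrable (fun ω => g N ω ⬝ᵥ s N ω) (P N) := integrable_finsetSum _ fun n _ => hgs n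
  have h0 : ∫ ω, g N ω ⬝ᵥ s N ω ∂(P N) = 0 := by
    simp only [dotProduct]
    rw [integral_finsetSum _ fun n _ => hgs n]
    refine Finset.sum_eq_zero fun n _ => ?_
    rw [(hIn n).integral_fun_mul_eq_mul_integral (hgn n).aestronglyMeasurable
      (hsn n).aestronglyMeasurable, hg0 n, zero_mul]
  have hc : gsCoeff P s (fun N ω => a • s N ω + g N ω) N = a := by
    rw [gsCoeff]
    simp only [add_dotProduct, smul_dotProduct, smul_eq_mul]
    rw [integral_add (hint.const_mul a) hgd,
      integral_const_mul, hsq, h0, add_zero]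
    field_simp
  rw [gsError, hc, add_sub_cancel_left]

end Rows

namespace System

universe u v w

/-- The side which sends in step `k`: step `0` sends the signal `x`, and steps `2 t - 1` and `2 t`
send the outputs of the estimators `φ_t` and `γ_t`. The side of `x` is `true`, that of `𝒳` is
`false`. -/
def side (k : ℕ) : Bool := decide (k = 0 ∨ k % 2 = 1)

/-- The step in which the input of the estimator of step `k` has been received, or `0` if this is
the initial input. -/
def inputStep (k : ℕ) : ℕ := if k < 3 then 0 else if k % 2 = 1 then k - 1 else k - 3

lemma step_cases (k : ℕ) : k = 0 ∨ (∃ j, k = 2 * j + 1) ∨ ∃ j, k = 2 * j + 2 := by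
  rcases Nat.even_or_odd' k with ⟨j, rfl | rfl⟩
  · rcases Nat.eq_zero_or_pos j with rfl | h
    · exact Or.inl rfl
    · exact Or.inr (Or.inr ⟨j - 1, by omega⟩)
  · exact Or.inr (Or.inl ⟨j, rfl⟩)

lemma side_zero : side 0 = true := rfl

lemma side_odd (j : ℕ) : side (2 * j + 1) = true := by
  simp only [side, decide_eq_true_eq]; omega

lemma side_even (j : ℕ) : side (2 * j + 2) = false := by
  simp only [side, decide_eq_false_iff_not]; omega

variable {Ω : ℕ → Type u} {Ξ : Type v} {W : Type w}

/-- The function which computes an entry of the message of step `k` from the entries of the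
primitives and of the previous messages on the same side. -/
def rule (S : System Ω Ξ W) (k : ℕ) (p : ((ℝ × ℝ × W) × (ℝ × Ξ)) × (ℕ → ℝ)) : ℝ :=
  if k = 0 then p.1.1.1
  else if k % 2 = 1 then
    S.φ ((k + 1) / 2) (if k = 1 then S.aφ * p.1.1.1 + p.1.1.2.1 else p.2 (k - 1)) p.1.1.1 p.1.1.2.2
  else S.γ (k / 2) (if k = 2 then S.aγ * p.2 0 + p.1.2.1 else p.2 (k - 3)) (p.2 0) p.1.2.2

/-- The primitives `(xₙ, f₀ₙ, wₙ)` of side `true` and `(g₀ₙ, ξₙ)` of side `false`, completed by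
constants to elements of a common space. -/
def entries (S : System Ω Ξ W) (ξ₀ : Ξ) (w₀ : W) (b : Bool) (N : ℕ) (ω : Ω N) (n : Fin N) :
    (ℝ × ℝ × W) × (ℝ × Ξ) :=
  if b then ((S.x N ω n, S.f₀ N ω n, S.w N ω n), (0, ξ₀))
  else ((0, 0, w₀), (S.g₀ N ω n, S.ξ N ω n))

/-- The message of step `k` as seen on side `b`. -/
def message (S : System Ω Ξ W) (b : Bool) (k N : ℕ) (ω : Ω N) : Fin N → ℝ :=
  if k = 0 then if b then S.x N ω else S.X N ω
  else if k % 2 = 1 then if b then S.xOut ((k + 1) / 2) N ω else S.XIn ((k + 1) / 2) N ω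
  else if b then S.xIn (k / 2) N ω else S.XOut (k / 2) N ω

lemma message_odd (S : System Ω Ξ W) (b : Bool) (j : ℕ) : S.message b (2 * j + 1) =
    if b then S.xOut (j + 1) else S.XIn (j + 1) := by
  funext N ω
  have h2 : (2 * j + 1) % 2 = 1 := by omega
  have h3 : (2 * j + 1 + 1) / 2 = j + 1 := by omega
  simp only [message, h2, h3, Nat.add_one_ne_zero, if_false, if_true]
  cases b <;> rfl

lemma message_even (S : System Ω Ξ W) (b : Bool) (j : ℕ) : S.message b (2 * j + 2) =
    if b then S.xIn (j + 1) else S.XOut (j + 1) := by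
  funext N ω
  have h1 : 2 * j + 2 ≠ 0 := by omega
  have h2 : (2 * j + 2) % 2 ≠ 1 := by omega
  have h3 : (2 * j + 2) / 2 = j + 1 := by omega
  simp only [message, h1, h2, h3, if_false]
  cases b <;> rfl

lemma rule_odd (S : System Ω Ξ W) (j : ℕ) (p : ((ℝ × ℝ × W) × (ℝ × Ξ)) × (ℕ → ℝ)) :
    S.rule (2 * j + 1) p = S.φ (j + 1) (if j = 0 then S.aφ * p.1.1.1 + p.1.1.2.1 else p.2 (2 * j))
      p.1.1.1 p.1.1.2.2 := by
  have h2 : (2 * j + 1) % 2 = 1 := by omega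
  have h3 : (2 * j + 1 + 1) / 2 = j + 1 := by omega
  have h4 : (2 * j + 1 = 1) ↔ j = 0 := by omega
  simp only [rule, h2, h3, h4, Nat.add_one_ne_zero, if_false, if_true, Nat.add_sub_cancel]

lemma rule_even (S : System Ω Ξ W) (j : ℕ) (p : ((ℝ × ℝ × W) × (ℝ × Ξ)) × (ℕ → ℝ)) :
    S.rule (2 * j + 2) p = S.γ (j + 1) (if j = 0 then S.aγ * p.2 0 + p.1.2.1 else p.2 (2 * j - 1))
      (p.2 0) p.1.2.2 := by
  have h1 : 2 * j + 2 ≠ 0 := by omega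
  have h2 : (2 * j + 2) % 2 ≠ 1 := by omega
  have h3 : (2 * j + 2) / 2 = j + 1 := by omega
  have h4 : (2 * j + 2 = 2) ↔ j = 0 := by omega
  have h5 : 2 * j + 2 - 3 = 2 * j - 1 := by omega
  simp only [rule, h1, h2, h3, h4, h5, if_false]

end System

end OAMP


namespace OAMP

open Filter Topology
open scoped ENNReal

namespace System

section Instantiation

set_option linter.unusedSectionVars false

universe u v w

variable {Ω : ℕ → Type u} [∀ N, MeasurableSpace (Ω N)] {P : ∀ N, Measure (Ω N)}
  [∀ N, IsProbabilityMeasure (P N)] {Ξ : Type v} {W : Type w} [MeasurableSpace Ξ]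
  [MeasurableSpace W] {S : System Ω Ξ W}

/-- The estimators follow a scheme in which each uses, besides the primitives, one message received
from the other side. -/
lemma scheme_rule (hS : S.Standing P) :
    Scheme side S.rule (fun p : (ℝ × ℝ × W) × (ℝ × Ξ) => p.1.1) inputStep where
  snd_zero := rfl
  measurable_signal := by fun_prop
  first p := by simp [rule]
  prev_lt k hk := by rw [inputStep]; split_ifs <;> omega
  snd_prev k hk h := by
    rcases step_cases k with rfl | ⟨j, rfl⟩ | ⟨j, rfl⟩
    · omega
    · have hj : j ≠ 0 := by rintro rfl; exact h rfl
      obtain ⟨i, rfl⟩ := Nat.exists_eq_succ_of_ne_zero hj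
      have : inputStep (2 * (i + 1) + 1) = 2 * i + 2 := by
        rw [inputStep, if_neg (by omega), if_pos (by omega)]; omega
      rw [Nat.succ_eq_add_one, this, side_odd, side_even]; rfl
    · have hj : j ≠ 0 := by rintro rfl; exact h rfl
      obtain ⟨i, rfl⟩ := Nat.exists_eq_succ_of_ne_zero hj
      have : inputStep (2 * (i + 1) + 2) = 2 * i + 1 := by
        rw [inputStep, if_neg (by omega), if_neg (by omega)]; omega
      rw [Nat.succ_eq_add_one, this, side_odd, side_even]; rfl
  memory k hk := by
    rcases step_cases k with rfl | ⟨j, rfl⟩ | ⟨j, rfl⟩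
    · omega
    · have hφ := hS.measurable_φ (j + 1)
      by_cases hj : j = 0
      · refine ⟨fun q => S.φ (j + 1) (S.aφ * q.1.1.1 + q.1.1.2.1) q.1.1.1 q.1.1.2.2, ?_,
          fun p => by rw [rule_odd, if_pos hj]⟩
        exact hφ.comp (g := fun p : ℝ × ℝ × W => S.φ (j + 1) p.1 p.2.1 p.2.2)
          (f := fun q : ((ℝ × ℝ × W) × (ℝ × Ξ)) × ℝ × ℝ =>
            (S.aφ * q.1.1.1 + q.1.1.2.1, q.1.1.1, q.1.1.2.2)) (by fun_prop)
      · have : inputStep (2 * j + 1) = 2 * j := by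
          rw [inputStep, if_neg (by omega), if_pos (by omega)]; omega
        refine ⟨fun q => S.φ (j + 1) q.2.2 q.1.1.1 q.1.1.2.2, ?_,
          fun p => by rw [rule_odd, if_neg hj, this]⟩
        exact hφ.comp (g := fun p : ℝ × ℝ × W => S.φ (j + 1) p.1 p.2.1 p.2.2)
          (f := fun q : ((ℝ × ℝ × W) × (ℝ × Ξ)) × ℝ × ℝ => (q.2.2, q.1.1.1, q.1.1.2.2))
          (by fun_prop)
    · have hγ := hS.measurable_γ (j + 1)
      by_cases hj : j = 0
      · refine ⟨fun q => S.γ (j + 1) (S.aγ * q.2.1 + q.1.2.1) q.2.1 q.1.2.2, ?_,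
          fun p => by rw [rule_even, if_pos hj]⟩
        exact hγ.comp (g := fun p : ℝ × ℝ × Ξ => S.γ (j + 1) p.1 p.2.1 p.2.2)
          (f := fun q : ((ℝ × ℝ × W) × (ℝ × Ξ)) × ℝ × ℝ =>
            (S.aγ * q.2.1 + q.1.2.1, q.2.1, q.1.2.2)) (by fun_prop)
      · have : inputStep (2 * j + 2) = 2 * j - 1 := by
          rw [inputStep, if_neg (by omega), if_neg (by omega)]; omega
        refine ⟨fun q => S.γ (j + 1) q.2.2 q.2.1 q.1.2.2, ?_,
          fun p => by rw [rule_even, if_neg hj, this]⟩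
        exact hγ.comp (g := fun p : ℝ × ℝ × Ξ => S.γ (j + 1) p.1 p.2.1 p.2.2)
          (f := fun q : ((ℝ × ℝ × W) × (ℝ × Ξ)) × ℝ × ℝ => (q.2.2, q.2.1, q.1.2.2))
          (by fun_prop)

lemma measurable_rule (hS : S.Standing P) (k : ℕ) : Measurable (S.rule k) := by
  rcases Nat.eq_zero_or_pos k with rfl | hk
  · have : S.rule 0 = fun p => p.1.1.1 := funext fun p => by simp [rule]
    rw [this]; fun_prop
  · obtain ⟨h, hm, he⟩ := (scheme_rule hS).memory k hk
    rw [show S.rule k = fun p => h (p.1, p.2 0, p.2 (inputStep k)) from funext he]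
    exact hm.comp (by fun_prop)

lemma measurable_X (hS : S.Standing P) (N : ℕ) : Measurable (S.X N) :=
  Measurable.matrix_mulVec (hS.haar N).measurable (hS.measurable_x N)

lemma measurable_applyγ (hS : S.Standing P) (t N : ℕ) {y : Ω N → Fin N → ℝ} (hy : Measurable y) :
    Measurable fun ω => S.applyγ t N ω (y ω) :=
  measurable_pi_iff.2 fun n => (hS.measurable_γ t).comp
    (((measurable_pi_apply n).comp hy).prodMk (((measurable_pi_apply n).comp
      (measurable_X hS N)).prodMk ((measurable_pi_apply n).comp (hS.measurable_ξ N))))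

lemma measurable_applyφ (hS : S.Standing P) (t N : ℕ) {y : Ω N → Fin N → ℝ} (hy : Measurable y) :
    Measurable fun ω => S.applyφ t N ω (y ω) :=
  measurable_pi_iff.2 fun n => (hS.measurable_φ t).comp
    (((measurable_pi_apply n).comp hy).prodMk (((measurable_pi_apply n).comp
      (hS.measurable_x N)).prodMk ((measurable_pi_apply n).comp (hS.measurable_w N))))

lemma measurable_inputs (hS : S.Standing P) (t N : ℕ) : Measurable (S.inputs t N) := by
  induction t with
  | zero =>
    exact (((measurable_X hS N).const_smul S.aγ).add (hS.measurable_g₀ N)).prodMk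
      (((hS.measurable_x N).const_smul S.aφ).add (hS.measurable_f₀ N))
  | succ t ih =>
    exact (Measurable.matrix_mulVec (hS.haar N).measurable
      (measurable_applyφ hS (t + 1) N ih.snd)).prodMk (Measurable.matrix_mulVec
        (Measurable.matrix_transpose (hS.haar N).measurable)
        (measurable_applyγ hS (t + 1) N ih.fst))

lemma measurable_message (hS : S.Standing P) (b : Bool) (k N : ℕ) :
    Measurable (S.message b k N) := by
  rcases step_cases k with rfl | ⟨j, rfl⟩ | ⟨j, rfl⟩
  · cases b
    · exact measurable_X hS N
    · exact hS.measurable_x N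
  · rw [message_odd]
    cases b
    · exact (measurable_inputs hS (j + 1) N).fst
    · exact measurable_applyφ hS (j + 1) N (measurable_inputs hS j N).snd
  · rw [message_even]
    cases b
    · exact measurable_applyγ hS (j + 1) N (measurable_inputs hS j N).fst
    · exact (measurable_inputs hS (j + 1) N).snd

/-- The messages of the system are exchanged through the orthogonal matrix as the rule says. -/
lemma passing_message (hS : S.Standing P) (ξ₀ : Ξ) (w₀ : W) :
    Passing (S.entries ξ₀ w₀) side S.rule (fun N ω => Matrix.of (S.V N ω)) S.message where
  measurable := measurable_message hS
  sent k N ω n := by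
    rcases step_cases k with rfl | ⟨j, rfl⟩ | ⟨j, rfl⟩
    · rfl
    · rw [side_odd, rule_odd, message_odd]
      rcases j with _ | i
      · rfl
      · have h1 : 2 * (i + 1) < 2 * (i + 1) + 1 := Nat.lt_succ_self _
        rw [if_neg (Nat.succ_ne_zero i)]
        dsimp only
        rw [if_pos h1, show 2 * (i + 1) = 2 * i + 2 by ring, message_even]
        rfl
    · rw [side_even, rule_even, message_even]
      rcases j with _ | i
      · rfl
      · have h1 : 2 * (i + 1) - 1 < 2 * (i + 1) + 2 := by omega
        have h2 : 0 < 2 * (i + 1) + 2 := by omega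
        rw [if_neg (Nat.succ_ne_zero i)]
        dsimp only
        rw [if_pos h1, if_pos h2, show 2 * (i + 1) - 1 = 2 * i + 1 by omega, message_odd]
        rfl
  forward k N ω h := by
    rcases step_cases k with rfl | ⟨j, rfl⟩ | ⟨j, rfl⟩
    · rfl
    · simp only [message_odd]
      rfl
    · rw [side_even] at h; exact absurd h (by simp)
  backward k N ω h := by
    rcases step_cases k with rfl | ⟨j, rfl⟩ | ⟨j, rfl⟩
    · rw [side_zero] at h; exact absurd h (by simp)
    · rw [side_odd] at h; exact absurd h (by simp)
    · simp only [message_even]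
      rfl

end Instantiation

end System

end OAMP


namespace OAMP

open Filter Topology
open scoped ENNReal

/-! ### The errors of the generic iterative process -/

namespace System

section Conclusion

set_option linter.unusedSectionVars false

universe u v w

variable {Ω : ℕ → Type u} [∀ N, MeasurableSpace (Ω N)] {P : ∀ N, Measure (Ω N)}
  [∀ N, IsProbabilityMeasure (P N)] {Ξ : Type v} {W : Type w} [MeasurableSpace Ξ]
  [MeasurableSpace W] {S : System Ω Ξ W}

/-- The rows of primitives on each side are IID, with a law that does not depend on `N`. The
coordinates of the other side are filled with constants. -/
lemma exists_iidRows (hS : S.Standing P) (ξ₀ : Ξ) (w₀ : W) :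
    ∃ ρ : Bool → Measure ((ℝ × ℝ × W) × (ℝ × Ξ)), (∀ b, IsProbabilityMeasure (ρ b)) ∧
      ∀ b, IIDRows P (S.entries ξ₀ w₀ b) (ρ b) := by
  obtain ⟨ρx, hx⟩ := hS.x_law
  obtain ⟨ρg, hg⟩ := hS.X_law
  have hxm : ∀ N n, Measurable fun ω => (S.x N ω n, S.f₀ N ω n, S.w N ω n) := fun N n =>
    ((measurable_pi_apply n).comp (hS.measurable_x N)).prodMk
      (((measurable_pi_apply n).comp (hS.measurable_f₀ N)).prodMk
        ((measurable_pi_apply n).comp (hS.measurable_w N)))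
  have hgm : ∀ N n, Measurable fun ω => (S.g₀ N ω n, S.ξ N ω n) := fun N n =>
    ((measurable_pi_apply n).comp (hS.measurable_g₀ N)).prodMk
      ((measurable_pi_apply n).comp (hS.measurable_ξ N))
  have p1 : IsProbabilityMeasure ρx :=
    hx 1 0 ▸ Measure.isProbabilityMeasure_map (hxm 1 0).aemeasurable
  have p2 : IsProbabilityMeasure ρg :=
    hg 1 0 ▸ Measure.isProbabilityMeasure_map (hgm 1 0).aemeasurable
  have m1 : Measurable fun a : ℝ × ℝ × W => (a, ((0 : ℝ), ξ₀)) := by fun_prop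
  have m2 : Measurable fun a : ℝ × Ξ => (((0 : ℝ), (0 : ℝ), w₀), a) := by fun_prop
  refine ⟨fun b => if b then ρx.map fun a => (a, ((0 : ℝ), ξ₀))
    else ρg.map fun a => (((0 : ℝ), (0 : ℝ), w₀), a), fun b => ?_, fun b => ?_⟩
  · cases b
    · exact Measure.isProbabilityMeasure_map m2.aemeasurable
    · exact Measure.isProbabilityMeasure_map m1.aemeasurable
  · cases b
    · exact (iidRows_of_iIndepFun hgm hS.X_iid hg).comp m2
    · exact (iidRows_of_iIndepFun hxm hS.x_iid hx).comp m1

lemma unifSq_message (hS : S.Standing P) (k : ℕ) :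
    UnifSq (fun p : (Σ N, Fin N) => P p.1) fun p ω => S.message (side k) k p.1 ω p.2 := by
  rcases step_cases k with rfl | ⟨j, rfl⟩ | ⟨j, rfl⟩
  · obtain ⟨ρx, hx⟩ := hS.x_law
    have hm : ∀ N n, Measurable fun ω => S.x N ω n := fun N n =>
      (measurable_pi_apply n).comp (hS.measurable_x N)
    have hl : ∀ N n, (P N).map (fun ω => S.x N ω n) = ρx.map Prod.fst := fun N n => by
      rw [← hx N n, Measure.map_map measurable_fst]
      · rfl
      · exact (hm N n).prodMk (((measurable_pi_apply n).comp (hS.measurable_f₀ N)).prodMk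
          ((measurable_pi_apply n).comp (hS.measurable_w N)))
    refine unifSq_of_map_eq (P := fun p : (Σ N, Fin N) => P p.1)
      (f := fun p ω => S.x p.1 ω p.2) (fun p => hm p.1 p.2) (m := ρx.map Prod.fst)
      (fun p => hl p.1 p.2) ?_
    rw [← hl 1 0, lintegral_map (by fun_prop) (hm 1 0)]
    have hint : Integrable (fun ω => S.x 1 ω 0 ^ 2) (P 1) := by
      by_contra h
      have := hS.x_normalized 1 0
      rw [integral_undef h] at this
      exact zero_ne_one this
    exact hint.lintegral_lt_top.ne
  · rw [side_odd, message_odd]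
    intro ε hε
    obtain ⟨K, hK⟩ := hS.xOut_sq (j + 1) (Nat.succ_pos j) ε hε
    exact ⟨K, fun p => hK p.1 p.2⟩
  · rw [side_even, message_even]
    intro ε hε
    obtain ⟨K, hK⟩ := hS.XOut_sq (j + 1) (Nat.succ_pos j) ε hε
    exact ⟨K, fun p => hK p.1 p.2⟩

lemma integral_x_dotProduct (hS : S.Standing P) (N : ℕ) :
    ∫ ω, S.x N ω ⬝ᵥ S.x N ω ∂(P N) = N := by
  have hint : ∀ n, Integrable (fun ω => S.x N ω n * S.x N ω n) (P N) := fun n => by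
    by_contra h
    have := hS.x_normalized N n
    simp only [sq] at this
    rw [integral_undef h] at this
    exact zero_ne_one this
  simp only [dotProduct]
  rw [integral_finsetSum _ fun n _ => hint n]
  simp only [← sq, hS.x_normalized]
  simp

lemma integral_X_dotProduct (hS : S.Standing P) (N : ℕ) :
    ∫ ω, S.X N ω ⬝ᵥ S.X N ω ∂(P N) = N := by
  rw [← integral_x_dotProduct hS N]
  refine integral_congr_ae ?_
  filter_upwards [(hS.haar N).orthogonal] with ω hω
  exact (isOrth_iff.2 hω).dotProduct _ _

lemma gIn_zero (hS : S.Standing P) (N : ℕ) (ω : Ω N) : S.gIn P 0 N ω = S.g₀ N ω :=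
  gsError_smul_add (g := S.g₀) S.aγ (measurable_X hS N) (hS.measurable_g₀ N)
    (integral_X_dotProduct hS N) (hS.g₀_gaussian N) (hS.g₀_indep N) ω

lemma fIn_zero (hS : S.Standing P) (N : ℕ) (ω : Ω N) : S.fIn P 0 N ω = S.f₀ N ω :=
  gsError_smul_add (g := S.f₀) S.aφ (hS.measurable_x N) (hS.measurable_f₀ N)
    (integral_x_dotProduct hS N) (hS.f₀_gaussian N) (hS.f₀_indep N) ω

/-- The orthogonality of the errors in the terms of the message passing process. -/
lemma llnOrthogonal_message (hO : S.IsOAMP P) (k : ℕ) (hk : 1 ≤ k) (h : inputStep k ≠ 0) :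
    LLNOrthogonal P (gsError P (S.message (side k) 0) (S.message (side k) (inputStep k)))
      (gsError P (S.message (side k) 0) (S.message (side k) k)) := by
  rcases step_cases k with rfl | ⟨j, rfl⟩ | ⟨j, rfl⟩
  · omega
  · have hj : j ≠ 0 := by rintro rfl; exact h rfl
    obtain ⟨i, rfl⟩ := Nat.exists_eq_succ_of_ne_zero hj
    have h1 : inputStep (2 * (i + 1) + 1) = 2 * i + 2 := by
      rw [inputStep, if_neg (by omega), if_pos (by omega)]; omega
    rw [Nat.succ_eq_add_one, h1, side_odd, message_odd, message_even]
    exact hO.f_orth (i + 2) (by omega) (i + 1) (by omega)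
  · have hj : j ≠ 0 := by rintro rfl; exact h rfl
    obtain ⟨i, rfl⟩ := Nat.exists_eq_succ_of_ne_zero hj
    have h1 : inputStep (2 * (i + 1) + 2) = 2 * i + 1 := by
      rw [inputStep, if_neg (by omega), if_neg (by omega)]; omega
    rw [Nat.succ_eq_add_one, h1, side_even, message_odd, message_even]
    exact hO.g_orth (i + 2) (by omega) (i + 1) (by omega)

/-- The generic iterative process satisfies the standing assumptions on message passing
processes. -/
lemma exists_regular (hS : S.Standing P) (ξ₀ : Ξ) (w₀ : W) {Z : ℕ → Type*}
    [∀ N, MeasurableSpace (Z N)] {z : ∀ N, Ω N → Z N} (hz : ∀ N, Measurable (z N))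
    (hV : ∀ N, IndepFun (S.V N) (fun ω => (S.primitives N ω, z N ω)) (P N)) :
    ∃ (ρ : Bool → Measure ((ℝ × ℝ × W) × (ℝ × Ξ))) (_ : ∀ b, IsProbabilityMeasure (ρ b)),
      Regular P (S.entries ξ₀ w₀) ρ side S.rule (fun p => p.1.1) inputStep z
        (fun N ω => Matrix.of (S.V N ω)) S.message := by
  obtain ⟨ρ, hρ, hI⟩ := exists_iidRows hS ξ₀ w₀
  refine ⟨ρ, hρ, ⟨measurable_rule hS, hI⟩, ⟨fun N => (hS.haar N).measurable, hz, fun N => ?_,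
    fun N U hU => ?_, fun N => ?_⟩, scheme_rule hS, ?_, passing_message hS ξ₀ w₀,
    unifSq_message hS⟩
  · filter_upwards [(hS.haar N).orthogonal] with ω hω using isOrth_iff.2 hω
  · exact (hS.haar N).invariant U (isOrth_iff.1 hU)
  · let Ψ : ((Fin N → ℝ) × (Fin N → ℝ) × (Fin N → ℝ) × (Fin N → Ξ) × (Fin N → W)) × Z N →
        (Bool → Fin N → (ℝ × ℝ × W) × (ℝ × Ξ)) × Z N := fun q =>
      (fun b n => if b then ((q.1.1 n, q.1.2.2.1 n, q.1.2.2.2.2 n), (0, ξ₀))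
        else ((0, 0, w₀), (q.1.2.1 n, q.1.2.2.2.1 n)), q.2)
    have hΨ : Measurable Ψ := by
      refine Measurable.prodMk (measurable_pi_iff.2 fun b => measurable_pi_iff.2 fun n => ?_)
        measurable_snd
      cases b
      · simp only [Bool.false_eq_true, if_false]; fun_prop
      · simp only [if_true]; fun_prop
    exact (hV N).comp measurable_id hΨ
  · have h1 := (hI true).law_row 1 0
    have hm : Measurable fun p : (ℝ × ℝ × W) × (ℝ × Ξ) => p.1.1 ^ 2 := by fun_prop
    rw [← h1, integral_map ((hI true).measurable_row 1 0).aemeasurable hm.aestronglyMeasurable]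
    exact hS.x_normalized 1 0

lemma GIn_eq (hS : S.Standing P) (ξ₀ : Ξ) (w₀ : W) (t : ℕ) :
    S.GIn P t = fun N ω => Matrix.of fun n s => errG P (S.entries ξ₀ w₀) S.message
      (fun p => p.2.1) false (fun s : Fin t => 2 * (s : ℕ) - 1) N ω n s := by
  funext N ω
  ext n ⟨s, hs⟩
  rcases s with _ | j
  · exact congrFun (gIn_zero hS N ω) n
  · have h1 : 2 * (j + 1) - 1 = 2 * j + 1 := by omega
    simp only [Matrix.of_apply, errG, h1, Nat.add_one_ne_zero, if_false, message_odd]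
    rfl

lemma FIn_eq (hS : S.Standing P) (ξ₀ : Ξ) (w₀ : W) (t : ℕ) :
    S.FIn P t = fun N ω => Matrix.of fun n s => errG P (S.entries ξ₀ w₀) S.message
      (fun p => p.1.2.1) true (fun s : Fin t => 2 * (s : ℕ)) N ω n s := by
  funext N ω
  ext n ⟨s, hs⟩
  rcases s with _ | j
  · exact congrFun (fIn_zero hS N ω) n
  · have h1 : 2 * (j + 1) = 2 * j + 2 := by omega
    have h2 : 2 * j + 2 ≠ 0 := by omega
    simp only [Matrix.of_apply, errG, h1, h2, if_false, message_even]
    rfl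

lemma side_col_false {s : ℕ} (h : 2 * s - 1 ≠ 0) : side (2 * s - 1) = !false := by
  obtain ⟨j, rfl⟩ : ∃ j, s = j + 1 := ⟨s - 1, by omega⟩
  rw [show 2 * (j + 1) - 1 = 2 * j + 1 by omega, side_odd]; rfl

lemma side_col_true {s : ℕ} (h : 2 * s ≠ 0) : side (2 * s) = !true := by
  obtain ⟨j, rfl⟩ : ∃ j, s = j + 1 := ⟨s - 1, by omega⟩
  rw [show 2 * (j + 1) = 2 * j + 2 by omega, side_even]; rfl

lemma nonempty_noise (P : ∀ N, Measure (Ω N)) [∀ N, IsProbabilityMeasure (P N)]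
    (S : System Ω Ξ W) : Nonempty Ξ ∧ Nonempty W := by
  have h : Nonempty (Ω 1) := (P 1).nonempty_of_neZero
  obtain ⟨ω⟩ := h
  exact ⟨⟨S.ξ 1 ω 0⟩, ⟨S.w 1 ω 0⟩⟩

lemma asympIndep_GIn (hS : S.Standing P) (hO : S.IsOAMP P) (t : ℕ) {Z : ℕ → Type*}
    [∀ N, MeasurableSpace (Z N)] {z : ∀ N, Ω N → Z N} (hz : ∀ N, Measurable (z N))
    (hV : ∀ N, IndepFun (S.V N) (fun ω => (S.primitives N ω, z N ω)) (P N))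
    (hI : ∀ N, IndepFun (S.g₀ N) (fun ω => (S.X N ω, z N ω)) (P N)) :
    AsympIndep P (S.GIn P t) fun N ω => (S.X N ω, z N ω) := by
  obtain ⟨⟨ξ₀⟩, ⟨w₀⟩⟩ := nonempty_noise P S
  obtain ⟨ρ, hρ, R⟩ := exists_regular hS ξ₀ w₀ hz hV
  rw [GIn_eq hS ξ₀ w₀]
  exact R.asympIndep (b := false) (fun k hk => llnOrthogonal_message hO k hk)
    (fun s hs => side_col_false hs) (by fun_prop) hI

lemma asympIndep_FIn (hS : S.Standing P) (hO : S.IsOAMP P) (t : ℕ) {Z : ℕ → Type*}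
    [∀ N, MeasurableSpace (Z N)] {z : ∀ N, Ω N → Z N} (hz : ∀ N, Measurable (z N))
    (hV : ∀ N, IndepFun (S.V N) (fun ω => (S.primitives N ω, z N ω)) (P N))
    (hI : ∀ N, IndepFun (S.f₀ N) (fun ω => (S.x N ω, z N ω)) (P N)) :
    AsympIndep P (S.FIn P t) fun N ω => (S.x N ω, z N ω) := by
  obtain ⟨⟨ξ₀⟩, ⟨w₀⟩⟩ := nonempty_noise P S
  obtain ⟨ρ, hρ, R⟩ := exists_regular hS ξ₀ w₀ hz hV
  rw [FIn_eq hS ξ₀ w₀]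
  exact R.asympIndep (b := true) (fun k hk => llnOrthogonal_message hO k hk)
    (fun s hs => side_col_true hs) (by fun_prop) hI

lemma indepFun_primitives_unit (hS : S.Standing P) (N : ℕ) :
    IndepFun (S.V N) (fun ω => (S.primitives N ω, ())) (P N) :=
  (hS.V_indep N).comp measurable_id (ψ := fun p => (p, ())) (by fun_prop)

lemma isCPIIDGRJG_GIn (hS : S.Standing P) (hO : S.IsOAMP P) (t : ℕ) :
    IsCPIIDGRJG P (S.GIn P t) := by
  obtain ⟨⟨ξ₀⟩, ⟨w₀⟩⟩ := nonempty_noise P S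
  obtain ⟨ρ, hρ, R⟩ := exists_regular hS ξ₀ w₀ (z := fun _ _ => ()) (fun N => measurable_const)
    (indepFun_primitives_unit hS)
  rw [GIn_eq hS ξ₀ w₀]
  refine R.isCPIIDGRJG (b := false) (fun k hk => llnOrthogonal_message hO k hk)
    (fun s hs => side_col_false hs) (by fun_prop) (v := S.vγ) ?_
  rw [← (R.model.iid false).law_row 1 0, Measure.map_map (by fun_prop)
    ((R.model.iid false).measurable_row 1 0)]
  exact hS.g₀_gaussian 1 0

lemma isCPIIDGRJG_FIn (hS : S.Standing P) (hO : S.IsOAMP P) (t : ℕ) :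
    IsCPIIDGRJG P (S.FIn P t) := by
  obtain ⟨⟨ξ₀⟩, ⟨w₀⟩⟩ := nonempty_noise P S
  obtain ⟨ρ, hρ, R⟩ := exists_regular hS ξ₀ w₀ (z := fun _ _ => ()) (fun N => measurable_const)
    (indepFun_primitives_unit hS)
  rw [FIn_eq hS ξ₀ w₀]
  refine R.isCPIIDGRJG (b := true) (fun k hk => llnOrthogonal_message hO k hk)
    (fun s hs => side_col_true hs) (by fun_prop) (v := S.vφ) ?_
  rw [← (R.model.iid true).law_row 1 0, Measure.map_map (by fun_prop)
    ((R.model.iid true).measurable_row 1 0)]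
  exact hS.f₀_gaussian 1 0

end Conclusion

end System

end OAMP

theorem mainTheorem1
    {Ω : ℕ → Type*} [∀ N, MeasurableSpace (Ω N)]
    (P : ∀ N, MeasureTheory.Measure (Ω N)) [∀ N, MeasureTheory.IsProbabilityMeasure (P N)]
    {Ξ W : Type*} [MeasurableSpace Ξ] [MeasurableSpace W]
    (S : OAMP.System Ω Ξ W) (hS : S.Standing P) (hO : S.IsOAMP P) (t : ℕ) :
    (OAMP.IsCPIIDGRJG P (S.GIn P t) ∧
      OAMP.AsympIndep P (S.GIn P t) S.X ∧
      ∀ (Z : ℕ → Type*) [∀ N, MeasurableSpace (Z N)] (z : ∀ N, Ω N → Z N),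
        (∀ N, Measurable (z N)) →
        (∀ N, ProbabilityTheory.IndepFun (S.V N) (fun ω => (S.primitives N ω, z N ω)) (P N)) →
        (∀ N, ProbabilityTheory.IndepFun (S.g₀ N) (fun ω => (S.X N ω, z N ω)) (P N)) →
        OAMP.AsympIndep P (S.GIn P t) (fun N ω => (S.X N ω, z N ω))) ∧
    (OAMP.IsCPIIDGRJG P (S.FIn P t) ∧
      OAMP.AsympIndep P (S.FIn P t) S.x ∧
      ∀ (Z : ℕ → Type*) [∀ N, MeasurableSpace (Z N)] (z : ∀ N, Ω N → Z N),
        (∀ N, Measurable (z N)) →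
        (∀ N, ProbabilityTheory.IndepFun (S.V N) (fun ω => (S.primitives N ω, z N ω)) (P N)) →
        (∀ N, ProbabilityTheory.IndepFun (S.f₀ N) (fun ω => (S.x N ω, z N ω)) (P N)) →
        OAMP.AsympIndep P (S.FIn P t) (fun N ω => (S.x N ω, z N ω))) := by
  refine ⟨⟨OAMP.System.isCPIIDGRJG_GIn hS hO t, fun M h k hk hk1 ε hε => ?_,
    fun Z _ z hz hV hI => OAMP.System.asympIndep_GIn hS hO t hz hV hI⟩,
    OAMP.System.isCPIIDGRJG_FIn hS hO t, fun M h k hk hk1 ε hε => ?_,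
    fun Z _ z hz hV hI => OAMP.System.asympIndep_FIn hS hO t hz hV hI⟩
  · exact OAMP.System.asympIndep_GIn hS hO t (z := fun _ _ => ()) (fun N => measurable_const)
      (OAMP.System.indepFun_primitives_unit hS)
      (fun N => (hS.g₀_indep N).comp measurable_id (ψ := fun y => (y, ())) (by fun_prop)) M h
      (fun N y => k N y.1) (fun N => (hk N).comp measurable_fst) (fun N y => hk1 N y.1) ε hε
  · exact OAMP.System.asympIndep_FIn hS hO t (z := fun _ _ => ()) (fun N => measurable_const)
      (OAMP.System.indepFun_primitives_unit hS)
      (fun N => (hS.f₀_indep N).comp measurable_id (ψ := fun y => (y, ())) (by fun_prop)) M h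
      (fun N y => k N y.1) (fun N => (hk N).comp measurable_fst) (fun N y => hk1 N y.1) ε hε
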